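/- **Model.** The machine is a randomized word RAM with $w$-bit words: a program, fixed independently of $w$ and of the input, uses finitely many word registers and finitely many arrays of $2^w$ words each, initially zero. It has unit-cost arithmetic, bitwise operations, shifts, comparisons, loads, stores, tests, and the drawing of a uniformly random word. Algorithms are Las Vegas (never wrong, running time measured in expectation), and for inputs of size $n$ they have to work for every $w\ge c\log_2(n+2)$, where $c$ is a constant of the algorithm; time bounds depend on $n$ and not on $w$. For a nonnegative function $f$ on $\mathbb N$, "$f(N)=\Omega(N^{b-o(1)})$" means that there is no $\varepsilon>0$ with $f(N)=O(N^{b-\varepsilon})$ as $N\to\infty$. **3SUM conjecture.** Every Las Vegas algorithm that decides, for a given set $A$ of $n$ integers of $w$ bits (two's complement), whether there are three distinct elements $x,y,z\in A$ with $x+y=z$, has (worst-case) expected running time $\Omega(n^{2-o(1)})$. **Problems.** A collection $X$ of nonempty documents (strings) of total length $N=\sum_{D\in X}|D|$ over the alphabet $\{0,\dots,N-1\}$ is preprocessed. Then queries arrive, each consisting of two nonempty patterns of length at most $N$ over the same alphabet. In the *Two Patterns* problem a query $(P_1,P_2)$ selects the documents that contain both $P_1$ and $P_2$ as contiguous substrings;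 in the *Forbidden Pattern* problem a query $(P^+,P^-)$ selects the documents that contain $P^+$ and do not contain $P^-$. In the decision version one has to decide whether some document is selected, in the reporting version one has to list all selected documents. A data structure has expected preprocessing time $t_p(N)$, amortized expected query time $t_q$, and, in the reporting version, amortized expected time $t_r(N)$ per reported document, if its expected preprocessing time is at most $t_p(N)$ and, for every collection and every finite sequence of queries, the expected total query time is at most the sum of $t_q$ over the queries plus $t_r(N)$ times the total number of reported documents. Here $t_q=t_q(N,m)$ may also depend on the total length $m$ of the two patterns of the query; below, $t_q$ stands for $t_q(N,2)$, its value for single-character patterns. **Theorem.** Assume the 3SUM conjecture. 1. For every $0<\gamma<1$, any data structure for the decision version of Forbidden Pattern Document Retrieval satisfies $$t_p + N^{\frac{1+\gamma}{3-2\gamma}}\, t_q = \Omega\left(N^{\frac{2}{3-2\gamma}-o(1)}\right).$$ 2. For every $0<\gamma<1$, any data structure for the decision version of Two Patterns Document Retrieval satisfies $$t_p + N^{\frac{1+\gamma}{2-\gamma}}\, t_q = \Omega\left(N^{\frac{2}{2-\gamma}-o(1)}\right).$$ 3. For every $0\le\gamma<1$ and every $\delta>0$, any data structure for the reporting version of Two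 Patterns Document Retrieval satisfies $$t_p + N^{\frac{2(1+\gamma)}{3+\delta-\gamma}}\, t_q + N^{\frac{2(2-\delta)}{3+\delta-\gamma}}\, t_r = \Omega\left(N^{\frac{4}{3+\delta-\gamma}-o(1)}\right).$$ -/

import Mathlib

open scoped NNReal ENNReal
open Asymptotics Filter

noncomputable section

namespace WordRAM

/-! ### A randomized word RAM with `w`-bit words

A program has finitely many registers, each holding a word, and finitely many arrays, each with
`2 ^ w` word cells that are addressed by words. Every elementary operation, every test and every
sequencing step costs one unit of time. -/

/-- The unit-cost binary operations on words. All of them are unsigned, modulo `2 ^ w`. -/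
inductive BinOp where
  | add | sub | mul | mulHi | div | mod | band | bor | bxor | shl | shr | lt | eq

/-- Semantics of the binary operations. `mulHi` is the upper word of the double-word product;
the comparisons return the word `1` for true and `0` for false. -/
def BinOp.eval {w : ℕ} : BinOp → BitVec w → BitVec w → BitVec w
  | add, x, y => x + y
  | sub, x, y => x - y
  | mul, x, y => x * y
  | mulHi, x, y => BitVec.ofNat w (x.toNat * y.toNat / 2 ^ w)
  | div, x, y => x / y
  | mod, x, y => x % y
  | band, x, y => x &&& y
  | bor, x, y => x ||| y
  | bxor, x, y => x ^^^ y
  | shl, x, y => x <<< y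
  | shr, x, y => x >>> y
  | lt, x, y => if x.toNat < y.toNat then 1 else 0
  | eq, x, y => if x = y then 1 else 0

/-- Programs. Register and array names are natural numbers fixed in the program text; programs do
not depend on the word size or on the input size. -/
inductive Prog where
  /-- do nothing -/
  | skip
  /-- `reg d := v` (modulo `2 ^ w`) -/
  | const (d v : ℕ)
  /-- `reg d := w` -/
  | wordSize (d : ℕ)
  /-- `reg d := reg x ∘ reg y` -/
  | op (o : BinOp) (d x y : ℕ)
  /-- `reg d := mem a [reg x]` -/
  | load (d a x : ℕ)
  /-- `mem a [reg x] := reg y` -/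
  | store (a x y : ℕ)
  /-- `reg d :=` a fresh uniformly random word -/
  | rand (d : ℕ)
  /-- sequential composition -/
  | seq (p q : Prog)
  /-- if `reg x ≠ 0` then `p` else `q` -/
  | ite (x : ℕ) (p q : Prog)
  /-- while `reg x ≠ 0` do `p` -/
  | loop (x : ℕ) (p : Prog)

/-- The contents of the registers and of the arrays. -/
structure State (w : ℕ) where
  reg : ℕ → BitVec w
  mem : ℕ → BitVec w → BitVec w

namespace State

variable {w : ℕ}

/-- The state in which every register and every cell holds `0`. -/
def zero (w : ℕ) : State w := ⟨fun _ => 0, fun _ _ => 0⟩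

def setReg (s : State w) (d : ℕ) (v : BitVec w) : State w :=
  { s with reg := Function.update s.reg d v }

def setMem (s : State w) (a : ℕ) (i v : BitVec w) : State w :=
  { s with mem := Function.update s.mem a (Function.update (s.mem a) i v) }

/-- Write the list `l` into the first `l.length` cells of array `a`; nothing else changes. -/
def writeArr (s : State w) (a : ℕ) (l : List (BitVec w)) : State w :=
  { s with mem := Function.update s.mem a fun i => l.getD i.toNat (s.mem a i) }

end State

/-- A configuration: the stack of programs still to be executed, and the state. The machine has
halted when the stack is empty. -/
abbrev Config (w : ℕ) := List Prog × State w

variable {w : ℕ}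

/-- One step of the machine, as a probability distribution on the next configuration. -/
def step : Config w → PMF (Config w)
  | ([], s) => PMF.pure ([], s)
  | (.skip :: k, s) => PMF.pure (k, s)
  | (.const d v :: k, s) => PMF.pure (k, s.setReg d (BitVec.ofNat w v))
  | (.wordSize d :: k, s) => PMF.pure (k, s.setReg d (BitVec.ofNat w w))
  | (.op o d x y :: k, s) => PMF.pure (k, s.setReg d (o.eval (s.reg x) (s.reg y)))
  | (.load d a x :: k, s) => PMF.pure (k, s.setReg d (s.mem a (s.reg x)))
  | (.store a x y :: k, s) => PMF.pure (k, s.setMem a (s.reg x) (s.reg y))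
  | (.rand d :: k, s) =>
      (PMF.uniformOfFintype (Fin (2 ^ w))).map fun v => (k, s.setReg d (BitVec.ofFin v))
  | (.seq p q :: k, s) => PMF.pure (p :: q :: k, s)
  | (.ite x p q :: k, s) => PMF.pure (if s.reg x ≠ 0 then (p :: k, s) else (q :: k, s))
  | (.loop x p :: k, s) => PMF.pure (if s.reg x ≠ 0 then (p :: .loop x p :: k, s) else (k, s))

/-- The distribution of the configuration after `t` steps. -/
def after : ℕ → Config w → PMF (Config w)
  | 0, c => PMF.pure c
  | t + 1, c => (step c).bind (after t)

/-- The expected running time `∑ t, ℙ[p has not halted after t steps]` of `p` started in `s`. -/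
def expTime (p : Prog) (s : State w) : ℝ≥0∞ :=
  ∑' t : ℕ, (after t ([p], s)).toOuterMeasure {c | c.1 ≠ []}

/-- The expectation of `f` at the final state of `p` started in `s` (runs that do not halt
contribute `0`). -/
def expFinal (p : Prog) (s : State w) (f : State w → ℝ≥0∞) : ℝ≥0∞ :=
  ⨆ t : ℕ, ∑' c : Config w, after t ([p], s) c * (if c.1 = [] then f c.2 else 0)

/-- With positive probability `p`, started in `s`, halts in the state `s'`. -/
def MayHalt (p : Prog) (s s' : State w) : Prop :=
  ∃ t : ℕ, ([], s') ∈ (after t ([p], s)).support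

/-! ### 3SUM -/

/-- The input of 3SUM: the numbers in array `0`, in any order, and their number in register `0`. -/
def threeSumInput (A : List (BitVec w)) : State w :=
  ((State.zero w).writeArr 0 A).setReg 0 (BitVec.ofNat w A.length)

/-- Some three distinct members of `A` satisfy `x + y = z` as integers (words represent integers
in two's complement). -/
def HasThreeSum (A : List (BitVec w)) : Prop :=
  ∃ x ∈ A, ∃ y ∈ A, ∃ z ∈ A, x ≠ y ∧ x ≠ z ∧ y ≠ z ∧ x.toInt + y.toInt = z.toInt

/-- `p` is a Las Vegas algorithm for 3SUM on sets of `w`-bit integers whose expected time on sets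
of size `n` is at most `T n`, for all word sizes `w ≥ c * log₂ (n + 2)`. The answer is yes iff
register `0` is finally nonzero. -/
def SolvesThreeSum (p : Prog) (c : ℕ) (T : ℕ → ℝ≥0) : Prop :=
  ∀ (w : ℕ) (A : List (BitVec w)), A.Nodup → (A.length + 2) ^ c ≤ 2 ^ w →
    expTime p (threeSumInput A) ≤ T A.length ∧
    ∀ s', MayHalt p (threeSumInput A) s' → (s'.reg 0 ≠ 0 ↔ HasThreeSum A)

/-- `f = Ω(N ^ (b - o(1)))` in the sense of conditional lower bounds: there is no `ε > 0` with
`f = O(N ^ (b - ε))`. -/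
def IsAlmostOmega (f : ℕ → ℝ) (b : ℝ) : Prop :=
  ∀ ε : ℝ, 0 < ε → ¬ f =O[atTop] fun N : ℕ => (N : ℝ) ^ (b - ε)

/-- The 3SUM conjecture: every Las Vegas algorithm for 3SUM takes `Ω(n ^ (2 - o(1)))` expected
time. -/
def ThreeSumConjecture : Prop :=
  ∀ (p : Prog) (c : ℕ) (T : ℕ → ℝ≥0), SolvesThreeSum p c T →
    IsAlmostOmega (fun n => (T n : ℝ)) 2

/-! ### Document retrieval with two patterns -/

/-- A document or a pattern: a string over an integer alphabet. -/
abbrev Str := List ℕ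

/-- The total length `N` of a collection of documents. -/
def totalLength (X : List Str) : ℕ := (X.map List.length).sum

/-- A collection of nonempty documents over the alphabet `{0, …, N - 1}`. -/
def ValidDocs (X : List Str) : Prop :=
  ∀ D ∈ X, D ≠ [] ∧ ∀ a ∈ D, a < totalLength X

/-- A query: a pair of patterns, `(P₁, P₂)` or `(P⁺, P⁻)`. -/
abbrev Query := Str × Str

/-- For a collection of total length `N`, the patterns are nonempty strings over the same alphabet
`{0, …, N - 1}`, of length at most `N`. -/
def ValidQuery (N : ℕ) (q : Query) : Prop :=
  (q.1 ≠ [] ∧ q.1.length ≤ N ∧ ∀ a ∈ q.1, a < N) ∧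
  (q.2 ≠ [] ∧ q.2.length ≤ N ∧ ∀ a ∈ q.2, a < N)

/-- The total length of the two patterns. -/
def patLength (q : Query) : ℕ := q.1.length + q.2.length

/-- Two Patterns: the document contains both patterns. -/
def twoPatterns (q : Query) (D : Str) : Prop := q.1 <:+: D ∧ q.2 <:+: D

/-- Forbidden Pattern: the document contains the first pattern and does not contain the second. -/
def forbiddenPattern (q : Query) (D : Str) : Prop := q.1 <:+: D ∧ ¬ q.2 <:+: D

/-- The indices of the documents of `X` selected by the query `q`. -/
def answer (R : Query → Str → Prop) (X : List Str) (q : Query) : Set ℕ :=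
  {i | ∃ D, X[i]? = some D ∧ R q D}

/-- A string, as a list of words. -/
def words (w : ℕ) (l : List ℕ) : List (BitVec w) := l.map (BitVec.ofNat w)

/-- The starting positions of the documents in the concatenated text, followed by its length. -/
def offsets (X : List Str) : List ℕ :=
  (List.range (X.length + 1)).map fun i => totalLength (X.take i)

/-- The input of the preprocessing: the concatenated text in array `0`, the offsets in array `1`,
the number of documents in register `0`, the length of the text in register `1`. -/
def docsInput (w : ℕ) (X : List Str) : State w :=
  ((((State.zero w).writeArr 0 (words w X.flatten)).writeArr 1 (words w (offsets X))).setReg 0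
    (BitVec.ofNat w X.length)).setReg 1 (BitVec.ofNat w (totalLength X))

/-- Posing a query to the data structure in the state `s`: the patterns are written into arrays `2`
and `3` and their lengths into registers `0` and `1`; nothing else changes. -/
def queryInput (q : Query) (s : State w) : State w :=
  (((s.writeArr 2 (words w q.1)).writeArr 3 (words w q.2)).setReg 0
    (BitVec.ofNat w q.1.length)).setReg 1 (BitVec.ofNat w q.2.length)

/-- A data structure: a preprocessing program, a query program that works on the state left behind
by the preprocessing and the earlier queries, and the constant `c` in the assumption
`w ≥ c * log₂ (N + 2)` on the word size. -/
structure DataStructure where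
  prep : Prog
  query : Prog
  c : ℕ

namespace DataStructure

/-- The states in which the data structure for `X` may be between two queries. -/
inductive Idle (S : DataStructure) (w : ℕ) (X : List Str) : State w → Prop
  | prep {s : State w} : MayHalt S.prep (docsInput w X) s → Idle S w X s
  | query {s s' : State w} {q : Query} : Idle S w X s → ValidQuery (totalLength X) q →
      MayHalt S.query (queryInput q s) s' → Idle S w X s'

/-- The expected total time of a sequence of queries, started in the state `s`. -/
def seqTime (S : DataStructure) : List Query → State w → ℝ≥0∞
  | [], _ => 0
  | q :: qs, s =>
      expTime S.query (queryInput q s) + expFinal S.query (queryInput q s) (S.seqTime qs)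

/-- Every halting query computation ends in a state with a correct output, where
`Good X q s'` says that the output in `s'` is correct for the query `q` on the collection `X`. -/
def Correct (S : DataStructure) (Good : List Str → Query → ∀ {w : ℕ}, State w → Prop) : Prop :=
  ∀ (w : ℕ) (X : List Str), ValidDocs X → (totalLength X + 2) ^ S.c ≤ 2 ^ w →
    ∀ s : State w, S.Idle w X s → ∀ q, ValidQuery (totalLength X) q →
      ∀ s', MayHalt S.query (queryInput q s) s' → Good X q s'

/-- The expected preprocessing time is at most `tp N`, and for every sequence of queries the
expected total query time is at most the sum of the amounts `cost X q` over the sequence. -/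
def TimeBound (S : DataStructure) (tp : ℕ → ℝ≥0) (cost : List Str → Query → ℝ≥0) : Prop :=
  ∀ (w : ℕ) (X : List Str), ValidDocs X → (totalLength X + 2) ^ S.c ≤ 2 ^ w →
    expTime S.prep (docsInput w X) ≤ tp (totalLength X) ∧
    ∀ qs : List Query, (∀ q ∈ qs, ValidQuery (totalLength X) q) →
      expFinal S.prep (docsInput w X) (S.seqTime qs) ≤ ((qs.map (cost X)).sum : ℝ≥0)

/-- `S` solves the decision version: register `0` is finally nonzero iff some document is
selected. The expected preprocessing time is at most `tp N`, and the amortized expected time of a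
query whose patterns have total length `m` is at most `tq N m`. -/
def Decides (S : DataStructure) (R : Query → Str → Prop) (tp : ℕ → ℝ≥0) (tq : ℕ → ℕ → ℝ≥0) :
    Prop :=
  S.Correct (fun X q _ s' => s'.reg 0 ≠ 0 ↔ (answer R X q).Nonempty) ∧
  S.TimeBound tp fun X q => tq (totalLength X) (patLength q)

/-- `S` solves the reporting version: register `0` finally holds the number of the selected
documents, and array `4` begins with a list of their indices without repetitions, in any order.
The expected preprocessing time is at most `tp N`, and the amortized expected time of a query
whose patterns have total length `m` is at most `tq N m`, plus `tr N` per reported document. -/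
def Reports (S : DataStructure) (R : Query → Str → Prop) (tp : ℕ → ℝ≥0) (tq : ℕ → ℕ → ℝ≥0)
    (tr : ℕ → ℝ≥0) : Prop :=
  S.Correct (fun X q w s' => ∃ l : List ℕ, l.Nodup ∧ (∀ i, i ∈ l ↔ i ∈ answer R X q) ∧
    (s'.reg 0).toNat = l.length ∧
    ∀ j (hj : j < l.length), s'.mem 4 (BitVec.ofNat w j) = BitVec.ofNat w l[j]) ∧
  S.TimeBound tp fun X q =>
    tq (totalLength X) (patLength q) + ((answer R X q).ncard : ℝ≥0) * tr (totalLength X)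

end DataStructure

end WordRAM

end

open WordRAM

/-! All three bounds come from one reduction. A data structure that beats them gives a Las Vegas
algorithm for 3SUM with expected time O(n^(2 - 1/q)) for some integer q. Sums of words are tested
modulo 2^w; `toInt_add_eq_iff` adds the sign condition that excludes overflow.

Hashing. Multiply-shift hashing with a random odd multiplier takes values below S = R T². It is
additive modulo S up to one carry bit (`hash_add`). A triple with z - x - y ≠ 0 satisfies the hash
equation with probability O(1/S) (`near_of_hash`, `near_card_le`), so the expected number of false
triples is O(n³/S). The high digit of the hash value (R possibilities) and the sign bit form the
bucket of a number. Buckets are cut into chunks of at most B numbers, where R B is about n, which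
leaves O(R) chunks (`chunks_num_mul_le`).

Queries. Fix z, a chunk for x, two carry bits and the sign of y. The high digits then determine the
bucket of y (`add_mod_iff_digits`), and what remains is whether the low digits of some x and y add
up to a given V < 2T². Write V = αT + β with α < 2T and β < T. Each x puts the character (chunk, α)
into document number (low digit) + 2T² - αT, and each y puts (bucket, β) into document number β +
2T² - (low digit). The two documents coincide exactly when the low digits add up to V
(`Inst.OK.mem_answer`). This gives O(nR) queries with single-character patterns on a text of length
O(nT). For Forbidden Pattern the second kind of character is complemented over all documents, which
adds O(T³R) to the length.

Verification. After a positive answer in the decision version the whole chunk is checked; in the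
reporting version only the numbers whose low digits can be read off the reported documents are. Each
x is checked by looking up z - x in the hash table. The search stops at the first success, so apart
from the last query only false triples and degenerate ones cost anything. Zero is left out of the
documents, because x + 0 = x is not a sum of distinct numbers. Pairs x = y with z = 2x would spoil
the decision version, so there a query from a bucket to itself is replaced by a direct check of the
chunk, which concerns O(n²/R + n) pairs (z, x) in expectation (`near_of_same_bucket`). In the
reporting version they are harmless, since there is at most one such z for each x.

Exponents. All parameters are powers of one X, with n about X^q, R = X^ρ, T = X^τ, B = X^(q-ρ). With
ρ about γq and suitable τ, the text length is at most about n^D, where 2/D is the exponent of the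
theorem, and the assumed bounds make the total cost O(X^(2q-1)) (`average_le`, `not_fast`). Where
the claimed exponent is at most 1 the conjecture is not needed: a data structure that is never wrong
has to read its whole text (`le_time_of_correct`).

Cost accounting. The functional `ert` adds to the expected running time the expectation of a
function f at the halting state. It is compositional, and with f infinite on wrong answers one
finite bound yields both the running time and correctness (`solvesThreeSum`). -/

noncomputable section
namespace WordRAM
variable {w : ℕ}

/-! ### Expected cost of configurations -/

/-- The expectation of `g` under `p`. -/
def mean {α : Type*} (p : PMF α) (g : α → ℝ≥0∞) : ℝ≥0∞ := ∑' a, p a * g a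

theorem mean_pure {α : Type*} (a : α) (g : α → ℝ≥0∞) : mean (PMF.pure a) g = g a := by
  unfold mean
  rw [tsum_eq_single a]
  · simp
  · intro b hb; simp [PMF.pure_apply, hb]

theorem mean_bind {α β : Type*} (p : PMF α) (q : α → PMF β) (g : β → ℝ≥0∞) :
    mean (p.bind q) g = mean p fun a => mean (q a) g := by
  unfold mean
  simp_rw [PMF.bind_apply, ← ENNReal.tsum_mul_right, ← ENNReal.tsum_mul_left]
  rw [ENNReal.tsum_comm]
  simp_rw [mul_assoc]

theorem mean_map {α β : Type*} (p : PMF α) (q : α → β) (g : β → ℝ≥0∞) :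
    mean (p.map q) g = mean p fun a => g (q a) := by
  rw [← PMF.bind_pure_comp, mean_bind]
  simp [mean_pure]

theorem mean_mono {α : Type*} (p : PMF α) {g h : α → ℝ≥0∞}
    (H : ∀ a ∈ p.support, g a ≤ h a) : mean p g ≤ mean p h := by
  refine ENNReal.tsum_le_tsum fun a => ?_
  by_cases ha : a ∈ p.support
  · gcongr; exact H a ha
  · rw [PMF.mem_support_iff, not_not] at ha; simp [ha]

theorem mean_const {α : Type*} (p : PMF α) (c : ℝ≥0∞) : mean p (fun _ => c) = c := by
  unfold mean; rw [ENNReal.tsum_mul_right, p.tsum_coe, one_mul]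

theorem mean_add {α : Type*} (p : PMF α) (g h : α → ℝ≥0∞) :
    mean p (fun a => g a + h a) = mean p g + mean p h := by
  unfold mean; simp_rw [mul_add]; exact ENNReal.tsum_add

theorem mean_uniform {α : Type*} [Fintype α] [Nonempty α] (g : α → ℝ≥0∞) :
    mean (PMF.uniformOfFintype α) g = (Fintype.card α : ℝ≥0∞)⁻¹ * ∑ a, g a := by
  unfold mean; simp [tsum_fintype, Finset.mul_sum]

theorem toOuterMeasure_eq_mean {α : Type*} (p : PMF α) (s : Set α) [DecidablePred (· ∈ s)] :
    p.toOuterMeasure s = mean p fun a => if a ∈ s then 1 else 0 := by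
  rw [PMF.toOuterMeasure_apply]; unfold mean
  refine tsum_congr fun a => ?_
  by_cases h : a ∈ s <;> simp [h]

theorem step_halted (s : State w) : step ([], s) = PMF.pure ([], s) := rfl

theorem after_halted (t : ℕ) (s : State w) : after t ([], s) = PMF.pure ([], s) := by
  induction t with
  | zero => rfl
  | succ t ih => simp [after, step_halted, ih]

/-- The expectation of the time spent within `t` steps plus `f` at the halting state, if that is
reached within `t` steps. -/
def ertN (f : State w → ℝ≥0∞) : ℕ → Config w → ℝ≥0∞
  | 0, c => if c.1 = [] then f c.2 else 0
  | t + 1, c => if c.1 = [] then f c.2 else 1 + mean (step c) (ertN f t)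

/-- The expected running time plus the expectation of `f` at the halting state. -/
def ert (f : State w → ℝ≥0∞) (c : Config w) : ℝ≥0∞ := ⨆ t, ertN f t c

/-- The truncation of `expFinal` to `t` steps; `expFinal` is its supremum over `t`. -/
def haltMean (f : State w → ℝ≥0∞) (t : ℕ) (c : Config w) : ℝ≥0∞ :=
  mean (after t c) fun c => if c.1 = [] then f c.2 else 0

/-- Halted configurations are fixed by `step`, so a contribution once made persists. Monotonicity is
what allows the two suprema in `ert_eq` to be added. -/
theorem haltMean_mono (f : State w → ℝ≥0∞) (c : Config w) :
    Monotone fun t => haltMean f t c := by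
  refine monotone_nat_of_le_succ fun t => ?_
  induction t generalizing c with
  | zero =>
    obtain ⟨l, s⟩ := c
    rcases eq_or_ne l [] with rfl | h
    · simp [haltMean, after_halted, mean_pure]
    · simp [haltMean, after, mean_pure, h]
  | succ t ih =>
    show mean ((step c).bind (after t)) _ ≤ mean ((step c).bind (after (t + 1))) _
    rw [mean_bind, mean_bind]
    exact mean_mono _ fun a _ => ih a

/-- Reconciles two descriptions of a run: `ertN` unrolls it from the first step, whereas `expTime`
and `expFinal` look at the distribution after a given number of steps. -/
theorem ertN_eq (f : State w → ℝ≥0∞) (t : ℕ) (c : Config w) :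
    ertN f t c = ∑ i ∈ Finset.range t, (after i c).toOuterMeasure {c | c.1 ≠ []} +
      haltMean f t c := by
  classical
  induction t generalizing c with
  | zero => simp [ertN, haltMean, after, mean_pure]
  | succ t ih =>
    obtain ⟨l, s⟩ := c
    rcases eq_or_ne l [] with rfl | h
    · simp [ertN, haltMean, after_halted, mean_pure]
    · simp only [ertN, h, if_false, ne_eq]
      -- The term for time 0 equals 1, because the configuration has not halted; the other terms are
      -- those of the shorter run, one step later.
      rw [Finset.sum_range_succ']
      simp only [toOuterMeasure_eq_mean]
      have h0 : mean (after 0 (l, s)) (fun a : Config w => if a ∈ {c : Config w | ¬c.1 = []} then (1:ℝ≥0∞) else 0) = 1 := by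
        simp [after, mean_pure, h]
      rw [h0, add_comm _ (1 : ℝ≥0∞), add_assoc]
      congr 1
      have : ertN f t = fun c => ∑ i ∈ Finset.range t, (after i c).toOuterMeasure {c | c.1 ≠ []} +
          haltMean f t c := funext ih
      rw [this, mean_add]
      congr 1
      · simp only [after, mean_bind, toOuterMeasure_eq_mean]
        clear this ih
        induction t with
        | zero => simp [mean_const]
        | succ t ih => simp_rw [Finset.sum_range_succ, mean_add, ih]
      · rw [haltMean, after, mean_bind]; rfl

/-- Links the compositional calculus of `ert` to the quantities of the model. Everything about
programs is proved for `ert` and translated back only here. -/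
theorem ert_eq (p : Prog) (s : State w) (f : State w → ℝ≥0∞) :
    ert f ([p], s) = expTime p s + expFinal p s f := by
  have h : expFinal p s f = ⨆ t, haltMean f t ([p], s) := by
    unfold expFinal haltMean mean; rfl
  rw [h]
  unfold ert expTime
  rw [ENNReal.tsum_eq_iSup_nat, ENNReal.iSup_add_iSup_of_monotone]
  · simp_rw [ertN_eq]
  · exact fun a b h => Finset.sum_le_sum_of_subset (Finset.range_mono h)
  · exact haltMean_mono f _

theorem ert_nil (f : State w → ℝ≥0∞) (s : State w) : ert f ([], s) = f s := by
  unfold ert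
  have : ∀ t, ertN f t ([], s) = f s := by intro t; cases t <;> simp [ertN]
  simp [this]

theorem ert_step_le (f : State w → ℝ≥0∞) (c : Config w) (h : c.1 ≠ []) :
    ert f c ≤ 1 + mean (step c) (ert f) := by
  refine iSup_le fun t => ?_
  cases t with
  | zero => simp [ertN, h]
  | succ t =>
    simp only [ertN, h, if_false]
    gcongr
    exact mean_mono _ fun a _ => le_iSup (fun t => ertN f t a) t

theorem ert_le_of_step_eq {f : State w → ℝ≥0∞} {p : Prog} {k : List Prog} {s : State w}
    {c : Config w} (h : step (p :: k, s) = PMF.pure c) :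
    ert f (p :: k, s) ≤ 1 + ert f c := by
  refine (ert_step_le f _ (by simp)).trans ?_
  rw [h, mean_pure]

/-- A step inspects only the top of the stack, so what lies below is carried along unchanged. -/
theorem step_append (p : Prog) (l k : List Prog) (s : State w) :
    step (p :: (l ++ k), s) = (step (p :: l, s)).map fun c => (c.1 ++ k, c.2) := by
  cases p <;> simp [step, PMF.pure_map, PMF.map_comp, Function.comp_def]
  all_goals split_ifs <;> rfl

/-- The sequencing rule. It is an inequality because on the right the continuation `k` gets
unlimited time, while on the left both parts share `t` steps. -/
theorem ertN_append_le (f : State w → ℝ≥0∞) (t : ℕ) (l k : List Prog) (s : State w) :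
    ertN f t (l ++ k, s) ≤ ertN (fun s' => ert f (k, s')) t (l, s) := by
  induction t generalizing l s with
  | zero =>
    cases l with
    | nil => simp only [ertN, List.nil_append, if_true]; exact le_iSup (fun t => ertN f t (k, s)) 0
    | cons p l => simp [ertN]
  | succ t ih =>
    cases l with
    | nil =>
      simp only [List.nil_append]
      rw [show ertN (fun s' => ert f (k, s')) (t+1) ([], s) = ert f (k, s) by simp [ertN]]
      exact le_iSup (fun t => ertN f t (k, s)) (t+1)
    | cons p l =>
      simp only [ertN, List.cons_append, reduceCtorEq, if_false]
      rw [step_append, mean_map]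
      gcongr
      exact mean_mono _ fun a _ => ih a.1 a.2

theorem ert_append_le (f : State w → ℝ≥0∞) (l k : List Prog) (s : State w) :
    ert f (l ++ k, s) ≤ ert (fun s' => ert f (k, s')) (l, s) :=
  iSup_mono fun t => ertN_append_le f t l k s

theorem ert_cons_le (f : State w → ℝ≥0∞) (p : Prog) (k : List Prog) (s : State w) :
    ert f (p :: k, s) ≤ ert (fun s' => ert f (k, s')) ([p], s) := ert_append_le f [p] k s

theorem ert_rand_le (f : State w → ℝ≥0∞) (d : ℕ) (k : List Prog) (s : State w) :
    ert f (.rand d :: k, s) ≤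
      1 + (2 ^ w : ℝ≥0∞)⁻¹ * ∑ v : Fin (2 ^ w), ert f (k, s.setReg d (BitVec.ofFin v)) := by
  refine (ert_step_le f _ (by simp)).trans ?_
  rw [show step (.rand d :: k, s) = (PMF.uniformOfFintype (Fin (2 ^ w))).map fun v =>
    (k, s.setReg d (BitVec.ofFin v)) from rfl, mean_map, mean_uniform]
  simp

/-! ### Halting states and monotonicity -/

theorem mem_support_after_succ {t : ℕ} {c c' : Config w} :
    c' ∈ (after (t + 1) c).support ↔ ∃ d ∈ (step c).support, c' ∈ (after t d).support := by
  simp [after]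

theorem expFinal_mono {p : Prog} {s : State w} {f g : State w → ℝ≥0∞}
    (h : ∀ s', MayHalt p s s' → f s' ≤ g s') : expFinal p s f ≤ expFinal p s g := by
  refine iSup_mono fun t => mean_mono _ fun c hc => ?_
  obtain ⟨l, s'⟩ := c
  rcases eq_or_ne l [] with rfl | h'
  · simpa using h s' ⟨t, hc⟩
  · simp [h']

theorem expFinal_add_le (p : Prog) (s : State w) (f g : State w → ℝ≥0∞) :
    expFinal p s (fun s' => f s' + g s') ≤ expFinal p s f + expFinal p s g := by
  refine iSup_le fun t => ?_
  refine le_trans ?_ (add_le_add (le_iSup _ t) (le_iSup _ t))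
  refine le_trans (le_of_eq ?_) (le_of_eq (mean_add _ _ _))
  unfold mean
  refine tsum_congr fun c => ?_
  by_cases h : c.1 = [] <;> simp [h]

theorem expFinal_const_le (p : Prog) (s : State w) (c : ℝ≥0∞) :
    expFinal p s (fun _ => c) ≤ c := by
  refine iSup_le fun t => ?_
  refine (mean_mono (h := fun _ => c) _ fun c _ => ?_).trans (mean_const _ _).le
  split_ifs <;> simp

/-- If the expected value of a function that is infinite on bad states is finite, then no bad state
is ever reached. -/
theorem of_expFinal_lt_top {p : Prog} {s : State w} {f : State w → ℝ≥0∞}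
    (h : expFinal p s f ≠ ∞) {s' : State w} (hs : MayHalt p s s') : f s' ≠ ∞ := by
  obtain ⟨t, ht⟩ := hs
  intro hf
  refine h (top_le_iff.1 ?_)
  refine le_trans ?_ (le_iSup _ t)
  refine le_trans ?_ (ENNReal.le_tsum ([], s'))
  rw [PMF.mem_support_iff] at ht
  simp [hf, ENNReal.mul_top ht]

end WordRAM
end

noncomputable section
namespace WordRAM
variable {w : ℕ}

/-! ### Structured programs

Variables live in the registers with even numbers. Those with odd numbers hold intermediate values
and are zero between statements. -/

/-- `p` takes at most `k` steps from `s` to `s'`. -/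
def Steps (p : Prog) (s s' : State w) (k : ℕ) : Prop :=
  ∀ (rest : List Prog) (f : State w → ℝ≥0∞),
    ert f (p :: rest, s) ≤ (k : ℝ≥0∞) + ert f (rest, s')

theorem Steps.mono {p : Prog} {s s' : State w} {k k' : ℕ} (h : Steps p s s' k) (hk : k ≤ k') :
    Steps p s s' k' := fun rest f => (h rest f).trans (by gcongr)

theorem Steps.of_step {p : Prog} {s s' : State w}
    (h : ∀ k : List Prog, step (p :: k, s) = PMF.pure (k, s')) : Steps p s s' 1 := by
  intro rest f
  simpa using ert_le_of_step_eq (f := f) (h rest)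

theorem Steps.seq {p q : Prog} {s s₁ s₂ : State w} {k₁ k₂ : ℕ} (hp : Steps p s s₁ k₁)
    (hq : Steps q s₁ s₂ k₂) : Steps (.seq p q) s s₂ (k₁ + k₂ + 1) := by
  intro rest f
  refine (ert_le_of_step_eq (c := (p :: q :: rest, s)) rfl).trans ?_
  refine (add_le_add le_rfl ((hp _ f).trans (add_le_add le_rfl (hq _ f)))).trans ?_
  push_cast
  apply le_of_eq; ring

inductive Expr where
  | var (r : ℕ)
  | lit (n : ℕ)
  | size
  | bin (o : BinOp) (a b : Expr)
  | ld (a : ℕ) (i : Expr)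

namespace Expr

instance : Add Expr := ⟨.bin .add⟩
instance : Sub Expr := ⟨.bin .sub⟩
instance : Mul Expr := ⟨.bin .mul⟩
instance : Div Expr := ⟨.bin .div⟩
instance : Mod Expr := ⟨.bin .mod⟩

/-- The program that computes an expression into the odd register number `t`. -/
def code : Expr → ℕ → Prog
  | var r, t => .op .bor (2 * t + 1) (2 * r) (2 * r)
  | lit n, t => .const (2 * t + 1) n
  | size, t => .wordSize (2 * t + 1)
  | bin o a b, t => .seq (a.code t) (.seq (b.code (t + 1))
      (.seq (.op o (2 * t + 1) (2 * t + 1) (2 * (t + 1) + 1)) (.const (2 * (t + 1) + 1) 0)))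
  | ld a i, t => .seq (i.code t) (.load (2 * t + 1) a (2 * t + 1))

def cost : Expr → ℕ
  | var _ => 1
  | lit _ => 1
  | size => 1
  | bin _ a b => a.cost + b.cost + 5
  | ld _ i => i.cost + 2

end Expr

namespace State

def get (s : State w) (r : ℕ) : BitVec w := s.reg (2 * r)

def set (s : State w) (r : ℕ) (v : BitVec w) : State w := s.setReg (2 * r) v

/-- The discipline on scratch registers: they are zero between statements, so every compiled
statement can restore them exactly and its effect is a pure change of variables and arrays. -/
def Clean (s : State w) : Prop := ∀ t, s.reg (2 * t + 1) = 0

theorem ext' {s s' : State w} (h : ∀ r, s.reg r = s'.reg r) (h' : s.mem = s'.mem) : s = s' := by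
  cases s; cases s'; simp only [mk.injEq]; exact ⟨funext h, h'⟩

theorem setReg_reg (s : State w) (d r : ℕ) (v : BitVec w) :
    (s.setReg d v).reg r = if r = d then v else s.reg r := by
  simp [setReg, Function.update_apply]

@[simp] theorem setReg_mem (s : State w) (d : ℕ) (v : BitVec w) : (s.setReg d v).mem = s.mem := rfl

theorem setReg_setReg (s : State w) (d : ℕ) (v v' : BitVec w) :
    (s.setReg d v).setReg d v' = s.setReg d v' := by
  simp [setReg]

theorem setReg_self (s : State w) (d : ℕ) (v : BitVec w) (h : s.reg d = v) :
    s.setReg d v = s := by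
  subst h; simp [setReg]

theorem setReg_comm (s : State w) {d d' : ℕ} (h : d ≠ d') (v v' : BitVec w) :
    (s.setReg d v).setReg d' v' = (s.setReg d' v').setReg d v := by
  simp [setReg, Function.update_comm h]

@[simp] theorem get_set (s : State w) (r r' : ℕ) (v : BitVec w) :
    (s.set r v).get r' = if r' = r then v else s.get r' := by
  simp [get, set, setReg_reg]

@[simp] theorem mem_set (s : State w) (r : ℕ) (v : BitVec w) : (s.set r v).mem = s.mem := rfl

@[simp] theorem get_setMem (s : State w) (a r : ℕ) (i v : BitVec w) :
    (s.setMem a i v).get r = s.get r := rfl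

@[simp] theorem mem_setMem (s : State w) (a b : ℕ) (i v : BitVec w) :
    (s.setMem a i v).mem b = if b = a then Function.update (s.mem a) i v else s.mem b := by
  simp only [setMem, Function.update_apply]

theorem Clean.set {s : State w} (h : s.Clean) (r : ℕ) (v : BitVec w) : (s.set r v).Clean := by
  intro t
  rw [State.set, setReg_reg, if_neg (by omega), h t]

theorem Clean.setMem {s : State w} (h : s.Clean) (a : ℕ) (i v : BitVec w) :
    (s.setMem a i v).Clean := h

end State

namespace Expr

def eval (s : State w) : Expr → BitVec w
  | var r => s.get r
  | lit n => BitVec.ofNat w n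
  | size => BitVec.ofNat w w
  | bin o a b => o.eval (a.eval s) (b.eval s)
  | ld a i => s.mem a (i.eval s)

/-- Expressions read only variables, that is, even registers. -/
theorem eval_setReg (s : State w) (e : Expr) (t : ℕ) (v : BitVec w) :
    e.eval (s.setReg (2 * t + 1) v) = e.eval s := by
  induction e with
  | var r => simp only [eval, State.get, State.setReg_reg]; rw [if_neg (by omega)]
  | lit n => rfl
  | size => rfl
  | bin o a b ha hb => simp [eval, ha, hb]
  | ld a i hi => simp [eval, hi]

/-- The odd registers serve as a stack: the second operand is evaluated one level higher and that
level is reset to zero. Since it was zero before, the net effect is confined to register `2 * t +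
1`. -/
theorem code_steps (e : Expr) (t : ℕ) (s : State w) (hs : ∀ t' > t, s.reg (2 * t' + 1) = 0) :
    Steps (e.code t) s (s.setReg (2 * t + 1) (e.eval s)) e.cost := by
  induction e generalizing t s with
  | var r =>
    apply Steps.of_step
    intro k
    show PMF.pure _ = _
    simp [BinOp.eval, eval, State.get]
  | lit n => exact Steps.of_step fun k => rfl
  | size => exact Steps.of_step fun k => rfl
  | bin o a b ha hb =>
    have h1 := ha t s hs
    have h2 := hb (t + 1) (s.setReg (2 * t + 1) (a.eval s)) (by
      intro t' ht'
      rw [State.setReg_reg, if_neg (by omega)]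
      exact hs t' (by omega))
    rw [eval_setReg] at h2
    set s2 := (s.setReg (2 * t + 1) (a.eval s)).setReg (2 * (t + 1) + 1) (b.eval s) with hs2
    have h3 : Steps (.op o (2 * t + 1) (2 * t + 1) (2 * (t + 1) + 1)) s2
        (s2.setReg (2 * t + 1) (o.eval (a.eval s) (b.eval s))) 1 := by
      apply Steps.of_step
      intro k
      show PMF.pure _ = _
      congr 4
      · simp only [hs2, State.setReg_reg]; rw [if_neg (by omega), if_pos trivial]
      · simp only [hs2, State.setReg_reg]; simp
    have h4 : Steps (.const (2 * (t + 1) + 1) 0)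
        (s2.setReg (2 * t + 1) (o.eval (a.eval s) (b.eval s)))
        (s.setReg (2 * t + 1) (o.eval (a.eval s) (b.eval s))) 1 := by
      apply Steps.of_step
      intro k
      show PMF.pure (k, _) = _
      congr 2
      refine State.ext' (fun r => ?_) rfl
      simp only [hs2, State.setReg_reg]
      -- The register of the second operand is reset to 0, which is the value it has in `s` by `hs`.
      by_cases h : r = 2 * (t + 1) + 1
      · subst h
        rw [if_pos rfl, if_neg (by omega), hs (t + 1) (by omega)]
        rfl
      · rw [if_neg h]
        by_cases h' : r = 2 * t + 1
        · simp [h']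
        · simp [h, h']
    exact (h1.seq (h2.seq (h3.seq h4))).mono (by simp only [cost]; omega)
  | ld a i hi =>
    refine ((hi t s hs).seq (Steps.of_step (s' := s.setReg (2 * t + 1) (eval s (ld a i)))
      fun k => ?_)).mono (by simp only [cost]; omega)
    show PMF.pure (k, _) = _
    congr 2
    rw [State.setReg_setReg]
    simp [State.setReg_reg, eval]

end Expr

/-- `p` halts deterministically within `k` steps in a state with the property `Q`. -/
def Runs (p : Prog) (s : State w) (k : ℕ) (Q : State w → Prop) : Prop :=
  s.Clean → ∃ s', s'.Clean ∧ Q s' ∧ Steps p s s' k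

theorem Runs.mono {p : Prog} {s : State w} {k k' : ℕ} {Q Q' : State w → Prop}
    (h : Runs p s k Q) (hk : k ≤ k') (hQ : ∀ s', Q s' → Q' s') : Runs p s k' Q' := by
  intro hs
  obtain ⟨s', h1, h2, h3⟩ := h hs
  exact ⟨s', h1, hQ _ h2, h3.mono hk⟩

theorem Runs.seq {p q : Prog} {s : State w} {k₁ k₂ : ℕ} {Q Q' : State w → Prop}
    (hp : Runs p s k₁ Q) (hq : ∀ s', Q s' → Runs q s' k₂ Q') :
    Runs (.seq p q) s (k₁ + k₂ + 1) Q' := by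
  intro hs
  obtain ⟨s', h1, h2, h3⟩ := hp hs
  obtain ⟨s'', h4, h5, h6⟩ := hq s' h2 h1
  exact ⟨s'', h4, h5, h3.seq h6⟩

inductive Instr where
  | asg (d : ℕ) (e : Expr)
  | sto (a : ℕ) (i v : Expr)

namespace Instr

def code : Instr → Prog
  | asg d e => .seq (e.code 0) (.seq (.op .bor (2 * d) 1 1) (.const 1 0))
  | sto a i v => .seq (i.code 0) (.seq (v.code 1) (.seq (.store a 1 3)
      (.seq (.const 1 0) (.const 3 0))))

def cost : Instr → ℕ
  | asg _ e => e.cost + 4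
  | sto _ i v => i.cost + v.cost + 7

def exec (s : State w) : Instr → State w
  | asg d e => s.set d (e.eval s)
  | sto a i v => s.setMem a (i.eval s) (v.eval s)

theorem exec_clean {s : State w} (hs : s.Clean) (i : Instr) : (i.exec s).Clean := by
  cases i
  · exact hs.set _ _
  · exact hs.setMem _ _ _

theorem code_steps {s : State w} (hs : s.Clean) (i : Instr) :
    Steps i.code s (i.exec s) i.cost := by
  cases i with
  | asg d e =>
    have h1 := e.code_steps 0 s fun t _ => hs t
    have h2 : Steps (.op .bor (2 * d) 1 1) (s.setReg (2 * 0 + 1) (e.eval s))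
        ((s.setReg 1 (e.eval s)).setReg (2 * d) (e.eval s)) 1 := by
      apply Steps.of_step
      intro k
      show PMF.pure _ = _
      simp [BinOp.eval, State.setReg_reg]
    have h3 : Steps (.const 1 0) ((s.setReg 1 (e.eval s)).setReg (2 * d) (e.eval s))
        (s.setReg (2 * d) (e.eval s)) 1 := by
      apply Steps.of_step
      intro k
      show PMF.pure (k, _) = _
      congr 2
      rw [State.setReg_comm _ (by omega), State.setReg_setReg]
      congr 1
      exact State.setReg_self _ _ _ (hs 0)
    exact (h1.seq (h2.seq h3)).mono (by simp only [cost]; omega)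
  | sto a i v =>
    have h1 := i.code_steps 0 s fun t _ => hs t
    have h2 := v.code_steps 1 (s.setReg (2 * 0 + 1) (i.eval s)) (by
      intro t ht
      rw [State.setReg_reg, if_neg (by omega)]; exact hs t)
    rw [Expr.eval_setReg] at h2
    set s2 := (s.setReg (2 * 0 + 1) (i.eval s)).setReg (2 * 1 + 1) (v.eval s) with hs2
    have h3 : Steps (.store a 1 3) s2 (s2.setMem a (i.eval s) (v.eval s)) 1 := by
      apply Steps.of_step
      intro k
      show PMF.pure _ = _
      congr 3
    have h4 : Steps (.const 1 0) (s2.setMem a (i.eval s) (v.eval s))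
        ((s2.setMem a (i.eval s) (v.eval s)).setReg 1 0) 1 := Steps.of_step fun k => rfl
    have h5 : Steps (.const 3 0) ((s2.setMem a (i.eval s) (v.eval s)).setReg 1 0)
        (s.setMem a (i.eval s) (v.eval s)) 1 := by
      apply Steps.of_step
      intro k
      show PMF.pure (k, _) = _
      congr 2
      refine State.ext' (fun r => ?_) rfl
      simp only [State.setReg_reg, State.setMem, hs2]
      have e1 := hs 0
      have e3 := hs 1
      simp only [Nat.mul_zero, Nat.zero_add, Nat.mul_one, Nat.reduceAdd] at e1 e3 ⊢
      split_ifs with h h' <;> simp_all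
    exact (h1.seq (h2.seq (h3.seq (h4.seq h5)))).mono (by simp only [cost]; omega)

end Instr

/-- A list of instructions as a program. -/
def block : List Instr → Prog
  | [] => .skip
  | i :: l => .seq i.code (block l)

def blockCost : List Instr → ℕ
  | [] => 1
  | i :: l => i.cost + blockCost l + 1

def exec (l : List Instr) (s : State w) : State w := l.foldl Instr.exec s

theorem Runs.block {l : List Instr} {s : State w} {Q : State w → Prop} (h : Q (exec l s)) :
    Runs (block l) s (blockCost l) Q := by
  intro hs
  refine ⟨exec l s, ?_, h, ?_⟩
  · clear h
    induction l generalizing s with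
    | nil => exact hs
    | cons i l ih => exact ih (Instr.exec_clean hs i)
  · clear h
    induction l generalizing s with
    | nil => exact Steps.of_step fun k => rfl
    | cons i l ih => exact (Instr.code_steps hs i).seq (ih (Instr.exec_clean hs i))

/-- The test value sits in scratch register 1. The first branch has to clear it; in the second
branch it is zero already. -/
def ifP (e : Expr) (p q : Prog) : Prog :=
  .seq (e.code 0) (.ite 1 (.seq (.const 1 0) p) q)

theorem State.Clean.clear {s : State w} (hs : s.Clean) (v : BitVec w) :
    (s.setReg (2 * 0 + 1) v).setReg 1 0 = s := by
  rw [State.setReg_setReg]; exact State.setReg_self _ _ _ (hs 0)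

theorem Steps.const_clear {s : State w} (hs : s.Clean) (v : BitVec w) :
    Steps (.const 1 0) (s.setReg (2 * 0 + 1) v) s 1 := by
  apply Steps.of_step
  intro k
  show PMF.pure (k, _) = _
  congr 2
  exact hs.clear v

theorem Runs.ifP {e : Expr} {p q : Prog} {s : State w} {k : ℕ} {Q : State w → Prop}
    (hp : e.eval s ≠ 0 → Runs p s k Q) (hq : e.eval s = 0 → Runs q s k Q) :
    Runs (ifP e p q) s (e.cost + k + 4) Q := by
  intro hs
  have h1 := e.code_steps 0 s fun t _ => hs t
  by_cases h : e.eval s = 0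
  · obtain ⟨s', a, b, c⟩ := hq h hs
    refine ⟨s', a, b, ?_⟩
    have : s.setReg (2 * 0 + 1) (e.eval s) = s := State.setReg_self _ _ _ (by rw [h]; exact hs 0)
    rw [this] at h1
    refine (h1.seq (s₂ := s') (k₂ := k + 1) fun rest f => ?_).mono (by omega)
    refine (ert_le_of_step_eq (c := (q :: rest, s)) ?_).trans ?_
    · show PMF.pure _ = _
      have := hs 0
      simp only [Nat.mul_zero, Nat.zero_add] at this
      simp [this]
    · refine (add_le_add le_rfl (c rest f)).trans (le_of_eq ?_)
      push_cast; ring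
  · obtain ⟨s', a, b, c⟩ := hp h hs
    refine ⟨s', a, b, ?_⟩
    have h2 := (Steps.const_clear hs (e.eval s)).seq c
    refine (h1.seq (s₂ := s') (k₂ := k + 3) fun rest f => ?_).mono (by omega)
    refine (ert_le_of_step_eq (c := (_ :: rest, s.setReg (2 * 0 + 1) (e.eval s))) ?_).trans
      ((add_le_add le_rfl (h2 rest f)).trans (le_of_eq ?_))
    · show PMF.pure _ = _
      have h' : ¬ e.eval s = 0#w := h
      simp [State.setReg_reg, h']
    · push_cast; ring

/-- The condition is recomputed at the end of the body, so register 1 always holds its current value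
when the loop tests it. -/
def whileP (e : Expr) (p : Prog) : Prog :=
  .seq (e.code 0) (.loop 1 (.seq (.const 1 0) (.seq p (e.code 0))))

/-- What remains to be executed when the body of a loop has been executed. -/
def whileRest (e : Expr) (p : Prog) (rest : List Prog) : List Prog :=
  e.code 0 :: .loop 1 (.seq (.const 1 0) (.seq p (e.code 0))) :: rest

theorem ert_whileP_le (e : Expr) (p : Prog) (rest : List Prog) (f : State w → ℝ≥0∞)
    (s : State w) : ert f (whileP e p :: rest, s) ≤ 1 + ert f (whileRest e p rest, s) :=
  ert_le_of_step_eq rfl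

theorem ert_whileRest_zero {e : Expr} {s : State w} (hs : s.Clean) (h : e.eval s = 0) (p : Prog)
    (rest : List Prog) (f : State w → ℝ≥0∞) :
    ert f (whileRest e p rest, s) ≤ ((e.cost + 1 : ℕ) : ℝ≥0∞) + ert f (rest, s) := by
  have h1 := e.code_steps 0 s fun t _ => hs t
  have : s.setReg (2 * 0 + 1) (e.eval s) = s := State.setReg_self _ _ _ (by rw [h]; exact hs 0)
  rw [this] at h1
  refine (h1 _ f).trans ?_
  push_cast
  rw [add_assoc]
  refine add_le_add le_rfl (ert_le_of_step_eq ?_)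
  show PMF.pure _ = _
  have := hs 0
  simp only [Nat.mul_zero, Nat.zero_add] at this
  simp [this]

theorem ert_whileRest_ne {e : Expr} {s : State w} (hs : s.Clean) (h : e.eval s ≠ 0) (p : Prog)
    (rest : List Prog) (f : State w → ℝ≥0∞) :
    ert f (whileRest e p rest, s) ≤
      ((e.cost + 4 : ℕ) : ℝ≥0∞) + ert f (p :: whileRest e p rest, s) := by
  have h1 := e.code_steps 0 s fun t _ => hs t
  refine (h1 _ f).trans ?_
  push_cast
  rw [add_assoc]
  refine add_le_add le_rfl ?_
  set s1 := s.setReg (2 * 0 + 1) (e.eval s) with hs1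
  refine (ert_le_of_step_eq (c := (.seq (.const 1 0) (.seq p (e.code 0)) ::
    .loop 1 (.seq (.const 1 0) (.seq p (e.code 0))) :: rest, s1)) ?_).trans ?_
  · show PMF.pure _ = _
    have h' : ¬ e.eval s = 0#w := h
    simp [hs1, State.setReg_reg, h']
  · refine (add_le_add le_rfl ((ert_le_of_step_eq rfl).trans (add_le_add le_rfl
      ((Steps.const_clear hs (e.eval s) _ f).trans
        (add_le_add le_rfl (ert_le_of_step_eq rfl)))))).trans (le_of_eq ?_)
    unfold whileRest
    push_cast; ring

/-- The invariant is indexed by the round, and the cost may depend on the round; this is needed for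
loops over linked lists of varying lengths, whose total length is what counts. -/
theorem Runs.while {e : Expr} {p : Prog} {s : State w} (Inv : ℕ → State w → Prop) (m : ℕ)
    (cost : ℕ → ℕ) (h0 : Inv 0 s) (hend : ∀ s, Inv m s → e.eval s = 0)
    (hgo : ∀ j < m, ∀ s, Inv j s → e.eval s ≠ 0 ∧ Runs p s (cost j) (Inv (j + 1))) :
    Runs (whileP e p) s (∑ j ∈ Finset.range m, (cost j + (e.cost + 4)) + (e.cost + 2))
      (Inv m) := by
  intro hs
  -- Induction on the number `d` of remaining rounds, from an arbitrary round `j`; the initial entry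
  -- into the loop accounts for the one extra step.
  suffices H : ∀ d j s, j + d = m → Inv j s → s.Clean → ∃ s', s'.Clean ∧ Inv m s' ∧
      ∀ rest f, ert f (whileRest e p rest, s) ≤
        ((∑ i ∈ Finset.range d, (cost (j + i) + (e.cost + 4)) + (e.cost + 1) : ℕ) : ℝ≥0∞) +
          ert f (rest, s') by
    obtain ⟨s', a, b, c⟩ := H m 0 s (by omega) h0 hs
    refine ⟨s', a, b, fun rest f => ?_⟩
    refine (ert_whileP_le _ _ _ _ _).trans ((add_le_add le_rfl (c rest f)).trans (le_of_eq ?_))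
    simp only [Nat.zero_add]
    push_cast; ring
  intro d
  induction d with
  | zero =>
    intro j s hj hI hc
    obtain rfl : j = m := by omega
    refine ⟨s, hc, hI, fun rest f => ?_⟩
    simpa using ert_whileRest_zero hc (hend s hI) p rest f
  | succ d ih =>
    intro j s hj hI hc
    obtain ⟨hne, hr⟩ := hgo j (by omega) s hI
    obtain ⟨s1, hc1, hI1, hst⟩ := hr hc
    obtain ⟨s', a, b, c⟩ := ih (j + 1) s1 (by omega) hI1 hc1
    refine ⟨s', a, b, fun rest f => ?_⟩
    refine (ert_whileRest_ne hc hne p rest f).trans ((add_le_add le_rfl ((hst _ f).trans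
      (add_le_add le_rfl (c rest f)))).trans (le_of_eq ?_))
    rw [Finset.sum_range_succ']
    simp only [Nat.add_zero, Nat.add_assoc, Nat.add_comm 1]
    push_cast; ring

end WordRAM
end

noncomputable section
namespace WordRAM
variable {w : ℕ}

/-! ### Running a data structure inside a larger program -/

/-- Rename the registers and arrays of a program: register `r` becomes variable `r + 40`, array `a`
becomes array `a + 20`. -/
def Prog.rename : Prog → Prog
  | .skip => .skip
  | .const d v => .const (2 * (d + 40)) v
  | .wordSize d => .wordSize (2 * (d + 40))
  | .op o d x y => .op o (2 * (d + 40)) (2 * (x + 40)) (2 * (y + 40))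
  | .load d a x => .load (2 * (d + 40)) (a + 20) (2 * (x + 40))
  | .store a x y => .store (a + 20) (2 * (x + 40)) (2 * (y + 40))
  | .rand d => .rand (2 * (d + 40))
  | .seq p q => .seq p.rename q.rename
  | .ite x p q => .ite (2 * (x + 40)) p.rename q.rename
  | .loop x p => .loop (2 * (x + 40)) p.rename

namespace State

/-- The state of the embedded program. -/
def inner (s : State w) : State w := ⟨fun r => s.get (r + 40), fun a => s.mem (a + 20)⟩

/-- Replace the state of the embedded program. -/
def embed (b d : State w) : State w where
  reg r := if r % 2 = 0 ∧ 80 ≤ r then d.reg (r / 2 - 40) else b.reg r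
  mem a := if 20 ≤ a then d.mem (a - 20) else b.mem a

theorem embed_inner (s : State w) : s.embed s.inner = s := by
  refine ext' (fun r => ?_) (funext fun a => ?_)
  · simp only [embed, inner, get]
    split_ifs with h
    · congr 1; omega
    · rfl
  · simp only [embed, inner]
    split_ifs with h
    · congr 1; omega
    · rfl

theorem inner_embed (b d : State w) : (b.embed d).inner = d := by
  refine ext' (fun r => ?_) (funext fun a => ?_)
  · simp only [embed, inner, get]
    rw [if_pos (by omega)]
    congr 1; omega
  · simp [embed, inner]

theorem get_embed (b d : State w) {r : ℕ} (h : r < 40) : (b.embed d).get r = b.get r := by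
  simp only [embed, get]; rw [if_neg (by omega)]

theorem mem_embed (b d : State w) {a : ℕ} (h : a < 20) : (b.embed d).mem a = b.mem a := by
  simp only [embed]; rw [if_neg (by omega)]

theorem Clean.embed {b : State w} (h : b.Clean) (d : State w) : (b.embed d).Clean := by
  intro t
  simp only [State.embed]; rw [if_neg (by omega), h t]

theorem embed_reg (b d : State w) (r : ℕ) : (b.embed d).reg (2 * (r + 40)) = d.reg r := by
  simp only [embed]; rw [if_pos (by omega)]; congr 1; omega

theorem embed_mem (b d : State w) (a : ℕ) : (b.embed d).mem (a + 20) = d.mem a := by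
  simp [embed]

theorem embed_setReg (b d : State w) (r : ℕ) (v : BitVec w) :
    (b.embed d).setReg (2 * (r + 40)) v = b.embed (d.setReg r v) := by
  refine ext' (fun r' => ?_) rfl
  simp only [setReg_reg, embed]
  by_cases h : r' = 2 * (r + 40)
  · rw [if_pos h, if_pos (by omega), if_pos (by omega)]
  · rw [if_neg h]
    by_cases h' : r' % 2 = 0 ∧ 80 ≤ r'
    · rw [if_pos h', if_pos h', if_neg (by omega)]
    · rw [if_neg h', if_neg h']

theorem embed_setMem (b d : State w) (a : ℕ) (i v : BitVec w) :
    (b.embed d).setMem (a + 20) i v = b.embed (d.setMem a i v) := by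
  refine ext' (fun r' => rfl) (funext fun a' => ?_)
  simp only [mem_setMem, embed_mem]
  by_cases h : a' = a + 20
  · subst h; simp [embed]
  · rw [if_neg h]
    simp only [embed, mem_setMem]
    by_cases h' : 20 ≤ a'
    · rw [if_pos h', if_pos h', if_neg (by omega)]
    · rw [if_neg h', if_neg h']

theorem inner_set_of_lt (s : State w) {r : ℕ} (h : r < 40) (v : BitVec w) :
    (s.set r v).inner = s.inner := by
  refine ext' (fun r' => ?_) rfl
  simp only [inner, get_set]; rw [if_neg (by omega)]

theorem inner_set (s : State w) (r : ℕ) (v : BitVec w) :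
    (s.set (r + 40) v).inner = s.inner.setReg r v := by
  refine ext' (fun r' => ?_) rfl
  simp only [inner, get_set, setReg_reg, Nat.add_right_cancel_iff]

theorem inner_setMem (s : State w) (a : ℕ) (i v : BitVec w) :
    (s.setMem (a + 20) i v).inner = s.inner.setMem a i v := by
  refine ext' (fun r' => rfl) (funext fun a' => ?_)
  simp only [inner, mem_setMem, Nat.add_right_cancel_iff]

theorem writeArr_singleton (s : State w) (a : ℕ) (v : BitVec w) :
    s.writeArr a [v] = s.setMem a 0 v := by
  refine ext' (fun r' => rfl) ?_
  simp only [writeArr, setMem]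
  congr 1
  funext i
  rw [Function.update_apply]
  split_ifs with h
  · subst h; simp
  · have : i.toNat ≠ 0 := fun h' => h (BitVec.eq_of_toNat_eq (by simpa using h'))
    obtain ⟨k, hk⟩ := Nat.exists_eq_succ_of_ne_zero this
    simp [hk]

end State

/-- A renamed program touches only even registers from 80 on and arrays from 20 on, so it acts on
the embedded state and leaves the host `b` alone. -/
theorem step_rename (l : List Prog) (b d : State w) :
    step (l.map Prog.rename, b.embed d) =
      (step (l, d)).map fun c => (c.1.map Prog.rename, b.embed c.2) := by
  cases l with
  | nil => simp [step, PMF.pure_map]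
  | cons p l =>
    cases p <;> simp only [List.map_cons, Prog.rename, step, PMF.pure_map, PMF.map_comp,
      Function.comp_def, State.embed_reg, State.embed_mem, State.embed_setReg,
      State.embed_setMem]
    all_goals split_ifs <;> rfl

theorem ertN_rename (f : State w → ℝ≥0∞) (t : ℕ) (l : List Prog) (b d : State w) :
    ertN f t (l.map Prog.rename, b.embed d) = ertN (fun d' => f (b.embed d')) t (l, d) := by
  induction t generalizing l d with
  | zero => simp [ertN]
  | succ t ih =>
    simp only [ertN, List.map_eq_nil_iff]
    rw [step_rename, mean_map]
    simp only [ih]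

/-- A call of the data structure is charged exactly the two quantities in which `TimeBound` is
expressed: its own expected time, and the expectation of the remaining cost at its halting state. -/
theorem ert_rename_le (f : State w → ℝ≥0∞) (p : Prog) (rest : List Prog) (s : State w) :
    ert f (p.rename :: rest, s) ≤
      expTime p s.inner + expFinal p s.inner fun d => ert f (rest, s.embed d) := by
  refine (ert_cons_le f _ _ _).trans (le_of_eq ?_)
  rw [← ert_eq]
  conv_lhs => rw [← s.embed_inner]
  exact iSup_congr fun t => ertN_rename _ t [p] s s.inner

/-! ### A data structure has to read the whole text -/

namespace State

def patch (j v : BitVec w) (s : State w) : State w := s.setMem 0 j v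

theorem patch_mem (j v : BitVec w) (s : State w) (a : ℕ) (i : BitVec w) (h : a = 0 → i ≠ j) :
    (s.patch j v).mem a i = s.mem a i := by
  simp only [patch, mem_setMem]
  split_ifs with h'
  · subst h'; rw [Function.update_of_ne (h rfl)]
  · rfl

end State

/-- A step addresses at most one cell index, by a load or a store. Changing array 0 at any other
index commutes with the step. The exceptional index is recorded regardless of which array is
addressed. -/
theorem step_patch (c : Config w) : ∃ T : Finset (BitVec w), T.card ≤ 1 ∧ ∀ j ∉ T, ∀ v,
    step (c.1, c.2.patch j v) = (step c).map fun c => (c.1, c.2.patch j v) := by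
  obtain ⟨l, s⟩ := c
  cases l with
  | nil => exact ⟨∅, by simp, fun j _ v => by simp [step, PMF.pure_map]⟩
  | cons p l =>
    cases p with
    | load d a x =>
      refine ⟨{s.reg x}, by simp, fun j hj v => ?_⟩
      simp only [step, PMF.pure_map]
      congr 2
      have : (s.patch j v).mem a ((s.patch j v).reg x) = s.mem a (s.reg x) :=
        State.patch_mem j v s a _ fun _ h => hj (by rw [Finset.mem_singleton, ← h]; rfl)
      rw [this]; rfl
    | store a x y =>
      refine ⟨{s.reg x}, by simp, fun j hj v => ?_⟩
      simp only [step, PMF.pure_map]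
      congr 2
      refine State.ext' (fun r => rfl) (funext fun b => ?_)
      have hne : j ≠ s.reg x := by simpa using hj
      simp only [State.patch, State.setMem]
      by_cases h1 : a = 0
      · subst h1
        by_cases h2 : b = 0
        · subst h2; simp [Function.update_comm hne]
        · simp [h2]
      · by_cases h2 : b = 0
        · subst h2; simp [Ne.symm h1]
        · simp [h1, h2, Function.update_apply]
    | rand d => exact ⟨∅, by simp, fun j _ v => by simp only [step, PMF.map_comp]; rfl⟩
    | ite x p q =>
      exact ⟨∅, by simp, fun j _ v => by simp only [step, PMF.pure_map]; congr 1; split_ifs <;> first | rfl | contradiction⟩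
    | loop x p =>
      exact ⟨∅, by simp, fun j _ v => by simp only [step, PMF.pure_map]; congr 1; split_ifs <;> first | rfl | contradiction⟩
    | _ => exact ⟨∅, by simp, fun j _ v => by simp only [step, PMF.pure_map] <;> rfl⟩

/-- A run of `t` steps addresses at most `t` indices. At every other index the input text can be
changed without destroying the run: it still has positive probability and ends in the same state, up
to that cell. -/
theorem after_patch (t : ℕ) (c c' : Config w) (h : c' ∈ (after t c).support) :
    ∃ T : Finset (BitVec w), T.card ≤ t ∧ ∀ j ∉ T, ∀ v,
      (c'.1, c'.2.patch j v) ∈ (after t (c.1, c.2.patch j v)).support := by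
  classical
  induction t generalizing c with
  | zero =>
    refine ⟨∅, by simp, fun j _ v => ?_⟩
    obtain rfl : c' = c := by simpa [after] using h
    simp [after]
  | succ t ih =>
    obtain ⟨d, hd, hc'⟩ := mem_support_after_succ.1 h
    obtain ⟨T1, hT1, H1⟩ := step_patch c
    obtain ⟨T2, hT2, H2⟩ := ih d hc'
    refine ⟨T1 ∪ T2, (Finset.card_union_le _ _).trans (by omega), fun j hj v => ?_⟩
    rw [Finset.mem_union, not_or] at hj
    refine mem_support_after_succ.2 ⟨(d.1, d.2.patch j v), ?_, H2 j hj.2 v⟩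
    rw [H1 j hj.1 v, PMF.support_map]
    exact ⟨d, hd, rfl⟩

/-- If every halting run of `t` steps ends in a state with `m ≤ t + f`, then `m` is a lower bound
for the expected cost. -/
theorem le_ertN (f : State w → ℝ≥0∞) (m : ℕ) (c : Config w)
    (h : ∀ t s, ([], s) ∈ (after t c).support → (m : ℝ≥0∞) ≤ t + f s) : (m : ℝ≥0∞) ≤ ertN f m c := by
  induction m generalizing c with
  | zero => simp
  | succ m ih =>
    by_cases hc : c.1 = []
    · obtain ⟨l, s⟩ := c
      subst hc
      simpa [ertN] using h 0 s (by simp [after])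
    · simp only [ertN, hc, if_false]
      push_cast
      rw [add_comm]
      gcongr
      rw [← mean_const (step c) (m : ℝ≥0∞)]
      refine mean_mono _ fun d hd => ?_
      refine ih d fun t s hs => ?_
      have := h (t + 1) s (mem_support_after_succ.2 ⟨d, hd, hs⟩)
      push_cast at this
      rw [add_right_comm] at this
      exact (ENNReal.add_le_add_iff_right (by simp)).1 this

theorem le_ert (f : State w → ℝ≥0∞) (m : ℕ) (c : Config w)
    (h : ∀ t s, ([], s) ∈ (after t c).support → (m : ℝ≥0∞) ≤ t + f s) : (m : ℝ≥0∞) ≤ ert f c :=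
  (le_ertN f m c h).trans (le_iSup (fun t => ertN f t c) m)

end WordRAM
end

/-! ### Changing one document that has not been read -/

noncomputable section
namespace WordRAM
variable {w : ℕ}

theorem State.writeArr_patch (s : State w) (a : ℕ) (l : List (BitVec w)) (j v : BitVec w)
    (h : a ≠ 0) : (s.patch j v).writeArr a l = (s.writeArr a l).patch j v := by
  refine State.ext' (fun r => rfl) (funext fun b => ?_)
  simp only [State.patch, State.writeArr, State.setMem, Function.update_apply]
  by_cases h1 : b = a
  · subst h1; simp [h]
  · by_cases h2 : b = 0
    · subst h2; simp [h1]
    · simp [h1, h2]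

theorem queryInput_patch (q : Query) (s : State w) (j v : BitVec w) :
    queryInput q (s.patch j v) = (queryInput q s).patch j v := by
  unfold queryInput
  rw [State.writeArr_patch _ _ _ _ _ (by decide), State.writeArr_patch _ _ _ _ _ (by decide)]
  rfl

/-- `N` documents of length one; only the one with index `j` is not `[0]`. -/
def oneDoc (N j : ℕ) : List Str := (List.replicate N [0]).set j [1]

theorem map_length_oneDoc (N j : ℕ) : (oneDoc N j).map List.length = List.replicate N 1 := by
  unfold oneDoc
  rw [List.map_set]
  simp only [List.map_replicate, List.length_singleton]
  exact List.set_replicate_self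

theorem totalLength_replicate (N : ℕ) : totalLength (List.replicate N [0]) = N := by
  simp [totalLength]

theorem totalLength_oneDoc (N j : ℕ) : totalLength (oneDoc N j) = N := by
  simp [totalLength, map_length_oneDoc]

theorem offsets_oneDoc (N j : ℕ) : offsets (oneDoc N j) = offsets (List.replicate N [0]) := by
  unfold offsets totalLength
  simp only [List.map_take, map_length_oneDoc]
  simp [oneDoc]

theorem flatten_oneDoc (N j : ℕ) : (oneDoc N j).flatten = (List.replicate N 0).set j 1 := by
  induction N generalizing j with
  | zero => simp [oneDoc]
  | succ N ih =>
    cases j with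
    | zero => simp [oneDoc, List.replicate_succ]
    | succ j => 
      have := ih j
      simp only [oneDoc] at this
      simp [oneDoc, List.replicate_succ, this]

/-- All documents have length one, so the offsets do not reveal the exceptional document; the two
inputs differ in a single cell of the text. -/
theorem docsInput_oneDoc {N j : ℕ} (hj : j < N) (hN : N ≤ 2 ^ w) :
    docsInput w (oneDoc N j) =
      (docsInput w (List.replicate N [0])).patch (BitVec.ofNat w j) (BitVec.ofNat w 1) := by
  unfold docsInput
  rw [offsets_oneDoc, totalLength_oneDoc, totalLength_replicate, flatten_oneDoc]
  refine State.ext' (fun r => ?_) (funext fun a => ?_)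
  · simp [State.setReg_reg, State.patch, State.setMem, oneDoc, State.writeArr]
  · simp only [State.setReg_mem, State.patch, State.mem_setMem, State.writeArr, State.zero]
    by_cases h0 : a = 0
    · subst h0
      simp only [ne_eq, zero_ne_one, not_false_eq_true, Function.update_of_ne,
        Function.update_self, if_true]
      funext i
      have hlen : (List.replicate N [0]).flatten = List.replicate N 0 := by simp
      rw [hlen, Function.update_apply]
      have hi : i = BitVec.ofNat w j ↔ i.toNat = j := by
        rw [← BitVec.toNat_inj, BitVec.toNat_ofNat, Nat.mod_eq_of_lt (by omega)]
      simp only [hi]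
      unfold words
      rw [List.map_set]
      by_cases h : i.toNat = j
      · simp [h, List.getD, hj]
      · simp [h, List.getD, Ne.symm h]
    · simp [Function.update_apply, h0]

theorem validDocs_oneDoc {N : ℕ} (hN : 2 ≤ N) (j : ℕ) : ValidDocs (oneDoc N j) := by
  intro D hD
  rw [totalLength_oneDoc]
  rcases List.mem_or_eq_of_mem_set hD with h | h
  · rw [List.eq_of_mem_replicate h]
    simp; omega
  · subst h; simp; omega

theorem validDocs_replicate {N : ℕ} (hN : 2 ≤ N) : ValidDocs (List.replicate N [0]) := by
  intro D hD
  rw [totalLength_replicate, List.eq_of_mem_replicate hD]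
  simp; omega

/-- A data structure that is never wrong has to read the whole text. -/
theorem le_time_of_correct {S : DataStructure} {tp : ℕ → ℝ≥0} {cost : List Str → Query → ℝ≥0}
    {Good : List Str → Query → ∀ {w : ℕ}, State w → Prop} (hC : S.Correct Good)
    (hT : S.TimeBound tp cost) {N : ℕ} (hN : 2 ≤ N) {q : Query} (hq : ValidQuery N q)
    (hG : ∀ (w : ℕ) (s : State w) (j : ℕ) (i v : BitVec w), j < N → N < 2 ^ w →
      Good (List.replicate N [0]) q s → ¬ Good (oneDoc N j) q (s.patch i v)) :
    (N : ℝ≥0) ≤ tp N + cost (List.replicate N [0]) q := by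
  classical
  -- The exponent is one more than required, so that also `N + 2 ≤ 2 ^ w` and the indices below `N`
  -- are distinct words.
  obtain ⟨w, hw⟩ : ∃ w, (N + 2) ^ (S.c + 1) ≤ 2 ^ w :=
    ⟨(N + 2) ^ (S.c + 1), Nat.lt_two_pow_self.le⟩
  have hw' : (N + 2) ^ S.c ≤ 2 ^ w := (Nat.pow_le_pow_right (by omega) (by omega)).trans hw
  have hNw : N + 2 ≤ 2 ^ w := (Nat.le_self_pow (by omega) _).trans hw
  set X := List.replicate N [0] with hX
  have hXl : totalLength X = N := totalLength_replicate N
  have hXv : ValidDocs X := validDocs_replicate hN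
  obtain ⟨h1, h2⟩ := hT w X hXv (by rw [hXl]; exact hw')
  have h3 := h2 [q] (by simpa [hXl] using hq)
  rw [hXl] at h1
  have key : (N : ℝ≥0∞) ≤ ert (S.seqTime [q]) ([S.prep], docsInput w X) := by
    refine le_ert _ _ _ fun t s hs => ?_
    by_cases htN : N ≤ t
    · exact le_add_right (by exact_mod_cast htN)
    -- The preprocessing run has used `t < N` steps. A query run of fewer than `N - t` steps would
    -- leave some document unread by both.
    have key2 : ((N - t : ℕ) : ℝ≥0∞) ≤ ert (fun _ => 0) ([S.query], queryInput q s) := by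
      refine le_ert _ _ _ fun t' s' hs' => ?_
      rw [add_zero]
      norm_cast
      by_contra hlt
      obtain ⟨T1, hT1, H1⟩ := after_patch t _ _ hs
      obtain ⟨T2, hT2, H2⟩ := after_patch t' _ _ hs'
      -- Pigeonhole: the two runs together address fewer than `N` indices.
      obtain ⟨j, hj, hjT⟩ : ∃ j < N, BitVec.ofNat w j ∉ T1 ∪ T2 := by
        by_contra hcon
        push Not at hcon
        have : ((Finset.range N).image (BitVec.ofNat w)).card ≤ (T1 ∪ T2).card := by
          refine Finset.card_le_card fun x hx => ?_
          obtain ⟨j, hj, rfl⟩ := Finset.mem_image.1 hx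
          exact hcon j (Finset.mem_range.1 hj)
        rw [Finset.card_image_of_injOn, Finset.card_range] at this
        · have := Finset.card_union_le T1 T2; omega
        · intro a ha b hb hab
          simp only [Finset.coe_range, Set.mem_Iio] at ha hb
          have := congrArg BitVec.toNat hab
          simpa [Nat.mod_eq_of_lt (show a < 2 ^ w by omega),
            Nat.mod_eq_of_lt (show b < 2 ^ w by omega)] using this
      rw [Finset.mem_union, not_or] at hjT
      have g1 := H1 _ hjT.1 (BitVec.ofNat w 1)
      have g2 := H2 _ hjT.2 (BitVec.ofNat w 1)
      simp only at g1 g2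
      -- The same runs are possible on the collection in which document `j` is different, and they
      -- end with the same output, which by `hG` cannot be correct for both collections.
      rw [← docsInput_oneDoc hj (by omega)] at g1
      rw [← queryInput_patch] at g2
      refine hG w s' j (BitVec.ofNat w j) (BitVec.ofNat w 1) hj (by omega) (hC w X hXv (by rw [hXl]; exact hw') s (.prep ⟨t, hs⟩) q
        (by rw [hXl]; exact hq) s' ⟨t', hs'⟩) ?_
      exact hC w (oneDoc N j) (validDocs_oneDoc hN j) (by rw [totalLength_oneDoc]; exact hw') _
        (.prep ⟨t, g1⟩) q (by rw [totalLength_oneDoc]; exact hq) _ ⟨t', g2⟩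
    have : S.seqTime [q] s = ert (fun _ => 0) ([S.query], queryInput q s) := by
      rw [ert_eq]; rfl
    rw [this]
    calc (N : ℝ≥0∞) = ((t + (N - t) : ℕ) : ℝ≥0∞) := by congr 1; omega
      _ ≤ _ := by push_cast [-ENNReal.natCast_sub]; gcongr
  rw [ert_eq] at key
  have := key.trans (add_le_add h1 h3)
  simp only [List.map_cons, List.map_nil, List.sum_cons, List.sum_nil, add_zero] at this
  exact_mod_cast this

theorem answer_replicate {R : Query → Str → Prop} {N : ℕ} {q : Query} (h : ¬ R q [0]) :
    answer R (List.replicate N [0]) q = ∅ := by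
  ext i
  simp only [answer, Set.mem_ofPred_eq, Set.mem_empty_iff_false, iff_false, not_exists, not_and]
  intro D hD
  rw [List.eq_of_mem_replicate (List.mem_of_getElem? hD)]
  exact h

theorem answer_oneDoc {R : Query → Str → Prop} {N j : ℕ} (hj : j < N) {q : Query} (h : R q [1]) :
    (answer R (oneDoc N j) q).Nonempty :=
  ⟨j, [1], by simp [oneDoc, hj], h⟩

/-- The query selects `[1]` but not `[0]`, so changing one unread document changes the answer from
no to yes. -/
theorem le_time_of_decides {S : DataStructure} {R : Query → Str → Prop} {tp : ℕ → ℝ≥0}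
    {tq : ℕ → ℕ → ℝ≥0} (h : S.Decides R tp tq) {N : ℕ} (hN : 2 ≤ N) {q : Query}
    (hq : ValidQuery N q) (h0 : ¬ R q [0]) (h1 : R q [1]) :
    (N : ℝ≥0) ≤ tp N + tq N (patLength q) := by
  have := le_time_of_correct h.1 h.2 hN hq ?_
  · rwa [totalLength_replicate] at this
  · intro w s j i v hj _ hg hg'
    rw [answer_replicate h0] at hg
    have h2 := hg'.2 (answer_oneDoc hj h1)
    exact Set.not_nonempty_empty (hg.1 h2)

theorem le_time_of_reports {S : DataStructure} {R : Query → Str → Prop} {tp : ℕ → ℝ≥0}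
    {tq : ℕ → ℕ → ℝ≥0} {tr : ℕ → ℝ≥0} (h : S.Reports R tp tq tr) {N : ℕ} (hN : 2 ≤ N) {q : Query}
    (hq : ValidQuery N q) (h0 : ¬ R q [0]) (h1 : R q [1]) :
    (N : ℝ≥0) ≤ tp N + tq N (patLength q) := by
  have := le_time_of_correct h.1 h.2 hN hq ?_
  · rw [totalLength_replicate, answer_replicate h0] at this
    simpa using this
  · rintro w s j i v hj _ ⟨l, -, hl, hlen, -⟩ ⟨l', -, hl', hlen', -⟩
    rw [answer_replicate h0] at hl
    obtain ⟨i', hi'⟩ := answer_oneDoc hj h1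
    have e1 : l = [] := List.eq_nil_iff_forall_not_mem.2 fun i hi => (hl i).1 hi
    have e2 : l' ≠ [] := List.ne_nil_of_mem ((hl' i').2 hi')
    have : l'.length = l.length := hlen'.symm.trans hlen
    exact e2 (List.length_eq_zero_iff.1 (by rw [this, e1]; rfl))

theorem validQuery_pair {N a b : ℕ} (ha : a < N) (hb : b < N) : ValidQuery N ([a], [b]) := by
  simp [ValidQuery]; omega

end WordRAM
end

noncomputable section
namespace WordRAM
variable {w : ℕ}

/-! ### Multiply-shift hashing -/

/-- Multiply-shift hashing with multiplier `m`: the product modulo `2 ^ w` without its `k` lowest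
bits. -/
def hash (m : BitVec w) (k : ℕ) (x : BitVec w) : ℕ := (m * x).toNat / 2 ^ k

/-- The word `v`, as an integer modulo `2 ^ w`, is within `4 * P` of `0`. -/
def Near (P : ℕ) (v : BitVec w) : Prop := v.toNat < 4 * P ∨ 2 ^ w < v.toNat + 4 * P

instance (P : ℕ) (v : BitVec w) : Decidable (Near P v) := by unfold Near; infer_instance

theorem near_of_int {P : ℕ} {v : BitVec w} {t k : ℤ} (hv : (v.toNat : ℤ) = t + k * 2 ^ w)
    (h1 : -(4 * P : ℤ) < t) (h2 : t < 4 * P) : Near P v := by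
  by_contra hcon
  simp only [Near, not_or, not_lt] at hcon
  obtain ⟨h3, h4⟩ := hcon
  have hlt := v.isLt
  zify at h3 h4 hlt
  have hk : (0 : ℤ) < 2 ^ w := by positivity
  rcases lt_trichotomy k 0 with h | h | h
  · have : k * 2 ^ w ≤ -1 * 2 ^ w := by gcongr; omega
    linarith
  · subst h; linarith
  · have : 1 * 2 ^ w ≤ k * 2 ^ w := by gcongr; omega
    linarith

/-- Write d = 2^t o with o odd and w = t + u + 1. The multiplier 2r + 1 is odd, so the product is
2^t b(r), where b(r) = (2r + 1) o modulo 2^(u+1) is odd. It determines r modulo 2^u, so every value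
of b comes from at most 2^(t+1) words r; only few values of b give a product close to 0. In terms of
probabilities the bound is 32 P / 2^w for every nonzero d. -/
theorem near_card_le (P : ℕ) (d : BitVec w) (hd : d ≠ 0) :
    (Finset.univ.filter fun r : Fin (2 ^ w) =>
      Near P ((BitVec.ofNat w 2 * BitVec.ofFin r + BitVec.ofNat w 1) * d)).card ≤ 32 * P := by
  have hD : d.toNat ≠ 0 := fun h => hd (BitVec.eq_of_toNat_eq (by simpa using h))
  obtain ⟨t, o, ho, hDo⟩ := Nat.exists_eq_two_pow_mul_odd hD
  have htw : t < w := by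
    by_contra hcon
    have h1 : 2 ^ w ≤ 2 ^ t := Nat.pow_le_pow_right (by omega) (by omega)
    have h2 : 1 ≤ o := ho.pos
    have := d.isLt
    nlinarith
  obtain ⟨u, rfl⟩ : ∃ u, w = t + (u + 1) := ⟨w - t - 1, by omega⟩
  set b : ℕ → ℕ := fun r => ((2 * r + 1) * o) % 2 ^ (u + 1) with hb
  have hbv : ∀ r : Fin (2 ^ (t + (u + 1))),
      ((BitVec.ofNat _ 2 * BitVec.ofFin r + BitVec.ofNat _ 1) * d).toNat = 2 ^ t * b r := by
    intro r
    simp only [BitVec.toNat_mul, BitVec.toNat_add, BitVec.toNat_ofFin, hDo, hb,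
      BitVec.toNat_ofNat, Nat.add_mod_mod, Nat.mod_add_mod, Nat.mod_mul_mod]
    rw [← Nat.mul_mod_mul_left, ← pow_add]
    congr 1
    ring
  have hbodd : ∀ r, b r % 2 = 1 := by
    intro r
    simp only [hb]
    rw [Nat.mod_mod_of_dvd _ (by rw [pow_succ]; exact Dvd.intro_left _ rfl)]
    have : Odd ((2 * r + 1) * o) := Odd.mul ⟨r, rfl⟩ ho
    exact Nat.odd_iff.1 this
  have hblt : ∀ r, b r < 2 ^ (u + 1) := fun r => Nat.mod_lt _ (by positivity)
  have hT : 0 < 2 ^ t := by positivity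
  -- Since b(r) is odd, the product differs from 0 modulo 2^w by at least 2^t; if this is at least
  -- `4 * P`, no word is counted.
  by_cases hP : 4 * P ≤ 2 ^ t
  · refine le_trans (Finset.card_eq_zero.2 ?_).le (Nat.zero_le _)
    refine Finset.filter_eq_empty_iff.2 fun r _ => ?_
    rw [Near, hbv, not_or, not_lt, not_lt]
    have h1 := hbodd r
    have h2 := hblt r
    have h3 : 1 ≤ b r := by omega
    constructor
    · nlinarith
    · have : 2 ^ t * (b r + 1) ≤ 2 ^ t * 2 ^ (u + 1) := by gcongr; omega
      have := pow_add 2 t (u + 1)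
      linarith
  · push Not at hP
    set c := 4 * P / 2 ^ t with hc
    have hcard : (Finset.univ.filter fun r : Fin (2 ^ (t + (u + 1))) =>
        Near P ((BitVec.ofNat _ 2 * BitVec.ofFin r + BitVec.ofNat _ 1) * d)).card ≤
        ((Finset.range (c + 1) ∪ (Finset.range (c + 1)).image fun x => 2 ^ (u + 1) - x) ×ˢ
          Finset.range (2 ^ (t + 1))).card := by
      -- A word is encoded by b(r), which lies within `c` of one of the two ends of its range, and
      -- by the upper bits r / 2^u.
      refine Finset.card_le_card_of_injOn (fun r => (b r, r.val / 2 ^ u)) ?_ ?_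
      · intro r hr
        simp only [Finset.coe_filter, Finset.mem_univ, true_and, Set.mem_ofPred_eq, Near, hbv] at hr
        simp only [Finset.coe_product, Set.mem_prod, Finset.mem_coe, Finset.mem_union,
          Finset.mem_range, Finset.mem_image]
        refine ⟨?_, ?_⟩
        · rcases hr with hr | hr
          · left
            rw [Nat.lt_add_one_iff, hc, Nat.le_div_iff_mul_le hT]
            linarith
          · right
            refine ⟨2 ^ (u + 1) - b r, ?_, by have := hblt r; omega⟩
            rw [Nat.lt_add_one_iff, hc, Nat.le_div_iff_mul_le hT, Nat.sub_mul, ← pow_add,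
              Nat.add_comm (u + 1) t, Nat.mul_comm (b r)]
            omega
        · rw [Nat.div_lt_iff_lt_mul (by positivity), ← pow_add]
          have := r.isLt
          rwa [show t + 1 + u = t + (u + 1) by omega]
      · intro r _ r' _ h
        simp only [Prod.mk.injEq] at h
        obtain ⟨h1, h2⟩ := h
        have h3 : (2 * r.val + 1) * o ≡ (2 * r'.val + 1) * o [MOD 2 ^ (u + 1)] := h1
        have hco : Nat.gcd (2 ^ (u + 1)) o = 1 :=
          Nat.Coprime.pow_left _ (Nat.coprime_two_left.2 ho)
        have h4 := Nat.ModEq.cancel_right_of_coprime hco h3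
        have h5 : 2 * r.val ≡ 2 * r'.val [MOD 2 * 2 ^ u] := by
          rw [← pow_succ']; exact Nat.ModEq.add_right_cancel' 1 h4
        have h6 : r.val ≡ r'.val [MOD 2 ^ u] := Nat.ModEq.mul_left_cancel' (by norm_num) h5
        refine Fin.ext ?_
        rw [← Nat.div_add_mod r.val (2 ^ u), ← Nat.div_add_mod r'.val (2 ^ u), h2, h6]
    refine hcard.trans ?_
    rw [Finset.card_product, Finset.card_range]
    have h1 : (Finset.range (c + 1) ∪ (Finset.range (c + 1)).image
        fun x => 2 ^ (u + 1) - x).card ≤ (c + 1) + (c + 1) := by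
      refine (Finset.card_union_le _ _).trans (add_le_add ?_ (Finset.card_image_le.trans ?_)) <;>
        simp
    have h2 : 2 ^ t * c ≤ 4 * P := Nat.mul_div_le _ _
    -- Both 4 · 2^t c and 4 · 2^t are at most 16 P, the latter because 2^t < 4 P in this case.
    calc _ ≤ ((c + 1) + (c + 1)) * 2 ^ (t + 1) := by gcongr
      _ = 4 * (2 ^ t * c) + 4 * 2 ^ t := by ring
      _ ≤ _ := by omega

theorem sum_near_card_le {ι : Type*} (s : Finset ι) (P : ℕ) (d : ι → BitVec w)
    (hd : ∀ i ∈ s, d i ≠ 0) :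
    ∑ r : Fin (2 ^ w), (s.filter fun i => Near P ((BitVec.ofNat w 2 * BitVec.ofFin r + BitVec.ofNat w 1) * d i)).card ≤
      32 * P * s.card := by
  simp_rw [Finset.card_filter]
  rw [Finset.sum_comm]
  simp_rw [← Finset.card_filter]
  refine (Finset.sum_le_sum fun i hi => near_card_le P (d i) (hd i hi)).trans ?_
  rw [Finset.sum_const, smul_eq_mul, mul_comm]

theorem toNat_mul_sub_int (m x y z : BitVec w) : ∃ k : ℤ,
    ((m * (z - x - y)).toNat : ℤ) =
      (m * z).toNat - (m * x).toNat - (m * y).toNat + k * 2 ^ w := by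
  have h : m * z = m * (z - x - y) + m * x + m * y := by
    rw [← BitVec.mul_add, ← BitVec.mul_add]
    congr 1
    rw [BitVec.add_assoc, BitVec.sub_sub, BitVec.sub_add_cancel]
  have h2 := congrArg BitVec.toNat h
  simp only [BitVec.toNat_add, Nat.mod_add_mod] at h2
  set A := (m * (z - x - y)).toNat
  refine ⟨((A + (m * x).toNat + (m * y).toNat) / 2 ^ w : ℕ), ?_⟩
  have h3 := Nat.div_add_mod (A + (m * x).toNat + (m * y).toNat) (2 ^ w)
  rw [← h2] at h3
  zify at h3 ⊢
  linarith

section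

variable {m : BitVec w} {k SS : ℕ}

theorem hash_lt (hw : 2 ^ w = SS * 2 ^ k) (x : BitVec w) : hash m k x < SS := by
  unfold hash
  rw [Nat.div_lt_iff_lt_mul (by positivity), ← hw]
  exact (m * x).isLt

/-- Multiplication by `m` is additive modulo 2^w; dropping the `k` lowest bits loses only the carry
`e` out of them. Adding `SS` before subtracting `e` avoids truncation. -/
theorem hash_add (hw : 2 ^ w = SS * 2 ^ k) (x y : BitVec w) : ∃ e < 2,
    (hash m k (x + y) + SS - e) % SS = (hash m k x + hash m k y) % SS := by
  have hP : 0 < 2 ^ k := by positivity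
  have hz : (m * (x + y)).toNat = ((m * x).toNat + (m * y).toNat) % (2 ^ k * SS) := by
    rw [BitVec.mul_add, BitVec.toNat_add, hw, Nat.mul_comm SS]
  unfold hash
  rw [hz, Nat.mod_mul_right_div_self]
  generalize (m * x).toNat = X
  generalize (m * y).toNat = Y
  have hX := Nat.div_add_mod X (2 ^ k)
  have hY := Nat.div_add_mod Y (2 ^ k)
  have hXl := Nat.mod_lt X hP
  have hYl := Nat.mod_lt Y hP
  have hS : 0 < SS := by
    rcases Nat.eq_zero_or_pos SS with h | h
    · rw [h] at hw; simp at hw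
    · exact h
  set e := (X % 2 ^ k + Y % 2 ^ k) / 2 ^ k with he
  have he2 : e < 2 := by rw [he, Nat.div_lt_iff_lt_mul hP]; omega
  have hsum : (X + Y) / 2 ^ k = X / 2 ^ k + Y / 2 ^ k + e := by
    conv_lhs => rw [← hX, ← hY]
    rw [show 2 ^ k * (X / 2 ^ k) + X % 2 ^ k + (2 ^ k * (Y / 2 ^ k) + Y % 2 ^ k) =
      (X % 2 ^ k + Y % 2 ^ k) + 2 ^ k * (X / 2 ^ k + Y / 2 ^ k) by ring,
      Nat.add_mul_div_left _ _ hP]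
    ring
  rw [hsum]
  generalize X / 2 ^ k + Y / 2 ^ k = B
  refine ⟨e, he2, ?_⟩
  rcases Nat.lt_or_ge SS 2 with h1 | h1
  · obtain rfl : SS = 1 := by omega
    simp [Nat.mod_one]
  · refine Nat.ModEq.add_right_cancel' e ?_
    show (_ + e) % SS = _
    rw [Nat.sub_add_cancel (by omega)]
    simp

/-- A converse of `hash_add` up to a small error: if the hash values fit, the multiple of z - x - y
consists of low parts only, e 2^k + z₀ - x₀ - y₀, which is smaller than 2 · 2^k in absolute value.
Thus `near_card_le` bounds the number of false triples. -/
theorem near_of_hash (hw : 2 ^ w = SS * 2 ^ k) {x y z : BitVec w} {e : ℕ} (he : e < 2)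
    (heS : e ≤ SS) (h : (hash m k z + SS - e) % SS = (hash m k x + hash m k y) % SS) :
    Near (2 ^ k) (m * (z - x - y)) := by
  have hP : 0 < 2 ^ k := by positivity
  obtain ⟨j, hj⟩ := toNat_mul_sub_int m x y z
  unfold hash at h
  have hX := Nat.div_add_mod (m * x).toNat (2 ^ k)
  have hY := Nat.div_add_mod (m * y).toNat (2 ^ k)
  have hZ := Nat.div_add_mod (m * z).toNat (2 ^ k)
  have hXl := Nat.mod_lt (m * x).toNat hP
  have hYl := Nat.mod_lt (m * y).toNat hP
  have hZl := Nat.mod_lt (m * z).toNat hP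
  obtain ⟨c, hc⟩ := (Nat.modEq_iff_dvd.1 (show Nat.ModEq SS _ _ from h))
  rw [Nat.cast_sub (le_trans heS (Nat.le_add_left _ _))] at hc
  zify at hX hY hZ hXl hYl hZl he hw
  push_cast at hc
  set x1 : ℤ := ((m * x).toNat : ℤ) / 2 ^ k
  set y1 : ℤ := ((m * y).toNat : ℤ) / 2 ^ k
  set z1 : ℤ := ((m * z).toNat : ℤ) / 2 ^ k
  refine near_of_int (t := e * 2 ^ k + (m * z).toNat % 2 ^ k - (m * x).toNat % 2 ^ k -
    (m * y).toNat % 2 ^ k) (k := j - 1 - c) ?_ ?_ ?_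
  · have hz1 : z1 = x1 + y1 + e - SS - SS * c := by linarith
    rw [hw] at hj ⊢
    rw [hz1] at hZ
    linear_combination hj - hZ + hX + hY
  · have h0 : (0 : ℤ) ≤ e := by positivity
    have := Int.emod_nonneg ((m * z).toNat : ℤ) (show (2 ^ k : ℤ) ≠ 0 by positivity)
    push_cast
    nlinarith
  · have := Int.emod_nonneg ((m * x).toNat : ℤ) (show (2 ^ k : ℤ) ≠ 0 by positivity)
    have := Int.emod_nonneg ((m * y).toNat : ℤ) (show (2 ^ k : ℤ) ≠ 0 by positivity)
    push_cast
    nlinarith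

/-- If the bucket computed for the second summand is that of x itself, then the hash value of z has
nearly twice the high digit of that of x. So m (z - 2x) is small on the scale QQ · 2^k, an event of
probability O(1/RR) for z ≠ 2x. -/
theorem near_of_same_bucket {QQ RR : ℕ} (hQ : 0 < QQ) (hSS : SS = RR * QQ)
    (hw : 2 ^ w = SS * 2 ^ k) {x z : BitVec w} {e e' : ℕ} (he : e < 2) (heS : e ≤ SS)
    (he' : e' < 2) (h : hash m k x / QQ =
      ((hash m k z + SS - e) % SS / QQ + 2 * RR - hash m k x / QQ - e') % RR) :
    Near (QQ * 2 ^ k) (m * (z - x - x)) := by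
  have hP : 0 < 2 ^ k := by positivity
  obtain ⟨j, hj⟩ := toNat_mul_sub_int m x x z
  have hxS := hash_lt (m := m) hw x
  have hS : 0 < SS := by omega
  have hR : 0 < RR := by
    rcases Nat.eq_zero_or_pos RR with h | h
    · simp [h] at hSS; omega
    · exact h
  set v := (hash m k z + SS - e) % SS with hv
  set a := hash m k x with ha
  have ha1 : a / QQ < RR := by rw [Nat.div_lt_iff_lt_mul hQ, ← hSS]; exact hxS
  have hXa : (m * x).toNat / 2 ^ k = a := rfl
  have hZc : (m * z).toNat / 2 ^ k = hash m k z := rfl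
  have hX := Nat.div_add_mod (m * x).toNat (2 ^ k)
  have hZ := Nat.div_add_mod (m * z).toNat (2 ^ k)
  have hXl := Nat.mod_lt (m * x).toNat hP
  have hZl := Nat.mod_lt (m * z).toNat hP
  rw [hXa] at hX
  rw [hZc] at hZ
  generalize (m * x).toNat % 2 ^ k = xl at *
  generalize (m * z).toNat % 2 ^ k = zl at *
  obtain ⟨c, hc⟩ : ∃ c : ℤ, (hash m k z : ℤ) = v + e + SS * c := by
    have h1 := Nat.div_add_mod (hash m k z + SS - e) SS
    rw [← hv] at h1
    refine ⟨((hash m k z + SS - e) / SS : ℕ) - 1, ?_⟩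
    have h2 : hash m k z + SS = SS * ((hash m k z + SS - e) / SS) + v + e := by omega
    zify at h2
    push_cast
    linarith
  obtain ⟨d, hd⟩ : ∃ d : ℤ, ((v / QQ : ℕ) : ℤ) = 2 * (a / QQ : ℕ) + e' + RR * d := by
    generalize v / QQ = v1 at *
    generalize a / QQ = a1 at *
    have h1 := Nat.div_add_mod (v1 + 2 * RR - a1 - e') RR
    rw [← h] at h1
    refine ⟨((v1 + 2 * RR - a1 - e') / RR : ℕ) - 2, ?_⟩
    have h2 : v1 + 2 * RR = RR * ((v1 + 2 * RR - a1 - e') / RR) + a1 + a1 + e' := by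
      omega
    zify at h2
    push_cast
    linarith
  have hv2 := Nat.div_add_mod v QQ
  have ha2 := Nat.div_add_mod a QQ
  have hvl := Nat.mod_lt v hQ
  have hal := Nat.mod_lt a hQ
  generalize v % QQ = v0 at *
  generalize a % QQ = a0 at *
  generalize v / QQ = v1 at *
  generalize a / QQ = a1 at *
  clear_value v a
  have hXl0 : (0 : ℤ) ≤ xl := by positivity
  have hZl0 : (0 : ℤ) ≤ zl := by positivity
  have hv00 : (0 : ℤ) ≤ v0 := by positivity
  have ha00 : (0 : ℤ) ≤ a0 := by positivity
  have he0 : (0 : ℤ) ≤ e := by positivity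
  have he'0 : (0 : ℤ) ≤ e' := by positivity
  zify at hX hZ hXl hZl he he' hw hv2 ha2 hvl hal hP hQ hSS
  have e1 : (e : ℤ) ≤ 1 := by linarith
  have e2 : (e' : ℤ) ≤ 1 := by linarith
  have e3 : (v0 : ℤ) + 1 ≤ QQ := by linarith
  have e4 : (a0 : ℤ) + 1 ≤ QQ := by linarith
  -- The error collects all discarded parts: the low digits `v0`, `a0`, the two carries, and the
  -- lowest `k` bits.
  refine near_of_int (t := (QQ * e' + v0 + e - 2 * a0) * 2 ^ k + zl - 2 * xl) (k := j + c + d) ?_ ?_ ?_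
  · rw [hw] at hj ⊢
    rw [hc] at hZ
    rw [hd] at hv2
    linear_combination hj - hZ + 2 * hX - 2 ^ k * hv2 + 2 * 2 ^ k * ha2 - d * 2 ^ k * hSS
  · push_cast
    have h1 : 0 ≤ (QQ * e' + v0 + e + 2 * (QQ - 1 - a0) : ℤ) * 2 ^ k := by
      apply mul_nonneg _ hP.le
      have : (0 : ℤ) ≤ QQ * e' := by positivity
      linarith
    have h2 : (0 : ℤ) < QQ * 2 ^ k := by positivity
    linarith
  · push_cast
    have h1 : 0 ≤ (QQ * (1 - e') + (QQ - 1 - v0) + (1 - e) + 2 * a0 : ℤ) * 2 ^ k := by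
      apply mul_nonneg _ hP.le
      have : (0 : ℤ) ≤ QQ * (1 - e') := mul_nonneg hQ.le (by linarith)
      linarith
    have h2 : 0 ≤ (QQ - 1 : ℤ) * 2 ^ k := mul_nonneg (by linarith) hP.le
    linarith

end

/-- The hash values `a`, `b` of two summands and the value `v` that their sum should have, written
with the digits in base `Q`. -/
theorem add_mod_iff_digits {Q R a b v : ℕ} (hQ : 0 < Q) (ha : a < R * Q) (hb : b < R * Q)
    (hv : v < R * Q) :
    (a + b) % (R * Q) = v ↔
      ∃ e < 2, a % Q + b % Q = v % Q + Q * e ∧ b / Q = (v / Q + 2 * R - a / Q - e) % R := by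
  have hR : 0 < R := by
    rcases Nat.eq_zero_or_pos R with h | h
    · simp [h] at ha
    · exact h
  have ha' := Nat.div_add_mod a Q
  have hb' := Nat.div_add_mod b Q
  have hv' := Nat.div_add_mod v Q
  have hal := Nat.mod_lt a hQ
  have hbl := Nat.mod_lt b hQ
  have hvl := Nat.mod_lt v hQ
  have ha1 : a / Q < R := by rwa [Nat.div_lt_iff_lt_mul hQ]
  have hb1 : b / Q < R := by rwa [Nat.div_lt_iff_lt_mul hQ]
  have hv1 : v / Q < R := by rwa [Nat.div_lt_iff_lt_mul hQ]
  generalize a % Q = a0 at *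
  generalize b % Q = b0 at *
  generalize v % Q = v0 at *
  generalize a / Q = a1 at *
  generalize b / Q = b1 at *
  generalize v / Q = v1 at *
  -- With the carry `e` of the low digits fixed, equality modulo `R * Q` becomes an equality of high
  -- digits modulo `R`.
  have key : ∀ e, a0 + b0 = v0 + Q * e → ((a + b) % (R * Q) = v ↔ (a1 + b1 + e) % R = v1) := by
    intro e he
    have h1 : a + b = v0 + Q * (a1 + b1 + e) := by
      rw [← ha', ← hb']
      linear_combination he
    rw [h1, Nat.mul_comm R Q, Nat.mod_mul, Nat.add_mul_mod_self_left, Nat.mod_eq_of_lt hvl,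
      Nat.add_mul_div_left _ _ hQ, Nat.div_eq_of_lt hvl, Nat.zero_add, ← hv', Nat.add_comm v0]
    constructor
    · intro h
      exact Nat.eq_of_mul_eq_mul_left hQ (by omega)
    · intro h; rw [h]
  -- Solving for the high digit of `b`. The summand `2 * R` keeps the natural subtraction exact,
  -- because `a1 + e ≤ R`.
  have key2 : ∀ e < 2, ((a1 + b1 + e) % R = v1 ↔ b1 = (v1 + 2 * R - a1 - e) % R) := by
    intro e he
    rw [← Nat.mod_eq_of_lt hv1]
    conv_rhs => rw [← Nat.mod_eq_of_lt hb1]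
    by_cases h1 : a1 + e ≤ v1 + 2 * R
    · have h2 : v1 % R + 2 * R - a1 - e + (a1 + e) = v1 + 2 * R := by
        rw [Nat.mod_eq_of_lt hv1]; omega
      constructor
      · intro h
        refine Nat.ModEq.add_right_cancel' (a1 + e) ?_
        rw [h2]
        show _ % R = _ % R
        rw [Nat.add_mul_mod_self_right, ← h]
        congr 1; omega
      · intro h
        have h3 := Nat.ModEq.add_right (a1 + e) (show Nat.ModEq R _ _ from h)
        rw [h2] at h3
        have h4 : (b1 + (a1 + e)) % R = (v1 + 2 * R) % R := h3
        rw [Nat.add_mul_mod_self_right] at h4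
        rw [← h4]
        congr 1; omega
    · omega
  constructor
  · intro h
    have h0 : (a0 + b0) % Q = v0 := by
      have h1 : (a + b) % Q = v0 := by
        rw [← Nat.mod_mul_left_mod (a + b) R Q, h, ← hv', Nat.mul_add_mod, Nat.mod_eq_of_lt hvl]
      rw [← h1, ← ha', ← hb', show Q * a1 + a0 + (Q * b1 + b0) = a0 + b0 + Q * (a1 + b1) by ring,
        Nat.add_mul_mod_self_left]
    have he2 : (a0 + b0) / Q < 2 := by rw [Nat.div_lt_iff_lt_mul hQ]; omega
    have he : a0 + b0 = v0 + Q * ((a0 + b0) / Q) := by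
      conv_lhs => rw [← Nat.mod_add_div (a0 + b0) Q, h0]
    exact ⟨_, he2, he, (key2 _ he2).1 ((key _ he).1 h)⟩
  · rintro ⟨e, he2, he, h⟩
    exact (key e he).2 ((key2 e he2).2 h)

/-- The sign bit. -/
def sgn (x : BitVec w) : ℕ := x.toNat / 2 ^ (w - 1)

theorem sgn_lt (hw : 0 < w) (x : BitVec w) : sgn x < 2 := by
  unfold sgn
  rw [Nat.div_lt_iff_lt_mul (by positivity), ← pow_succ', Nat.sub_add_cancel hw]
  exact x.isLt

/-- Integer and modular sums differ only by overflow, and overflow occurs exactly when both summands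
have one sign and the modular sum has the other. The problem thereby becomes a problem modulo 2^w
with a condition on three bits. -/
theorem toInt_add_eq_iff (hw : 0 < w) (x y z : BitVec w) :
    x.toInt + y.toInt = z.toInt ↔ y = z - x ∧ ¬ (sgn x = sgn y ∧ sgn z ≠ sgn x) := by
  obtain ⟨u, rfl⟩ : ∃ u, w = u + 1 := ⟨w - 1, by omega⟩
  have hy : y = z - x ↔ x + y = z := by
    constructor
    · rintro rfl; rw [BitVec.add_comm, BitVec.sub_add_cancel]
    · rintro rfl; rw [BitVec.add_comm, BitVec.add_sub_cancel]
  have hs : ∀ a : BitVec (u + 1), (sgn a = 0 ∧ a.toNat < 2 ^ u ∧ a.toInt = a.toNat) ∨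
      (sgn a = 1 ∧ 2 ^ u ≤ a.toNat ∧ a.toInt = a.toNat - 2 ^ (u + 1)) := by
    intro a
    have h1 := sgn_lt (by omega) a
    have h2 := Nat.div_add_mod a.toNat (2 ^ u)
    have h3 := Nat.mod_lt a.toNat (show 0 < 2 ^ u by positivity)
    have h4 : sgn a = a.toNat / 2 ^ u := by simp [sgn]
    rw [← h4] at h2
    rw [BitVec.toInt_eq_toNat_cond, pow_succ]
    have : sgn a = 0 ∨ sgn a = 1 := by omega
    rcases this with h | h
    · left; rw [h] at h2; refine ⟨h, by omega, ?_⟩; rw [if_pos (by omega)]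
    · right; rw [h] at h2; refine ⟨h, by omega, ?_⟩; rw [if_neg (by omega)]; push_cast; rfl
  rw [hy, ← BitVec.toNat_inj, BitVec.toNat_add]
  have hx := x.isLt
  have hyl := y.isLt
  have hz := z.isLt
  have hp : 2 ^ (u + 1) = 2 * 2 ^ u := pow_succ' 2 u
  have hmod : (x.toNat + y.toNat) % 2 ^ (u + 1) = z.toNat ↔
      (x.toNat + y.toNat = z.toNat ∨ x.toNat + y.toNat = z.toNat + 2 ^ (u + 1)) := by
    constructor
    · intro h
      rcases Nat.lt_or_ge (x.toNat + y.toNat) (2 ^ (u + 1)) with h1 | h1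
      · rw [Nat.mod_eq_of_lt h1] at h; exact Or.inl h
      · rw [Nat.mod_eq_sub_mod h1, Nat.mod_eq_of_lt (by omega)] at h; right; omega
    · rintro (h | h)
      · rw [h, Nat.mod_eq_of_lt hz]
      · rw [h, Nat.add_mod_right, Nat.mod_eq_of_lt hz]
  rw [hmod]
  have hp' : (2 : ℤ) ^ (u + 1) = 2 * 2 ^ u := pow_succ' 2 u
  have hc : ((2 ^ u : ℕ) : ℤ) = 2 ^ u := by push_cast; rfl
  rcases hs x with hx' | hx' <;> rcases hs y with hy' | hy' <;> rcases hs z with hz' | hz' <;>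
    (clear hs hmod; simp only [hx'.1, hy'.1, hz'.1, hx'.2.2, hy'.2.2, hz'.2.2, ne_eq, one_ne_zero, zero_ne_one, not_false_eq_true, not_true_eq_false, and_true, and_false, iff_false]; omega)

end WordRAM
end

noncomputable section
namespace WordRAM
variable {w : ℕ}

/-! ### Linked lists by key -/

/-- One more than the last index below `m` with key `k`, or `0` if there is none. -/
def last (key : ℕ → ℕ) : ℕ → ℕ → ℕ
  | 0, _ => 0
  | m + 1, k => if key m = k then m + 1 else last key m k

/-- The link from the entry with index `i` to the preceding one with the same key. -/
def link (key : ℕ → ℕ) (m i : ℕ) : ℕ := if i < m then last key i (key i) else 0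

/-- The indices below `m` with key `k`, in descending order. -/
def chain (key : ℕ → ℕ) : ℕ → ℕ → List ℕ
  | 0, _ => []
  | m + 1, k => if key m = k then m :: chain key m k else chain key m k

/-- The recursion in the form of an array update, as it is executed in one round of the loop that
builds the lists. -/
theorem last_succ (key : ℕ → ℕ) (m : ℕ) :
    last key (m + 1) = Function.update (last key m) (key m) (m + 1) := by
  funext k
  by_cases h : key m = k
  · subst h; simp [last]
  · simp [last, h, Function.update_of_ne (Ne.symm h)]

theorem link_succ (key : ℕ → ℕ) (m : ℕ) :
    link key (m + 1) = Function.update (link key m) m (last key m (key m)) := by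
  funext i
  by_cases h : i = m
  · subst h; simp [link]
  · rw [Function.update_of_ne h]
    unfold link
    by_cases h' : i < m
    · rw [if_pos h', if_pos (by omega)]
    · rw [if_neg h', if_neg (by omega)]

theorem mem_chain {key : ℕ → ℕ} {m k i : ℕ} : i ∈ chain key m k ↔ i < m ∧ key i = k := by
  induction m with
  | zero => simp [chain]
  | succ m ih =>
    simp only [chain]
    split_ifs with h
    · rw [List.mem_cons, ih]
      constructor
      · rintro (rfl | ⟨h1, h2⟩)
        · exact ⟨by omega, h⟩
        · exact ⟨by omega, h2⟩
      · rintro ⟨h1, h2⟩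
        by_cases h3 : i = m
        · exact Or.inl h3
        · exact Or.inr ⟨by omega, h2⟩
    · rw [ih]
      constructor
      · rintro ⟨h1, h2⟩; exact ⟨by omega, h2⟩
      · rintro ⟨h1, h2⟩
        refine ⟨?_, h2⟩
        by_contra h3
        obtain rfl : i = m := by omega
        exact h h2

theorem chain_nodup (key : ℕ → ℕ) (m k : ℕ) : (chain key m k).Nodup := by
  induction m with
  | zero => simp [chain]
  | succ m ih =>
    simp only [chain]
    split_ifs with h
    · refine List.nodup_cons.2 ⟨fun h' => ?_, ih⟩
      have := (mem_chain.1 h').1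
      omega
    · exact ih

theorem chain_toFinset (key : ℕ → ℕ) (m k : ℕ) :
    (chain key m k).toFinset = (Finset.range m).filter fun i => key i = k := by
  ext i; simp [mem_chain]

theorem chain_length (key : ℕ → ℕ) (m k : ℕ) :
    (chain key m k).length = ((Finset.range m).filter fun i => key i = k).card := by
  rw [← chain_toFinset, List.toFinset_card_of_nodup (chain_nodup key m k)]

/-- The pointer to the head of a list of indices. -/
def ptr : List ℕ → ℕ
  | [] => 0
  | i :: _ => i + 1

theorem last_eq_ptr (key : ℕ → ℕ) (m k : ℕ) : last key m k = ptr (chain key m k) := by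
  induction m with
  | zero => rfl
  | succ m ih =>
    simp only [last, chain]
    split_ifs
    · rfl
    · exact ih

/-- Following a link from the head of the rest of a list leads to its tail. -/
theorem link_drop {key : ℕ → ℕ} {m k j : ℕ} (h : j < (chain key m k).length) :
    link key m (chain key m k)[j] = ptr ((chain key m k).drop (j + 1)) := by
  have hmem := mem_chain.1 (List.getElem_mem h)
  rw [link, if_pos hmem.1, hmem.2, last_eq_ptr]
  congr 1
  clear hmem
  induction m generalizing j with
  | zero => simp [chain] at h
  | succ m ih =>
    simp only [chain] at h ⊢
    by_cases hk : key m = k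
    · simp only [hk, if_true] at h ⊢
      cases j with
      | zero => simp
      | succ j => simpa using ih (j := j) (by simpa using h)
    · simp only [hk, if_false] at h ⊢
      exact ih h

/-! ### Splitting buckets into chunks -/

/-- `cnt b` counts the indices placed so far from bucket `b`, `cur b` is the chunk of `b` that was
opened last, `bkt κ` is the bucket of the chunk `κ`, `ch i` is the chunk of the index `i`, and `num`
is the number of chunks. -/
structure Chunks where
  cnt : ℕ → ℕ
  cur : ℕ → ℕ
  bkt : ℕ → ℕ
  ch : ℕ → ℕ
  num : ℕ

/-- A count divisible by `B` means that the current chunk is full or that there is none yet; then a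
new chunk is opened. -/
def Chunks.push (B b i : ℕ) (c : Chunks) : Chunks :=
  let c' : Chunks := if c.cnt b % B = 0 then
    { c with cur := Function.update c.cur b c.num, bkt := Function.update c.bkt c.num b,
             num := c.num + 1 } else c
  { c' with ch := Function.update c.ch i (c'.cur b), cnt := Function.update c.cnt b (c.cnt b + 1) }

/-- Put the indices below `m` into chunks of at most `B` indices from the same bucket. -/
def chunks (B : ℕ) (bk : ℕ → ℕ) : ℕ → Chunks
  | 0 => ⟨fun _ => 0, fun _ => 0, fun _ => 0, fun _ => 0, 0⟩
  | m + 1 => (chunks B bk m).push B (bk m) m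

section

variable (B : ℕ) (bk : ℕ → ℕ)

def chunkCard (m κ : ℕ) : ℕ := ((Finset.range m).filter fun i => (chunks B bk m).ch i = κ).card

theorem chunks_cnt (m b : ℕ) :
    (chunks B bk m).cnt b = ((Finset.range m).filter fun i => bk i = b).card := by
  induction m with
  | zero => simp [chunks]
  | succ m ih =>
    rw [Finset.range_add_one, Finset.filter_insert]
    simp only [chunks, Chunks.push, Function.update_apply]
    by_cases h : bk m = b
    · subst h; simp [ih]
    · simp [h, Ne.symm h, ih]

theorem chunks_num_le (m : ℕ) : (chunks B bk m).num ≤ m := by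
  induction m with
  | zero => simp [chunks]
  | succ m ih => simp only [chunks, Chunks.push]; split_ifs; exacts [Nat.succ_le_succ ih, Nat.le_succ_of_le ih]

theorem card_filter_update (m : ℕ) (g : ℕ → ℕ) (v κ : ℕ) :
    ((Finset.range (m + 1)).filter fun i => Function.update g m v i = κ).card =
      ((Finset.range m).filter fun i => g i = κ).card + if v = κ then 1 else 0 := by
  rw [Finset.range_add_one, Finset.filter_insert]
  have : ((Finset.range m).filter fun i => Function.update g m v i = κ) =
      (Finset.range m).filter fun i => g i = κ := by
    refine Finset.filter_congr fun i hi => ?_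
    rw [Function.update_of_ne (by have := Finset.mem_range.1 hi; omega)]
  rw [this]
  by_cases h : v = κ <;> simp [h]

/-- The third part drives the induction: when the count of a bucket is not divisible by `B`, its
open chunk holds exactly the remainder and so has room. The fourth part says that chunks not yet
opened are empty. -/
theorem chunks_inv (hB : 0 < B) (m : ℕ) :
    (∀ i < m, (chunks B bk m).ch i < (chunks B bk m).num ∧
      (chunks B bk m).bkt ((chunks B bk m).ch i) = bk i) ∧
    (∀ κ, chunkCard B bk m κ ≤ B) ∧
    (∀ b, (chunks B bk m).cnt b % B ≠ 0 → (chunks B bk m).cur b < (chunks B bk m).num ∧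
      (chunks B bk m).bkt ((chunks B bk m).cur b) = b ∧
      chunkCard B bk m ((chunks B bk m).cur b) = (chunks B bk m).cnt b % B) ∧
    (∀ κ, (chunks B bk m).num ≤ κ → chunkCard B bk m κ = 0) := by
  induction m with
  | zero =>
    have h0 : ∀ κ, chunkCard B bk 0 κ = 0 := fun κ => by
      unfold chunkCard; rw [Finset.range_zero, Finset.filter_empty, Finset.card_empty]
    simp [chunks, h0]
  | succ m ih =>
    obtain ⟨h1, h2, h3, h4⟩ := ih
    unfold chunkCard at *
    have hs : chunks B bk (m + 1) = (chunks B bk m).push B (bk m) m := rfl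
    rw [hs]
    clear hs
    generalize chunks B bk m = c at *
    unfold Chunks.push
    by_cases h0 : c.cnt (bk m) % B = 0
    · simp only [h0, if_true, card_filter_update, Function.update_self]
      refine ⟨fun i hi => ?_, fun κ => ?_, fun b hb => ?_, fun κ hκ => ?_⟩
      · by_cases him : i = m
        · subst him; simp
        · have := h1 i (by omega)
          rw [Function.update_of_ne him, Function.update_of_ne (by omega)]
          exact ⟨by omega, this.2⟩
      · split_ifs with h
        · subst h; rw [h4 _ le_rfl]; omega
        · simpa using h2 κ
      · by_cases hbm : b = bk m
        · subst hbm
          simp only [Function.update_self, if_true] at hb ⊢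
          refine ⟨by omega, trivial, ?_⟩
          rw [h4 _ le_rfl]
          rw [Nat.add_mod, h0] at hb ⊢
          simp only [Nat.zero_add, Nat.mod_mod] at hb ⊢
          rcases Nat.lt_or_ge 1 B with h | h
          · rw [Nat.mod_eq_of_lt h]
          · obtain rfl : B = 1 := by omega
            simp at hb
        · rw [Function.update_of_ne hbm] at hb ⊢
          have := h3 b hb
          rw [Function.update_of_ne hbm, Function.update_of_ne (by omega), if_neg (by omega)]
          exact ⟨by omega, this.2.1, by simpa using this.2.2⟩
      · rw [h4 κ (by omega), if_neg (by omega)]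
    · simp only [h0, if_false, card_filter_update]
      have hcur := h3 _ h0
      have hlt := Nat.mod_lt (c.cnt (bk m)) hB
      have hsucc : (c.cnt (bk m) + 1) % B ≠ 0 → (c.cnt (bk m) + 1) % B = c.cnt (bk m) % B + 1 := by
        intro hb
        have h1B : 1 < B := by
          by_contra hcon
          obtain rfl : B = 1 := by omega
          exact hb (Nat.mod_one _)
        rw [Nat.add_mod, Nat.mod_eq_of_lt h1B] at hb ⊢
        refine Nat.mod_eq_of_lt ?_
        by_contra hcon
        have : c.cnt (bk m) % B + 1 = B := by omega
        rw [this, Nat.mod_self] at hb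
        exact hb rfl
      refine ⟨fun i hi => ?_, fun κ => ?_, fun b hb => ?_, fun κ hκ => ?_⟩
      · by_cases him : i = m
        · subst him; rw [Function.update_self]; exact ⟨hcur.1, hcur.2.1⟩
        · rw [Function.update_of_ne him]; exact h1 i (by omega)
      · split_ifs with h
        · subst h; rw [hcur.2.2]; omega
        · simpa using h2 κ
      · by_cases hbm : b = bk m
        · subst hbm
          rw [Function.update_self] at hb ⊢
          refine ⟨hcur.1, hcur.2.1, ?_⟩
          rw [hcur.2.2, if_pos rfl, hsucc hb]
        · rw [Function.update_of_ne hbm] at hb ⊢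
          have := h3 b hb
          refine ⟨this.1, this.2.1, ?_⟩
          rw [if_neg, this.2.2, Nat.add_zero]
          intro h
          apply hbm
          rw [← this.2.1, ← h, hcur.2.1]
      · rw [h4 κ hκ, if_neg (by omega)]

/-- Every bucket is cut into ⌈count / B⌉ chunks: a new one is opened exactly when this ceiling
increases. -/
theorem chunks_num_eq (hB : 0 < B) (L : ℕ) (m : ℕ) (hbk : ∀ i < m, bk i < L) :
    (chunks B bk m).num = ∑ b ∈ Finset.range L, ((chunks B bk m).cnt b + (B - 1)) / B := by
  induction m with
  | zero =>
    simp only [chunks]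
    rw [Finset.sum_eq_zero]
    intro b _
    exact Nat.div_eq_of_lt (by omega)
  | succ m ih =>
    have ih := ih fun i hi => hbk i (by omega)
    simp only [chunks, Chunks.push]
    set c := chunks B bk m with hc
    have hmem : bk m ∈ Finset.range L := Finset.mem_range.2 (hbk m (by omega))
    have hsum : ∑ b ∈ Finset.range L, (Function.update c.cnt (bk m) (c.cnt (bk m) + 1) b + (B - 1)) / B
        = c.num + if c.cnt (bk m) % B = 0 then 1 else 0 := by
      rw [ih, ← Finset.add_sum_erase _ _ hmem, ← Finset.add_sum_erase _ _ hmem, Function.update_self]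
      have h2 : ∑ b ∈ (Finset.range L).erase (bk m),
          (Function.update c.cnt (bk m) (c.cnt (bk m) + 1) b + (B - 1)) / B =
          ∑ b ∈ (Finset.range L).erase (bk m), (c.cnt b + (B - 1)) / B := by
        refine Finset.sum_congr rfl fun b hb => ?_
        rw [Function.update_of_ne (Finset.ne_of_mem_erase hb)]
      rw [h2, show c.cnt (bk m) + 1 + (B - 1) = c.cnt (bk m) + B by omega, Nat.add_div_right _ hB]
      have h3 : (c.cnt (bk m) + (B - 1)) / B = c.cnt (bk m) / B + if c.cnt (bk m) % B = 0 then 0 else 1 := by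
        have hd := Nat.div_add_mod (c.cnt (bk m)) B
        have hl := Nat.mod_lt (c.cnt (bk m)) hB
        conv_lhs => rw [← hd, Nat.add_assoc, Nat.mul_add_div hB]
        congr 1
        split_ifs with h
        · exact Nat.div_eq_of_lt (by omega)
        · rw [Nat.div_eq_iff hB]; omega
      rw [h3]
      split_ifs <;> omega
    rw [hsum]
    split_ifs <;> rfl

/-- Rounding up wastes less than `B` places in each of the `L` buckets. With `B` about m / L this
gives O(L) chunks, however uneven the buckets are. -/
theorem chunks_num_mul_le (hB : 0 < B) (L : ℕ) (m : ℕ) (hbk : ∀ i < m, bk i < L) :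
    (chunks B bk m).num * B ≤ m + L * B := by
  rw [chunks_num_eq B bk hB L m hbk, Finset.sum_mul]
  have h1 : ∑ b ∈ Finset.range L, ((chunks B bk m).cnt b + (B - 1)) / B * B ≤
      ∑ b ∈ Finset.range L, ((chunks B bk m).cnt b + B) :=
    Finset.sum_le_sum fun b _ => (Nat.div_mul_le_self _ _).trans (by omega)
  refine h1.trans ?_
  rw [Finset.sum_add_distrib, Finset.sum_const, Finset.card_range, smul_eq_mul]
  gcongr
  simp_rw [chunks_cnt]
  rw [← Finset.card_eq_sum_card_fiberwise (f := bk) (s := Finset.range m)]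
  · simp
  · intro i hi
    exact Finset.mem_coe.2 (Finset.mem_range.2 (hbk i (Finset.mem_range.1 hi)))

end

end WordRAM
end

noncomputable section
namespace WordRAM
variable {w : ℕ}

/-! ### Evaluating expressions in natural numbers -/

/-- The contents of an array, given in natural numbers. -/
def arr (g : ℕ → ℕ) : BitVec w → BitVec w := fun i => BitVec.ofNat w (g i.toNat)

theorem toNat_ofNat_of_lt {x : ℕ} (hx : x < 2 ^ w) : (BitVec.ofNat w x).toNat = x := by
  rw [BitVec.toNat_ofNat, Nat.mod_eq_of_lt hx]

theorem ofNat_inj {x y : ℕ} (hx : x < 2 ^ w) (hy : y < 2 ^ w) :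
    BitVec.ofNat w x = BitVec.ofNat w y ↔ x = y := by
  rw [← BitVec.toNat_inj, toNat_ofNat_of_lt hx, toNat_ofNat_of_lt hy]

theorem update_arr (g : ℕ → ℕ) {i : ℕ} (v : ℕ) (hi : i < 2 ^ w) :
    Function.update (arr g : BitVec w → BitVec w) (BitVec.ofNat w i) (BitVec.ofNat w v) =
      arr (Function.update g i v) := by
  funext j
  simp only [arr, Function.update_apply]
  have : j = BitVec.ofNat w i ↔ j.toNat = i := by
    rw [← BitVec.toNat_inj, toNat_ofNat_of_lt hi]
  simp only [this]
  split_ifs <;> rfl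

/-- The expression `e` evaluates to the number `v`. -/
def Ev (s : State w) (e : Expr) (v : ℕ) : Prop := e.eval s = BitVec.ofNat w v

namespace Ev

variable {s : State w} {a b : Expr} {x y : ℕ}

theorem var {r : ℕ} (h : s.get r = BitVec.ofNat w x) : Ev s (.var r) x := h

theorem lit (n : ℕ) : Ev s (.lit n) n := rfl

theorem size : Ev s .size w := rfl

theorem cast (h : Ev s a x) (hxy : x = y) : Ev s a y := hxy ▸ h

theorem add (ha : Ev s a x) (hb : Ev s b y) : Ev s (a + b) (x + y) := by
  show a.eval s + b.eval s = _
  rw [ha, hb, BitVec.ofNat_add]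

theorem mul (ha : Ev s a x) (hb : Ev s b y) : Ev s (a * b) (x * y) := by
  show a.eval s * b.eval s = _
  rw [ha, hb, BitVec.ofNat_mul]

theorem sub (ha : Ev s a x) (hb : Ev s b y) (h : y ≤ x) : Ev s (a - b) (x - y) := by
  show a.eval s - b.eval s = _
  rw [ha, hb]
  have : BitVec.ofNat w x = BitVec.ofNat w (x - y) + BitVec.ofNat w y := by
    rw [← BitVec.ofNat_add, Nat.sub_add_cancel h]
  rw [this, BitVec.add_sub_cancel]

theorem div (ha : Ev s a x) (hb : Ev s b y) (hx : x < 2 ^ w) (hy : y < 2 ^ w) :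
    Ev s (a / b) (x / y) := by
  show a.eval s / b.eval s = _
  rw [ha, hb]
  apply BitVec.eq_of_toNat_eq
  rw [BitVec.toNat_udiv, toNat_ofNat_of_lt hx, toNat_ofNat_of_lt hy,
    toNat_ofNat_of_lt ((Nat.div_le_self _ _).trans_lt hx)]

theorem mod (ha : Ev s a x) (hb : Ev s b y) (hx : x < 2 ^ w) (hy : y < 2 ^ w) :
    Ev s (a % b) (x % y) := by
  show a.eval s % b.eval s = _
  rw [ha, hb]
  apply BitVec.eq_of_toNat_eq
  rw [BitVec.toNat_umod, toNat_ofNat_of_lt hx, toNat_ofNat_of_lt hy,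
    toNat_ofNat_of_lt ((Nat.mod_le _ _).trans_lt hx)]

theorem lt (ha : Ev s a x) (hb : Ev s b y) (hx : x < 2 ^ w) (hy : y < 2 ^ w) :
    Ev s (.bin .lt a b) (if x < y then 1 else 0) := by
  show (if (a.eval s).toNat < (b.eval s).toNat then (1 : BitVec w) else 0) = _
  rw [ha, hb, toNat_ofNat_of_lt hx, toNat_ofNat_of_lt hy]
  split_ifs <;> rfl

theorem eq (ha : Ev s a x) (hb : Ev s b y) (hx : x < 2 ^ w) (hy : y < 2 ^ w) :
    Ev s (.bin .eq a b) (if x = y then 1 else 0) := by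
  show (if a.eval s = b.eval s then (1 : BitVec w) else 0) = _
  rw [ha, hb]
  simp only [ofNat_inj hx hy]
  split_ifs <;> rfl

theorem eq_word {u v : BitVec w} (ha : a.eval s = u) (hb : b.eval s = v) :
    Ev s (.bin .eq a b) (if u = v then 1 else 0) := by
  show (if a.eval s = b.eval s then (1 : BitVec w) else 0) = _
  rw [ha, hb]
  split_ifs <;> rfl

theorem shl (ha : Ev s a 1) (hb : Ev s b y) (hy : y < 2 ^ w) :
    Ev s (.bin .shl a b) (2 ^ y) := by
  show a.eval s <<< b.eval s = _
  rw [ha, hb]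
  apply BitVec.eq_of_toNat_eq
  rw [BitVec.shiftLeft_eq', BitVec.toNat_shiftLeft, toNat_ofNat_of_lt hy, BitVec.toNat_ofNat,
    BitVec.toNat_ofNat, Nat.shiftLeft_eq, Nat.mod_mul_mod, Nat.one_mul]

theorem shr_word {u : BitVec w} (ha : a.eval s = u) (hb : Ev s b y) (hy : y < 2 ^ w) :
    Ev s (.bin .shr a b) (u.toNat / 2 ^ y) := by
  show a.eval s >>> b.eval s = _
  rw [ha, hb]
  apply BitVec.eq_of_toNat_eq
  rw [BitVec.ushiftRight_eq', BitVec.toNat_ushiftRight, toNat_ofNat_of_lt hy,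
    toNat_ofNat_of_lt ((Nat.div_le_self _ _).trans_lt u.isLt), Nat.shiftRight_eq_div_pow]

theorem ld {c : ℕ} {g : ℕ → ℕ} (hm : s.mem c = arr g) (ha : Ev s a x) (hx : x < 2 ^ w) :
    Ev s (.ld c a) (g x) := by
  show s.mem c (a.eval s) = _
  rw [hm, ha]
  simp only [arr]
  rw [toNat_ofNat_of_lt hx]

theorem ne_zero_iff (ha : Ev s a x) (hx : x < 2 ^ w) : a.eval s ≠ 0 ↔ x ≠ 0 := by
  rw [ha]
  exact not_congr (ofNat_inj hx (by positivity))

theorem eq_zero (ha : Ev s a 0) : a.eval s = 0 := ha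

end Ev

theorem lt_self_two_pow : w < 2 ^ w := Nat.lt_two_pow_self

/-! ### Frames -/

/-- The states agree except for some variables and arrays. -/
def Agree (rs as : List ℕ) (s s' : State w) : Prop :=
  (∀ r, r ∉ rs → s'.get r = s.get r) ∧ ∀ a, a ∉ as → s'.mem a = s.mem a

namespace Agree

variable {rs as rs' as' : List ℕ} {s s' s'' : State w}

theorem refl (rs as : List ℕ) (s : State w) : Agree rs as s s := ⟨fun _ _ => rfl, fun _ _ => rfl⟩

theorem trans (h : Agree rs as s s') (h' : Agree rs as s' s'') : Agree rs as s s'' :=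
  ⟨fun r hr => (h'.1 r hr).trans (h.1 r hr), fun a ha => (h'.2 a ha).trans (h.2 a ha)⟩

theorem mono (h : Agree rs as s s') (h1 : rs ⊆ rs') (h2 : as ⊆ as') : Agree rs' as' s s' :=
  ⟨fun r hr => h.1 r fun h' => hr (h1 h'), fun a ha => h.2 a fun h' => ha (h2 h')⟩

theorem inner (h : Agree rs as s s') (h1 : ∀ r ∈ rs, r < 40) (h2 : ∀ a ∈ as, a < 20) :
    s'.inner = s.inner := by
  refine State.ext' (fun r => ?_) (funext fun a => ?_)
  · exact h.1 _ fun h' => by have := h1 _ h'; omega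
  · exact h.2 _ fun h' => by have := h2 _ h'; omega

end Agree

/-- Boolean-valued, so that the frame conditions of concrete programs are settled by `decide`. -/
def Instr.ok (rs as : List ℕ) : Instr → Bool
  | .asg d _ => rs.contains d
  | .sto a _ _ => as.contains a

theorem Agree.exec {rs as : List ℕ} {s₀ s : State w} (h : Agree rs as s₀ s) (l : List Instr)
    (hl : l.all (Instr.ok rs as) = true) : Agree rs as s₀ (exec l s) := by
  induction l generalizing s with
  | nil => exact h
  | cons i l ih =>
    rw [List.all_cons, Bool.and_eq_true] at hl
    refine ih (s := i.exec s) ?_ hl.2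
    cases i with
    | asg d e =>
      have hd : d ∈ rs := by simpa [Instr.ok] using hl.1
      refine ⟨fun r hr => ?_, h.2⟩
      simp only [Instr.exec, State.get_set]
      rw [if_neg (fun h' : r = d => hr (h' ▸ hd)), h.1 r hr]
    | sto a e v =>
      have hd : a ∈ as := by simpa [Instr.ok] using hl.1
      refine ⟨h.1, fun b hb => ?_⟩
      simp only [Instr.exec, State.mem_setMem]
      rw [if_neg (fun h' : b = a => hb (h' ▸ hd)), h.2 b hb]

theorem Runs.block_agree {l : List Instr} {s₀ s : State w} {rs as : List ℕ} {k : ℕ}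
    {Q : State w → Prop} (h : Agree rs as s₀ s) (hl : l.all (Instr.ok rs as) = true)
    (hk : blockCost l ≤ k) (hQ : Agree rs as s₀ (WordRAM.exec l s) → Q (WordRAM.exec l s)) :
    Runs (WordRAM.block l) s k Q :=
  (Runs.block (hQ (h.exec l hl))).mono hk fun _ h => h

theorem exec_nil (s : State w) : exec [] s = s := rfl

theorem exec_asg {d : ℕ} {e : Expr} {l : List Instr} {s : State w} {v : BitVec w}
    (h : e.eval s = v) : exec (.asg d e :: l) s = exec l (s.set d v) := by
  subst h; rfl

theorem exec_asg_nat {d : ℕ} {e : Expr} {l : List Instr} {s : State w} {v : ℕ}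
    (h : Ev s e v) : exec (.asg d e :: l) s = exec l (s.set d (BitVec.ofNat w v)) :=
  exec_asg h

theorem exec_sto {a : ℕ} {e e' : Expr} {l : List Instr} {s : State w} {i v : ℕ}
    (h : Ev s e i) (h' : Ev s e' v) :
    exec (.sto a e e' :: l) s = exec l (s.setMem a (BitVec.ofNat w i) (BitVec.ofNat w v)) := by
  show exec l (s.setMem a (e.eval s) (e'.eval s)) = _
  rw [h, h']

/-! ### Instances -/

/-- An instance of 3SUM, with the parameters and the multiplier of the hash function. -/
structure Inst (w : ℕ) where
  n : ℕ
  xs : ℕ → BitVec w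
  m : BitVec w
  k : ℕ
  TT : ℕ
  RR : ℕ
  BB : ℕ

namespace Inst

variable (I : Inst w)

/-- A square, because a sum of two low digits is below `2 * TT ^ 2` and so splits in base `TT` into
a pair (α, β) with α < 2 TT and β < TT. -/
def QQ : ℕ := I.TT * I.TT
def SS : ℕ := I.RR * I.QQ

/-- The hash value of the `i`-th number. -/
def hh (i : ℕ) : ℕ := hash I.m I.k (I.xs i)

/-- The bucket of the `i`-th number: the high part of its hash value, and its sign. -/
def bk (i : ℕ) : ℕ := I.hh i / I.QQ + I.RR * sgn (I.xs i)

def chk : Chunks := chunks I.BB I.bk I.n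
def ch (i : ℕ) : ℕ := I.chk.ch i
def K : ℕ := I.chk.num
def bkt (κ : ℕ) : ℕ := I.chk.bkt κ

/-- A common bound for monomials that occur in addresses. -/
def Z : ℕ := (I.n + 1) ^ 2 * I.TT ^ 3 * I.RR

/-- `hw` makes the hash values range below `SS`; `big` leaves room for all addresses and counters,
so that word arithmetic on them agrees with that of natural numbers. -/
structure OK : Prop where
  hw : 2 ^ w = I.SS * 2 ^ I.k
  w_pos : 0 < w
  TT_pos : 0 < I.TT
  RR_pos : 0 < I.RR
  BB_pos : 0 < I.BB
  BB_lt : I.BB < 2 ^ w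
  big : 64 * I.Z < 2 ^ w
  inj : ∀ i < I.n, ∀ j < I.n, I.xs i = I.xs j → i = j

end Inst

theorem Inst.K_le (I : Inst w) : I.K ≤ I.n := chunks_num_le _ _ _

namespace Inst.OK

variable {I : Inst w} (h : I.OK)
include h

theorem QQ_pos : 0 < I.QQ := Nat.mul_pos h.TT_pos h.TT_pos

theorem SS_pos : 0 < I.SS := Nat.mul_pos h.RR_pos h.QQ_pos

theorem mono (a b c : ℕ) (ha : a ≤ 2) (hb : b ≤ 3) (hc : c ≤ 1) :
    (I.n + 1) ^ a * I.TT ^ b * I.RR ^ c ≤ I.Z := by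
  unfold Inst.Z
  have := h.TT_pos
  have := h.RR_pos
  calc _ ≤ (I.n + 1) ^ 2 * I.TT ^ 3 * I.RR ^ 1 := by (gcongr; all_goals omega)
    _ = _ := by rw [pow_one]

theorem hh_lt (i : ℕ) : I.hh i < I.SS := hash_lt h.hw _

theorem k_le : I.k ≤ w := by
  refine (Nat.pow_le_pow_iff_right (a := 2) (by norm_num)).1 ?_
  rw [h.hw]
  exact Nat.le_mul_of_pos_left _ h.SS_pos

theorem hash_lt (x : BitVec w) : hash I.m I.k x < I.SS := WordRAM.hash_lt h.hw _

theorem SS_le : I.SS ≤ I.Z := by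
  refine le_trans ?_ (h.mono 0 2 1 (by norm_num) (by norm_num) le_rfl)
  simp only [pow_zero, one_mul, pow_one]
  unfold Inst.SS Inst.QQ
  exact le_of_eq (by ring)

theorem n_lt_Z : I.n + 1 ≤ I.Z := by
  simpa using h.mono 1 0 0 (by norm_num) (by norm_num) (by norm_num)

theorem TT_le : I.TT ≤ I.Z := by
  simpa using h.mono 0 1 0 (by norm_num) (by norm_num) (by norm_num)

theorem QQ_le : I.QQ ≤ I.Z := by
  simpa [Inst.QQ, pow_two] using h.mono 0 2 0 (by norm_num) (by norm_num) (by norm_num)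

theorem RR_le : I.RR ≤ I.Z := by
  simpa using h.mono 0 0 1 (by norm_num) (by norm_num) (by norm_num)

theorem hh_div_lt (i : ℕ) : I.hh i / I.QQ < I.RR := by
  rw [Nat.div_lt_iff_lt_mul h.QQ_pos]; exact h.hh_lt i

theorem bk_lt (i : ℕ) : I.bk i < 2 * I.RR := by
  have h1 := h.hh_div_lt i
  have h2 := sgn_lt h.w_pos (I.xs i)
  unfold Inst.bk
  have h3 : I.RR * sgn (I.xs i) ≤ I.RR * 1 := by gcongr; omega
  omega

theorem ch_lt {i : ℕ} (hi : i < I.n) : I.ch i < I.K := ((chunks_inv _ _ h.BB_pos _).1 i hi).1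

theorem bkt_ch {i : ℕ} (hi : i < I.n) : I.bkt (I.ch i) = I.bk i :=
  ((chunks_inv _ _ h.BB_pos _).1 i hi).2

theorem chunk_card (κ : ℕ) : ((Finset.range I.n).filter fun i => I.ch i = κ).card ≤ I.BB :=
  (chunks_inv _ _ h.BB_pos _).2.1 κ

theorem K_mul_le : I.K * I.BB ≤ I.n + 2 * I.RR * I.BB :=
  chunks_num_mul_le _ _ h.BB_pos _ _ fun i _ => h.bk_lt i

end Inst.OK

theorem chunks_ch_stable (B : ℕ) (bk : ℕ → ℕ) {i m : ℕ} (h : i < m) :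
    (chunks B bk m).ch i = (chunks B bk (i + 1)).ch i := by
  induction m with
  | zero => omega
  | succ m ih =>
    by_cases h' : i = m
    · subst h'; rfl
    · rw [← ih (by omega)]
      show ((chunks B bk m).push B (bk m) m).ch i = _
      unfold Chunks.push
      simp only
      rw [Function.update_of_ne h']

theorem chunks_bkt_lt (B : ℕ) (bk : ℕ → ℕ) (L m κ : ℕ) (hL : 0 < L) (h : ∀ i, bk i < L) :
    (chunks B bk m).bkt κ < L := by
  induction m with
  | zero => exact hL
  | succ m ih =>
    show ((chunks B bk m).push B (bk m) m).bkt κ < L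
    unfold Chunks.push
    simp only
    split_ifs
    · simp only [Function.update_apply]
      split_ifs
      · exact h _
      · exact ih
    · exact ih

theorem Inst.OK.bkt_lt {I : Inst w} (h : I.OK) (κ : ℕ) : I.bkt κ < 2 * I.RR :=
  chunks_bkt_lt _ _ _ _ _ (by have := h.RR_pos; omega) h.bk_lt

end WordRAM
end

noncomputable section
namespace WordRAM
variable {w : ℕ}

/-! ### Building the tables

Variables: `0` number of words, `2` to `9` parameters as in `Env`, `10` number of chunks, `11` and
`12` offsets of character codes, `14` and higher work space, `39` answer. Arrays: `0` input, `1` and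
`2` lists by hash value, `3` to `6` chunks, `7` and `8` lists by chunk, `9` to `11` lists of
characters by document, `12` marks. -/

local notation "V" => Expr.var

def hashE (e : Expr) : Expr := .bin .shr (V 8 * e) (V 6)
def sgnE (e : Expr) : Expr := .bin .shr e (V 9)

/-- The parameters of the instance are stored in their variables. -/
structure Env (I : Inst w) (s : State w) : Prop where
  n : s.get 0 = BitVec.ofNat w I.n
  TT : s.get 2 = BitVec.ofNat w I.TT
  QQ : s.get 3 = BitVec.ofNat w I.QQ
  RR : s.get 4 = BitVec.ofNat w I.RR
  BB : s.get 5 = BitVec.ofNat w I.BB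
  k : s.get 6 = BitVec.ofNat w I.k
  SS : s.get 7 = BitVec.ofNat w I.SS
  m : s.get 8 = I.m
  sg : s.get 9 = BitVec.ofNat w (w - 1)
  xs : s.mem 0 = fun i => I.xs i.toNat

theorem Env.agree {I : Inst w} {s s' : State w} {rs as : List ℕ} (h : Env I s)
    (hA : Agree rs as s s') (hr : rs.all (10 ≤ ·) = true) (ha : as.all (1 ≤ ·) = true) :
    Env I s' := by
  have h1 : ∀ r < 10, s'.get r = s.get r := fun r h10 => hA.1 r fun hr' => by
    have := List.all_eq_true.1 hr r hr'
    simp only [decide_eq_true_eq] at this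
    omega
  have h2 : s'.mem 0 = s.mem 0 := hA.2 0 fun ha' => by
    have := List.all_eq_true.1 ha 0 ha'
    simp at this
  constructor
  all_goals first
    | rw [h1 _ (by norm_num)]
    | rw [h2]
  exacts [h.n, h.TT, h.QQ, h.RR, h.BB, h.k, h.SS, h.m, h.sg, h.xs]

theorem Env.set {I : Inst w} {s : State w} (h : Env I s) {r : ℕ} {v : BitVec w}
    (hr : 10 ≤ r := by decide) : Env I (s.set r v) :=
  h.agree (rs := [r]) (as := []) ⟨fun r' hr' => by
    have : r' ≠ r := by simpa using hr'
    simp [this], fun _ _ => rfl⟩ (by simpa using hr) rfl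

theorem Ev.hash {s : State w} {m : BitVec w} {k : ℕ} {e : Expr} {x : BitVec w}
    (h8 : s.get 8 = m) (h6 : s.get 6 = BitVec.ofNat w k) (hk : k ≤ w) (hx : e.eval s = x) :
    Ev s (hashE e) (hash m k x) := by
  refine Ev.shr_word (u := m * x) ?_ (Ev.var h6) (hk.trans_lt lt_self_two_pow)
  show s.get 8 * e.eval s = _
  rw [h8, hx]

theorem Ev.sgn {s : State w} {e : Expr} {x : BitVec w}
    (h9 : s.get 9 = BitVec.ofNat w (w - 1)) (hx : e.eval s = x) : Ev s (sgnE e) (sgn x) :=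
  Ev.shr_word hx (Ev.var h9) ((Nat.sub_le _ _).trans_lt lt_self_two_pow)

theorem eval_ld_xs {I : Inst w} {s : State w} {e : Expr} {i : ℕ}
    (hm : s.mem 0 = fun i => I.xs i.toNat) (he : Ev s e i) (hi : i < 2 ^ w) :
    (Expr.ld 0 e).eval s = I.xs i := by
  show s.mem 0 (e.eval s) = _
  rw [hm, he]
  simp only
  rw [toNat_ofNat_of_lt hi]

/-- The key by which the numbers are listed for the verification. -/
def Inst.akey (I : Inst w) (rep : Bool) (i : ℕ) : ℕ :=
  bif rep then I.ch i * I.QQ + I.hh i % I.QQ else I.ch i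

def akeyE : Bool → Expr
  | true => V 18 * V 3 + V 16 % V 3
  | false => V 18

def indexBody (rep : Bool) : Prog :=
  .seq (block [.asg 15 (.ld 0 (V 14)), .asg 16 (hashE (V 15)),
      .asg 17 (V 16 / V 3 + V 4 * sgnE (V 15)),
      .sto 2 (V 14) (.ld 1 (V 16)), .sto 1 (V 16) (V 14 + .lit 1)])
    (.seq (ifP (.bin .eq (.ld 3 (V 17) % V 5) (.lit 0))
        (block [.sto 4 (V 17) (V 10), .sto 5 (V 10) (V 17), .asg 10 (V 10 + .lit 1)]) (block []))
      (block [.asg 18 (.ld 4 (V 17)), .sto 3 (V 17) (.ld 3 (V 17) + .lit 1), .sto 6 (V 14) (V 18),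
        .asg 19 (akeyE rep), .sto 8 (V 14) (.ld 7 (V 19)), .sto 7 (V 19) (V 14 + .lit 1),
        .asg 14 (V 14 + .lit 1)]))

def indexLoop (rep : Bool) : Prog := whileP (.bin .lt (V 14) (V 0)) (indexBody rep)

/-- The state of the index tables after `j` rounds. -/
structure IndexInv (I : Inst w) (rep : Bool) (s₀ : State w) (j : ℕ) (s : State w) : Prop where
  agree : Agree [10, 14, 15, 16, 17, 18, 19] [1, 2, 3, 4, 5, 6, 7, 8] s₀ s
  idx : s.get 14 = BitVec.ofNat w j
  num : s.get 10 = BitVec.ofNat w (chunks I.BB I.bk j).num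
  m1 : s.mem 1 = arr (last I.hh j)
  m2 : s.mem 2 = arr (link I.hh j)
  m3 : s.mem 3 = arr (chunks I.BB I.bk j).cnt
  m4 : s.mem 4 = arr (chunks I.BB I.bk j).cur
  m5 : s.mem 5 = arr (chunks I.BB I.bk j).bkt
  m6 : s.mem 6 = arr (chunks I.BB I.bk j).ch
  m7 : s.mem 7 = arr (last (I.akey rep) j)
  m8 : s.mem 8 = arr (link (I.akey rep) j)

theorem Inst.OK.lt_of_le_Z {I : Inst w} (h : I.OK) {x : ℕ} (hx : x ≤ 64 * I.Z) : x < 2 ^ w :=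
  hx.trans_lt h.big

theorem Inst.OK.akey_lt {I : Inst w} (h : I.OK) (rep : Bool) {i : ℕ} (hi : i < I.n) :
    I.akey rep i < 2 ^ w := by
  have hc := h.ch_lt hi
  have hK := I.K_le
  have hq := Nat.mod_lt (I.hh i) h.QQ_pos
  have h1 : (I.n + 1) * I.QQ ≤ I.Z := by
    simpa [Inst.QQ, pow_two] using h.mono 1 2 0 (by norm_num) (by norm_num) (by norm_num)
  have h2 : I.ch i * I.QQ + I.QQ ≤ (I.n + 1) * I.QQ := by
    rw [← Nat.succ_mul]; gcongr; omega
  have h3 := h.n_lt_Z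
  refine h.lt_of_le_Z ?_
  cases rep <;> simp only [Inst.akey, cond_true, cond_false] <;> omega

theorem indexBody_runs {I : Inst w} (h : I.OK) (rep : Bool) {s₀ : State w} (h0 : Env I s₀)
    {j : ℕ} (hj : j < I.n) {s : State w} (hs : IndexInv I rep s₀ j s) :
    Runs (indexBody rep) s 300 (IndexInv I rep s₀ (j + 1)) := by
  have hE : Env I s := h0.agree hs.agree (by decide) (by decide)
  have hZ := h.n_lt_Z
  have hjw : j < 2 ^ w := h.lt_of_le_Z (by omega)
  have hhw : I.hh j < 2 ^ w := h.lt_of_le_Z (by have := h.hh_lt j; have := h.SS_le; omega)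
  have hbw : I.bk j < 2 ^ w := h.lt_of_le_Z (by have := h.bk_lt j; have := h.RR_le; omega)
  have hQw : I.QQ < 2 ^ w := h.lt_of_le_Z (by have := h.QQ_le; omega)
  have hchw : ∀ i, (chunks I.BB I.bk j).cnt i < 2 ^ w := fun i => by
    rw [chunks_cnt]
    refine lt_of_le_of_lt ((Finset.card_filter_le _ _).trans (by simp)) hjw
  have hnum : (chunks I.BB I.bk j).num < 2 ^ w := (chunks_num_le _ _ _).trans_lt hjw
  have hs1 : ∀ s', s' = exec [.asg 15 (.ld 0 (V 14)), .asg 16 (hashE (V 15)),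
      .asg 17 (V 16 / V 3 + V 4 * sgnE (V 15)),
      .sto 2 (V 14) (.ld 1 (V 16)), .sto 1 (V 16) (V 14 + .lit 1)] s →
      Agree [10, 14, 15, 16, 17, 18, 19] [1, 2, 3, 4, 5, 6, 7, 8] s₀ s' ∧
      s'.get 14 = BitVec.ofNat w j ∧ s'.get 10 = BitVec.ofNat w (chunks I.BB I.bk j).num ∧
      s'.get 16 = BitVec.ofNat w (I.hh j) ∧ s'.get 17 = BitVec.ofNat w (I.bk j) ∧
      s'.mem 1 = arr (last I.hh (j + 1)) ∧ s'.mem 2 = arr (link I.hh (j + 1)) ∧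
      ∀ a, 3 ≤ a → s'.mem a = s.mem a := by
    rintro s' rfl
    refine ⟨hs.agree.exec _ (by decide), ?_⟩
    rw [exec_asg (eval_ld_xs hE.xs (Ev.var hs.idx) hjw),
      exec_asg_nat (Ev.hash (x := I.xs j) (by simpa using hE.m) (by simpa using hE.k) h.k_le
        (by simp [Expr.eval])),
      exec_asg_nat (v := I.bk j) ((((Ev.var (by simp; rfl)).div (Ev.var (by simpa using hE.QQ)) hhw hQw).add
        ((Ev.var (by simpa using hE.RR)).mul (Ev.sgn (x := I.xs j) (by simpa using hE.sg) (by simp [Expr.eval]))))),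
      exec_sto (i := j) (v := last I.hh j (I.hh j)) (Ev.var (by simpa using hs.idx))
        (Ev.ld (by simpa using hs.m1) (Ev.var (by simp; rfl)) hhw),
      exec_sto (i := I.hh j) (v := j + 1) (Ev.var (by simp; rfl))
        ((Ev.var (by simpa using hs.idx)).add (Ev.lit 1)), exec_nil]
    refine ⟨by simpa using hs.idx, by simpa using hs.num, by simp; rfl, by simp, ?_, ?_, ?_⟩
    · simp [hs.m1, update_arr _ _ hhw, last_succ]
    · simp [hs.m2, update_arr _ _ hjw, link_succ]
    · intro a ha
      simp only [State.mem_setMem, State.mem_set]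
      rw [if_neg (by omega), if_neg (by omega)]
  set c := chunks I.BB I.bk j with hc
  have hsucc : chunks I.BB I.bk (j + 1) = c.push I.BB (I.bk j) j := rfl
  set c' : Chunks := if c.cnt (I.bk j) % I.BB = 0 then
    { c with cur := Function.update c.cur (I.bk j) c.num,
             bkt := Function.update c.bkt c.num (I.bk j), num := c.num + 1 } else c with hc'
  have e1 : (chunks I.BB I.bk (j + 1)).num = c'.num := rfl
  have e2 : (chunks I.BB I.bk (j + 1)).cur = c'.cur := rfl
  have e3 : (chunks I.BB I.bk (j + 1)).bkt = c'.bkt := rfl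
  have e4 : (chunks I.BB I.bk (j + 1)).ch = Function.update c.ch j (c'.cur (I.bk j)) := rfl
  have e5 : (chunks I.BB I.bk (j + 1)).cnt =
    Function.update c.cnt (I.bk j) (c.cnt (I.bk j) + 1) := rfl
  -- The chunk chosen in round `j` is never revised, so the key used for the verification lists is
  -- already the final one.
  have e6 : I.ch j = c'.cur (I.bk j) := by
    show (chunks I.BB I.bk I.n).ch j = _
    rw [chunks_ch_stable _ _ hj, e4, Function.update_self]
  refine Runs.mono (k' := 300) (Runs.seq (k₂ := 200) (Runs.block rfl) fun s' hs' => ?_)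
    (by decide) fun _ h => h
  obtain ⟨hA, i14, i10, i16, i17, a1, a2, a3⟩ := hs1 s' hs'.symm
  clear hs1 hs'
  have hE' : Env I s' := h0.agree hA (by decide) (by decide)
  have hcond : Ev s' (.bin .eq (.ld 3 (V 17) % V 5) (.lit 0))
      (if c.cnt (I.bk j) % I.BB = 0 then 1 else 0) :=
    Ev.eq ((Ev.ld (by rw [a3 3 le_rfl, hs.m3]) (Ev.var i17) hbw).mod (Ev.var hE'.BB)
      (hchw _) h.BB_lt) (Ev.lit 0) ((Nat.mod_le _ _).trans_lt (hchw _)) (by positivity)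
  have h1w : (if c.cnt (I.bk j) % I.BB = 0 then 1 else 0) < 2 ^ w := by
    have := h.big
    split_ifs <;> omega
  refine Runs.mono (k' := 200) (Runs.seq (k₁ := (Expr.bin .eq (.ld 3 (V 17) % V 5) (.lit 0)).cost + 40 + 4)
    (k₂ := 120) (Q := fun s'' => Agree [10, 14, 15, 16, 17, 18, 19] [1, 2, 3, 4, 5, 6, 7, 8] s₀ s'' ∧
      Agree [10] [4, 5] s' s'' ∧ s''.get 10 = BitVec.ofNat w c'.num ∧
      s''.mem 4 = arr c'.cur ∧ s''.mem 5 = arr c'.bkt) (Runs.ifP (fun hne => ?_) fun he => ?_) ?_) (by decide) fun _ h => h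
  · have h0' : c.cnt (I.bk j) % I.BB = 0 := by
      by_contra hcon
      exact (hcond.ne_zero_iff h1w).1 hne (if_neg hcon)
    refine Runs.mono (Runs.block (Q := fun x => x = exec _ s') rfl) (by decide) ?_
    rintro _ rfl
    refine ⟨hA.exec _ (by decide), (Agree.refl _ _ _).exec _ (by decide), ?_⟩
    rw [exec_sto (Ev.var i17) (Ev.var i10), exec_sto (i := c.num) (v := I.bk j)
      (Ev.var (by simpa using i10)) (Ev.var (by simpa using i17)),
      exec_asg_nat ((Ev.var (by simp; exact i10)).add (Ev.lit 1)), exec_nil]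
    rw [hc', if_pos h0']
    refine ⟨by simp, ?_, ?_⟩
    · simp [a3, hs.m4, update_arr _ _ hbw, hc]
    · simp [a3, hs.m5, ← hc, update_arr _ _ hnum]
  · have h0' : ¬ c.cnt (I.bk j) % I.BB = 0 := by
      intro hcon
      exact (hcond.ne_zero_iff h1w).2 (by rw [if_pos hcon]; exact one_ne_zero) he
    refine Runs.mono (Runs.block (Q := fun x => x = s') rfl) (by decide) ?_
    rintro _ rfl
    refine ⟨hA, Agree.refl _ _ _, ?_⟩
    rw [hc', if_neg h0']
    exact ⟨i10, by rw [a3 4 (by norm_num), hs.m4], by rw [a3 5 (by norm_num), hs.m5]⟩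
  rintro s2 ⟨hA2, hA12, k10, b4, b5⟩
  have hE2 : Env I s2 := h0.agree hA2 (by decide) (by decide)
  have k14 : s2.get 14 = BitVec.ofNat w j := by rw [hA12.1 _ (by decide), i14]
  have k16 : s2.get 16 = BitVec.ofNat w (I.hh j) := by rw [hA12.1 _ (by decide), i16]
  have k17 : s2.get 17 = BitVec.ofNat w (I.bk j) := by rw [hA12.1 _ (by decide), i17]
  have b1 : s2.mem 1 = arr (last I.hh (j + 1)) := by rw [hA12.2 _ (by decide), a1]
  have b2 : s2.mem 2 = arr (link I.hh (j + 1)) := by rw [hA12.2 _ (by decide), a2]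
  have b3 : s2.mem 3 = arr c.cnt := by rw [hA12.2 _ (by decide), a3 _ le_rfl, hs.m3]
  have b6 : s2.mem 6 = arr c.ch := by rw [hA12.2 _ (by decide), a3 _ (by norm_num), hs.m6]
  have b7 : s2.mem 7 = arr (last (I.akey rep) j) := by
    rw [hA12.2 _ (by decide), a3 _ (by norm_num), hs.m7]
  have b8 : s2.mem 8 = arr (link (I.akey rep) j) := by
    rw [hA12.2 _ (by decide), a3 _ (by norm_num), hs.m8]
  have hkw := h.akey_lt rep hj
  have hkey : ∀ s' : State w, s'.get 18 = BitVec.ofNat w (I.ch j) →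
      s'.get 16 = BitVec.ofNat w (I.hh j) → s'.get 3 = BitVec.ofNat w I.QQ →
      Ev s' (akeyE rep) (I.akey rep j) := by
    intro s' h18 h16 h3
    cases rep
    · exact Ev.var h18
    · exact ((Ev.var h18).mul (Ev.var h3)).add ((Ev.var h16).mod (Ev.var h3) hhw hQw)
  refine Runs.block_agree hA2 (by cases rep <;> decide) (by cases rep <;> decide) ?_
  rw [exec_asg_nat (Ev.ld b4 (Ev.var k17) hbw), ← e6,
    exec_sto (Ev.var (by simpa using k17))
      ((Ev.ld (by simpa using b3) (Ev.var (by simpa using k17)) hbw).add (Ev.lit 1)),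
    exec_sto (v := I.ch j) (Ev.var (by simpa using k14)) (Ev.var (by simp)),
    exec_asg_nat (hkey _ (by simp) (by simpa using k16) (by simpa using hE2.QQ)),
    exec_sto (i := j) (Ev.var (by simpa using k14)) (Ev.ld (by simpa using b7)
      (Ev.var (x := I.akey rep j) (by simp)) hkw),
    exec_sto (i := I.akey rep j) (v := j + 1) (Ev.var (by simp))
      ((Ev.var (by simpa using k14)).add (Ev.lit 1)),
    exec_asg_nat (v := j + 1) ((Ev.var (by simpa using k14)).add (Ev.lit 1)), exec_nil]
  intro hag
  constructor
  · exact hag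
  · simp
  · simpa [e1] using k10
  · simpa using b1
  · simpa using b2
  · simp [b3, update_arr _ _ hbw, e5]
  · simpa [e2] using b4
  · simpa [e3] using b5
  · simp [b6, update_arr _ _ hjw, e4, e6]
  · simp [b7, update_arr _ _ hkw, last_succ]
  · simp [b8, update_arr _ _ hjw, link_succ]

theorem indexLoop_runs {I : Inst w} (h : I.OK) (rep : Bool) {s₀ : State w} (h0 : Env I s₀)
    (hs : IndexInv I rep s₀ 0 s₀) :
    Runs (indexLoop rep) s₀ (400 * I.n + 20) (IndexInv I rep s₀ I.n) := by
  have hn : I.n < 2 ^ w := h.lt_of_le_Z (by have := h.n_lt_Z; omega)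
  have h1 : 1 < 2 ^ w := h.lt_of_le_Z (by have := h.n_lt_Z; omega)
  have hcond : ∀ j ≤ I.n, ∀ s, IndexInv I rep s₀ j s →
      Ev s (.bin .lt (V 14) (V 0)) (if j < I.n then 1 else 0) := fun j hj s hI =>
    Ev.lt (Ev.var hI.idx) (Ev.var (h0.agree hI.agree (by decide) (by decide)).n)
      (hj.trans_lt hn) hn
  refine Runs.mono (Runs.while (IndexInv I rep s₀) I.n (fun _ => 300) hs (fun s hI => ?_)
    fun j hj s hI => ⟨?_, indexBody_runs h rep h0 hj hI⟩) ?_ fun _ h => h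
  · have := hcond I.n le_rfl s hI
    rw [if_neg (lt_irrefl _)] at this
    exact this.eq_zero
  · have := hcond j hj.le s hI
    rw [if_pos hj] at this
    exact (this.ne_zero_iff h1).2 one_ne_zero
  · simp only [Finset.sum_const, Finset.card_range, smul_eq_mul, Expr.cost]
    omega

end WordRAM
end

noncomputable section
namespace WordRAM
set_option linter.unusedSectionVars false
variable {w : ℕ}

/-! ### The documents -/

namespace Inst

variable (I : Inst w)

/-- The low part of the hash value of the `i`-th number. -/
def h2 (i : ℕ) : ℕ := I.hh i % I.QQ

/-- The document that receives the character `α` for the `i`-th number as a first summand. The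
value `4 * QQ` stands for no document. -/
def docA (i α : ℕ) : ℕ := if I.xs i = 0 then 4 * I.QQ else I.h2 i + 2 * I.QQ - α * I.TT

/-- The document that receives the character `β` for the `i`-th number as a second summand. -/
def docB (i β : ℕ) : ℕ := if I.xs i = 0 then 4 * I.QQ else β + 2 * I.QQ - I.h2 i

/-- The characters for first summands are below `CB`, those for second summands are not. -/
def CB : ℕ := 1 + I.K * (2 * I.TT)

/-- An unused character. -/
def DUM : ℕ := I.CB + 2 * I.RR * I.TT

def GA : ℕ := I.n * (2 * I.TT)
-- For Forbidden Pattern every pair of a document and a second character is a potential occurrence,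
-- since the complement is written. This is the term T³R in the length of the text.
def GB (forb : Bool) : ℕ := bif forb then 4 * I.QQ * (2 * I.RR * I.TT) else I.n * I.TT

/-- The pair (document, character) belonging to the `t`-th second-summand occurrence, coded as one
address; `t` codes a number and its digit β. In the forbidden case the text contains the unmarked
pairs. -/
def markIdx (t : ℕ) : ℕ :=
  I.docB (t / I.TT) (t % I.TT) * (2 * I.RR * I.TT) + (I.bk (t / I.TT) * I.TT + t % I.TT)

open Classical in
def marks (m t : ℕ) : ℕ := if ∃ g < m, I.markIdx g = t then 1 else 0

def keyB (forb : Bool) (t : ℕ) : ℕ :=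
  bif forb then
    if I.marks (I.n * I.TT) t = 0 then t / (2 * I.RR * I.TT) else 4 * I.QQ
  else I.docB (t / I.TT) (t % I.TT)

def chrB (forb : Bool) (t : ℕ) : ℕ :=
  bif forb then I.CB + t % (2 * I.RR * I.TT)
  else I.CB + (I.bk (t / I.TT) * I.TT + t % I.TT)

/-- The document of the `g`-th occurrence. -/
def ukey (forb : Bool) (g : ℕ) : ℕ :=
  if g < I.GA then I.docA (g / (2 * I.TT)) (g % (2 * I.TT)) else I.keyB forb (g - I.GA)

/-- The character of the `g`-th occurrence. -/
def uchr (forb : Bool) (g : ℕ) : ℕ :=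
  if g < I.GA then 1 + I.ch (g / (2 * I.TT)) * (2 * I.TT) + g % (2 * I.TT)
  else I.chrB forb (g - I.GA)

/-- The leading 0 makes the document nonempty; no query uses the character 0. -/
def doc (forb : Bool) (u : ℕ) : Str :=
  0 :: (chain (I.ukey forb) (I.GA + I.GB forb) u).map (I.uchr forb)

/-- The last document is padding: it contains no character of a query, and its length `DUM + 1`
guarantees that all characters are below the total length. -/
def docs (forb : Bool) : List Str :=
  (List.range (4 * I.QQ)).map (I.doc forb) ++ [List.replicate (I.DUM + 1) 0]

theorem marks_succ (m : ℕ) : I.marks (m + 1) = Function.update (I.marks m) (I.markIdx m) 1 := by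
  funext t
  rw [Function.update_apply]
  unfold marks
  by_cases h : t = I.markIdx m
  · rw [if_pos h, if_pos ⟨m, by omega, h.symm⟩]
  · rw [if_neg h]
    congr 1
    refine propext ⟨fun ⟨g, hg, hgt⟩ => ⟨g, ?_, hgt⟩, fun ⟨g, hg, hgt⟩ => ⟨g, by omega, hgt⟩⟩
    rcases Nat.lt_succ_iff_lt_or_eq.1 hg with h' | rfl
    · exact h'
    · exact absurd hgt.symm h

end Inst

theorem mul_add_inj {c a b a' b' : ℕ} (hb : b < c) (hb' : b' < c) :
    a * c + b = a' * c + b' ↔ a = a' ∧ b = b' := by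
  constructor
  · intro h
    have h1 : (a * c + b) / c = (a' * c + b') / c := by rw [h]
    have h2 : (a * c + b) % c = (a' * c + b') % c := by rw [h]
    have hc : 0 < c := by omega
    rw [Nat.add_comm, Nat.add_mul_div_right _ _ hc, Nat.div_eq_of_lt hb, Nat.add_comm (a' * c),
      Nat.add_mul_div_right _ _ hc, Nat.div_eq_of_lt hb'] at h1
    rw [Nat.add_comm, Nat.add_mul_mod_self_right, Nat.mod_eq_of_lt hb, Nat.add_comm (a' * c),
      Nat.add_mul_mod_self_right, Nat.mod_eq_of_lt hb'] at h2
    exact ⟨by omega, h2⟩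
  · rintro ⟨rfl, rfl⟩; rfl

theorem mul_add_lt {a b c d : ℕ} (ha : a < d) (hb : b < c) : a * c + b < d * c := by
  have : (a + 1) * c ≤ d * c := by gcongr; omega
  rw [Nat.succ_mul] at this
  omega

theorem divmod_eq {a b c : ℕ} (hb : b < c) : (a * c + b) / c = a ∧ (a * c + b) % c = b := by
  have hc : 0 < c := by omega
  rw [Nat.add_comm, Nat.add_mul_div_right _ _ hc, Nat.div_eq_of_lt hb,
    Nat.add_mul_mod_self_right, Nat.mod_eq_of_lt hb]
  omega

namespace Inst.OK

variable {I : Inst w} (h : I.OK) (forb : Bool)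
include h

theorem h2_lt (i : ℕ) : I.h2 i < I.QQ := Nat.mod_lt _ h.QQ_pos

/-- The shift by `2 * QQ` keeps the subtraction exact. With `docB_bounds`, equal document numbers
mean that the low digits add up to αT + β. -/
theorem docA_bounds {i α : ℕ} (hα : α < 2 * I.TT) (hx : I.xs i ≠ 0) :
    I.docA i α + α * I.TT = I.h2 i + 2 * I.QQ ∧ I.docA i α < 4 * I.QQ := by
  have h1 : α * I.TT ≤ 2 * I.QQ := by
    unfold Inst.QQ; rw [← Nat.mul_assoc]; gcongr
  have := h.h2_lt i
  unfold Inst.docA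
  rw [if_neg hx]
  omega

theorem docB_bounds {i β : ℕ} (hβ : β < I.TT) (hx : I.xs i ≠ 0) :
    I.docB i β + I.h2 i = β + 2 * I.QQ ∧ I.docB i β < 4 * I.QQ := by
  have h1 : I.TT ≤ I.QQ := Nat.le_mul_of_pos_left _ h.TT_pos
  have := h.h2_lt i
  unfold Inst.docB
  rw [if_neg hx]
  omega

theorem docA_le {i α : ℕ} (hα : α < 2 * I.TT) : I.docA i α ≤ 4 * I.QQ := by
  by_cases hx : I.xs i = 0
  · simp [Inst.docA, hx]
  · exact (h.docA_bounds hα hx).2.le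

theorem docB_le {i β : ℕ} (hβ : β < I.TT) : I.docB i β ≤ 4 * I.QQ := by
  by_cases hx : I.xs i = 0
  · simp [Inst.docB, hx]
  · exact (h.docB_bounds hβ hx).2.le

theorem charB_lt {j β : ℕ} (hj : j < 2 * I.RR) (hβ : β < I.TT) :
    j * I.TT + β < 2 * I.RR * I.TT := mul_add_lt hj hβ

theorem charA_lt {κ α : ℕ} (hκ : κ < I.K) (hα : α < 2 * I.TT) :
    1 + κ * (2 * I.TT) + α < I.CB := by
  have := mul_add_lt hκ hα
  unfold Inst.CB; omega

theorem RT_pos : 0 < 2 * I.RR * I.TT := by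
  have := h.RR_pos; have := h.TT_pos; positivity

theorem keyB_le {t : ℕ} (ht : t < I.GB forb) : I.keyB forb t ≤ 4 * I.QQ := by
  cases forb
  · exact h.docB_le (Nat.mod_lt _ h.TT_pos)
  · simp only [Inst.keyB, cond_true]
    split_ifs
    · refine le_of_lt ((Nat.div_lt_iff_lt_mul h.RT_pos).2 ht)
    · exact le_rfl

theorem ukey_le {g : ℕ} (hg : g < I.GA + I.GB forb) : I.ukey forb g ≤ 4 * I.QQ := by
  unfold Inst.ukey
  split_ifs with h'
  · exact h.docA_le (Nat.mod_lt _ (by have := h.TT_pos; omega))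
  · exact h.keyB_le forb (by omega)

theorem chrB_ge (t : ℕ) : I.CB ≤ I.chrB forb t := by
  cases forb <;> exact Nat.le_add_right _ _

theorem chrB_lt (t : ℕ) : I.chrB forb t < I.DUM := by
  cases forb
  · exact Nat.add_lt_add_left (h.charB_lt (h.bk_lt _) (Nat.mod_lt _ h.TT_pos)) _
  · exact Nat.add_lt_add_left (Nat.mod_lt _ h.RT_pos) _

theorem uchr_lt (g : ℕ) : I.uchr forb g < I.DUM := by
  unfold Inst.uchr
  split_ifs with hg
  · have h1 : g / (2 * I.TT) < I.n := by
      rwa [Nat.div_lt_iff_lt_mul (by have := h.TT_pos; omega)]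
    have := h.charA_lt (h.ch_lt h1) (Nat.mod_lt g (by have := h.TT_pos; omega : 0 < 2 * I.TT))
    unfold Inst.DUM; omega
  · exact h.chrB_lt forb _

theorem mem_doc {u c : ℕ} (hc : c ≠ 0) :
    c ∈ I.doc forb u ↔ ∃ g < I.GA + I.GB forb, I.ukey forb g = u ∧ I.uchr forb g = c := by
  simp only [Inst.doc, List.mem_cons, hc, false_or, List.mem_map, mem_chain]
  exact ⟨fun ⟨g, ⟨a, b⟩, c⟩ => ⟨g, a, b, c⟩, fun ⟨g, a, b, c⟩ => ⟨g, ⟨a, b⟩, c⟩⟩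

theorem mem_doc_charA {u κ α : ℕ} (hκ : κ < I.K) (hα : α < 2 * I.TT) :
    1 + κ * (2 * I.TT) + α ∈ I.doc forb u ↔ ∃ x < I.n, I.ch x = κ ∧ I.docA x α = u := by
  have hT : 0 < 2 * I.TT := by have := h.TT_pos; omega
  rw [h.mem_doc forb (by omega)]
  constructor
  · rintro ⟨g, hg, h1, h2⟩
    by_cases hgA : g < I.GA
    · simp only [Inst.ukey, Inst.uchr, hgA, if_true] at h1 h2
      rw [Nat.add_assoc, Nat.add_assoc, Nat.add_left_cancel_iff,
        mul_add_inj (Nat.mod_lt _ hT) hα] at h2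
      exact ⟨g / (2 * I.TT), (Nat.div_lt_iff_lt_mul hT).2 hgA, h2.1, h2.2 ▸ h1⟩
    · simp only [Inst.uchr, hgA, if_false] at h2
      have := h.chrB_ge forb (g - I.GA)
      have := h.charA_lt hκ hα
      omega
  · rintro ⟨x, hx, rfl, rfl⟩
    have hlt : x * (2 * I.TT) + α < I.GA := mul_add_lt hx hα
    have := divmod_eq (a := x) hα
    refine ⟨x * (2 * I.TT) + α, by omega, ?_, ?_⟩
    · simp [Inst.ukey, hlt, this]
    · simp [Inst.uchr, hlt, this]

theorem marks_iff {u j β : ℕ} (hj : j < 2 * I.RR) (hβ : β < I.TT) :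
    I.marks (I.n * I.TT) (u * (2 * I.RR * I.TT) + (j * I.TT + β)) ≠ 0 ↔
      ∃ y < I.n, I.bk y = j ∧ I.docB y β = u := by
  unfold Inst.marks
  rw [ne_eq, ite_eq_right_iff]
  simp only [one_ne_zero, imp_false, not_not]
  constructor
  · rintro ⟨g, hg, hge⟩
    unfold Inst.markIdx at hge
    rw [mul_add_inj (h.charB_lt (h.bk_lt _) (Nat.mod_lt _ h.TT_pos)) (h.charB_lt hj hβ),
      mul_add_inj (Nat.mod_lt _ h.TT_pos) hβ] at hge
    exact ⟨g / I.TT, (Nat.div_lt_iff_lt_mul h.TT_pos).2 hg, hge.2.1, hge.2.2 ▸ hge.1⟩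
  · rintro ⟨y, hy, rfl, rfl⟩
    refine ⟨y * I.TT + β, mul_add_lt hy hβ, ?_⟩
    simp [Inst.markIdx, divmod_eq (a := y) hβ]

/-- In the forbidden case the character is present exactly when no suitable y exists. Not containing
it then selects the same documents as containing it does in the other case. -/
theorem mem_doc_charB {u j β : ℕ} (hu : u < 4 * I.QQ) (hj : j < 2 * I.RR) (hβ : β < I.TT) :
    (I.CB + (j * I.TT + β) ∈ I.doc forb u ↔
      if forb then ¬ ∃ y < I.n, I.bk y = j ∧ I.docB y β = u
      else ∃ y < I.n, I.bk y = j ∧ I.docB y β = u) := by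
  rw [h.mem_doc forb (by unfold Inst.CB; omega)]
  have hlow : ∀ g < I.GA, I.uchr forb g ≠ I.CB + (j * I.TT + β) := fun g hg => by
    simp only [Inst.uchr, hg, if_true]
    have h1 : g / (2 * I.TT) < I.n := by
      rwa [Nat.div_lt_iff_lt_mul (by have := h.TT_pos; omega)]
    have := h.charA_lt (h.ch_lt h1) (Nat.mod_lt g (by have := h.TT_pos; omega : 0 < 2 * I.TT))
    omega
  have hshift : (∃ g < I.GA + I.GB forb, I.ukey forb g = u ∧
      I.uchr forb g = I.CB + (j * I.TT + β)) ↔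
      ∃ t < I.GB forb, I.keyB forb t = u ∧ I.chrB forb t = I.CB + (j * I.TT + β) := by
    constructor
    · rintro ⟨g, hg, h1, h2⟩
      have hgA : ¬ g < I.GA := fun h' => hlow g h' h2
      simp only [Inst.ukey, Inst.uchr, hgA, if_false] at h1 h2
      exact ⟨g - I.GA, by omega, h1, h2⟩
    · rintro ⟨t, ht, h1, h2⟩
      refine ⟨I.GA + t, by omega, ?_⟩
      simpa [Inst.ukey, Inst.uchr] using ⟨h1, h2⟩
  rw [hshift]
  cases forb
  · simp only [Inst.keyB, Inst.chrB, Inst.GB, cond_false, Bool.false_eq_true, if_false]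
    constructor
    · rintro ⟨t, ht, h1, h2⟩
      rw [Nat.add_left_cancel_iff, mul_add_inj (Nat.mod_lt _ h.TT_pos) hβ] at h2
      exact ⟨t / I.TT, (Nat.div_lt_iff_lt_mul h.TT_pos).2 ht, h2.1, h2.2 ▸ h1⟩
    · rintro ⟨y, hy, rfl, rfl⟩
      refine ⟨y * I.TT + β, mul_add_lt hy hβ, ?_⟩
      simp [divmod_eq (a := y) hβ]
  · simp only [Inst.keyB, Inst.chrB, Inst.GB, cond_true, if_true]
    rw [← h.marks_iff hj hβ, not_not]
    have hb := h.charB_lt hj hβ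
    constructor
    · rintro ⟨t, ht, h1, h2⟩
      rw [Nat.add_left_cancel_iff] at h2
      split_ifs at h1 with hm
      · rw [← h1, ← h2, Nat.div_add_mod']; exact hm
      · omega
    · intro hm
      refine ⟨_, mul_add_lt hu hb, ?_, ?_⟩
      · rw [if_pos hm]; exact (divmod_eq hb).1
      · rw [(divmod_eq hb).2]

end Inst.OK

theorem sum_map_range (f : ℕ → ℕ) (n : ℕ) :
    ((List.range n).map f).sum = ∑ i ∈ Finset.range n, f i := by
  induction n with
  | zero => simp
  | succ n ih => rw [List.range_succ, Finset.sum_range_succ, ← ih]; simp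

theorem singleton_infix_iff {c : ℕ} {l : Str} : [c] <:+: l ↔ c ∈ l := by
  constructor
  · intro h; exact h.subset (by simp)
  · intro h
    obtain ⟨a, b, rfl⟩ := List.append_of_mem h
    exact ⟨a, b, by simp⟩

/-- The selection predicate of Two Patterns or of Forbidden Pattern. -/
def selects (forb : Bool) : Query → Str → Prop :=
  bif forb then forbiddenPattern else twoPatterns

namespace Inst.OK

variable {I : Inst w} (h : I.OK) (forb : Bool)
include h

theorem mem_answer_iff {q : Query} {u : ℕ} {c : ℕ} (hq : q.1 = [c]) (hc : c ≠ 0) :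
    u ∈ answer (selects forb) (I.docs forb) q ↔
      u < 4 * I.QQ ∧ selects forb q (I.doc forb u) := by
  unfold answer Inst.docs
  simp only [Set.mem_ofPred_eq]
  rcases lt_or_ge u (4 * I.QQ) with hu | hu
  · rw [List.getElem?_append_left (by simpa using hu)]
    simp [hu]
  · rw [List.getElem?_append_right (by simpa using hu)]
    constructor
    · rintro ⟨D, hD, hs⟩
      exfalso
      have hD' : D = List.replicate (I.DUM + 1) 0 := by
        have := List.mem_of_getElem? hD
        simpa using this
      have : [c] <:+: D := by
        rw [← hq]
        cases forb
        · exact hs.1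
        · exact hs.1
      rw [singleton_infix_iff, hD'] at this
      exact hc (List.eq_of_mem_replicate this)
    · intro h'; omega

/-- The documents that are selected by a query correspond to pairs of numbers with a given sum of
the low parts of their hash values. -/
theorem mem_answer {u κ α j β : ℕ} (hκ : κ < I.K) (hα : α < 2 * I.TT) (hj : j < 2 * I.RR)
    (hβ : β < I.TT) :
    u ∈ answer (selects forb) (I.docs forb)
        ([1 + κ * (2 * I.TT) + α], [I.CB + (j * I.TT + β)]) ↔
      u < 4 * I.QQ ∧ (∃ x < I.n, I.ch x = κ ∧ I.docA x α = u) ∧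
        ∃ y < I.n, I.bk y = j ∧ I.docB y β = u := by
  rw [h.mem_answer_iff forb rfl (by omega)]
  refine and_congr_right fun hu => ?_
  have h1 := h.mem_doc_charA forb (u := u) hκ hα
  have h2 := h.mem_doc_charB forb (u := u) hu hj hβ
  cases forb
  · simp only [selects, cond_false, twoPatterns, singleton_infix_iff]
    rw [h1, h2]; simp
  · simp only [selects, cond_true, forbiddenPattern, singleton_infix_iff]
    rw [h1, h2]; simp

/-- The first pattern has to be present in both problems, so a character that occurs nowhere yields
the empty answer. Hidden queries use it. -/
theorem answer_dum (c : ℕ) :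
    answer (selects forb) (I.docs forb) ([I.DUM], [c]) = ∅ := by
  have hD : I.DUM ≠ 0 := by unfold Inst.DUM Inst.CB; omega
  refine Set.eq_empty_of_forall_notMem fun u hu => ?_
  rw [h.mem_answer_iff forb rfl hD] at hu
  have : I.DUM ∈ I.doc forb u := by
    rw [← singleton_infix_iff]
    cases forb
    · exact hu.2.1
    · exact hu.2.1
  obtain ⟨g, -, -, hg⟩ := (h.mem_doc forb hD).1 this
  exact (h.uchr_lt forb g).ne hg

theorem totalLength_docs_ge : I.DUM + 1 ≤ totalLength (I.docs forb) := by
  simp [totalLength, Inst.docs]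

omit h in
theorem sum_chain_length_le (key : ℕ → ℕ) (m L : ℕ) :
    ∑ u ∈ Finset.range L, (chain key m u).length ≤ m := by
  simp_rw [chain_length]
  rw [Finset.sum_card_fiberwise_eq_card_filter]
  exact (Finset.card_filter_le _ _).trans (by simp)

theorem totalLength_docs_le :
    totalLength (I.docs forb) ≤ 4 * I.QQ + (I.GA + I.GB forb) + (I.DUM + 1) := by
  have h1 := sum_chain_length_le (I.ukey forb) (I.GA + I.GB forb) (4 * I.QQ)
  have h2 : totalLength (I.docs forb) = ∑ u ∈ Finset.range (4 * I.QQ),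
      ((chain (I.ukey forb) (I.GA + I.GB forb) u).length + 1) + (I.DUM + 1) := by
    rw [← sum_map_range]
    simp [totalLength, Inst.docs, Inst.doc, Function.comp_def]
  rw [h2, Finset.sum_add_distrib]
  simp
  omega

theorem validDocs : ValidDocs (I.docs forb) := by
  intro D hD
  have hlen := h.totalLength_docs_ge forb
  simp only [Inst.docs, List.mem_append, List.mem_map, List.mem_range, List.mem_singleton] at hD
  rcases hD with ⟨u, -, rfl⟩ | rfl
  · refine ⟨by simp [Inst.doc], fun a ha => ?_⟩
    simp only [Inst.doc, List.mem_cons, List.mem_map] at ha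
    rcases ha with rfl | ⟨g, -, rfl⟩
    · omega
    · have := h.uchr_lt forb g; omega
  · refine ⟨by simp, fun a ha => ?_⟩
    rw [List.eq_of_mem_replicate ha]; omega

theorem GA_le : I.GA ≤ 2 * I.Z := by
  have := h.mono 1 1 0 (by norm_num) (by norm_num) (by norm_num)
  simp only [pow_one, pow_zero, mul_one] at this
  unfold Inst.GA
  have h' : I.n * I.TT ≤ (I.n + 1) * I.TT := by gcongr; omega
  linarith

theorem GB_le : I.GB forb ≤ 8 * I.Z := by
  cases forb
  · have := h.mono 1 1 0 (by norm_num) (by norm_num) (by norm_num)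
    simp only [pow_one, pow_zero, mul_one] at this
    simp only [Inst.GB, cond_false]
    have h' : I.n * I.TT ≤ (I.n + 1) * I.TT := by gcongr; omega
    linarith
  · have := h.mono 0 3 1 (by norm_num) (by norm_num) (by norm_num)
    simp only [pow_one, pow_zero, one_mul] at this
    simp only [Inst.GB, cond_true, Inst.QQ]
    calc _ = 8 * (I.TT ^ 3 * I.RR) := by ring
      _ ≤ _ := by gcongr

theorem RT_le : 2 * I.RR * I.TT ≤ 2 * I.Z := by
  have := h.mono 0 1 1 (by norm_num) (by norm_num) (by norm_num)
  simp only [pow_one, pow_zero, one_mul] at this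
  linarith

theorem CB_le : I.CB ≤ 3 * I.Z := by
  have h1 : I.K * (2 * I.TT) ≤ I.GA := Nat.mul_le_mul_right _ I.K_le
  have := h.GA_le
  have := h.n_lt_Z
  unfold Inst.CB; omega

theorem DUM_le : I.DUM ≤ 5 * I.Z := by
  have := h.CB_le
  have := h.RT_le
  unfold Inst.DUM; omega

theorem totalLength_le_Z : totalLength (I.docs forb) + 2 ≤ 24 * I.Z := by
  have := h.totalLength_docs_le forb
  have := h.GA_le
  have := h.GB_le forb
  have := h.DUM_le
  have := h.QQ_le
  have := h.n_lt_Z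
  omega

end Inst.OK

end WordRAM
end

noncomputable section
namespace WordRAM
variable {w : ℕ}

/-! ### Collecting the occurrences of characters -/

local notation "V" => Expr.var

/-- The entry `e` for the number in variable `22`, which is discarded if that number is zero. -/
def docE (e : Expr) : Expr :=
  e * (.lit 1 - .bin .eq (V 22) (.lit 0)) + V 24 * .bin .eq (V 22) (.lit 0)

def bucketE : Expr := hashE (V 22) / V 3 + V 4 * sgnE (V 22)

def prelude (forb : Bool) : List Instr :=
  [.asg 11 (.lit 1 + V 10 * (.lit 2 * V 2)), .asg 23 (.lit 2 * V 4 * V 2), .asg 12 (V 11 + V 23),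
    .asg 24 (.lit 4 * V 3), .asg 13 (V 0 * V 2), .asg 15 (V 0 * (.lit 2 * V 2)),
    .asg 16 (V 15 + bif forb then V 24 * V 23 else V 13), .asg 14 (.lit 0)]

def markBody : List Instr :=
  [.asg 18 (V 14 / V 2), .asg 19 (V 14 % V 2), .asg 22 (.ld 0 (V 18)),
    .asg 20 (docE (V 19 + .lit 2 * V 3 - hashE (V 22) % V 3)),
    .sto 12 (V 20 * V 23 + (bucketE * V 2 + V 19)) (.lit 1), .asg 14 (V 14 + .lit 1)]

def occA : List Instr :=
  [.asg 18 (V 14 / (.lit 2 * V 2)), .asg 19 (V 14 % (.lit 2 * V 2)), .asg 22 (.ld 0 (V 18)),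
    .asg 20 (docE (hashE (V 22) % V 3 + .lit 2 * V 3 - V 19 * V 2)),
    .asg 21 (.lit 1 + .ld 6 (V 18) * (.lit 2 * V 2) + V 19)]

def occB : Bool → List Instr
  | false => [.asg 17 (V 14 - V 15), .asg 18 (V 17 / V 2), .asg 19 (V 17 % V 2),
      .asg 22 (.ld 0 (V 18)), .asg 20 (docE (V 19 + .lit 2 * V 3 - hashE (V 22) % V 3)),
      .asg 21 (V 11 + (bucketE * V 2 + V 19))]
  | true => [.asg 17 (V 14 - V 15), .asg 19 (.bin .eq (.ld 12 (V 17)) (.lit 0)),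
      .asg 20 (V 17 / V 23 * V 19 + V 24 * (.lit 1 - V 19)), .asg 21 (V 11 + V 17 % V 23)]

def pushBody (forb : Bool) : Prog :=
  .seq (ifP (.bin .lt (V 14) (V 15)) (block occA) (block (occB forb)))
    (block [.sto 10 (V 14) (.ld 9 (V 20)), .sto 9 (V 20) (V 14 + .lit 1), .sto 11 (V 14) (V 21),
      .asg 14 (V 14 + .lit 1)])

def markLoop : Bool → Prog
  | false => block []
  | true => whileP (.bin .lt (V 14) (V 13)) (block markBody)

def occLoop (forb : Bool) : Prog :=
  .seq (block (prelude forb)) (.seq (markLoop forb) (.seq (block [.asg 14 (.lit 0)])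
    (whileP (.bin .lt (V 14) (V 16)) (pushBody forb))))

/-- The parameters, the numbers of the chunks, and some derived quantities. -/
structure Env2 (I : Inst w) (forb : Bool) (s : State w) : Prop where
  env : Env I s
  K : s.get 10 = BitVec.ofNat w I.K
  CB : s.get 11 = BitVec.ofNat w I.CB
  DUM : s.get 12 = BitVec.ofNat w I.DUM
  nTT : s.get 13 = BitVec.ofNat w (I.n * I.TT)
  GA : s.get 15 = BitVec.ofNat w I.GA
  G : s.get 16 = BitVec.ofNat w (I.GA + I.GB forb)
  RT : s.get 23 = BitVec.ofNat w (2 * I.RR * I.TT)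
  QQ4 : s.get 24 = BitVec.ofNat w (4 * I.QQ)
  ch : s.mem 6 = arr I.ch

theorem Env2.agree {I : Inst w} {forb : Bool} {s s' : State w} {rs as : List ℕ}
    (h : Env2 I forb s) (hA : Agree rs as s s')
    (hr : rs.all (fun r => 14 ≤ r ∧ r ≠ 15 ∧ r ≠ 16 ∧ r ≠ 23 ∧ r ≠ 24) = true)
    (ha : as.all (9 ≤ ·) = true) : Env2 I forb s' := by
  have h1 : ∀ r, ¬ (14 ≤ r ∧ r ≠ 15 ∧ r ≠ 16 ∧ r ≠ 23 ∧ r ≠ 24) → s'.get r = s.get r :=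
    fun r h10 => hA.1 r fun hr' => by
      have := List.all_eq_true.1 hr r hr'
      simp only [decide_eq_true_eq] at this
      exact h10 this
  refine ⟨h.env.agree hA ?_ ?_, (h1 _ (by decide)).trans h.K, (h1 _ (by decide)).trans h.CB,
    (h1 _ (by decide)).trans h.DUM, (h1 _ (by decide)).trans h.nTT, (h1 _ (by decide)).trans h.GA,
    (h1 _ (by decide)).trans h.G, (h1 _ (by decide)).trans h.RT, (h1 _ (by decide)).trans h.QQ4,
    (hA.2 6 fun h' => by simpa using List.all_eq_true.1 ha 6 h').trans h.ch⟩
  · rw [List.all_eq_true] at hr ⊢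
    intro r hr'
    have := hr r hr'
    simp only [decide_eq_true_eq] at this ⊢
    omega
  · rw [List.all_eq_true] at ha ⊢
    intro r hr'
    have := ha r hr'
    simp only [decide_eq_true_eq] at this ⊢
    omega

theorem Ev.docE {s : State w} {I : Inst w} {e : Expr} {i v : ℕ} (h22 : s.get 22 = I.xs i)
    (h24 : s.get 24 = BitVec.ofNat w (4 * I.QQ)) (he : Ev s e v) :
    Ev s (docE e) (if I.xs i = 0 then 4 * I.QQ else v) := by
  have hz : Ev s (.bin .eq (V 22) (.lit 0)) (if I.xs i = 0 then 1 else 0) :=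
    Ev.eq_word h22 rfl
  refine ((he.mul ((Ev.lit 1).sub hz (by split_ifs <;> omega))).add
    ((Ev.var h24).mul hz)).cast ?_
  split_ifs <;> simp

theorem Ev.bucketE {s : State w} {I : Inst w} (h : I.OK) (hE : Env I s) {i : ℕ}
    (h22 : s.get 22 = I.xs i) : Ev s bucketE (I.bk i) := by
  have hhw : I.hh i < 2 ^ w := h.lt_of_le_Z (by have := h.hh_lt i; have := h.SS_le; omega)
  have hQw : I.QQ < 2 ^ w := h.lt_of_le_Z (by have := h.QQ_le; omega)
  exact ((Ev.hash (e := V 22) hE.m hE.k h.k_le h22).div (Ev.var hE.QQ) hhw hQw).add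
    ((Ev.var hE.RR).mul (Ev.sgn (e := V 22) hE.sg h22))

theorem Ev.h2 {s : State w} {I : Inst w} (h : I.OK) (hE : Env I s) {i : ℕ}
    (h22 : s.get 22 = I.xs i) : Ev s (hashE (V 22) % V 3) (I.h2 i) := by
  have hhw : I.hh i < 2 ^ w := h.lt_of_le_Z (by have := h.hh_lt i; have := h.SS_le; omega)
  have hQw : I.QQ < 2 ^ w := h.lt_of_le_Z (by have := h.QQ_le; omega)
  exact (Ev.hash (e := V 22) hE.m hE.k h.k_le h22).mod (Ev.var hE.QQ) hhw hQw

theorem prelude_runs {I : Inst w} (forb : Bool) {s : State w} (hE : Env I s)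
    (hK : s.get 10 = BitVec.ofNat w I.K) (hch : s.mem 6 = arr I.ch) :
    Runs (block (prelude forb)) s 200 fun s' =>
      Agree [11, 12, 13, 14, 15, 16, 23, 24] [] s s' ∧ Env2 I forb s' ∧ s'.get 14 = 0 := by
  refine Runs.block_agree (Agree.refl [11, 12, 13, 14, 15, 16, 23, 24] [] s)
    (by cases forb <;> decide) (by cases forb <;> decide) fun hA => ?_
  refine ⟨hA, ?_⟩
  have hE' := hE.agree hA (by decide) (by decide)
  have hK' := (hA.1 10 (by decide)).trans hK
  have hch' := (hA.2 6 (by decide)).trans hch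
  revert hE' hK' hch'
  clear hA
  unfold prelude
  rw [exec_asg_nat (v := I.CB) ((Ev.lit 1).add ((Ev.var hK).mul ((Ev.lit 2).mul (Ev.var hE.TT)))),
    exec_asg_nat (v := 2 * I.RR * I.TT)
      (((Ev.lit 2).mul (Ev.var (by simpa using hE.RR))).mul (Ev.var (by simpa using hE.TT))),
    exec_asg_nat (v := I.DUM) ((Ev.var (x := I.CB) (by simp)).add
      (Ev.var (x := 2 * I.RR * I.TT) (by simp))),
    exec_asg_nat (v := 4 * I.QQ) ((Ev.lit 4).mul (Ev.var (by simpa using hE.QQ))),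
    exec_asg_nat (v := I.n * I.TT) ((Ev.var (by simpa using hE.n)).mul
      (Ev.var (by simpa using hE.TT))),
    exec_asg_nat (v := I.GA) ((Ev.var (by simpa using hE.n)).mul
      ((Ev.lit 2).mul (Ev.var (by simpa using hE.TT)))),
    exec_asg_nat (v := I.GA + I.GB forb) ((Ev.var (x := I.GA) (by simp)).add (by
      cases forb
      · exact Ev.var (by simp [Inst.GB])
      · exact (Ev.var (x := 4 * I.QQ) (by simp)).mul
          (Ev.var (x := 2 * I.RR * I.TT) (by simp)))),
    exec_asg_nat (Ev.lit 0), exec_nil]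
  intro hE' hK' hch'
  refine ⟨⟨hE', hK', ?_, ?_, ?_, ?_, ?_, ?_, ?_, hch'⟩, ?_⟩ <;> simp

/-- The marks after `j` rounds. -/
structure MarkInv (I : Inst w) (s₀ : State w) (j : ℕ) (s : State w) : Prop where
  agree : Agree [14, 17, 18, 19, 20, 21, 22] [12] s₀ s
  idx : s.get 14 = BitVec.ofNat w j
  mem : s.mem 12 = arr (I.marks j)

theorem Inst.OK.docB_mul_lt {I : Inst w} (h : I.OK) {i β b : ℕ} (hβ : β < I.TT)
    (hb : b < 2 * I.RR * I.TT) : I.docB i β * (2 * I.RR * I.TT) + b < 2 ^ w := by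
  refine h.lt_of_le_Z ?_
  have h1 := mul_add_lt (d := 4 * I.QQ + 1) (Nat.lt_succ_of_le (h.docB_le hβ (i := i))) hb
  have h2 := h.GB_le true
  have h3 := h.RT_le
  simp only [Inst.GB, cond_true] at h2
  rw [Nat.succ_mul] at h1
  linarith

theorem markBody_runs {I : Inst w} (h : I.OK) (forb : Bool) {s₀ : State w} (h0 : Env2 I forb s₀)
    {j : ℕ} (hj : j < I.n * I.TT) {s : State w} (hs : MarkInv I s₀ j s) :
    Runs (block markBody) s 200 (MarkInv I s₀ (j + 1)) := by
  refine Runs.block_agree hs.agree (by decide) (by decide) ?_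
  have hE2 : Env2 I forb s := h0.agree hs.agree (by decide) (by decide)
  have hE := hE2.env
  have hi : j / I.TT < I.n := (Nat.div_lt_iff_lt_mul h.TT_pos).2 hj
  have hβ := Nat.mod_lt j h.TT_pos
  have hZ := h.n_lt_Z
  have hjw : j < 2 ^ w := h.lt_of_le_Z (by
    have := h.GA_le; unfold Inst.GA at this; rw [Nat.mul_left_comm] at this; omega)
  have hTw : I.TT < 2 ^ w := h.lt_of_le_Z (by have := h.TT_le; omega)
  have hiw : j / I.TT < 2 ^ w := h.lt_of_le_Z (by omega)
  have hh := h.h2_lt (j / I.TT)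
  have hidx : I.markIdx j < 2 ^ w := h.docB_mul_lt hβ (h.charB_lt (h.bk_lt _) hβ)
  unfold markBody
  rw [exec_asg_nat ((Ev.var hs.idx).div (Ev.var hE.TT) hjw hTw),
    exec_asg_nat ((Ev.var (by simpa using hs.idx)).mod (Ev.var (by simpa using hE.TT)) hjw hTw),
    exec_asg (v := I.xs (j / I.TT)) (eval_ld_xs (by simpa using hE.xs) (Ev.var (x := j / I.TT) (by simp)) hiw),
    exec_asg_nat (v := I.docB (j / I.TT) (j % I.TT)) (Ev.docE (by simp) (by simpa using hE2.QQ4)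
      (((Ev.var (x := j % I.TT) (by simp)).add ((Ev.lit 2).mul
        (Ev.var (by simpa using hE.QQ)))).sub (Ev.h2 h hE.set.set.set (by simp)) (by omega))),
    exec_sto (i := I.markIdx j) (((Ev.var (x := I.docB (j / I.TT) (j % I.TT)) (by simp)).mul
      (Ev.var (x := 2 * I.RR * I.TT) (by simpa using hE2.RT))).add
        (((Ev.bucketE h hE.set.set.set.set (by simp)).mul (Ev.var (by simpa using hE.TT))).add
          (Ev.var (x := j % I.TT) (by simp)))) (Ev.lit 1),
    exec_asg_nat (v := j + 1) ((Ev.var (by simpa using hs.idx)).add (Ev.lit 1)), exec_nil]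
  intro hA
  refine ⟨hA, by simp, ?_⟩
  simp [hs.mem, update_arr _ _ hidx, I.marks_succ]

theorem while_counter_runs {body : Prog} {a b N c : ℕ} {s : State w} (Inv : ℕ → State w → Prop)
    (hN : N < 2 ^ w) (h0 : Inv 0 s) (ha : ∀ j s, Inv j s → s.get a = BitVec.ofNat w j)
    (hb : ∀ j s, Inv j s → s.get b = BitVec.ofNat w N)
    (hgo : ∀ j < N, ∀ s, Inv j s → Runs body s c (Inv (j + 1))) :
    Runs (whileP (.bin .lt (V a) (V b)) body) s ((c + 11) * N + 9) (Inv N) := by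
  have hcond : ∀ j ≤ N, ∀ s, Inv j s → Ev s (.bin .lt (V a) (V b)) (if j < N then 1 else 0) :=
    fun j hj s hI => Ev.lt (Ev.var (ha j s hI)) (Ev.var (hb j s hI)) (hj.trans_lt hN) hN
  refine Runs.mono (Runs.while Inv N (fun _ => c) h0 (fun s hI => ?_)
    fun j hj s hI => ⟨?_, hgo j hj s hI⟩) ?_ fun _ h => h
  · have := hcond N le_rfl s hI
    rw [if_neg (lt_irrefl _)] at this
    exact this.eq_zero
  · have := hcond j hj.le s hI
    rw [if_pos hj] at this
    exact (this.ne_zero_iff (by omega)).2 one_ne_zero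
  · simp only [Finset.sum_const, Finset.card_range, smul_eq_mul, Expr.cost]
    exact le_of_eq (by ring)

theorem marks_zero (I : Inst w) : I.marks 0 = fun _ => 0 := by
  funext t; simp [Inst.marks]

theorem Inst.OK.nTT_le {I : Inst w} (h : I.OK) : I.n * I.TT ≤ I.Z := by
  have := h.GA_le; unfold Inst.GA at this; rw [Nat.mul_left_comm] at this; omega

theorem markLoop_runs {I : Inst w} (h : I.OK) (forb : Bool) {s : State w}
    (h0 : Env2 I forb s) (h14 : s.get 14 = 0) (h12 : s.mem 12 = fun _ => 0) :
    Runs (markLoop forb) s (300 * (I.n * I.TT) + 20) fun s' =>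
      Agree [14, 17, 18, 19, 20, 21, 22] [12] s s' ∧
        (forb = true → s'.mem 12 = arr (I.marks (I.n * I.TT))) := by
  cases forb
  · refine Runs.mono (Runs.block (Q := fun x => x = s) rfl) ?_ ?_
    · simp [blockCost]
    · rintro _ rfl; exact ⟨Agree.refl _ _ _, by simp⟩
  · refine Runs.mono (while_counter_runs (c := 200) (N := I.n * I.TT) (MarkInv I s)
      (h.lt_of_le_Z (by have := h.nTT_le; omega)) ⟨Agree.refl _ _ _, h14, ?_⟩
      (fun j s hI => hI.idx) (fun j s' hI => (h0.agree hI.agree (by decide) (by decide)).nTT)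
      fun j hj s' hI => markBody_runs h true h0 hj hI) ?_ fun s' hI => ⟨hI.agree, fun _ => hI.mem⟩
    · rw [h12, marks_zero]; rfl
    · nlinarith [Nat.zero_le (I.n * I.TT)]

end WordRAM
end

/-! ### The lists of occurrences, document by document -/

noncomputable section
namespace WordRAM
variable {w : ℕ}

local notation "V" => Expr.var

/-- The lists of occurrences after `g` rounds. -/
structure OccInv (I : Inst w) (forb : Bool) (s₀ : State w) (g : ℕ) (s : State w) : Prop where
  agree : Agree [14, 17, 18, 19, 20, 21, 22] [9, 10, 11] s₀ s
  idx : s.get 14 = BitVec.ofNat w g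
  m9 : s.mem 9 = arr (last (I.ukey forb) g)
  m10 : s.mem 10 = arr (link (I.ukey forb) g)
  m11 : s.mem 11 = arr fun i => if i < g then I.uchr forb i else 0

theorem occA_runs {I : Inst w} (h : I.OK) (forb : Bool) {s : State w} (hE2 : Env2 I forb s) {g : ℕ}
    (hg : g < I.GA) (h14 : s.get 14 = BitVec.ofNat w g) :
    Runs (block occA) s 200 fun s' => Agree [17, 18, 19, 20, 21, 22] [] s s' ∧
      s'.get 20 = BitVec.ofNat w (I.ukey forb g) ∧ s'.get 21 = BitVec.ofNat w (I.uchr forb g) := by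
  refine Runs.block_agree (Agree.refl [17, 18, 19, 20, 21, 22] [] s) (by decide) (by decide) ?_
  have hE := hE2.env
  have hT : 0 < 2 * I.TT := by have := h.TT_pos; omega
  have hi : g / (2 * I.TT) < I.n := (Nat.div_lt_iff_lt_mul hT).2 hg
  have hβ := Nat.mod_lt g hT
  have hZ := h.n_lt_Z
  have hgw : g < 2 ^ w := h.lt_of_le_Z (by have := h.GA_le; omega)
  have hTw : 2 * I.TT < 2 ^ w := h.lt_of_le_Z (by have := h.TT_le; omega)
  have hiw : g / (2 * I.TT) < 2 ^ w := h.lt_of_le_Z (by omega)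
  have hh := h.h2_lt (g / (2 * I.TT))
  have hs1 : g % (2 * I.TT) * I.TT ≤ 2 * I.QQ := by
    unfold Inst.QQ; rw [← Nat.mul_assoc]; gcongr
  unfold occA
  rw [exec_asg_nat ((Ev.var h14).div ((Ev.lit 2).mul (Ev.var hE.TT)) hgw hTw),
    exec_asg_nat ((Ev.var (by simpa using h14)).mod
      ((Ev.lit 2).mul (Ev.var (by simpa using hE.TT))) hgw hTw),
    exec_asg (v := I.xs (g / (2 * I.TT))) (eval_ld_xs (by simpa using hE.xs)
      (Ev.var (x := g / (2 * I.TT)) (by simp)) hiw),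
    exec_asg_nat (v := I.docA (g / (2 * I.TT)) (g % (2 * I.TT)))
      (Ev.docE (by simp) (by simpa using hE2.QQ4)
        (((Ev.h2 h hE.set.set.set (by simp)).add ((Ev.lit 2).mul (Ev.var (by simpa using hE.QQ)))).sub
          ((Ev.var (x := g % (2 * I.TT)) (by simp)).mul (Ev.var (by simpa using hE.TT))) (by omega))),
    exec_asg_nat (v := 1 + I.ch (g / (2 * I.TT)) * (2 * I.TT) + g % (2 * I.TT))
      (((Ev.lit 1).add ((Ev.ld (by simpa using hE2.ch) (Ev.var (x := g / (2 * I.TT)) (by simp)) hiw).mul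
        ((Ev.lit 2).mul (Ev.var (by simpa using hE.TT))))).add (Ev.var (by simp))), exec_nil]
  intro hA
  refine ⟨hA, ?_⟩
  simp [Inst.ukey, Inst.uchr, hg]

theorem occB_runs {I : Inst w} (h : I.OK) (forb : Bool) {s : State w} (hE2 : Env2 I forb s) {g : ℕ}
    (hm : forb = true → s.mem 12 = arr (I.marks (I.n * I.TT)))
    (hg : I.GA ≤ g) (hg' : g < I.GA + I.GB forb) (h14 : s.get 14 = BitVec.ofNat w g) :
    Runs (block (occB forb)) s 200 fun s' => Agree [17, 18, 19, 20, 21, 22] [] s s' ∧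
      s'.get 20 = BitVec.ofNat w (I.ukey forb g) ∧ s'.get 21 = BitVec.ofNat w (I.uchr forb g) := by
  refine Runs.block_agree (Agree.refl [17, 18, 19, 20, 21, 22] [] s) (by cases forb <;> decide)
    (by cases forb <;> decide) ?_
  have hE := hE2.env
  have hZ := h.n_lt_Z
  obtain ⟨t, rfl⟩ := Nat.exists_eq_add_of_le hg
  have ht : t < I.GB forb := by omega
  have htw : t < 2 ^ w := h.lt_of_le_Z (by have := h.GB_le forb; omega)
  have hnot : ¬ (I.GA + t < I.GA) := by omega
  have hk : I.ukey forb (I.GA + t) = I.keyB forb t := by simp [Inst.ukey]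
  have hc : I.uchr forb (I.GA + t) = I.chrB forb t := by simp [Inst.uchr]
  rw [hk, hc]
  have hsub : Ev s (V 14 - V 15) t :=
    ((Ev.var h14).sub (Ev.var hE2.GA) (by omega)).cast (by omega)
  cases forb
  · simp only [Inst.GB, cond_false] at ht
    have hi : t / I.TT < I.n := (Nat.div_lt_iff_lt_mul h.TT_pos).2 ht
    have hβ := Nat.mod_lt t h.TT_pos
    have hTw : I.TT < 2 ^ w := h.lt_of_le_Z (by have := h.TT_le; omega)
    have hiw : t / I.TT < 2 ^ w := h.lt_of_le_Z (by omega)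
    have hh := h.h2_lt (t / I.TT)
    unfold occB
    rw [exec_asg_nat hsub, exec_asg_nat ((Ev.var (x := t) (by simp)).div
        (Ev.var (by simpa using hE.TT)) htw hTw),
      exec_asg_nat ((Ev.var (x := t) (by simp)).mod (Ev.var (by simpa using hE.TT)) htw hTw),
      exec_asg (v := I.xs (t / I.TT)) (eval_ld_xs (by simpa using hE.xs)
        (Ev.var (x := t / I.TT) (by simp)) hiw),
      exec_asg_nat (v := I.docB (t / I.TT) (t % I.TT)) (Ev.docE (by simp) (by simpa using hE2.QQ4)
        (((Ev.var (x := t % I.TT) (by simp)).add ((Ev.lit 2).mul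
          (Ev.var (by simpa using hE.QQ)))).sub (Ev.h2 h hE.set.set.set.set (by simp)) (by omega))),
      exec_asg_nat (v := I.chrB false t) ((Ev.var (by simpa using hE2.CB)).add
        (((Ev.bucketE h hE.set.set.set.set.set (by simp)).mul (Ev.var (by simpa using hE.TT))).add
          (Ev.var (x := t % I.TT) (by simp)))), exec_nil]
    intro hA
    exact ⟨hA, by simp [Inst.keyB], by simp⟩
  · simp only [Inst.GB, cond_true] at ht
    have hRw : 2 * I.RR * I.TT < 2 ^ w := h.lt_of_le_Z (by have := h.RT_le; omega)
    have hmw : I.marks (I.n * I.TT) t < 2 ^ w := h.lt_of_le_Z (by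
      unfold Inst.marks; split_ifs <;> omega)
    have h0w : 0 < 2 ^ w := by positivity
    unfold occB
    rw [exec_asg_nat hsub,
      exec_asg_nat (Ev.eq (Ev.ld (by simpa using hm rfl) (Ev.var (x := t) (by simp)) htw)
        (Ev.lit 0) hmw h0w),
      exec_asg_nat (v := I.keyB true t) (Ev.cast (((Ev.var (x := t) (by simp)).div
          (Ev.var (by simpa using hE2.RT)) htw hRw |>.mul
            (Ev.var (x := if I.marks (I.n * I.TT) t = 0 then 1 else 0) (by simp))).add
          ((Ev.var (by simpa using hE2.QQ4)).mul ((Ev.lit 1).sub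
            (Ev.var (x := if I.marks (I.n * I.TT) t = 0 then 1 else 0) (by simp))
            (by split_ifs <;> omega)))) (by
              simp only [Inst.keyB, cond_true]
              split_ifs <;> simp)),
      exec_asg_nat (v := I.chrB true t) ((Ev.var (by simpa using hE2.CB)).add
        ((Ev.var (x := t) (by simp)).mod (Ev.var (by simpa using hE2.RT)) htw hRw)), exec_nil]
    intro hA
    exact ⟨hA, by simp, by simp⟩

theorem pushBody_runs {I : Inst w} (h : I.OK) (forb : Bool) {s₀ : State w}
    (h0 : Env2 I forb s₀) (hm : forb = true → s₀.mem 12 = arr (I.marks (I.n * I.TT))) {g : ℕ}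
    (hg : g < I.GA + I.GB forb) {s : State w} (hs : OccInv I forb s₀ g s) :
    Runs (pushBody forb) s 320 (OccInv I forb s₀ (g + 1)) := by
  have hE2 : Env2 I forb s := h0.agree hs.agree (by decide) (by decide)
  have hZ := h.n_lt_Z
  have hgw : g < 2 ^ w := h.lt_of_le_Z (by have := h.GA_le; have := h.GB_le forb; omega)
  have hGw : I.GA < 2 ^ w := h.lt_of_le_Z (by have := h.GA_le; omega)
  have hkw : I.ukey forb g < 2 ^ w := h.lt_of_le_Z (by
    have := h.ukey_le forb hg; have := h.QQ_le; omega)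
  have hcond := Ev.lt (Ev.var hs.idx) (Ev.var hE2.GA) hgw hGw
  refine Runs.mono (Runs.seq (k₁ := (Expr.bin .lt (V 14) (V 15)).cost + 200 + 4) (k₂ := 60)
    (Q := fun s' => Agree [17, 18, 19, 20, 21, 22] [] s s' ∧
      s'.get 20 = BitVec.ofNat w (I.ukey forb g) ∧ s'.get 21 = BitVec.ofNat w (I.uchr forb g))
    (Runs.ifP (fun hne => ?_) fun he => ?_) ?_) (by decide) fun _ h => h
  · refine occA_runs h forb hE2 ?_ hs.idx
    by_contra hcon
    rw [if_neg hcon] at hcond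
    exact hne hcond.eq_zero
  · refine occB_runs h forb hE2 ?_ ?_ hg hs.idx
    · intro hf; rw [hs.agree.2 12 (by decide), hm hf]
    · by_contra hcon
      rw [if_pos (not_le.1 hcon)] at hcond
      exact (hcond.ne_zero_iff (h.lt_of_le_Z (by omega))).2 one_ne_zero he
  rintro s' ⟨hA, h20, h21⟩
  have h14 := (hA.1 14 (by decide)).trans hs.idx
  have m9 := (hA.2 9 (by decide)).trans hs.m9
  have m10 := (hA.2 10 (by decide)).trans hs.m10
  have m11 := (hA.2 11 (by decide)).trans hs.m11
  refine Runs.block_agree (hs.agree.trans (hA.mono (rs' := [14, 17, 18, 19, 20, 21, 22])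
    (as' := [9, 10, 11]) (by decide) (by decide))) (by decide) (by decide) ?_
  rw [exec_sto (Ev.var h14) (Ev.ld m9 (Ev.var h20) hkw),
    exec_sto (Ev.var (by simpa using h20)) ((Ev.var (by simpa using h14)).add (Ev.lit 1)),
    exec_sto (Ev.var (by simpa using h14)) (Ev.var (by simpa using h21)),
    exec_asg_nat ((Ev.var (by simpa using h14)).add (Ev.lit 1)), exec_nil]
  intro hB
  refine ⟨hB, by simp, ?_, ?_, ?_⟩
  · simp [m9, update_arr _ _ hkw, last_succ]
  · simp [m10, update_arr _ _ hgw, link_succ]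
  · simp only [State.mem_setMem, State.mem_set, Nat.reduceEqDiff, if_true, if_false, m11,
      update_arr _ _ hgw]
    congr 1
    funext i
    rw [Function.update_apply]
    split_ifs <;> first | rfl | omega | (congr 1; omega)

/-- What is known when the occurrences have been collected. -/
structure OccDone (I : Inst w) (forb : Bool) (s₀ s : State w) : Prop where
  agree : Agree [11, 12, 13, 14, 15, 16, 17, 18, 19, 20, 21, 22, 23, 24] [9, 10, 11, 12] s₀ s
  env : Env2 I forb s
  m9 : s.mem 9 = arr (last (I.ukey forb) (I.GA + I.GB forb))
  m10 : s.mem 10 = arr (link (I.ukey forb) (I.GA + I.GB forb))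
  m11 : s.mem 11 = arr fun i => if i < I.GA + I.GB forb then I.uchr forb i else 0

theorem occLoop_runs {I : Inst w} (h : I.OK) (forb : Bool) {s : State w} (hE : Env I s)
    (hK : s.get 10 = BitVec.ofNat w I.K) (hch : s.mem 6 = arr I.ch)
    (hm : ∀ a, 9 ≤ a → a ≤ 12 → s.mem a = fun _ => 0) :
    Runs (occLoop forb) s (700 * (I.GA + I.GB forb) + 400) (OccDone I forb s) := by
  -- Marking takes `n * TT` rounds, half of `GA`, so it is absorbed by the cost of collecting the
  -- occurrences.
  have hGA : 300 * (I.n * I.TT) + 331 * (I.GA + I.GB forb) ≤ 700 * (I.GA + I.GB forb) := by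
    unfold Inst.GA; nlinarith [Nat.zero_le (I.n * I.TT), Nat.zero_le (I.GB forb)]
  have hGw : I.GA + I.GB forb < 2 ^ w := h.lt_of_le_Z (by
    have := h.GA_le; have := h.GB_le forb; have := h.n_lt_Z; omega)
  refine Runs.mono (Runs.seq (k₂ := (300 * (I.n * I.TT) + 20) + (20 + (331 * (I.GA + I.GB forb) + 9)
    + 1) + 1) (prelude_runs forb hE hK hch) ?_) (by omega) fun _ h => h
  rintro s1 ⟨hA1, hE1, h14⟩
  refine Runs.seq (markLoop_runs h forb hE1 h14 ?_) ?_
  · rw [hA1.2 _ (by decide), hm 12 (by norm_num) (by norm_num)]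
  rintro s2 ⟨hA2, hmk⟩
  have hE2 := hE1.agree hA2 (by decide) (by decide)
  refine Runs.seq (Q := fun s3 => Agree [14] [] s2 s3 ∧ s3.get 14 = 0)
    (Runs.block_agree (Agree.refl [14] [] s2) (by decide) (by decide) fun hA => ⟨hA, ?_⟩) ?_
  · rw [exec_asg_nat (Ev.lit 0), exec_nil]; simp
  rintro s3 ⟨hA3, h14'⟩
  have hE3 := hE2.agree hA3 (by decide) (by decide)
  have hz : ∀ a, 9 ≤ a → a ≤ 11 → s3.mem a = fun _ => 0 := by
    intro a h1 h2
    rw [hA3.2 _ (by simp), hA2.2 _ (by simp; omega), hA1.2 _ (by simp), hm a h1 (by omega)]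
  refine Runs.mono (while_counter_runs (c := 320) (N := I.GA + I.GB forb) (OccInv I forb s3) hGw
    ⟨Agree.refl _ _ _, h14', ?_, ?_, ?_⟩ (fun j s hI => hI.idx)
    (fun j s hI => (hE3.agree hI.agree (by decide) (by decide)).G)
    fun j hj s hI => pushBody_runs h forb hE3 (fun hf => ?_) hj hI) le_rfl fun s4 hI => ⟨?_, ?_,
      hI.m9, hI.m10, hI.m11⟩
  · rw [hz 9 (by norm_num) (by norm_num)]; rfl
  · rw [hz 10 (by norm_num) (by norm_num)]; rfl
  · rw [hz 11 (by norm_num) (by norm_num)]; rfl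
  · rw [hA3.2 _ (by decide), hmk hf]
  · exact ((hA1.mono (by decide) (by decide)).trans (hA2.mono (by decide) (by decide))).trans
      ((hA3.mono (by decide) (by decide)).trans (hI.agree.mono (by decide) (by decide)))
  · exact hE3.agree hI.agree (by decide) (by decide)

end WordRAM
end

noncomputable section
namespace WordRAM
variable {w : ℕ}

/-! ### Writing the documents -/

local notation "V" => Expr.var

/-- The contents of an array that begins with `l`. -/
def lst (l : List ℕ) : ℕ → ℕ := fun p => l.getD p 0

theorem lst_concat (l : List ℕ) (v : ℕ) : lst (l ++ [v]) = Function.update (lst l) l.length v := by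
  funext p
  rw [Function.update_apply]
  unfold lst
  rcases lt_trichotomy p l.length with hp | rfl | hp
  · rw [if_neg hp.ne, List.getD_append _ _ _ _ hp]
  · rw [if_pos rfl, List.getD_append_right _ _ _ _ le_rfl]; simp
  · rw [if_neg hp.ne', List.getD_append_right _ _ _ _ hp.le, List.getD_eq_default _ _ hp.le,
      List.getD_eq_default]
    simp; omega

/-- Unwritten cells hold 0, so the leading zeros of the documents and the padding document are part
of the text without being stored. -/
theorem lst_append_replicate (l : List ℕ) (m : ℕ) : lst (l ++ List.replicate m 0) = lst l := by
  funext p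
  unfold lst
  rcases lt_or_ge p l.length with hp | hp
  · rw [List.getD_append _ _ _ _ hp]
  · rw [List.getD_append_right _ _ _ _ hp, List.getD_eq_default _ _ hp]
    rcases lt_or_ge (p - l.length) m with h | h
    · rw [List.getD_replicate _ h]
    · rw [List.getD_eq_default]; simpa using h

theorem arr_lst (l : List ℕ) :
    (arr (lst l) : BitVec w → BitVec w) = fun i => (words w l).getD i.toNat 0 := by
  funext i
  simp only [arr, lst, words]
  exact (List.getD_map l 0 (BitVec.ofNat w) (n := i.toNat)).symm

theorem ptr_drop {l : List ℕ} {j : ℕ} (hj : j < l.length) : ptr (l.drop j) = l[j] + 1 := by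
  rw [List.drop_eq_getElem_cons hj]; rfl

namespace Inst

variable (I : Inst w) (forb : Bool)

def text (u : ℕ) : List ℕ := ((List.range u).map (I.doc forb)).flatten

def offs (u : ℕ) : List ℕ := (List.range u).map fun i => (I.text forb i).length

theorem text_succ (u : ℕ) : I.text forb (u + 1) = I.text forb u ++ I.doc forb u := by
  simp [text, List.range_succ]

theorem offs_succ (u : ℕ) : I.offs forb (u + 1) = I.offs forb u ++ [(I.text forb u).length] := by
  simp [offs, List.range_succ]

theorem offs_length (u : ℕ) : (I.offs forb u).length = u := by simp [offs]

theorem text_length_mono {u v : ℕ} (h : u ≤ v) :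
    (I.text forb u).length ≤ (I.text forb v).length := by
  induction v, h using Nat.le_induction with
  | base => exact le_rfl
  | succ v _ ih => rw [text_succ, List.length_append]; omega

theorem docs_flatten : (I.docs forb).flatten =
    I.text forb (4 * I.QQ) ++ List.replicate (I.DUM + 1) 0 := by
  simp [docs, text]

theorem docs_length : (I.docs forb).length = 4 * I.QQ + 1 := by simp [docs]

theorem totalLength_eq (X : List Str) : totalLength X = X.flatten.length := by
  simp [totalLength]

theorem totalLength_docs : totalLength (I.docs forb) =
    (I.text forb (4 * I.QQ)).length + (I.DUM + 1) := by
  rw [totalLength_eq, docs_flatten]; simp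

theorem totalLength_take {u : ℕ} (hu : u ≤ 4 * I.QQ) :
    totalLength ((I.docs forb).take u) = (I.text forb u).length := by
  rw [totalLength_eq, docs, List.take_append_of_le_length (by simpa using hu), ← List.map_take,
    List.take_range, min_eq_left hu]
  rfl

theorem offsets_docs : offsets (I.docs forb) =
    I.offs forb (4 * I.QQ) ++ [(I.text forb (4 * I.QQ)).length] ++ [totalLength (I.docs forb)] := by
  unfold offsets
  rw [docs_length, List.range_succ, List.map_append, List.map_singleton, ← I.offs_succ]
  congr 1
  · refine List.map_congr_left fun u hu => ?_
    exact I.totalLength_take forb (by have := List.mem_range.1 hu; omega)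
  · rw [List.take_of_length_le (by rw [docs_length])]

end Inst

def emitChain : Prog :=
  whileP (V 19) (block [.sto 20 (V 18) (.ld 11 (V 19 - .lit 1)), .asg 18 (V 18 + .lit 1),
    .asg 19 (.ld 10 (V 19 - .lit 1))])

def emitBody : Prog :=
  .seq (block [.sto 21 (V 17) (V 18), .asg 18 (V 18 + .lit 1), .asg 19 (.ld 9 (V 17))])
    (.seq emitChain (block [.asg 17 (V 17 + .lit 1)]))

/-- The output is placed where the embedded preprocessing expects its input: arrays 20 and 21 are
its arrays 0 and 1, variables 40 and 41 are its registers 0 and 1. -/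
def emitLoop : Prog :=
  .seq (block [.asg 17 (.lit 0), .asg 18 (.lit 0)])
    (.seq (whileP (.bin .lt (V 17) (V 24)) emitBody)
      (block [.sto 21 (V 24) (V 18), .asg 18 (V 18 + V 12 + .lit 1), .sto 21 (V 24 + .lit 1) (V 18),
        .asg 40 (V 24 + .lit 1), .asg 41 (V 18)]))

/-- The lists of occurrences are stored, and the documents before `u` have been written. -/
structure EmitInv (I : Inst w) (forb : Bool) (s₀ : State w) (u : ℕ) (s : State w) : Prop where
  agree : Agree [17, 18, 19] [20, 21] s₀ s
  idx : s.get 17 = BitVec.ofNat w u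
  pos : s.get 18 = BitVec.ofNat w (I.text forb u).length
  m20 : s.mem 20 = arr (lst (I.text forb u))
  m21 : s.mem 21 = arr (lst (I.offs forb u))

/-- The state while the occurrences in the document `u` are written. -/
structure EmitInv2 (I : Inst w) (forb : Bool) (s₀ : State w) (u j : ℕ) (s : State w) : Prop where
  agree : Agree [17, 18, 19] [20, 21] s₀ s
  idx : s.get 17 = BitVec.ofNat w u
  ptr : s.get 19 = BitVec.ofNat w
    (ptr ((chain (I.ukey forb) (I.GA + I.GB forb) u).drop j))
  pos : s.get 18 = BitVec.ofNat w ((I.text forb u).length + 1 + j)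
  m20 : s.mem 20 = arr (lst (I.text forb u ++
    0 :: ((chain (I.ukey forb) (I.GA + I.GB forb) u).take j).map (I.uchr forb)))
  m21 : s.mem 21 = arr (lst (I.offs forb (u + 1)))

theorem emitChain_runs {I : Inst w} (h : I.OK) (forb : Bool) {s₀ : State w}
    (m10 : s₀.mem 10 = arr (link (I.ukey forb) (I.GA + I.GB forb)))
    (m11 : s₀.mem 11 = arr fun i => if i < I.GA + I.GB forb then I.uchr forb i else 0)
    {u : ℕ} (hu : u < 4 * I.QQ) {s : State w} (hs : EmitInv2 I forb s₀ u 0 s) :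
    Runs emitChain s (70 * (chain (I.ukey forb) (I.GA + I.GB forb) u).length + 10)
      (EmitInv2 I forb s₀ u (chain (I.ukey forb) (I.GA + I.GB forb) u).length) := by
  set l := chain (I.ukey forb) (I.GA + I.GB forb) u with hl
  have hGw : I.GA + I.GB forb < 2 ^ w := h.lt_of_le_Z (by
    have := h.GA_le; have := h.GB_le forb; have := h.n_lt_Z; omega)
  have hdoc : (I.text forb u).length + 1 + l.length ≤ totalLength (I.docs forb) := by
    have h1 := I.text_length_mono forb (Nat.succ_le_of_lt hu)
    have h2 := I.totalLength_docs forb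
    rw [Nat.succ_eq_add_one, I.text_succ] at h1
    simp only [List.length_append, Inst.doc, List.length_cons, List.length_map, ← hl] at h1
    omega
  refine Runs.mono (Runs.while (EmitInv2 I forb s₀ u) l.length (fun _ => 60) hs (fun s hI => ?_)
    fun j hj s hI => ?_) ?_ fun _ h => h
  · have := hI.ptr
    rw [← hl, List.drop_length] at this
    exact this
  · have hp := hI.ptr
    rw [← hl, ptr_drop hj] at hp
    have hlt : l[j] < I.GA + I.GB forb := (mem_chain.1 (List.getElem_mem hj)).1
    have hpw : l[j] < 2 ^ w := hlt.trans hGw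
    have hposw : (I.text forb u).length + 1 + j < 2 ^ w := h.lt_of_le_Z (by
      have := h.totalLength_le_Z forb; omega)
    have hE : Ev s (V 19) (l[j] + 1) := Ev.var hp
    refine ⟨(hE.ne_zero_iff (by omega)).2 (by omega), ?_⟩
    refine Runs.block_agree hI.agree (by decide) (by decide) ?_
    have hm10 := (hI.agree.2 10 (by decide)).trans m10
    have hm11 := (hI.agree.2 11 (by decide)).trans m11
    rw [exec_sto (i := (I.text forb u).length + 1 + j) (v := I.uchr forb l[j]) (Ev.var hI.pos)
        ((Ev.ld hm11 ((hE.sub (Ev.lit 1) (by omega)).cast (Nat.add_sub_cancel _ _)) hpw).cast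
          (if_pos hlt)),
      exec_asg_nat (v := (I.text forb u).length + 1 + (j + 1))
        ((Ev.var (x := (I.text forb u).length + 1 + j) (by simpa using hI.pos)).add (Ev.lit 1)),
      exec_asg_nat (Ev.ld (by simpa using hm10) (((Ev.var (x := l[j] + 1) (by simpa using hp)).sub
        (Ev.lit 1) (by omega)).cast (Nat.add_sub_cancel _ _)) hpw), exec_nil]
    intro hA
    refine ⟨hA, by simpa using hI.idx, ?_, by simp, ?_, by simpa using hI.m21⟩
    · have := link_drop (key := I.ukey forb) (m := I.GA + I.GB forb) (k := u) hj
      simp only [State.get_set, if_true]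
      rw [← this]
    · have h1 := hI.m20
      rw [← hl] at h1
      simp only [State.mem_set, State.mem_setMem, if_true]
      rw [h1, update_arr _ _ hposw, ← hl, ← List.take_concat_get' _ _ hj, List.map_append,
        ← List.cons_append, ← List.append_assoc, List.map_singleton, lst_concat]
      congr 2
      simp only [List.length_append, List.length_cons, List.length_map, List.length_take]
      rw [min_eq_left hj.le]; omega
  · simp only [Finset.sum_const, Finset.card_range, smul_eq_mul, Expr.cost]
    omega

theorem emitBody_runs {I : Inst w} (h : I.OK) (forb : Bool) {s₀ : State w}
    (m9 : s₀.mem 9 = arr (last (I.ukey forb) (I.GA + I.GB forb)))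
    (m10 : s₀.mem 10 = arr (link (I.ukey forb) (I.GA + I.GB forb)))
    (m11 : s₀.mem 11 = arr fun i => if i < I.GA + I.GB forb then I.uchr forb i else 0)
    {u : ℕ} (hu : u < 4 * I.QQ) {s : State w} (hs : EmitInv I forb s₀ u s) :
    Runs emitBody s (70 * (chain (I.ukey forb) (I.GA + I.GB forb) u).length + 100)
      (EmitInv I forb s₀ (u + 1)) := by
  have huw : u < 2 ^ w := h.lt_of_le_Z (by have := h.QQ_le; omega)
  refine Runs.mono (Runs.seq (k₁ := 50)
    (k₂ := 70 * (chain (I.ukey forb) (I.GA + I.GB forb) u).length + 10 + 20 + 1)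
    (Q := EmitInv2 I forb s₀ u 0) ?_ fun s' hs' =>
    Runs.seq (emitChain_runs h forb m10 m11 hu hs') fun s'' hs'' => ?_) (by omega) fun _ h => h
  · refine Runs.block_agree hs.agree (by decide) (by decide) ?_
    rw [exec_sto (Ev.var hs.idx) (Ev.var hs.pos),
      exec_asg_nat ((Ev.var (by simpa using hs.pos)).add (Ev.lit 1)),
      exec_asg_nat (Ev.ld (g := last (I.ukey forb) (I.GA + I.GB forb))
        (by simpa using (hs.agree.2 9 (by decide)).trans m9)
        (Ev.var (by simpa using hs.idx)) huw), exec_nil]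
    intro hA
    refine ⟨hA, by simpa using hs.idx, ?_, by simp, ?_, ?_⟩
    · simp [last_eq_ptr]
    · simp only [State.mem_set, State.mem_setMem, List.take_zero, List.map_nil]
      rw [if_neg (by decide), hs.m20]
      exact congrArg arr (lst_append_replicate _ 1).symm
    · simp only [State.mem_set, State.mem_setMem, if_true]
      rw [hs.m21, update_arr _ _ huw, I.offs_succ, lst_concat, I.offs_length]
  · refine Runs.block_agree hs''.agree (by decide) (by decide) ?_
    rw [exec_asg_nat ((Ev.var hs''.idx).add (Ev.lit 1)), exec_nil]
    intro hA
    refine ⟨hA, by simp, ?_, ?_, by simpa using hs''.m21⟩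
    · have := hs''.pos
      simp only [State.get_set]
      rw [if_neg (by decide), this, I.text_succ]
      simp only [List.length_append, Inst.doc, List.length_cons, List.length_map]
      congr 1; omega
    · have := hs''.m20
      rw [List.take_length] at this
      rw [State.mem_set, this, I.text_succ]; rfl

theorem emitLoop_runs {I : Inst w} (h : I.OK) (forb : Bool) {s : State w} (hE : Env2 I forb s)
    (m9 : s.mem 9 = arr (last (I.ukey forb) (I.GA + I.GB forb)))
    (m10 : s.mem 10 = arr (link (I.ukey forb) (I.GA + I.GB forb)))
    (m11 : s.mem 11 = arr fun i => if i < I.GA + I.GB forb then I.uchr forb i else 0)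
    (hin : s.inner = State.zero w) :
    Runs emitLoop s (70 * (I.GA + I.GB forb) + 120 * (4 * I.QQ) + 200) fun s' =>
      Agree [17, 18, 19, 40, 41] [20, 21] s s' ∧ s'.inner = docsInput w (I.docs forb) := by
  have hQw : 4 * I.QQ + 1 < 2 ^ w := h.lt_of_le_Z (by
    have := h.QQ_le; have := h.n_lt_Z; omega)
  have hcond : ∀ j ≤ 4 * I.QQ, ∀ s', EmitInv I forb s j s' →
      Ev s' (.bin .lt (V 17) (V 24)) (if j < 4 * I.QQ then 1 else 0) := fun j hj s' hI =>
    Ev.lt (Ev.var hI.idx) (Ev.var ((hI.agree.1 24 (by decide)).trans hE.QQ4)) (by omega)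
      (by omega)
  have z20 : s.mem 20 = fun _ => 0 := congrFun (congrArg State.mem hin) 0
  have z21 : s.mem 21 = fun _ => 0 := congrFun (congrArg State.mem hin) 1
  have hsum := Inst.OK.sum_chain_length_le (I.ukey forb) (I.GA + I.GB forb) (4 * I.QQ)
  refine Runs.mono (Runs.seq (k₁ := 20) (k₂ := 70 * (I.GA + I.GB forb) + 111 * (4 * I.QQ) + 9 +
    100 + 1) (Q := EmitInv I forb s 0) ?_ fun s1 h1 => Runs.seq (k₁ := 70 * (I.GA + I.GB forb) + 111 * (4 * I.QQ) + 9) (k₂ := 100)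
      (Q := EmitInv I forb s (4 * I.QQ))
      (Runs.mono (Runs.while (EmitInv I forb s) (4 * I.QQ) (fun u =>
        70 * (chain (I.ukey forb) (I.GA + I.GB forb) u).length + 100) h1 (fun s' hI => ?_)
          fun j hj s' hI => ⟨?_, emitBody_runs h forb m9 m10 m11 hj hI⟩) ?_ fun _ h => h)
      fun s2 h2 => ?_) (by omega) fun _ h => h
  · refine Runs.block_agree (Agree.refl [17, 18, 19] [20, 21] s) (by decide) (by decide) ?_
    rw [exec_asg_nat (Ev.lit 0), exec_asg_nat (Ev.lit 0), exec_nil]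
    intro hA
    refine ⟨hA, by simp, by simp [Inst.text], ?_, ?_⟩
    · simp only [State.mem_set, z20, Inst.text]; rfl
    · simp only [State.mem_set, z21, Inst.offs]; rfl
  · have := hcond _ le_rfl s' hI
    rw [if_neg (lt_irrefl _)] at this
    exact this.eq_zero
  · have := hcond j hj.le s' hI
    rw [if_pos hj] at this
    exact (this.ne_zero_iff (by omega)).2 one_ne_zero
  · simp only [Finset.sum_add_distrib, ← Finset.mul_sum, Finset.sum_const, Finset.card_range,
      smul_eq_mul, Expr.cost]
    omega
  · have h24 := (h2.agree.1 24 (by decide)).trans hE.QQ4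
    have h12 := (h2.agree.1 12 (by decide)).trans hE.DUM
    refine Runs.block_agree (h2.agree.mono (rs' := [17, 18, 19, 40, 41]) (as' := [20, 21])
      (by decide) (by decide)) (by decide) (by decide) ?_
    rw [exec_sto (Ev.var h24) (Ev.var h2.pos),
      exec_asg_nat (v := totalLength (I.docs forb)) (Ev.cast (((Ev.var (by simpa using h2.pos)).add
        (Ev.var (by simpa using h12))).add (Ev.lit 1)) (I.totalLength_docs forb).symm),
      exec_sto ((Ev.var (by simpa using h24)).add (Ev.lit 1))
        (Ev.var (x := totalLength (I.docs forb)) (by simp)),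
      exec_asg_nat (v := 4 * I.QQ + 1) ((Ev.var (by simpa using h24)).add (Ev.lit 1)),
      exec_asg_nat (Ev.var (x := totalLength (I.docs forb)) (by simp)), exec_nil]
    intro hA
    refine ⟨hA, ?_⟩
    refine State.ext' (fun r => ?_) (funext fun a => ?_)
    · have hz : ∀ r, s.get (r + 40) = 0 := fun r => congrFun (congrArg State.reg hin) r
      rcases r with _ | _ | r
      · simp [State.inner, docsInput, State.setReg_reg, I.docs_length]
      · simp [State.inner, docsInput, State.setReg_reg]
      · have h1 := hA.1 (r + 2 + 40) (by simp)
        rw [hz] at h1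
        refine Eq.trans h1 ?_
        simp [docsInput, State.setReg_reg, State.writeArr, State.zero]
    · have hz : ∀ a, s.mem (a + 20) = fun _ => 0 := fun a => congrFun (congrArg State.mem hin) a
      rcases a with _ | _ | a
      · have : (docsInput w (I.docs forb)).mem 0 = arr (lst (I.docs forb).flatten) := by
          rw [arr_lst]
          simp [docsInput, State.writeArr, State.zero]
        rw [this, I.docs_flatten, lst_append_replicate]
        simp [State.inner, h2.m20]
      · have : (docsInput w (I.docs forb)).mem 1 = arr (lst (offsets (I.docs forb))) := by
          rw [arr_lst]
          simp [docsInput, State.writeArr, State.zero]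
        rw [this, I.offsets_docs, lst_concat, lst_concat, ← update_arr _ _ (by
          simp [I.offs_length]; omega), ← update_arr _ _ (by simp [I.offs_length]; omega)]
        simp [State.inner, h2.m21, I.offs_length]
      · have h1 := hA.2 (a + 2 + 20) (by simp)
        rw [hz] at h1
        refine Eq.trans h1 ?_
        simp [docsInput, State.writeArr, State.zero]

end WordRAM
end

noncomputable section
namespace WordRAM
set_option linter.unusedSectionVars false
variable {w : ℕ}

/-! ### The queries -/

theorem sum_range_mul (a b : ℕ) (f : ℕ → ℕ) :
    ∑ q ∈ Finset.range (a * b), f q =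
      ∑ i ∈ Finset.range a, ∑ j ∈ Finset.range b, f (i * b + j) := by
  induction a with
  | zero => simp
  | succ a ih => rw [Nat.succ_mul, Finset.sum_range_add, ih, Finset.sum_range_succ]

namespace Inst

variable (I : Inst w) (rep : Bool)

/-- The number of queries. -/
def nq : ℕ := I.n * (I.K * 8)

/-- The index `q` codes the number z, a chunk, and three bits: the carry of the hash function (`q %
2`), the carry of the low digits (`q / 2 % 2`), and the guessed sign of y (`q % 8 / 4`). -/
def zi (q : ℕ) : ℕ := q / (I.K * 8)
def qκ (q : ℕ) : ℕ := q / 8 % I.K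

/-- The sum of the hash values, if the carry is `q % 2`. -/
def qv (q : ℕ) : ℕ := (I.hh (I.zi q) + I.SS - q % 8 % 2) % I.SS

/-- The sum of the low parts of the hash values, if the second carry is `q / 2 % 2`. -/
def qV (q : ℕ) : ℕ := I.qv q % I.QQ + I.QQ * (q % 8 / 2 % 2)
def qi (q : ℕ) : ℕ := I.bkt (I.qκ q)
-- The only bucket in which y can lie: its high digit is obtained by solving the digit equation of
-- `add_mod_iff_digits`, its sign is the guessed one.
def qj (q : ℕ) : ℕ :=
  (I.qv q / I.QQ + 2 * I.RR - I.qi q % I.RR - q % 8 / 2 % 2) % I.RR + I.RR * (q % 8 / 4)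

/-- The sum of numbers with these signs overflows. -/
def bad (q : ℕ) : Prop := I.qi q / I.RR = q % 8 / 4 ∧ sgn (I.xs (I.zi q)) ≠ q % 8 / 4

/-- Overflowing sums are never solutions. In the decision version a query from a bucket to itself is
hidden too, as a pair x = y with z = 2x could answer it positively without giving a solution. -/
def hide (q : ℕ) : Prop := I.bad q ∨ rep = false ∧ I.qi q = I.qj q

open Classical in
def hits (q : ℕ) : Finset (ℕ × ℕ) :=
  if I.hide rep q then ∅ else
    (Finset.range I.n ×ˢ Finset.range I.n).filter fun p => I.ch p.1 = I.qκ q ∧ I.bk p.2 = I.qj q ∧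
      I.xs p.1 ≠ 0 ∧ I.xs p.2 ≠ 0 ∧ I.h2 p.1 + I.h2 p.2 = I.qV q

open Classical in
def query (q : ℕ) : Query :=
  ([if I.hide rep q then I.DUM else 1 + I.qκ q * (2 * I.TT) + I.qV q / I.TT],
    [I.CB + (I.qj q * I.TT + I.qV q % I.TT)])

/-- The `z`-th number is the sum of the `x`-th number and of another one. -/
def Valid (z x : ℕ) : Prop :=
  ∃ y < I.n, I.xs y = I.xs z - I.xs x ∧ I.xs x ≠ I.xs y ∧ I.xs x ≠ I.xs z ∧ I.xs y ≠ I.xs z ∧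
    ¬ (sgn (I.xs x) = sgn (I.xs y) ∧ sgn (I.xs z) ≠ sgn (I.xs x))

/-- The numbers that are checked after the query `q`. -/
def Walked (q x : ℕ) : Prop :=
  x < I.n ∧ I.ch x = I.qκ q ∧
    bif rep then ∃ p ∈ I.hits rep q, I.h2 p.1 = I.h2 x
    else ¬ I.bad q ∧ (I.qi q = I.qj q ∨ (I.hits rep q).Nonempty)

def Wins (q : ℕ) : Prop := ∃ x, I.Walked rep q x ∧ I.Valid (I.zi q) x

/-- The difference is nonzero, but its hash value is almost zero. -/
def False3 (z x y : ℕ) : Prop :=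
  I.xs z - I.xs x - I.xs y ≠ 0 ∧ Near (2 ^ I.k) (I.m * (I.xs z - I.xs x - I.xs y))

open Classical in
def FF (z x : ℕ) : ℕ := ((Finset.range I.n).filter fun y => I.False3 z x y).card

open Classical in
-- Pays for the chunks that the decision version checks directly because both summands would come
-- from the same bucket.
def GG (z x : ℕ) : ℕ := if Near (I.QQ * 2 ^ I.k) (I.m * (I.xs z - I.xs x - I.xs x)) then 1 else 0

def chunk (κ : ℕ) : Finset ℕ := (Finset.range I.n).filter fun i => I.ch i = κ

def Ftot : ℕ := ∑ z ∈ Finset.range I.n, ∑ x ∈ Finset.range I.n, I.FF z x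
def Gtot : ℕ := ∑ z ∈ Finset.range I.n, ∑ x ∈ Finset.range I.n, I.GG z x

open Classical in
-- Counts the degenerate pairs x = y, which the reporting version does report.
def EE (z x : ℕ) : ℕ := if I.xs z = I.xs x + I.xs x then 1 else 0

end Inst

namespace Inst.OK

variable {I : Inst w} (h : I.OK) (rep forb : Bool)
include h

theorem bk_div (i : ℕ) : I.bk i / I.RR = sgn (I.xs i) ∧ I.bk i % I.RR = I.hh i / I.QQ := by
  have := divmod_eq (a := sgn (I.xs i)) (h.hh_div_lt i)
  unfold Inst.bk
  rwa [Nat.add_comm, Nat.mul_comm]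

theorem zi_lt {q : ℕ} (hq : q < I.nq) : I.zi q < I.n := by
  have : 0 < I.K * 8 := by
    rcases Nat.eq_zero_or_pos (I.K * 8) with h0 | h0
    · rw [Inst.nq, h0] at hq; omega
    · exact h0
  exact (Nat.div_lt_iff_lt_mul this).2 hq

theorem qκ_lt {q : ℕ} (hq : q < I.nq) : I.qκ q < I.K := by
  refine Nat.mod_lt _ (Nat.pos_of_ne_zero fun h0 => ?_)
  rw [Inst.nq, h0] at hq; omega

theorem qv_lt (q : ℕ) : I.qv q < I.SS := Nat.mod_lt _ h.SS_pos

theorem qV_lt (q : ℕ) : I.qV q < 2 * I.QQ := by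
  have h1 := Nat.mod_lt (I.qv q) h.QQ_pos
  have h2 : q % 8 / 2 % 2 ≤ 1 := by omega
  have h3 := Nat.mul_le_mul_left I.QQ h2
  unfold Inst.qV
  omega

theorem qj_lt (q : ℕ) : I.qj q < 2 * I.RR := by
  have h1 := Nat.mod_lt (I.qv q / I.QQ + 2 * I.RR - I.qi q % I.RR - q % 8 / 2 % 2) h.RR_pos
  have h2 : q % 8 / 4 ≤ 1 := by omega
  have h3 := Nat.mul_le_mul_left I.RR h2
  unfold Inst.qj
  omega

theorem qα_lt (q : ℕ) : I.qV q / I.TT < 2 * I.TT := by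
  rw [Nat.div_lt_iff_lt_mul h.TT_pos]
  have := h.qV_lt q
  unfold Inst.QQ at this
  rwa [← Nat.mul_assoc] at this

theorem mem_hits {q : ℕ} {p : ℕ × ℕ} : p ∈ I.hits rep q ↔ ¬ I.hide rep q ∧ p.1 < I.n ∧ p.2 < I.n ∧
    I.ch p.1 = I.qκ q ∧ I.bk p.2 = I.qj q ∧ I.xs p.1 ≠ 0 ∧ I.xs p.2 ≠ 0 ∧
      I.h2 p.1 + I.h2 p.2 = I.qV q := by
  unfold Inst.hits
  split_ifs with hh
  · simp [hh]
  · simp [hh, and_assoc]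

/-- The documents selected by the query `q`. -/
theorem mem_answer_query {q : ℕ} (hq : q < I.nq) {u : ℕ} :
    u ∈ answer (selects forb) (I.docs forb) (I.query rep q) ↔
      ∃ p ∈ I.hits rep q, u + I.qV q / I.TT * I.TT = I.h2 p.1 + 2 * I.QQ := by
  unfold Inst.query
  split_ifs with hh
  · rw [h.answer_dum]
    simp [h.mem_hits, hh]
  · have hα := h.qα_lt q
    have hβ := Nat.mod_lt (I.qV q) h.TT_pos
    have hV := Nat.div_add_mod' (I.qV q) I.TT
    rw [h.mem_answer forb (h.qκ_lt hq) hα (h.qj_lt q) hβ]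
    constructor
    · rintro ⟨hu, ⟨x, hx, hcx, hux⟩, y, hy, hby, huy⟩
      have hx0 : I.xs x ≠ 0 := fun h0 => by simp [Inst.docA, h0] at hux; omega
      have hy0 : I.xs y ≠ 0 := fun h0 => by simp [Inst.docB, h0] at huy; omega
      have h1 := (h.docA_bounds hα hx0).1
      have h2 := (h.docB_bounds hβ hy0).1
      refine ⟨(x, y), (h.mem_hits rep).2 ⟨hh, hx, hy, hcx, hby, hx0, hy0, ?_⟩, ?_⟩
      · dsimp only; omega
      · dsimp only; omega
    · rintro ⟨⟨x, y⟩, hp, hu⟩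
      obtain ⟨-, hx, hy, hcx, hby, hx0, hy0, hs⟩ := (h.mem_hits rep).1 hp
      dsimp only at hu hx hy hcx hby hx0 hy0 hs
      have h1 := h.docA_bounds hα hx0
      have h2 := h.docB_bounds hβ hy0
      exact ⟨by omega, ⟨x, hx, hcx, by omega⟩, y, hy, hby, by omega⟩

/-- The document number is a function of the low digit of x, so several pairs may share a document
but no document comes without a pair. -/
theorem answer_ncard_le {q : ℕ} (hq : q < I.nq) :
    (answer (selects forb) (I.docs forb) (I.query rep q)).ncard ≤ (I.hits rep q).card := by
  classical
  have hsub : answer (selects forb) (I.docs forb) (I.query rep q) ⊆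
      ↑((I.hits rep q).image fun p => I.h2 p.1 + 2 * I.QQ - I.qV q / I.TT * I.TT) := by
    intro u hu
    obtain ⟨p, hp, hpu⟩ := (h.mem_answer_query rep forb hq).1 hu
    simp only [Finset.coe_image, Set.mem_image, Finset.mem_coe]
    exact ⟨p, hp, by omega⟩
  refine (Set.ncard_le_ncard hsub (Finset.finite_toSet _)).trans ?_
  rw [Set.ncard_coe_finset]
  exact Finset.card_image_le

theorem answer_nonempty {q : ℕ} (hq : q < I.nq) :
    (answer (selects forb) (I.docs forb) (I.query rep q)).Nonempty ↔ (I.hits rep q).Nonempty := by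
  constructor
  · rintro ⟨u, hu⟩
    obtain ⟨p, hp, -⟩ := (h.mem_answer_query rep forb hq).1 hu
    exact ⟨p, hp⟩
  · rintro ⟨p, hp⟩
    obtain ⟨-, -, -, -, -, hx0, -⟩ := (h.mem_hits rep).1 hp
    refine ⟨I.docA p.1 (I.qV q / I.TT), (h.mem_answer_query rep forb hq).2 ⟨p, hp, ?_⟩⟩
    exact (h.docA_bounds (h.qα_lt q) hx0).1

theorem query_valid {q : ℕ} (hq : q < I.nq) :
    ValidQuery (totalLength (I.docs forb)) (I.query rep q) := by
  have hN := h.totalLength_docs_ge forb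
  have h1 := h.charA_lt (h.qκ_lt hq) (h.qα_lt q)
  have h2 := h.charB_lt (h.qj_lt q) (Nat.mod_lt (I.qV q) h.TT_pos)
  have hC : I.CB + 2 * I.RR * I.TT = I.DUM := rfl
  unfold Inst.query ValidQuery
  simp only [ne_eq, List.cons_ne_nil, not_false_eq_true, List.length_singleton, List.mem_singleton,
    forall_eq, true_and]
  refine ⟨⟨by omega, ?_⟩, by omega, by omega⟩
  split_ifs <;> omega

/-- The pairs that are found by a query have almost the right sum of hash values. -/
theorem near_of_mem_hits {q : ℕ} {p : ℕ × ℕ} (hp : p ∈ I.hits rep q) :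
    Near (2 ^ I.k) (I.m * (I.xs (I.zi q) - I.xs p.1 - I.xs p.2)) ∧
      sgn (I.xs p.2) = q % 8 / 4 := by
  obtain ⟨-, hx, hy, hcx, hby, hx0, hy0, hs⟩ := (h.mem_hits rep).1 hp
  have hS := h.SS_pos
  have hb := h.bk_div p.1
  have hqi : I.qi q = I.bk p.1 := by unfold Inst.qi; rw [← hcx, h.bkt_ch hx]
  unfold Inst.bk Inst.qj at hby
  rw [Nat.add_comm, Nat.mul_comm, Nat.add_comm _ (I.RR * _), Nat.mul_comm I.RR (_ / _),
    mul_add_inj (h.hh_div_lt _) (Nat.mod_lt _ h.RR_pos), hqi, hb.2] at hby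
  refine ⟨near_of_hash h.hw (e := q % 8 % 2) (by omega) (by omega) ?_, hby.1⟩
  exact ((add_mod_iff_digits h.QQ_pos (h.hh_lt p.1) (h.hh_lt p.2) (h.qv_lt q)).2
    ⟨q % 8 / 2 % 2, by omega, hs, hby.2⟩).symm

omit h in
theorem sub_sub_eq_zero {x y z : BitVec w} : z - x - y = 0 ↔ y = z - x := by
  constructor
  · intro h'
    have := congrArg (· + y) h'
    simp only [BitVec.sub_add_cancel] at this
    rw [this]; simp
  · rintro rfl; simp

theorem walked_of_mem_hits {q : ℕ} {p : ℕ × ℕ} (hp : p ∈ I.hits rep q) : I.Walked rep q p.1 := by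
  obtain ⟨hh, hx, hy, hcx, -⟩ := (h.mem_hits rep).1 hp
  refine ⟨hx, hcx, ?_⟩
  cases rep
  · exact ⟨fun hb => hh (Or.inl hb), Or.inr ⟨p, hp⟩⟩
  · exact ⟨p, hp, rfl⟩

/-- If no valid sum is found, then a pair that the query finds is false, or it consists of equal
numbers. -/
theorem false_of_not_wins {q : ℕ} (hw : ¬ I.Wins rep q) {p : ℕ × ℕ}
    (hp : p ∈ I.hits rep q) : I.False3 (I.zi q) p.1 p.2 ∨
      rep = true ∧ p.1 = p.2 ∧ I.xs (I.zi q) = I.xs p.1 + I.xs p.1 := by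
  obtain ⟨hn, hsg⟩ := h.near_of_mem_hits rep hp
  obtain ⟨hh, hx, hy, hcx, hby, hx0, hy0, hs⟩ := (h.mem_hits rep).1 hp
  have hqi : I.qi q = I.bk p.1 := by unfold Inst.qi; rw [← hcx, h.bkt_ch hx]
  by_cases hd : I.xs (I.zi q) - I.xs p.1 - I.xs p.2 = 0
  · right
    rw [sub_sub_eq_zero] at hd
    have hz : I.xs (I.zi q) = I.xs p.2 + I.xs p.1 := by rw [hd, BitVec.sub_add_cancel]
    -- Equal numbers lie in one bucket, so the decision version would have hidden the query.
    -- Distinct numbers form a genuine solution, which `hw` excludes: they are nonzero, hence also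
    -- distinct from z, and overflow would have hidden the query.
    by_cases hxy : I.xs p.1 = I.xs p.2
    · have hpe : p.1 = p.2 := h.inj _ hx _ hy hxy
      refine ⟨?_, hpe, by rw [hz, ← hxy]⟩
      by_contra hrep
      refine hh (Or.inr ⟨by simpa using hrep, ?_⟩)
      rw [hqi, hpe, hby]
    · exfalso
      refine hw ⟨p.1, h.walked_of_mem_hits rep hp, p.2, hy, hd, hxy, ?_, ?_, ?_⟩
      · intro h'
        rw [hd, ← h'] at hy0
        exact hy0 (by simp)
      · intro h'
        rw [← h'] at hz
        have : I.xs p.2 + 0 = I.xs p.2 + I.xs p.1 := by rw [← hz]; simp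
        exact hx0 (by simpa using this.symm)
      · rintro ⟨h1, h2⟩
        refine hh (Or.inl ⟨?_, ?_⟩)
        · rw [hqi, (h.bk_div _).1, h1, hsg]
        · rwa [← hsg, ← h1]
  · exact Or.inl ⟨hd, hn⟩

/-- Completeness. A solution determines its query: the chunk of x, the two carries from `hash_add`
and `add_mod_iff_digits`, and the sign of y. -/
theorem exists_wins {x z : ℕ} (hx : x < I.n) (hz : z < I.n) (hv : I.Valid z x) :
    ∃ q < I.nq, I.Wins rep q := by
  have hv' := hv
  obtain ⟨y, hy, hyz, hxy, hxz, hyz', hsg⟩ := hv'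
  have hK := h.ch_lt hx
  have hsum : I.xs x + I.xs y = I.xs z := by rw [hyz, BitVec.add_comm, BitVec.sub_add_cancel]
  obtain ⟨e, he, hee⟩ := hash_add (m := I.m) h.hw (I.xs x) (I.xs y)
  rw [hsum] at hee
  obtain ⟨e', he', hs, hb⟩ := (add_mod_iff_digits h.QQ_pos (h.hh_lt x) (h.hh_lt y)
    (Nat.mod_lt (hash I.m I.k (I.xs z) + I.SS - e) h.SS_pos)).1 hee.symm
  have hsy := sgn_lt h.w_pos (I.xs y)
  set c := e + 2 * e' + 4 * sgn (I.xs y) with hc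
  have hc8 : c < 8 := by omega
  set q := z * (I.K * 8) + (I.ch x * 8 + c) with hqdef
  have hlt : I.ch x * 8 + c < I.K * 8 := mul_add_lt hK hc8
  have hq : q < I.nq := mul_add_lt hz hlt
  have e1 : I.zi q = z := (divmod_eq hlt).1
  have e2 : q = (z * I.K + I.ch x) * 8 + c := by rw [hqdef]; ring
  have e3 : q % 8 = c := by rw [e2]; exact (divmod_eq hc8).2
  have e4 : I.qκ q = I.ch x := by
    unfold Inst.qκ
    rw [e2, (divmod_eq hc8).1]
    exact (divmod_eq hK).2
  have c1 : c % 2 = e := by omega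
  have c2 : c / 2 % 2 = e' := by omega
  have c4 : c / 4 = sgn (I.xs y) := by omega
  have eqi : I.qi q = I.bk x := by unfold Inst.qi; rw [e4, h.bkt_ch hx]
  have ev : I.qv q = (hash I.m I.k (I.xs z) + I.SS - e) % I.SS := by
    unfold Inst.qv Inst.hh; rw [e1, e3, c1]
  have ej : I.qj q = I.bk y := by
    unfold Inst.qj; rw [ev, eqi, (h.bk_div x).2, e3, c2, c4]
    exact congrArg (· + I.RR * sgn (I.xs y)) hb.symm
  have eV : I.h2 x + I.h2 y = I.qV q := by
    unfold Inst.qV; rw [ev, e3, c2]; exact hs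
  have hbad : ¬ I.bad q := by
    rintro ⟨b1, b2⟩
    rw [eqi, (h.bk_div x).1, e3, c4] at b1
    rw [e1, e3, c4] at b2
    exact hsg ⟨b1, by rwa [b1]⟩
  refine ⟨q, hq, x, ?_, by rwa [e1]⟩
  -- Overflow is impossible for a solution. A query hidden for the other reason belongs to the
  -- decision version, where the whole chunk is checked anyway. Otherwise (x, y) is a hit, as
  -- neither number is zero: that would make two of the three equal.
  by_cases hh : I.hide rep q
  · rcases hh with hh | ⟨rfl, hh⟩
    · exact absurd hh hbad
    · exact ⟨hx, e4.symm, hbad, Or.inl hh⟩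
  · refine h.walked_of_mem_hits rep (p := (x, y)) ((h.mem_hits rep).2 ⟨hh, hx, hy, e4.symm, ej.symm,
      ?_, ?_, eV⟩)
    · intro h0
      rw [h0] at hsum
      exact hyz' (by simpa using hsum)
    · intro h0
      rw [h0] at hsum
      exact hxz (by simpa using hsum)

/-- The chunks partition the numbers, so each pair (z, x) is met in exactly eight queries, one for
each choice of the three bits. -/
theorem sum_chunks (f : ℕ → ℕ → ℕ) :
    ∑ q ∈ Finset.range I.nq, ∑ x ∈ I.chunk (I.qκ q), f (I.zi q) x =
      8 * ∑ z ∈ Finset.range I.n, ∑ x ∈ Finset.range I.n, f z x := by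
  unfold Inst.nq
  rw [sum_range_mul, Finset.mul_sum]
  refine Finset.sum_congr rfl fun z _ => ?_
  rw [sum_range_mul]
  have h1 : ∀ κ ∈ Finset.range I.K, ∑ c ∈ Finset.range 8,
      ∑ x ∈ I.chunk (I.qκ (z * (I.K * 8) + (κ * 8 + c))), f (I.zi (z * (I.K * 8) + (κ * 8 + c))) x =
        8 * ∑ x ∈ I.chunk κ, f z x := by
    intro κ hκ
    rw [Finset.mem_range] at hκ
    rw [Finset.sum_congr rfl (g := fun _ => ∑ x ∈ I.chunk κ, f z x)]
    · simp
    · intro c hc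
      rw [Finset.mem_range] at hc
      have e1 : I.zi (z * (I.K * 8) + (κ * 8 + c)) = z := (divmod_eq (mul_add_lt hκ hc)).1
      have e4 : I.qκ (z * (I.K * 8) + (κ * 8 + c)) = κ := by
        unfold Inst.qκ
        rw [show z * (I.K * 8) + (κ * 8 + c) = (z * I.K + κ) * 8 + c by ring, (divmod_eq hc).1]
        exact (divmod_eq hκ).2
      rw [e1, e4]
  rw [Finset.sum_congr rfl h1, ← Finset.mul_sum]
  congr 1
  exact Finset.sum_fiberwise_of_maps_to (fun x hx =>
    Finset.mem_range.2 (h.ch_lt (Finset.mem_range.1 hx))) _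

theorem mem_chunk {κ x : ℕ} : x ∈ I.chunk κ ↔ x < I.n ∧ I.ch x = κ := by
  simp [Inst.chunk]

/-- An upper bound for the number of pairs found by a query. -/
theorem hits_card_le {q : ℕ} :
    (I.hits rep q).card ≤ ∑ x ∈ I.chunk (I.qκ q), I.FF (I.zi q) x + I.BB := by
  classical
  have h1 : (I.hits rep q) ⊆ ((I.chunk (I.qκ q)).sigma fun x =>
      (Finset.range I.n).filter fun y => I.False3 (I.zi q) x y).image (fun s => (s.1, s.2)) ∪
      ((I.hits rep q).filter fun p => I.xs p.2 = I.xs (I.zi q) - I.xs p.1) := by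
    intro p hp
    obtain ⟨hn, -⟩ := h.near_of_mem_hits rep hp
    obtain ⟨hh, hx, hy, hcx, -⟩ := (h.mem_hits rep).1 hp
    rw [Finset.mem_union]
    by_cases hd : I.xs p.2 = I.xs (I.zi q) - I.xs p.1
    · exact Or.inr (Finset.mem_filter.2 ⟨hp, hd⟩)
    · left
      refine Finset.mem_image.2 ⟨⟨p.1, p.2⟩, Finset.mem_sigma.2 ⟨h.mem_chunk.2 ⟨hx, hcx⟩,
        Finset.mem_filter.2 ⟨Finset.mem_range.2 hy, fun h0 => hd (sub_sub_eq_zero.1 h0), hn⟩⟩, rfl⟩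
  refine (Finset.card_le_card h1).trans ((Finset.card_union_le _ _).trans
    (add_le_add (Finset.card_image_le.trans (by rw [Finset.card_sigma]; rfl)) ?_))
  -- In a true pair y is determined by x, and x lies in a chunk of at most `BB` numbers.
  refine le_trans ?_ (h.chunk_card (I.qκ q))
  refine Finset.card_le_card_of_injOn Prod.fst (fun p hp => ?_) fun p hp p' hp' he => ?_
  · obtain ⟨hh, hx, hy, hcx, -⟩ := (h.mem_hits rep).1 (Finset.mem_filter.1 hp).1
    exact Finset.mem_coe.2 (Finset.mem_filter.2 ⟨Finset.mem_range.2 hx, hcx⟩)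
  · have a1 := Finset.mem_filter.1 hp
    have a2 := Finset.mem_filter.1 hp'
    obtain ⟨-, -, hy, -⟩ := (h.mem_hits rep).1 a1.1
    obtain ⟨-, -, hy', -⟩ := (h.mem_hits rep).1 a2.1
    refine Prod.ext he (h.inj _ hy _ hy' ?_)
    rw [a1.2, a2.2, he]

/-- By `false_of_not_wins` a query without success finds only false pairs, and pairs x = y in the
reporting version. This is sharper than `hits_card_le`, whose summand `BB` would be charged for
every query. -/
theorem hits_card_le_of_not_wins {q : ℕ} (hw : ¬ I.Wins rep q) :
    (I.hits rep q).card ≤ ∑ x ∈ I.chunk (I.qκ q), I.FF (I.zi q) x +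
      bif rep then ∑ x ∈ I.chunk (I.qκ q), I.EE (I.zi q) x else 0 := by
  classical
  have h1 : (I.hits rep q) ⊆ ((I.chunk (I.qκ q)).sigma fun x =>
      (Finset.range I.n).filter fun y => I.False3 (I.zi q) x y).image (fun s => (s.1, s.2)) ∪
      (bif rep then ((I.chunk (I.qκ q)).filter fun x => I.xs (I.zi q) = I.xs x + I.xs x).image
        (fun x => (x, x)) else ∅) := by
    intro p hp
    obtain ⟨hh, hx, hy, hcx, -⟩ := (h.mem_hits rep).1 hp
    rw [Finset.mem_union]
    rcases h.false_of_not_wins rep hw hp with hF | ⟨rfl, hpe, hz⟩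
    · left
      exact Finset.mem_image.2 ⟨⟨p.1, p.2⟩, Finset.mem_sigma.2 ⟨h.mem_chunk.2 ⟨hx, hcx⟩,
        Finset.mem_filter.2 ⟨Finset.mem_range.2 hy, hF⟩⟩, rfl⟩
    · right
      exact Finset.mem_image.2 ⟨p.1, Finset.mem_filter.2 ⟨h.mem_chunk.2 ⟨hx, hcx⟩, hz⟩,
        Prod.ext rfl hpe⟩
  refine (Finset.card_le_card h1).trans ((Finset.card_union_le _ _).trans
    (add_le_add (Finset.card_image_le.trans (by rw [Finset.card_sigma]; rfl)) ?_))
  cases rep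
  · simp
  · refine Finset.card_image_le.trans ?_
    rw [Finset.card_filter]; rfl

/-- The number z = 2x is determined by x, and the numbers are distinct. -/
theorem sum_EE_le : ∑ z ∈ Finset.range I.n, ∑ x ∈ Finset.range I.n, I.EE z x ≤ I.n := by
  classical
  rw [Finset.sum_comm]
  calc _ ≤ ∑ x ∈ Finset.range I.n, 1 := by
        refine Finset.sum_le_sum fun x _ => ?_
        unfold Inst.EE
        rw [← Finset.card_filter, Finset.card_le_one]
        intro a ha b hb
        rw [Finset.mem_filter, Finset.mem_range] at ha hb
        exact h.inj _ ha.1 _ hb.1 (ha.2.trans hb.2.symm)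
    _ = I.n := by simp

/-- The total number of pairs found by the queries up to the first success. -/
theorem sum_hits_le {M : ℕ} (hM : M ≤ I.nq) (hw : ∀ q, q + 1 < M → ¬ I.Wins rep q) :
    ∑ q ∈ Finset.range M, (I.hits rep q).card ≤
      8 * I.Ftot + (bif rep then 8 * I.n else 0) + I.BB := by
  rcases M with _ | M
  · simp
  -- Only the last query may succeed; it gets the weaker bound and contributes the single summand
  -- `BB`.
  rw [Finset.sum_range_succ]
  have h1 : ∑ q ∈ Finset.range M, (I.hits rep q).card ≤ ∑ q ∈ Finset.range M,
      (∑ x ∈ I.chunk (I.qκ q), I.FF (I.zi q) x +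
        bif rep then ∑ x ∈ I.chunk (I.qκ q), I.EE (I.zi q) x else 0) :=
    Finset.sum_le_sum fun q hq => h.hits_card_le_of_not_wins rep
      (hw q (by have := Finset.mem_range.1 hq; omega))
  rw [Finset.sum_add_distrib] at h1
  have h2 := h.hits_card_le rep (q := M)
  have h3 : ∑ q ∈ Finset.range (M + 1), ∑ x ∈ I.chunk (I.qκ q), I.FF (I.zi q) x ≤ 8 * I.Ftot := by
    rw [Inst.Ftot, ← h.sum_chunks]
    exact Finset.sum_le_sum_of_subset (Finset.range_subset_range.2 hM)
  rw [Finset.sum_range_succ] at h3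
  have h4 : (∑ q ∈ Finset.range M, bif rep then ∑ x ∈ I.chunk (I.qκ q), I.EE (I.zi q) x else 0) ≤
      bif rep then 8 * I.n else 0 := by
    cases rep
    · simp
    · simp only [cond_true]
      refine le_trans (Finset.sum_le_sum_of_subset (Finset.range_subset_range.2
        (Nat.le_of_succ_le hM))) ?_
      rw [h.sum_chunks]
      exact Nat.mul_le_mul_left _ h.sum_EE_le
  omega

end Inst.OK

end WordRAM
end

noncomputable section
namespace WordRAM
set_option linter.unusedSectionVars false
variable {w : ℕ}

/-! ### The cost of the verification -/

namespace Inst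

variable (I : Inst w) (rep : Bool)

open Classical in
def walkedSet (q : ℕ) : Finset ℕ := (I.chunk (I.qκ q)).filter (I.Walked rep q)

/-- The number of candidates for the second summand. -/
def cand (z x : ℕ) : ℕ := (chain I.hh I.n (hash I.m I.k (I.xs z - I.xs x))).length

def walkCost (q : ℕ) : ℕ := ∑ x ∈ I.walkedSet rep q, (1 + I.cand (I.zi q) x)

end Inst

namespace Inst.OK

variable {I : Inst w} (h : I.OK) (rep forb : Bool)
include h

theorem mem_walkedSet {q x : ℕ} : x ∈ I.walkedSet rep q ↔ I.Walked rep q x := by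
  classical
  unfold Inst.walkedSet
  rw [Finset.mem_filter, h.mem_chunk]
  exact ⟨fun h' => h'.2, fun h' => ⟨⟨h'.1, h'.2.1⟩, h'⟩⟩

/-- All candidates have the hash value of z - x. At most one of them equals z - x; by `near_of_hash`
the others are false. -/
theorem cand_le (z x : ℕ) : I.cand z x ≤ I.FF z x + 1 := by
  classical
  have hS := h.SS_pos
  unfold Inst.cand
  rw [chain_length]
  have hsub : ((Finset.range I.n).filter fun y => I.hh y = hash I.m I.k (I.xs z - I.xs x)) ⊆
      ((Finset.range I.n).filter fun y => I.False3 z x y) ∪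
        ((Finset.range I.n).filter fun y => I.xs y = I.xs z - I.xs x) := by
    intro y hy
    rw [Finset.mem_filter] at hy
    rw [Finset.mem_union, Finset.mem_filter, Finset.mem_filter]
    by_cases hd : I.xs y = I.xs z - I.xs x
    · exact Or.inr ⟨hy.1, hd⟩
    · refine Or.inl ⟨hy.1, fun h0 => hd (sub_sub_eq_zero.1 h0), ?_⟩
      obtain ⟨e, he, hee⟩ := hash_add (m := I.m) h.hw (I.xs x) (I.xs z - I.xs x)
      rw [BitVec.add_comm, BitVec.sub_add_cancel, ← hy.2] at hee
      exact near_of_hash h.hw he (by omega) hee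
  refine (Finset.card_le_card hsub).trans ((Finset.card_union_le _ _).trans
    (add_le_add le_rfl (Finset.card_le_one.2 fun a ha b hb => ?_)))
  rw [Finset.mem_filter, Finset.mem_range] at ha hb
  exact h.inj _ ha.1 _ hb.1 (ha.2.trans hb.2.symm)

/-- In the decision version a hit pays for its whole chunk, and a query from a bucket to itself is
paid by `GG`, which is 1 for every number of the chunk. In the reporting version a checked number
shares chunk and low digit with a hit; if nonzero, it is the first component of a hit itself. The
extra 1 is for the number zero. -/
theorem walkedSet_card_le {q : ℕ} : (I.walkedSet rep q).card ≤
    (bif rep then 1 else I.BB) * (I.hits rep q).card + 1 +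
      ∑ x ∈ I.chunk (I.qκ q), I.GG (I.zi q) x := by
  classical
  have hS := h.SS_pos
  cases rep
  · have hchunk : (I.walkedSet false q).card ≤ (I.chunk (I.qκ q)).card := by
      unfold Inst.walkedSet; exact Finset.card_filter_le _ _
    simp only [cond_false]
    rcases Finset.eq_empty_or_nonempty (I.walkedSet false q) with he | ⟨x, hx⟩
    · rw [he]; simp
    obtain ⟨-, -, -, hw⟩ := (h.mem_walkedSet false).1 hx
    rcases hw with hw | hw
    · suffices (I.chunk (I.qκ q)).card ≤ ∑ x ∈ I.chunk (I.qκ q), I.GG (I.zi q) x by omega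
      rw [Finset.card_eq_sum_ones]
      refine Finset.sum_le_sum fun x hx => ?_
      obtain ⟨hxn, hxc⟩ := h.mem_chunk.1 hx
      unfold Inst.GG
      rw [if_pos]
      have hqi : I.qi q = I.bk x := by unfold Inst.qi; rw [← hxc, h.bkt_ch hxn]
      unfold Inst.qj at hw
      rw [hqi, (h.bk_div x).2] at hw
      unfold Inst.bk at hw
      rw [Nat.add_comm, Nat.mul_comm, Nat.add_comm _ (I.RR * _), Nat.mul_comm I.RR (_ / _),
        mul_add_inj (h.hh_div_lt _) (Nat.mod_lt _ h.RR_pos)] at hw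
      exact near_of_same_bucket h.QQ_pos rfl h.hw (e := q % 8 % 2) (e' := q % 8 / 2 % 2)
        (by omega) (by show _ ≤ I.SS; omega) (by omega) hw.2
    · have h1 : 1 ≤ (I.hits false q).card := hw.card_pos
      have h2 : (I.chunk (I.qκ q)).card ≤ I.BB := h.chunk_card _
      have h3 : I.BB * 1 ≤ I.BB * (I.hits false q).card := Nat.mul_le_mul_left _ h1
      omega
  · simp only [cond_true, one_mul]
    refine le_trans ?_ (Nat.le_add_right _ _)
    have hsub : I.walkedSet true q ⊆ (I.hits true q).image Prod.fst ∪
        ((Finset.range I.n).filter fun x => I.xs x = 0) := by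
      intro x hx
      obtain ⟨hxn, hxc, p, hp, hpx⟩ := (h.mem_walkedSet true).1 hx
      rw [Finset.mem_union, Finset.mem_filter]
      by_cases h0 : I.xs x = 0
      · exact Or.inr ⟨Finset.mem_range.2 hxn, h0⟩
      · obtain ⟨hh, hx1, hy, hcx, hby, hx0, hy0, hs⟩ := (h.mem_hits true).1 hp
        exact Or.inl (Finset.mem_image.2 ⟨(x, p.2), (h.mem_hits true).2
          ⟨hh, hxn, hy, hxc, hby, h0, hy0, by rw [← hs, hpx]⟩, rfl⟩)
    refine (Finset.card_le_card hsub).trans ((Finset.card_union_le _ _).trans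
      (add_le_add Finset.card_image_le (Finset.card_le_one.2 fun a ha b hb => ?_)))
    rw [Finset.mem_filter, Finset.mem_range] at ha hb
    exact h.inj _ ha.1 _ hb.1 (ha.2.trans hb.2.symm)

/-- The total cost of the verification up to the first success. -/
theorem sum_walkCost_le {M : ℕ} (hM : M ≤ I.nq) (hw : ∀ q, q + 1 < M → ¬ I.Wins rep q) :
    ∑ q ∈ Finset.range M, I.walkCost rep q ≤
      2 * ((bif rep then 1 else I.BB) * (8 * I.Ftot + (bif rep then 8 * I.n else 0) + I.BB) +
        I.nq + 8 * I.Gtot) + 8 * I.Ftot := by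
  classical
  have h1 : ∀ q ∈ Finset.range M, I.walkCost rep q ≤ 2 * ((bif rep then 1 else I.BB) *
      (I.hits rep q).card + 1 + ∑ x ∈ I.chunk (I.qκ q), I.GG (I.zi q) x) +
        ∑ x ∈ I.chunk (I.qκ q), I.FF (I.zi q) x := by
    intro q _
    have e1 : I.walkCost rep q ≤ ∑ x ∈ I.walkedSet rep q, (2 + I.FF (I.zi q) x) :=
      Finset.sum_le_sum fun x _ => by have := h.cand_le (I.zi q) x; omega
    have e2 : ∑ x ∈ I.walkedSet rep q, I.FF (I.zi q) x ≤
        ∑ x ∈ I.chunk (I.qκ q), I.FF (I.zi q) x :=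
      Finset.sum_le_sum_of_subset (Finset.filter_subset _ _)
    have e3 := h.walkedSet_card_le rep (q := q)
    rw [Finset.sum_add_distrib, Finset.sum_const, smul_eq_mul] at e1
    omega
  refine (Finset.sum_le_sum h1).trans ?_
  have h2 : ∑ q ∈ Finset.range M, ∑ x ∈ I.chunk (I.qκ q), I.FF (I.zi q) x ≤ 8 * I.Ftot := by
    rw [Inst.Ftot, ← h.sum_chunks]
    exact Finset.sum_le_sum_of_subset (Finset.range_subset_range.2 hM)
  have h3 : ∑ q ∈ Finset.range M, ∑ x ∈ I.chunk (I.qκ q), I.GG (I.zi q) x ≤ 8 * I.Gtot := by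
    rw [Inst.Gtot, ← h.sum_chunks]
    exact Finset.sum_le_sum_of_subset (Finset.range_subset_range.2 hM)
  have h4 := Nat.mul_le_mul_left (bif rep then 1 else I.BB) (h.sum_hits_le rep hM hw)
  rw [Finset.mul_sum] at h4
  simp only [Finset.sum_add_distrib, ← Finset.mul_sum, Finset.sum_const, Finset.card_range,
    smul_eq_mul]
  rw [← Finset.mul_sum] at h4
  omega

end Inst.OK

/-! ### Expectations over the multiplier -/

/-- The odd multiplier that belongs to a random word. -/
def oddMul (r : Fin (2 ^ w)) : BitVec w := BitVec.ofNat w 2 * BitVec.ofFin r + BitVec.ofNat w 1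

/-- After exchanging the sums, `sum_near_card_le` applies for fixed z and x to the nonzero
differences z - x - y. Divided by 2^w, this is an expectation of O(n³ / SS). -/
theorem sum_Ftot_le (J : Fin (2 ^ w) → Inst w) (n k : ℕ) (xs : ℕ → BitVec w)
    (hJ : ∀ r, (J r).n = n ∧ (J r).k = k ∧ (J r).xs = xs ∧ (J r).m = oddMul r) :
    ∑ r, (J r).Ftot ≤ 32 * 2 ^ k * n ^ 3 := by
  classical
  have h1 : ∀ r, (J r).Ftot = ∑ z ∈ Finset.range n, ∑ x ∈ Finset.range n,
      (((Finset.range n).filter fun y => xs z - xs x - xs y ≠ 0).filter fun y =>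
        Near (2 ^ k) (oddMul r * (xs z - xs x - xs y))).card := by
    intro r
    obtain ⟨h1, h2, h3, h4⟩ := hJ r
    unfold Inst.Ftot Inst.FF Inst.False3
    simp only [h1, h2, h3, h4, Finset.filter_filter]
  simp_rw [h1]
  rw [Finset.sum_comm]
  simp_rw [Finset.sum_comm (s := Finset.univ)]
  calc _ ≤ ∑ z ∈ Finset.range n, ∑ x ∈ Finset.range n, 32 * 2 ^ k * n := by
        refine Finset.sum_le_sum fun z _ => Finset.sum_le_sum fun x _ => ?_
        refine (sum_near_card_le _ (2 ^ k) (fun y => xs z - xs x - xs y) fun y hy =>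
          (Finset.mem_filter.1 hy).2).trans (Nat.mul_le_mul_left _ ?_)
        exact (Finset.card_filter_le _ _).trans (by simp)
    _ = _ := by
        simp only [Finset.sum_const, Finset.card_range, smul_eq_mul]; ring

/-- As for `sum_Ftot_le`, with differences z - 2x at the coarser scale. The pairs with z = 2x are
always near; there are at most `n` of them for each multiplier. -/
theorem sum_Gtot_le (J : Fin (2 ^ w) → Inst w) (hOK : ∀ r, (J r).OK) (n k QQ : ℕ)
    (xs : ℕ → BitVec w)
    (hJ : ∀ r, (J r).n = n ∧ (J r).k = k ∧ (J r).xs = xs ∧ (J r).m = oddMul r ∧ (J r).QQ = QQ) :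
    ∑ r, (J r).Gtot ≤ 32 * (QQ * 2 ^ k) * n ^ 2 + 2 ^ w * n := by
  classical
  have h1 : ∀ r, (J r).Gtot ≤ ∑ z ∈ Finset.range n,
      (((Finset.range n).filter fun x => xs z - xs x - xs x ≠ 0).filter fun x =>
        Near (QQ * 2 ^ k) (oddMul r * (xs z - xs x - xs x))).card + n := by
    intro r
    refine le_trans ?_ (Nat.add_le_add_left ((hOK r).sum_EE_le.trans (hJ r).1.le) _)
    obtain ⟨h1, h2, h3, h4, h5⟩ := hJ r
    unfold Inst.Gtot Inst.GG Inst.EE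
    simp only [h1, h2, h3, h4, h5]
    rw [← Finset.sum_add_distrib]
    refine Finset.sum_le_sum fun z _ => ?_
    rw [Finset.filter_filter, Finset.card_filter, ← Finset.sum_add_distrib]
    refine Finset.sum_le_sum fun x _ => ?_
    by_cases hd : xs z - xs x - xs x = 0
    · have : xs z = xs x + xs x := by
        rw [Inst.OK.sub_sub_eq_zero] at hd
        nth_rw 2 [hd]
        rw [BitVec.add_comm, BitVec.sub_add_cancel]
      rw [if_pos this]
      split_ifs <;> omega
    · split_ifs with a b c <;> first | omega | exact absurd ⟨hd, a⟩ b
  refine (Finset.sum_le_sum fun r _ => h1 r).trans ?_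
  rw [Finset.sum_add_distrib, Finset.sum_comm]
  refine add_le_add ?_ (by simp)
  calc _ ≤ ∑ z ∈ Finset.range n, 32 * (QQ * 2 ^ k) * n := by
        refine Finset.sum_le_sum fun z _ => ?_
        refine (sum_near_card_le _ (QQ * 2 ^ k) (fun x => xs z - xs x - xs x) fun y hy =>
          (Finset.mem_filter.1 hy).2).trans (Nat.mul_le_mul_left _ ?_)
        exact (Finset.card_filter_le _ _).trans (by simp)
    _ = _ := by
        simp only [Finset.sum_const, Finset.card_range, smul_eq_mul]; ring

end WordRAM
end

noncomputable section
namespace WordRAM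
variable {w : ℕ}

/-! ### Truth values -/

local notation "V" => Expr.var

open Classical in
def b2n (P : Prop) : ℕ := if P then 1 else 0

theorem b2n_true {P : Prop} (h : P) : b2n P = 1 := if_pos h

theorem b2n_false {P : Prop} (h : ¬ P) : b2n P = 0 := if_neg h

theorem b2n_congr {P Q : Prop} (h : P ↔ Q) : b2n P = b2n Q := by rw [propext h]

theorem b2n_le (P : Prop) : b2n P ≤ 1 := by unfold b2n; split_ifs <;> omega

theorem b2n_ne_zero {P : Prop} : b2n P ≠ 0 ↔ P := by
  by_cases h : P
  · rw [b2n_true h]; simp [h]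
  · rw [b2n_false h]; simp [h]

def notE (e : Expr) : Expr := .lit 1 - e

def orE (e e' : Expr) : Expr := e + e' - e * e'

namespace Ev

variable {s : State w} {a b : Expr} {x y : ℕ} {P Q : Prop}

theorem beq (ha : Ev s a x) (hb : Ev s b y) (hx : x < 2 ^ w) (hy : y < 2 ^ w) :
    Ev s (.bin .eq a b) (b2n (x = y)) :=
  (ha.eq hb hx hy).cast (by unfold b2n; congr)

theorem blt (ha : Ev s a x) (hb : Ev s b y) (hx : x < 2 ^ w) (hy : y < 2 ^ w) :
    Ev s (.bin .lt a b) (b2n (x < y)) :=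
  (ha.lt hb hx hy).cast (by unfold b2n; congr)

theorem beq_word {u v : BitVec w} (ha : a.eval s = u) (hb : b.eval s = v) :
    Ev s (.bin .eq a b) (b2n (u = v)) :=
  (eq_word ha hb).cast (by unfold b2n; congr)

theorem band (ha : Ev s a (b2n P)) (hb : Ev s b (b2n Q)) : Ev s (a * b) (b2n (P ∧ Q)) :=
  (ha.mul hb).cast (by by_cases hP : P <;> by_cases hQ : Q <;> simp [b2n, hP, hQ])

theorem bnot (ha : Ev s a (b2n P)) : Ev s (notE a) (b2n (¬ P)) :=
  ((lit 1).sub ha (b2n_le P)).cast (by by_cases hP : P <;> simp [b2n, hP])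

theorem bor (ha : Ev s a (b2n P)) (hb : Ev s b (b2n Q)) : Ev s (orE a b) (b2n (P ∨ Q)) :=
  ((ha.add hb).sub (ha.mul hb) (by
    by_cases hP : P <;> by_cases hQ : Q <;> simp [b2n, hP, hQ])).cast (by
    by_cases hP : P <;> by_cases hQ : Q <;> simp [b2n, hP, hQ])

end Ev

/-! ### Verification -/

def testE : Expr :=
  .bin .eq (V 37) (V 35) * (notE (.bin .eq (V 34) (V 37)) * (notE (.bin .eq (V 34) (V 17)) *
    (notE (.bin .eq (V 37) (V 17)) * notE (.bin .eq (sgnE (V 34)) (sgnE (V 37)) *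
      notE (.bin .eq (sgnE (V 17)) (sgnE (V 34)))))))

def yChain : Prog :=
  whileP (V 36) (block [.asg 37 (.ld 0 (V 36 - .lit 1)), .asg 39 (orE (V 39) testE),
    .asg 36 (.ld 2 (V 36 - .lit 1))])

def xChain : Prog :=
  whileP (V 33) (.seq (block [.asg 34 (.ld 0 (V 33 - .lit 1)), .asg 35 (V 17 - V 34),
    .asg 36 (.ld 1 (hashE (V 35)))]) (.seq yChain (block [.asg 33 (.ld 8 (V 33 - .lit 1))])))

/-- In the reporting version array 24 is the output array 4 of the data structure. A reported
document u belongs to the low digit u + αT - 2 QQ, which together with the chunk is the key of the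
list to be checked. -/
def keyE : Bool → Expr
  | false => V 15
  | true => V 15 * V 3 + (.ld 24 (V 31) + V 20 / V 2 * V 2 - .lit 2 * V 3)

def verify (rep : Bool) : Prog :=
  whileP (.bin .lt (V 31) (V 30)) (.seq (block [.asg 32 (keyE rep), .asg 33 (.ld 7 (V 32))])
    (.seq xChain (block [.asg 31 (V 31 + .lit 1)])))

/-- What the query loop needs to know about the tables. -/
structure QEnv (I : Inst w) (rep : Bool) (s : State w) : Prop where
  env : Env I s
  K : s.get 10 = BitVec.ofNat w I.K
  CB : s.get 11 = BitVec.ofNat w I.CB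
  DUM : s.get 12 = BitVec.ofNat w I.DUM
  nq : s.get 28 = BitVec.ofNat w I.nq
  m1 : s.mem 1 = arr (last I.hh I.n)
  m2 : s.mem 2 = arr (link I.hh I.n)
  m5 : s.mem 5 = arr I.bkt
  m7 : s.mem 7 = arr (last (I.akey rep) I.n)
  m8 : s.mem 8 = arr (link (I.akey rep) I.n)

theorem QEnv.congr {I : Inst w} {rep : Bool} {s s' : State w} (h : QEnv I rep s)
    (h1 : ∀ r, r < 13 ∨ r = 28 → s'.get r = s.get r) (h2 : ∀ a < 9, s'.mem a = s.mem a) :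
    QEnv I rep s' := by
  constructor
  · constructor
    all_goals first
      | rw [h1 _ (by norm_num)]
      | rw [h2 _ (by norm_num)]
    exacts [h.env.n, h.env.TT, h.env.QQ, h.env.RR, h.env.BB, h.env.k, h.env.SS, h.env.m, h.env.sg,
      h.env.xs]
  all_goals first
    | rw [h1 _ (by norm_num)]
    | rw [h2 _ (by norm_num)]
  exacts [h.K, h.CB, h.DUM, h.nq, h.m1, h.m2, h.m5, h.m7, h.m8]

theorem QEnv.agree {I : Inst w} {rep : Bool} {s s' : State w} {rs as : List ℕ}
    (h : QEnv I rep s) (hA : Agree rs as s s') (hr : rs.all (fun r => 13 ≤ r ∧ r ≠ 28) = true)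
    (ha : as.all (9 ≤ ·) = true) : QEnv I rep s' := by
  refine h.congr (fun r hr' => hA.1 r fun hm => ?_) fun a ha' => hA.2 a fun hm => ?_
  · have := List.all_eq_true.1 hr r hm
    simp only [decide_eq_true_eq] at this
    omega
  · have := List.all_eq_true.1 ha a hm
    simp only [decide_eq_true_eq] at this
    omega

namespace Inst

variable (I : Inst w)

def Test (z x y : ℕ) : Prop :=
  I.xs y = I.xs z - I.xs x ∧ I.xs x ≠ I.xs y ∧ I.xs x ≠ I.xs z ∧ I.xs y ≠ I.xs z ∧
    ¬ (sgn (I.xs x) = sgn (I.xs y) ∧ ¬ sgn (I.xs z) = sgn (I.xs x))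

def cands (z x : ℕ) : List ℕ := chain I.hh I.n (hash I.m I.k (I.xs z - I.xs x))

/-- The list of candidates misses nothing, since y = z - x has the hash value by which it was
chosen. -/
theorem valid_iff (z x : ℕ) : I.Valid z x ↔ ∃ y ∈ I.cands z x, I.Test z x y := by
  constructor
  · rintro ⟨y, hy, h1, h2⟩
    exact ⟨y, mem_chain.2 ⟨hy, by rw [← h1]; rfl⟩, h1, h2⟩
  · rintro ⟨y, hy, h1, h2⟩
    exact ⟨y, (mem_chain.1 hy).1, h1, h2⟩

end Inst

/-- `P` stands for the successes found before this list was entered, so the flag is cumulative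
across nested loops. -/
structure YInv (I : Inst w) (s₀ : State w) (z x : ℕ) (P : Prop) (j : ℕ) (s : State w) : Prop where
  agree : Agree [36, 37, 39] [] s₀ s
  ptr : s.get 36 = BitVec.ofNat w (ptr ((I.cands z x).drop j))
  found : s.get 39 = BitVec.ofNat w (b2n (P ∨ ∃ y ∈ (I.cands z x).take j, I.Test z x y))

theorem Inst.OK.n_lt {I : Inst w} (h : I.OK) : I.n + 1 < 2 ^ w :=
  h.lt_of_le_Z (by have := h.n_lt_Z; omega)

theorem Inst.OK.sgn_lt_two_pow {I : Inst w} (h : I.OK) (x : BitVec w) : sgn x < 2 ^ w := by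
  have := sgn_lt h.w_pos x
  have := h.lt_of_le_Z (x := 2) (by have := h.n_lt_Z; omega)
  omega

theorem yChain_runs {I : Inst w} (h : I.OK) {rep : Bool} {s : State w} (hE : QEnv I rep s)
    {z x : ℕ} {P : Prop} (h17 : s.get 17 = I.xs z) (h34 : s.get 34 = I.xs x)
    (h35 : s.get 35 = I.xs z - I.xs x) (hs : YInv I s z x P 0 s) :
    Runs yChain s (500 * I.cand z x + 10) (YInv I s z x P (I.cand z x)) := by
  refine Runs.mono (Runs.while (YInv I s z x P) (I.cand z x) (fun _ => 480) hs (fun s' hI => ?_)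
    fun j hj s' hI => ?_) ?_ fun _ h => h
  · have := hI.ptr
    rw [show I.cand z x = (I.cands z x).length from rfl, List.drop_length] at this
    exact this
  · have hj' : j < (I.cands z x).length := hj
    have hp := hI.ptr
    rw [ptr_drop hj'] at hp
    have hlt : (I.cands z x)[j] < I.n := (mem_chain.1 (List.getElem_mem hj')).1
    have hpw : (I.cands z x)[j] < 2 ^ w := by have := h.n_lt; omega
    have hp1 : Ev s' (V 36) ((I.cands z x)[j] + 1) := Ev.var hp
    refine ⟨(hp1.ne_zero_iff (by have := h.n_lt; omega)).2 (by omega), ?_⟩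
    have hE' := hE.agree hI.agree (by decide) (by decide)
    refine Runs.block_agree hI.agree (by decide) (by decide) ?_
    have g17 := (hI.agree.1 17 (by decide)).trans h17
    have g34 := (hI.agree.1 34 (by decide)).trans h34
    have g35 := (hI.agree.1 35 (by decide)).trans h35
    rw [exec_asg (v := I.xs (I.cands z x)[j]) (eval_ld_xs hE'.env.xs
      ((hp1.sub (Ev.lit 1) (by omega)).cast (Nat.add_sub_cancel _ _)) hpw)]
    set y := (I.cands z x)[j] with hy
    set s1 := s'.set 37 (I.xs y) with hs1
    have k17 : s1.get 17 = I.xs z := by simpa [hs1] using g17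
    have k34 : s1.get 34 = I.xs x := by simpa [hs1] using g34
    have k35 : s1.get 35 = I.xs z - I.xs x := by simpa [hs1] using g35
    have k37 : s1.get 37 = I.xs y := by simp [hs1]
    have k9 : s1.get 9 = BitVec.ofNat w (w - 1) := by simpa [hs1] using hE'.env.sg
    have ht : Ev s1 testE (b2n (I.Test z x y)) := by
      refine (Ev.beq_word (a := V 37) (b := V 35) k37 k35).band
        ((Ev.beq_word (a := V 34) (b := V 37) k34 k37).bnot.band
        ((Ev.beq_word (a := V 34) (b := V 17) k34 k17).bnot.band
        ((Ev.beq_word (a := V 37) (b := V 17) k37 k17).bnot.band (((Ev.beq (Ev.sgn (e := V 34) k9 k34)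
          (Ev.sgn (e := V 37) k9 k37) (h.sgn_lt_two_pow _) (h.sgn_lt_two_pow _)).band (Ev.beq (Ev.sgn (e := V 17) k9 k17)
            (Ev.sgn (e := V 34) k9 k34) (h.sgn_lt_two_pow _) (h.sgn_lt_two_pow _)).bnot).bnot))))
    rw [exec_asg_nat (Ev.bor (Ev.var (by simpa [hs1] using hI.found)) ht),
      exec_asg_nat (Ev.ld (by simpa [hs1] using hE'.m2) (((Ev.var (x := y + 1)
        (by simpa [hs1] using hp)).sub (Ev.lit 1) (by omega)).cast (Nat.add_sub_cancel _ _)) hpw),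
      exec_nil]
    intro hA
    refine ⟨hA, ?_, ?_⟩
    · have := link_drop (key := I.hh) (m := I.n) hj'
      simp only [State.get_set, if_true]
      exact congrArg _ this
    · simp only [State.get_set, Nat.reduceEqDiff, if_false, if_true]
      congr 1
      refine b2n_congr ?_
      rw [← List.take_concat_get' _ _ hj']
      simp only [List.mem_append, List.mem_singleton, or_and_right, exists_or, exists_eq_left]
      rw [or_assoc]
  · simp only [Finset.sum_const, Finset.card_range, smul_eq_mul, Expr.cost]
    omega

structure XInv (I : Inst w) (rep : Bool) (s₀ : State w) (z key : ℕ) (P : Prop) (j : ℕ)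
    (s : State w) : Prop where
  agree : Agree [33, 34, 35, 36, 37, 39] [] s₀ s
  ptr : s.get 33 = BitVec.ofNat w (ptr ((chain (I.akey rep) I.n key).drop j))
  found : s.get 39 = BitVec.ofNat w
    (b2n (P ∨ ∃ x ∈ (chain (I.akey rep) I.n key).take j, I.Valid z x))

theorem sum_range_getElem (l : List ℕ) (f : ℕ → ℕ) (g : ℕ → ℕ)
    (hg : ∀ j (hj : j < l.length), g j = f l[j]) :
    ∑ j ∈ Finset.range l.length, g j = (l.map f).sum := by
  induction l generalizing g with
  | nil => simp
  | cons a l ih =>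
    rw [List.length_cons, Finset.sum_range_succ', List.map_cons, List.sum_cons, Nat.add_comm,
      hg 0 (by simp), ih (fun j => g (j + 1)) fun j hj => hg (j + 1) (by simpa using hj)]
    rfl

theorem xChain_runs {I : Inst w} (h : I.OK) {rep : Bool} {s : State w} (hE : QEnv I rep s)
    {z key : ℕ} {P : Prop} (h17 : s.get 17 = I.xs z) (hs : XInv I rep s z key P 0 s) :
    Runs xChain s (600 * ((chain (I.akey rep) I.n key).map fun x => 1 + I.cand z x).sum + 10)
      (XInv I rep s z key P (chain (I.akey rep) I.n key).length) := by
  set l := chain (I.akey rep) I.n key with hl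
  have hsum := sum_range_getElem l (fun x => 1 + I.cand z x)
    (fun j => 1 + I.cand z (l.getD j 0)) fun j hj => by rw [List.getD_eq_getElem _ _ hj]
  refine Runs.mono (Runs.while (XInv I rep s z key P) l.length
    (fun j => 500 * I.cand z (l.getD j 0) + 150) hs
    (fun s' hI => ?_) fun j hj s' hI => ?_) ?_ fun _ h => h
  · have := hI.ptr
    rw [← hl, List.drop_length] at this
    exact this
  · have hp := hI.ptr
    rw [← hl, ptr_drop hj] at hp
    rw [List.getD_eq_getElem _ _ hj]
    have hlt : l[j] < I.n := (mem_chain.1 (List.getElem_mem hj)).1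
    have hpw : l[j] < 2 ^ w := by have := h.n_lt; omega
    have hp1 : Ev s' (V 33) (l[j] + 1) := Ev.var hp
    refine ⟨(hp1.ne_zero_iff (by have := h.n_lt; omega)).2 (by omega), ?_⟩
    have hE' := hE.agree hI.agree (by decide) (by decide)
    have g17 := (hI.agree.1 17 (by decide)).trans h17
    set x := l[j] with hx
    have hhw : hash I.m I.k (I.xs z - I.xs x) < 2 ^ w := h.lt_of_le_Z (by
      have := h.hash_lt (I.xs z - I.xs x); have := h.SS_le; omega)
    set P' := P ∨ ∃ x ∈ l.take j, I.Valid z x with hP'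
    refine Runs.mono (Runs.seq (k₁ := 60) (k₂ := 500 * I.cand z x + 10 + 30 + 1)
      (Q := fun s1 => Agree [34, 35, 36] [] s' s1 ∧ s1.get 34 = I.xs x ∧
        s1.get 35 = I.xs z - I.xs x ∧ YInv I s1 z x P' 0 s1) ?_ fun s1 hs1 =>
      Runs.seq (yChain_runs h (P := P') (x := x) (hE'.agree hs1.1 (by decide) (by decide))
        ((hs1.1.1 17 (by decide)).trans g17) hs1.2.1 hs1.2.2.1 hs1.2.2.2) fun s2 hs2 => ?_)
      (by omega) fun _ h => h
    · refine Runs.block_agree (Agree.refl [34, 35, 36] [] s') (by decide) (by decide) ?_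
      have hsub : (V 17 - V 34).eval (s'.set 34 (I.xs x)) = I.xs z - I.xs x := by
        show (s'.set 34 (I.xs x)).get 17 - (s'.set 34 (I.xs x)).get 34 = _
        simp [g17]
      rw [exec_asg (v := I.xs x) (eval_ld_xs hE'.env.xs
          ((hp1.sub (Ev.lit 1) (by omega)).cast (Nat.add_sub_cancel _ _)) hpw),
        exec_asg hsub,
        exec_asg_nat (Ev.ld (by simpa using hE'.m1) (Ev.hash (x := I.xs z - I.xs x)
          (by simpa using hE'.env.m) (by simpa using hE'.env.k) h.k_le (by simp [Expr.eval])) hhw),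
        exec_nil]
      intro hA
      refine ⟨hA, by simp, by simp, Agree.refl _ _ _, ?_, ?_⟩
      · simp [last_eq_ptr, Inst.cands]
      · have := hI.found
        rw [← hl] at this
        simpa [hP'] using this
    · have hA := hs1.1.mono (rs' := [33, 34, 35, 36, 37, 39]) (as' := []) (by decide) (by decide)
      have hB := hs2.agree.mono (rs' := [33, 34, 35, 36, 37, 39]) (as' := []) (by decide)
        (by decide)
      have hC := hI.agree.trans (hA.trans hB)
      have g33 : s2.get 33 = BitVec.ofNat w (x + 1) := by
        rw [hs2.agree.1 33 (by decide), hs1.1.1 33 (by decide), hp]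
      refine Runs.block_agree hC (by decide) (by decide) ?_
      rw [exec_asg_nat (Ev.ld (hE.agree hC (by decide) (by decide)).m8
        (((Ev.var g33).sub (Ev.lit 1) (by omega)).cast (Nat.add_sub_cancel _ _)) hpw), exec_nil]
      intro hD
      refine ⟨hD, ?_, ?_⟩
      · have := link_drop (key := I.akey rep) (m := I.n) (k := key) hj
        simp only [State.get_set, if_true]
        exact congrArg _ this
      · have := hs2.found
        simp only [State.get_set, Nat.reduceEqDiff, if_false]
        rw [this]
        congr 1
        refine b2n_congr ?_
        rw [show I.cand z x = (I.cands z x).length from rfl, List.take_length, ← I.valid_iff, hP',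
          ← hl, ← List.take_concat_get' _ _ hj]
        simp only [List.mem_append, List.mem_singleton, or_and_right, exists_or, exists_eq_left]
        rw [or_assoc]
  · simp only [Expr.cost]
    rw [← hsum, Finset.mul_sum]
    refine Nat.add_le_add (Finset.sum_le_sum fun j _ => by omega) (by norm_num)

end WordRAM
end

noncomputable section
namespace WordRAM
variable {w : ℕ}

local notation "V" => Expr.var

/-! ### Posing a query -/

def qpre1 (rep : Bool) : List Instr :=
  [.asg 14 (V 27 / (V 10 * .lit 8)), .asg 15 (V 27 / .lit 8 % V 10), .asg 16 (V 27 % .lit 8),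
    .asg 17 (.ld 0 (V 14)), .asg 18 ((hashE (V 17) + V 7 - V 16 % .lit 2) % V 7),
    .asg 19 (V 16 / .lit 2 % .lit 2), .asg 20 (V 18 % V 3 + V 3 * V 19), .asg 21 (.ld 5 (V 15)),
    .asg 22 ((V 18 / V 3 + .lit 2 * V 4 - V 21 % V 4 - V 19) % V 4 + V 4 * (V 16 / .lit 4)),
    .asg 23 (.bin .eq (V 21 / V 4) (V 16 / .lit 4) *
      notE (.bin .eq (sgnE (V 17)) (V 16 / .lit 4))),
    .asg 24 (bif rep then .lit 0 else .bin .eq (V 21) (V 22))]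

/-- Variables 40, 41 and arrays 22, 23 are the registers 0, 1 and the arrays 2, 3 of the embedded
query program. The choice between the dummy and the proper first pattern is made arithmetically with
the flag in variable 25. -/
def qpre2 : List Instr :=
  [.asg 25 (orE (V 23) (V 24)),
    .asg 26 ((.lit 1 + V 15 * (.lit 2 * V 2) + V 20 / V 2) * notE (V 25) + V 12 * V 25),
    .asg 29 (V 11 + (V 22 * V 2 + V 20 % V 2)),
    .sto 22 (.lit 0) (V 26), .sto 23 (.lit 0) (V 29), .asg 40 (.lit 1), .asg 41 (.lit 1)]

/-- The quantities that are computed before a query. -/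
structure QVars (I : Inst w) (rep : Bool) (q : ℕ) (s : State w) : Prop where
  κ : s.get 15 = BitVec.ofNat w (I.qκ q)
  z : s.get 17 = I.xs (I.zi q)
  sum : s.get 20 = BitVec.ofNat w (I.qV q)
  bad : s.get 23 = BitVec.ofNat w (b2n (I.bad q))
  same : s.get 24 = BitVec.ofNat w (b2n (rep = false ∧ I.qi q = I.qj q))

theorem QVars.agree {I : Inst w} {rep : Bool} {q : ℕ} {s s' : State w} {rs as : List ℕ}
    (h : QVars I rep q s) (hA : Agree rs as s s')
    (hr : rs.all (fun r => r ≠ 15 ∧ r ≠ 17 ∧ r ≠ 20 ∧ r ≠ 23 ∧ r ≠ 24) = true) :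
    QVars I rep q s' := by
  have h1 : ∀ r, ¬ (r ≠ 15 ∧ r ≠ 17 ∧ r ≠ 20 ∧ r ≠ 23 ∧ r ≠ 24) → s'.get r = s.get r :=
    fun r h10 => hA.1 r fun hr' => by
      have := List.all_eq_true.1 hr r hr'
      simp only [decide_eq_true_eq] at this
      exact h10 this
  exact ⟨(h1 _ (by decide)).trans h.κ, (h1 _ (by decide)).trans h.z, (h1 _ (by decide)).trans h.sum,
    (h1 _ (by decide)).trans h.bad, (h1 _ (by decide)).trans h.same⟩

theorem Inst.OK.nq_le {I : Inst w} (h : I.OK) : I.nq ≤ 8 * I.Z := by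
  have h1 := h.mono 2 0 0 (by norm_num) (by norm_num) (by norm_num)
  simp only [pow_zero, mul_one] at h1
  have h2 : I.n * (I.K * 8) ≤ (I.n + 1) * ((I.n + 1) * 8) := by
    have := I.K_le
    gcongr <;> omega
  unfold Inst.nq
  nlinarith

theorem qpre1_runs {I : Inst w} (h : I.OK) {rep : Bool} {s : State w} (hE : QEnv I rep s) {q : ℕ}
    (hq : q < I.nq) (h27 : s.get 27 = BitVec.ofNat w q) :
    Runs (block (qpre1 rep)) s 350 fun s' =>
      Agree [14, 15, 16, 17, 18, 19, 20, 21, 22, 23, 24] [] s s' ∧ QVars I rep q s' ∧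
        s'.get 22 = BitVec.ofNat w (I.qj q) := by
  refine Runs.block_agree (Agree.refl [14, 15, 16, 17, 18, 19, 20, 21, 22, 23, 24] [] s)
    (by cases rep <;> decide) (by cases rep <;> decide) ?_
  have hZ := h.n_lt_Z
  have hqw : q < 2 ^ w := h.lt_of_le_Z (by have := h.nq_le; omega)
  have hK := I.K_le
  have hKw : I.K * 8 < 2 ^ w := h.lt_of_le_Z (by omega)
  have hKw' : I.K < 2 ^ w := by omega
  have hzw : I.zi q < 2 ^ w := (Nat.div_le_self _ _).trans_lt hqw
  have h8 : 8 < 2 ^ w := h.lt_of_le_Z (by omega)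
  have hSle := h.SS_le
  have hSw : I.SS < 2 ^ w := h.lt_of_le_Z (by omega)
  have hh := h.hh_lt (I.zi q)
  have hsumw : I.hh (I.zi q) + I.SS - q % 8 % 2 < 2 ^ w := h.lt_of_le_Z (by omega)
  have hQw : I.QQ < 2 ^ w := h.lt_of_le_Z (by have := h.QQ_le; omega)
  have hRle := h.RR_le
  have hRw : I.RR < 2 ^ w := h.lt_of_le_Z (by omega)
  have hvw : I.qv q < 2 ^ w := (h.qv_lt q).trans hSw
  have hκw : I.qκ q < 2 ^ w := (h.qκ_lt hq).trans hKw'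
  have hiw : I.qi q < 2 ^ w := h.lt_of_le_Z (by have := h.bkt_lt (I.qκ q); unfold Inst.qi; omega)
  have hvd : I.qv q / I.QQ < I.RR := (Nat.div_lt_iff_lt_mul h.QQ_pos).2 (h.qv_lt q)
  have him := Nat.mod_lt (I.qi q) h.RR_pos
  have hR := h.RR_pos
  have hjw : I.qj q < 2 ^ w := h.lt_of_le_Z (by have := h.qj_lt q; omega)
  have aux : ∀ a b c : ℕ, a < I.RR → b < I.RR → c < 2 → b ≤ a + 2 * I.RR ∧
      c ≤ a + 2 * I.RR - b ∧ a + 2 * I.RR - b - c ≤ 64 * I.Z := fun a b c h1 h2 h3 => by omega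
  obtain ⟨x1, x2, x3⟩ := aux _ _ _ hvd him (Nat.mod_lt (q % 8 / 2) two_pos)
  have hid : I.qi q / I.RR < 2 ^ w := (Nat.div_le_self _ _).trans_lt hiw
  unfold qpre1
  rw [exec_asg_nat (v := I.zi q) ((Ev.var h27).div ((Ev.var hE.K).mul (Ev.lit 8)) hqw hKw),
    exec_asg_nat (v := I.qκ q) (((Ev.var (by simpa using h27)).div (Ev.lit 8) hqw h8).mod
      (Ev.var (by simpa using hE.K)) ((Nat.div_le_self _ _).trans_lt hqw) hKw'),
    exec_asg_nat (v := q % 8) ((Ev.var (by simpa using h27)).mod (Ev.lit 8) hqw h8),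
    exec_asg (v := I.xs (I.zi q)) (eval_ld_xs (by simpa using hE.env.xs) (Ev.var (by simp)) hzw),
    exec_asg_nat (v := I.qv q) ((((Ev.hash (x := I.xs (I.zi q)) (by simpa using hE.env.m)
      (by simpa using hE.env.k) h.k_le (by simp [Expr.eval])).add
        (Ev.var (by simpa using hE.env.SS))).sub ((Ev.var (x := q % 8) (by simp)).mod (Ev.lit 2)
          (by omega) (by omega)) (by omega)).mod (Ev.var (by simpa using hE.env.SS)) hsumw hSw),
    exec_asg_nat (v := q % 8 / 2 % 2) (((Ev.var (x := q % 8) (by simp)).div (Ev.lit 2) (by omega)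
      (by omega)).mod (Ev.lit 2) (by omega) (by omega)),
    exec_asg_nat (v := I.qV q) (((Ev.var (x := I.qv q) (by simp)).mod
      (Ev.var (by simpa using hE.env.QQ)) hvw hQw).add ((Ev.var (by simpa using hE.env.QQ)).mul
        (Ev.var (x := q % 8 / 2 % 2) (by simp)))),
    exec_asg_nat (v := I.qi q) (Ev.ld (g := I.bkt) (by simpa using hE.m5) (Ev.var (x := I.qκ q) (by simp)) hκw),
    exec_asg_nat (v := I.qj q) ((((((Ev.var (x := I.qv q) (by simp)).div
      (Ev.var (by simpa using hE.env.QQ)) hvw hQw).add ((Ev.lit 2).mul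
        (Ev.var (by simpa using hE.env.RR)))).sub ((Ev.var (x := I.qi q) (by simp)).mod
          (Ev.var (by simpa using hE.env.RR)) hiw hRw) x1).sub
            (Ev.var (x := q % 8 / 2 % 2) (by simp)) x2).mod
              (Ev.var (by simpa using hE.env.RR)) (h.lt_of_le_Z x3) hRw |>.add
                ((Ev.var (by simpa using hE.env.RR)).mul ((Ev.var (x := q % 8) (by simp)).div
                  (Ev.lit 4) (by omega) (by omega)))),
    exec_asg_nat (v := b2n (I.bad q)) ((Ev.beq ((Ev.var (x := I.qi q) (by simp)).div
      (Ev.var (by simpa using hE.env.RR)) hiw hRw) ((Ev.var (x := q % 8) (by simp)).div (Ev.lit 4)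
        (by omega) (by omega)) hid (by omega)).band (Ev.beq
          (Ev.sgn (x := I.xs (I.zi q)) (by simpa using hE.env.sg) (by simp [Expr.eval]))
          ((Ev.var (x := q % 8) (by simp)).div (Ev.lit 4) (by omega) (by omega))
          (h.sgn_lt_two_pow _) (by omega)).bnot),
    exec_asg_nat (v := b2n (rep = false ∧ I.qi q = I.qj q)) (by
      cases rep
      · exact (Ev.beq (Ev.var (x := I.qi q) (by simp)) (Ev.var (x := I.qj q) (by simp)) hiw
          hjw).cast (b2n_congr (by simp))
      · exact (Ev.lit 0).cast (b2n_false (by simp)).symm), exec_nil]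
  intro hA
  refine ⟨hA, ⟨?_, ?_, ?_, ?_, ?_⟩, ?_⟩ <;> simp

theorem State.inner_set_zero (s : State w) (v : BitVec w) :
    (s.set 40 v).inner = s.inner.setReg 0 v := State.inner_set s 0 v

theorem State.inner_set_one (s : State w) (v : BitVec w) :
    (s.set 41 v).inner = s.inner.setReg 1 v := State.inner_set s 1 v

theorem State.inner_setMem_two (s : State w) (i v : BitVec w) :
    (s.setMem 22 i v).inner = s.inner.setMem 2 i v := State.inner_setMem s 2 i v

theorem State.inner_setMem_three (s : State w) (i v : BitVec w) :
    (s.setMem 23 i v).inner = s.inner.setMem 3 i v := State.inner_setMem s 3 i v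

open Classical in
theorem qpre2_runs {I : Inst w} (h : I.OK) {rep : Bool} {s : State w} (hE : QEnv I rep s) {q : ℕ}
    (hV : QVars I rep q s) (h22 : s.get 22 = BitVec.ofNat w (I.qj q)) :
    Runs (block qpre2) s 200 fun s' =>
      Agree [25, 26, 29, 40, 41] [22, 23] s s' ∧
        s'.inner = queryInput (I.query rep q) s.inner := by
  refine Runs.block_agree (Agree.refl [25, 26, 29, 40, 41] [22, 23] s) (by decide) (by decide) ?_
  have hTw : I.TT < 2 ^ w := h.lt_of_le_Z (by have := h.TT_le; omega)
  have hVw : I.qV q < 2 ^ w := h.lt_of_le_Z (by have := h.qV_lt q; have := h.QQ_le; omega)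
  unfold qpre2
  rw [exec_asg_nat (v := b2n (I.hide rep q)) (Ev.bor (Ev.var hV.bad) (Ev.var hV.same)),
    exec_asg_nat (v := (1 + I.qκ q * (2 * I.TT) + I.qV q / I.TT) * b2n (¬ I.hide rep q) +
      I.DUM * b2n (I.hide rep q))
      (((((Ev.lit 1).add ((Ev.var (by simpa using hV.κ)).mul ((Ev.lit 2).mul
        (Ev.var (by simpa using hE.env.TT))))).add ((Ev.var (by simpa using hV.sum)).div
          (Ev.var (by simpa using hE.env.TT)) hVw hTw)).mul (Ev.bnot (P := I.hide rep q)
            (Ev.var (by simp)))).add ((Ev.var (by simpa using hE.DUM)).mul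
              (Ev.var (x := b2n (I.hide rep q)) (by simp)))),
    exec_asg_nat (v := I.CB + (I.qj q * I.TT + I.qV q % I.TT))
      ((Ev.var (by simpa using hE.CB)).add (((Ev.var (by simpa using h22)).mul
        (Ev.var (by simpa using hE.env.TT))).add ((Ev.var (by simpa using hV.sum)).mod
          (Ev.var (by simpa using hE.env.TT)) hVw hTw))),
    exec_sto (Ev.lit 0) (Ev.var (x := (1 + I.qκ q * (2 * I.TT) + I.qV q / I.TT) *
      b2n (¬ I.hide rep q) + I.DUM * b2n (I.hide rep q)) (by simp)),
    exec_sto (Ev.lit 0) (Ev.var (x := I.CB + (I.qj q * I.TT + I.qV q % I.TT)) (by simp)),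
    exec_asg_nat (Ev.lit 1), exec_asg_nat (Ev.lit 1), exec_nil]
  intro hA
  refine ⟨hA, ?_⟩
  rw [State.inner_set_one, State.inner_set_zero, State.inner_setMem_three, State.inner_setMem_two,
    State.inner_set_of_lt _ (by norm_num), State.inner_set_of_lt _ (by norm_num),
    State.inner_set_of_lt _ (by norm_num)]
  have h1 : (1 + I.qκ q * (2 * I.TT) + I.qV q / I.TT) * b2n (¬ I.hide rep q) +
      I.DUM * b2n (I.hide rep q) = if I.hide rep q then I.DUM else
        1 + I.qκ q * (2 * I.TT) + I.qV q / I.TT := by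
    by_cases hh : I.hide rep q
    · rw [b2n_false (by simpa using hh), b2n_true hh, if_pos hh]; ring
    · rw [b2n_false hh, b2n_true hh, if_neg hh]; ring
  rw [h1]
  unfold queryInput Inst.query words
  simp only [List.map_cons, List.map_nil, State.writeArr_singleton, List.length_singleton]
  rfl

/-! ### Evaluating the answer -/

structure VInv (I : Inst w) (rep : Bool) (s₀ : State w) (z : ℕ) (ks : List ℕ) (j : ℕ)
    (s : State w) : Prop where
  agree : Agree [31, 32, 33, 34, 35, 36, 37, 39] [] s₀ s
  idx : s.get 31 = BitVec.ofNat w j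
  found : s.get 39 = BitVec.ofNat w
    (b2n (∃ key ∈ ks.take j, ∃ x ∈ chain (I.akey rep) I.n key, I.Valid z x))

theorem verify_runs {I : Inst w} (h : I.OK) {rep : Bool} {s : State w} (hE : QEnv I rep s)
    {z : ℕ} (h17 : s.get 17 = I.xs z) {ks : List ℕ} (h30 : s.get 30 = BitVec.ofNat w ks.length)
    (hlen : ks.length < 2 ^ w) (hkw : ∀ key ∈ ks, key < 2 ^ w)
    (hkey : ∀ j (hj : j < ks.length) (s' : State w),
      Agree [31, 32, 33, 34, 35, 36, 37, 39] [] s s' → s'.get 31 = BitVec.ofNat w j →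
        Ev s' (keyE rep) ks[j]) (hs : VInv I rep s z ks 0 s) :
    Runs (verify rep) s (600 * (ks.map fun key =>
      ((chain (I.akey rep) I.n key).map fun x => 1 + I.cand z x).sum).sum + 150 * ks.length + 20)
      (VInv I rep s z ks ks.length) := by
  have hcond : ∀ j ≤ ks.length, ∀ s', VInv I rep s z ks j s' →
      Ev s' (.bin .lt (V 31) (V 30)) (if j < ks.length then 1 else 0) := fun j hj s' hI =>
    Ev.lt (Ev.var hI.idx) (Ev.var ((hI.agree.1 30 (by decide)).trans h30)) (by omega) hlen
  set F : ℕ → ℕ := fun key => ((chain (I.akey rep) I.n key).map fun x => 1 + I.cand z x).sum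
    with hF
  have hsum := sum_range_getElem ks F (fun j => F (ks.getD j 0)) fun j hj => by
    rw [List.getD_eq_getElem _ _ hj]
  refine Runs.mono (Runs.while (VInv I rep s z ks) ks.length
    (fun j => 600 * F (ks.getD j 0) + 110) hs
    (fun s' hI => ?_) fun j hj s' hI => ⟨?_, ?_⟩) ?_ fun _ h => h
  · have := hcond _ le_rfl s' hI
    rw [if_neg (lt_irrefl _)] at this
    exact this.eq_zero
  · have := hcond j hj.le s' hI
    rw [if_pos hj] at this
    exact (this.ne_zero_iff (by omega)).2 one_ne_zero
  · rw [List.getD_eq_getElem _ _ hj]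
    have hk := hkey j hj s' hI.agree hI.idx
    have hkj := hkw _ (List.getElem_mem hj)
    have hE' := hE.agree hI.agree (by decide) (by decide)
    have g17 := (hI.agree.1 17 (by decide)).trans h17
    set key := ks[j] with hkeydef
    set P := ∃ key ∈ ks.take j, ∃ x ∈ chain (I.akey rep) I.n key, I.Valid z x with hP
    refine Runs.mono (Runs.seq (k₁ := 60) (k₂ := 600 * F key + 10 + 20 + 1)
      (Q := fun s1 => Agree [32, 33] [] s' s1 ∧ XInv I rep s1 z key P 0 s1) ?_ fun s1 hs1 =>
      Runs.seq (xChain_runs h (hE'.agree hs1.1 (by decide) (by decide))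
        ((hs1.1.1 17 (by decide)).trans g17) hs1.2) fun s2 hs2 => ?_)
      (by omega) fun _ h => h
    · refine Runs.block_agree (Agree.refl [32, 33] [] s') (by cases rep <;> decide)
        (by cases rep <;> decide) ?_
      rw [exec_asg_nat hk, exec_asg_nat (Ev.ld (by simpa using hE'.m7) (Ev.var (x := key) (by simp))
        hkj), exec_nil]
      intro hA
      refine ⟨hA, Agree.refl _ _ _, ?_, ?_⟩
      · simp [last_eq_ptr]
      · simpa using hI.found
    · have hA := hs1.1.mono (rs' := [31, 32, 33, 34, 35, 36, 37, 39]) (as' := []) (by decide)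
        (by decide)
      have hB := hs2.agree.mono (rs' := [31, 32, 33, 34, 35, 36, 37, 39]) (as' := []) (by decide)
        (by decide)
      have hC := hI.agree.trans (hA.trans hB)
      have g31 : s2.get 31 = BitVec.ofNat w j := by
        rw [hs2.agree.1 31 (by decide), hs1.1.1 31 (by decide), hI.idx]
      refine Runs.block_agree hC (by decide) (by decide) ?_
      rw [exec_asg_nat ((Ev.var g31).add (Ev.lit 1)), exec_nil]
      intro hD
      refine ⟨hD, by simp, ?_⟩
      have := hs2.found
      simp only [State.get_set, Nat.reduceEqDiff, if_false]
      rw [this]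
      congr 1
      refine b2n_congr ?_
      rw [List.take_length, hP, ← List.take_concat_get' _ _ hj]
      simp only [List.mem_append, List.mem_singleton, or_and_right, exists_or, exists_eq_left]
      rfl
  · simp only [Expr.cost]
    rw [← hsum, Finset.mul_sum, Finset.sum_add_distrib, Finset.sum_add_distrib]
    simp only [Finset.sum_const, Finset.card_range, smul_eq_mul]
    omega

end WordRAM
end

/-! ### The numbers checked after an answer -/

noncomputable section
namespace WordRAM
variable {w : ℕ}

local notation "V" => Expr.var

/-- The output that is used: whether documents are selected, or all of them. -/
def Reads (rep : Bool) (R : Query → Str → Prop) (X : List Str) (q : Query) (s : State w) : Prop :=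
  bif rep then ∃ l : List ℕ, l.Nodup ∧ (∀ i, i ∈ l ↔ i ∈ answer R X q) ∧
    (s.reg 0).toNat = l.length ∧
    ∀ j (hj : j < l.length), s.mem 4 (BitVec.ofNat w j) = BitVec.ofNat w l[j]
  else (s.reg 0 ≠ 0 ↔ (answer R X q).Nonempty)

namespace Inst.OK

variable {I : Inst w} (h : I.OK) (rep forb : Bool)
include h

omit h in
theorem sum_map_chain (key : ℕ → ℕ) (m : ℕ) (g : ℕ → ℕ) {ks : List ℕ} (hks : ks.Nodup) :
    (ks.map fun k => ((chain key m k).map g).sum).sum =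
      ∑ x ∈ (Finset.range m).filter (fun x => key x ∈ ks), g x := by
  classical
  have h1 : ∀ k, ((chain key m k).map g).sum =
      ∑ x ∈ (Finset.range m).filter (fun x => key x = k), g x := fun k => by
    rw [← chain_toFinset, List.sum_toFinset _ (chain_nodup key m k)]
  simp only [h1]
  rw [← List.sum_toFinset _ hks, ← Finset.sum_fiberwise_of_maps_to
    (t := ks.toFinset) (g := key) (fun x hx => List.mem_toFinset.2 (Finset.mem_filter.1 hx).2)]
  refine Finset.sum_congr rfl fun k hk => Finset.sum_congr ?_ fun _ _ => rfl
  ext x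
  simp only [Finset.mem_filter, Finset.mem_range]
  rw [List.mem_toFinset] at hk
  constructor
  · rintro ⟨a, rfl⟩; exact ⟨⟨a, hk⟩, rfl⟩
  · rintro ⟨⟨a, -⟩, b⟩; exact ⟨a, b⟩

/-- The keys are distinct, so the lists that are traversed are disjoint and no number is checked
twice. -/
theorem walkCost_eq {q : ℕ} {ks : List ℕ} (hks : ks.Nodup)
    (hW : ∀ x < I.n, I.akey rep x ∈ ks ↔ I.Walked rep q x) :
    (ks.map fun key => ((chain (I.akey rep) I.n key).map fun x =>
      1 + I.cand (I.zi q) x).sum).sum = I.walkCost rep q ∧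
    ((∃ key ∈ ks, ∃ x ∈ chain (I.akey rep) I.n key, I.Valid (I.zi q) x) ↔ I.Wins rep q) := by
  classical
  constructor
  · rw [sum_map_chain _ _ _ hks]
    refine Finset.sum_congr ?_ fun _ _ => rfl
    ext x
    rw [h.mem_walkedSet, Finset.mem_filter, Finset.mem_range]
    exact ⟨fun hx => (hW x hx.1).1 hx.2, fun hx => ⟨hx.1, (hW x hx.1).2 hx⟩⟩
  · constructor
    · rintro ⟨key, hk, x, hxc, hv⟩
      obtain ⟨hx, rfl⟩ := mem_chain.1 hxc
      exact ⟨x, (hW x hx).1 hk, hv⟩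
    · rintro ⟨x, hx, hv⟩
      exact ⟨_, (hW x hx.1).2 hx, x, mem_chain.2 ⟨hx.1, rfl⟩, hv⟩

omit h in
theorem walked_false_iff {q x : ℕ} (hx : x < I.n) : I.Walked false q x ↔
    I.ch x = I.qκ q ∧ ¬ I.bad q ∧ (I.qi q = I.qj q ∨ (I.hits false q).Nonempty) := by
  simp [Inst.Walked, hx]

/-- For fixed α a reported document and the low digit of x determine each other; so the keys
computed from the output describe the numbers that share chunk and low digit with a hit. -/
theorem walked_true_iff {q x : ℕ} (hq : q < I.nq) (hx : x < I.n) {l : List ℕ}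
    (hl : ∀ u, u ∈ l ↔ u ∈ answer (selects forb) (I.docs forb) (I.query true q)) :
    I.akey true x ∈ l.map (fun u => I.qκ q * I.QQ +
      (u + I.qV q / I.TT * I.TT - 2 * I.QQ)) ↔ I.Walked true q x := by
  have hx2 := h.h2_lt x
  rw [List.mem_map]
  simp only [hl, h.mem_answer_query true forb hq]
  constructor
  · rintro ⟨u, ⟨p, hp, hpu⟩, hk⟩
    rw [hpu, Nat.add_sub_cancel] at hk
    obtain ⟨h1, h2⟩ := (mul_add_inj (h.h2_lt p.1) hx2).1 hk
    exact ⟨hx, h1.symm, p, hp, h2⟩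
  · rintro ⟨-, hc, p, hp, hpx⟩
    obtain ⟨-, -, -, -, -, hx0, -⟩ := (h.mem_hits true).1 hp
    have hd := (h.docA_bounds (h.qα_lt q) hx0).1
    refine ⟨I.docA p.1 (I.qV q / I.TT), ⟨p, hp, hd⟩, ?_⟩
    rw [hd, Nat.add_sub_cancel, hpx, ← hc]
    rfl

end Inst.OK

/-! ### The loop over the queries -/

/-- Variable 30 is the number of lists to traverse: the number of reported documents, or in the
decision version 1 or 0. In the latter case the chunk is checked if the answer is positive or the
buckets agree, unless the sum overflows. -/
def qmid (rep : Bool) : List Instr :=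
  [.asg 30 (bif rep then V 40 else
    notE (.bin .eq (V 40) (.lit 0) * notE (V 24)) * notE (V 23)), .asg 31 (.lit 0)]

def evaluate (rep : Bool) : Prog :=
  .seq (block (qmid rep)) (.seq (verify rep) (block [.asg 27 (V 27 + .lit 1)]))

theorem VInv.start {I : Inst w} {rep : Bool} {s : State w} {z : ℕ} {ks : List ℕ}
    (h31 : s.get 31 = BitVec.ofNat w 0) (h39 : s.get 39 = BitVec.ofNat w 0) :
    VInv I rep s z ks 0 s :=
  ⟨Agree.refl _ _ _, h31, by rw [h39, b2n_false (by simp)]⟩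

theorem evaluate_runs {I : Inst w} (h : I.OK) {rep forb : Bool} {s : State w}
    (hE : QEnv I rep s) {q : ℕ} (hq : q < I.nq) (hV : QVars I rep q s)
    (h27 : s.get 27 = BitVec.ofNat w q) (h39 : s.get 39 = BitVec.ofNat w 0)
    (hR : Reads rep (selects forb) (I.docs forb) (I.query rep q) s.inner) :
    Runs (evaluate rep) s (600 * I.walkCost rep q + 150 * (I.hits rep q).card + 300) fun s' =>
      Agree [27, 30, 31, 32, 33, 34, 35, 36, 37, 39] [] s s' ∧
        s'.get 27 = BitVec.ofNat w (q + 1) ∧ s'.get 39 = BitVec.ofNat w (b2n (I.Wins rep q)) := by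
  classical
  have hn := h.n_lt
  -- the list of keys
  have key : ∃ ks : List ℕ, ks.Nodup ∧ (∀ x < I.n, I.akey rep x ∈ ks ↔ I.Walked rep q x) ∧
      ks.length ≤ (I.hits rep q).card + 1 ∧ ks.length < 2 ^ w ∧ (∀ key ∈ ks, key < 2 ^ w) ∧
      Ev s (bif rep then V 40 else notE (.bin .eq (V 40) (.lit 0) * notE (V 24)) * notE (V 23))
        ks.length ∧
      ∀ s1 : State w, Agree [30, 31, 32, 33, 34, 35, 36, 37, 39] [] s s1 →
        ∀ j (hj : j < ks.length), s1.get 31 = BitVec.ofNat w j → Ev s1 (keyE rep) ks[j] := by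
    cases rep with
    | false =>
      have hR' : s.get 40 ≠ 0 ↔ (I.hits false q).Nonempty :=
        Iff.trans hR (h.answer_nonempty false forb hq)
      set P := ¬ (s.get 40 = 0 ∧ ¬ (false = false ∧ I.qi q = I.qj q)) ∧ ¬ I.bad q with hP
      have hP' : P ↔ ¬ I.bad q ∧ (I.qi q = I.qj q ∨ (I.hits false q).Nonempty) := by
        rw [hP, ← hR']; tauto
      have hlen : (if P then [I.qκ q] else []).length = b2n P := by
        by_cases hp : P <;> simp [hp, b2n]
      refine ⟨if P then [I.qκ q] else [], ?_, ?_, ?_, ?_, ?_, ?_, ?_⟩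
      · split_ifs <;> simp
      · intro x hx
        rw [Inst.OK.walked_false_iff hx, ← hP']
        show I.ch x ∈ _ ↔ _
        split_ifs with hp <;> simp [hp]
      · have := b2n_le P; omega
      · have := b2n_le P; omega
      · intro key hk
        have hκ := h.qκ_lt hq
        have := I.K_le
        split_ifs at hk with hp
        · simp only [List.mem_singleton] at hk; omega
        · simp at hk
      · rw [hlen]
        exact (((Ev.beq_word (a := V 40) (b := .lit 0) (u := s.get 40) rfl rfl).band
          (Ev.bnot (Ev.var hV.same))).bnot).band (Ev.bnot (Ev.var hV.bad))
      · intro s1 hA j hj _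
        have hall : ∀ a ∈ (if P then [I.qκ q] else []), a = I.qκ q := by
          intro a ha
          split_ifs at ha with hp
          · simpa using ha
          · simp at ha
        rw [hall _ (List.getElem_mem hj)]
        exact Ev.var ((hA.1 15 (by decide)).trans hV.κ)
    | true =>
      obtain ⟨l, hl1, hl2, hl3, hl4⟩ : ∃ l : List ℕ, l.Nodup ∧ (∀ i, i ∈ l ↔ i ∈ answer _ _ _) ∧
        (s.inner.reg 0).toNat = l.length ∧ ∀ j (hj : j < l.length),
          s.inner.mem 4 (BitVec.ofNat w j) = BitVec.ofNat w l[j] := hR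
      have hu : ∀ u ∈ l, ∃ p ∈ I.hits true q,
          u + I.qV q / I.TT * I.TT = I.h2 p.1 + 2 * I.QQ := fun u hu =>
        (h.mem_answer_query true forb hq).1 ((hl2 u).1 hu)
      -- Every reported u satisfies u + αT ≥ 2 QQ, so the truncated subtraction is injective on the
      -- output.
      have hinj : Set.InjOn (fun u => I.qκ q * I.QQ + (u + I.qV q / I.TT * I.TT - 2 * I.QQ))
          {u | u ∈ l} := by
        intro u hul v hvl huv
        obtain ⟨p, -, hp⟩ := hu u hul
        obtain ⟨p', -, hp'⟩ := hu v hvl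
        dsimp only at huv
        omega
      refine ⟨l.map fun u => I.qκ q * I.QQ + (u + I.qV q / I.TT * I.TT - 2 * I.QQ), ?_, ?_, ?_, ?_,
        ?_, ?_, ?_⟩
      · exact (List.nodup_map_iff_inj_on hl1).2 fun a ha b hb => hinj ha hb
      · exact fun x hx => h.walked_true_iff forb hq hx hl2
      · rw [List.length_map, ← List.toFinset_card_of_nodup hl1]
        refine le_trans ?_ (Nat.le_succ_of_le (h.answer_ncard_le true forb hq))
        rw [← Set.ncard_coe_finset]
        refine le_of_eq (congrArg _ (Set.ext fun i => ?_))
        simp [hl2]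
      · rw [List.length_map, ← hl3]; exact BitVec.isLt _
      · intro key hk
        obtain ⟨u, hul, rfl⟩ := List.mem_map.1 hk
        obtain ⟨p, hp, hpu⟩ := hu u hul
        obtain ⟨-, hx, -, hc, -⟩ := (h.mem_hits true).1 hp
        rw [hpu, Nat.add_sub_cancel, ← hc]
        exact h.akey_lt true hx
      · rw [List.length_map, ← hl3]
        show s.get 40 = _
        simp [State.inner]
      · intro s1 hA j hj h31
        rw [List.length_map] at hj
        rw [List.getElem_map]
        obtain ⟨p, -, hp⟩ := hu l[j] (List.getElem_mem hj)
        have hE1 := hE.agree hA (by decide) (by decide)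
        have hTw : I.TT < 2 ^ w := h.lt_of_le_Z (by have := h.TT_le; omega)
        have hVw : I.qV q < 2 ^ w := h.lt_of_le_Z (by have := h.qV_lt q; have := h.QQ_le; omega)
        have hld : Ev s1 (.ld 24 (V 31)) l[j] := by
          show s1.mem 24 (s1.get 31) = _
          rw [h31, hA.2 24 (by decide)]
          exact hl4 j hj
        have hV20 : Ev s1 (V 20) (I.qV q) := Ev.var ((hA.1 20 (by decide)).trans hV.sum)
        exact ((Ev.var ((hA.1 15 (by decide)).trans hV.κ)).mul (Ev.var hE1.env.QQ)).add
          ((hld.add ((hV20.div (Ev.var hE1.env.TT) hVw hTw).mul (Ev.var hE1.env.TT))).sub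
            ((Ev.lit 2).mul (Ev.var hE1.env.QQ)) (by omega))
  obtain ⟨ks, hnd, hW, hlen, hlw, hkw, h30, hkey⟩ := key
  obtain ⟨hc, hwin⟩ := h.walkCost_eq rep hnd hW
  refine Runs.mono (Runs.seq (k₁ := 60) (Q := fun s1 => Agree [30, 31] [] s s1 ∧
    s1.get 30 = BitVec.ofNat w ks.length ∧ s1.get 31 = BitVec.ofNat w 0 ∧
      s1.get 39 = BitVec.ofNat w 0) ?_ fun s1 hs1 =>
    Runs.seq (k₂ := 40) (verify_runs h (hE.agree hs1.1 (by decide) (by decide))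
      ((hs1.1.1 17 (by decide)).trans hV.z) hs1.2.1 hlw hkw
      (fun j hj s' hA h31 => hkey s' ((hs1.1.mono (by decide) (by decide)).trans
        (hA.mono (by decide) (by decide))) j hj h31) (VInv.start hs1.2.2.1 hs1.2.2.2))
    fun s2 hs2 => ?_) (by rw [hc]; omega) fun _ h => h
  · refine Runs.block_agree (Agree.refl [30, 31] [] s) (by cases rep <;> decide) (by cases rep <;> decide) ?_
    unfold qmid
    rw [exec_asg_nat h30, exec_asg_nat (Ev.lit 0), exec_nil]
    intro hA
    exact ⟨hA, by simp, by simp, by simpa using h39⟩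
  · have hA : Agree [27, 30, 31, 32, 33, 34, 35, 36, 37, 39] [] s s2 :=
      (hs1.1.mono (by decide) (by decide)).trans (hs2.agree.mono (by decide) (by decide))
    refine Runs.block_agree hA (by decide) (by decide) ?_
    rw [exec_asg_nat ((Ev.var (show s2.get 27 = BitVec.ofNat w q by
      rw [hs2.agree.1 27 (by decide), hs1.1.1 27 (by decide), h27])).add (Ev.lit 1)), exec_nil]
    intro hD
    refine ⟨hD, by simp, ?_⟩
    have := hs2.found
    rw [List.take_length] at this
    simp only [State.get_set, Nat.reduceEqDiff, if_false]
    rw [this, b2n_congr hwin]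

end WordRAM
end

/-! ### One round, and the loop up to the first success -/

noncomputable section
namespace WordRAM
variable {w : ℕ}

local notation "V" => Expr.var

def queryBody (p : Prog) (rep : Bool) : Prog :=
  .seq (block (qpre1 rep)) (.seq (block qpre2) (.seq p.rename (evaluate rep)))

def queryCond : Expr := .bin .lt (V 27) (V 28) * notE (V 39)

structure LoopInv (I : Inst w) (S : DataStructure) (rep forb : Bool) (q : ℕ) (s : State w) :
    Prop where
  clean : s.Clean
  env : QEnv I rep s
  idx : s.get 27 = BitVec.ofNat w q
  found : s.get 39 = BitVec.ofNat w (b2n (∃ q' < q, I.Wins rep q'))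
  idle : S.Idle w (I.docs forb) s.inner

/-- The number of queries posed depends only on the instance, not on the random choices of the data
structure, because success is a property of the query alone. So the sequence of queries is fixed in
advance, as the amortized bound in `TimeBound` requires. -/
theorem Inst.exists_first_win (I : Inst w) (rep : Bool) : ∃ M ≤ I.nq,
    (∀ q, q + 1 < M → ¬ I.Wins rep q) ∧ ((∃ q < M, I.Wins rep q) ∨ M = I.nq) := by
  classical
  by_cases hex : ∃ q, q < I.nq ∧ I.Wins rep q
  · refine ⟨Nat.find hex + 1, (Nat.find_spec hex).1, fun q hq hw => ?_,
      Or.inl ⟨_, Nat.lt_succ_self _, (Nat.find_spec hex).2⟩⟩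
    exact Nat.find_min hex (by omega) ⟨by have := (Nat.find_spec hex).1; omega, hw⟩
  · exact ⟨I.nq, le_rfl, fun q hq hw => hex ⟨q, by omega, hw⟩, Or.inr rfl⟩

def Inst.roundCost (I : Inst w) (rep : Bool) (q : ℕ) : ℕ :=
  600 * I.walkCost rep q + 150 * (I.hits rep q).card + 900

theorem LoopInv.cond {I : Inst w} (h : I.OK) {S : DataStructure} {rep forb : Bool} {q : ℕ}
    {s : State w} (hI : LoopInv I S rep forb q s) (hq : q ≤ I.nq) :
    Ev s queryCond (b2n (q < I.nq ∧ ¬ ∃ q' < q, I.Wins rep q')) := by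
  have hn : I.nq < 2 ^ w := h.lt_of_le_Z (by have := h.nq_le; omega)
  exact (Ev.blt (Ev.var hI.idx) (Ev.var hI.env.nq) (by omega) hn).band
    (Ev.bnot (Ev.var hI.found))

/-- If the cost of the later rounds is bounded by a function `g` of the embedded state plus a
constant, one round turns it into the expression that defines `seqTime`. Only the output read
through `Reads` influences the host. -/
theorem ert_queryBody_le {I : Inst w} (h : I.OK) {S : DataStructure} {rep forb : Bool}
    (hS : S.Correct fun X q _ s => Reads rep (selects forb) X q s)
    (hw : (totalLength (I.docs forb) + 2) ^ S.c ≤ 2 ^ w) {q : ℕ} (hq : q < I.nq)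
    (hwin : ¬ ∃ q' < q, I.Wins rep q') {s : State w} (hI : LoopInv I S rep forb q s)
    (rest : List Prog) (f : State w → ℝ≥0∞) (g : State w → ℝ≥0∞) (c : ℝ≥0∞)
    (hg : ∀ s', LoopInv I S rep forb (q + 1) s' → ert f (rest, s') ≤ g s'.inner + c) :
    ert f (queryBody S.query rep :: rest, s) ≤
      (expTime S.query (queryInput (I.query rep q) s.inner) +
        expFinal S.query (queryInput (I.query rep q) s.inner) g) +
        ((I.roundCost rep q : ℕ) + c) := by
  obtain ⟨s1, c1, ⟨a1, v1, j1⟩, st1⟩ := qpre1_runs h hI.env hq hI.idx hI.clean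
  have e1 := hI.env.agree a1 (by decide) (by decide)
  obtain ⟨s2, c2, ⟨a2, i2⟩, st2⟩ := qpre2_runs h e1 v1 j1 c1
  have e2 := e1.agree a2 (by decide) (by decide)
  have v2 := v1.agree a2 (by decide)
  have hinner : s1.inner = s.inner := a1.inner (by decide) (by decide)
  rw [hinner] at i2
  have h27 : s2.get 27 = BitVec.ofNat w q := by
    rw [a2.1 27 (by decide), a1.1 27 (by decide), hI.idx]
  have h39 : s2.get 39 = BitVec.ofNat w 0 := by
    rw [a2.1 39 (by decide), a1.1 39 (by decide), hI.found, b2n_false hwin]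
  have hv := h.query_valid rep forb hq
  have hafter : ∀ d, MayHalt S.query (queryInput (I.query rep q) s.inner) d →
      ert f (evaluate rep :: rest, s2.embed d) ≤ g d +
        ((600 * I.walkCost rep q + 150 * (I.hits rep q).card + 300 : ℕ) + c) := by
    intro d hd
    have hgood := hS w _ (h.validDocs forb) hw _ hI.idle _ hv d hd
    have hcl := c2.embed d
    have eE : QEnv I rep (s2.embed d) := e2.congr
      (fun r hr => State.get_embed _ _ (by omega)) (fun a ha => State.mem_embed _ _ (by omega))
    have eV : QVars I rep q (s2.embed d) := by
      constructor <;> rw [State.get_embed _ _ (by norm_num)]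
      exacts [v2.κ, v2.z, v2.sum, v2.bad, v2.same]
    obtain ⟨s3, c3, ⟨a3, k27, k39⟩, st3⟩ := evaluate_runs (forb := forb) h eE hq eV
      (by rw [State.get_embed _ _ (by norm_num), h27])
      (by rw [State.get_embed _ _ (by norm_num), h39])
      (by rw [State.inner_embed]; exact hgood) hcl
    have i3 : s3.inner = d := by
      rw [a3.inner (by decide) (by decide), State.inner_embed]
    have hL : LoopInv I S rep forb (q + 1) s3 := by
      refine ⟨c3, eE.agree a3 (by decide) (by decide), k27, ?_, ?_⟩
      · rw [k39]
        congr 1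
        refine b2n_congr ⟨fun hw => ⟨q, by omega, hw⟩, fun ⟨q', hq', hw⟩ => ?_⟩
        rcases Nat.lt_succ_iff_lt_or_eq.1 hq' with h' | rfl
        · exact absurd ⟨q', h', hw⟩ hwin
        · exact hw
      · rw [i3]; exact .query hI.idle hv hd
    refine (st3 rest f).trans ((add_le_add le_rfl (hg s3 hL)).trans (le_of_eq ?_))
    rw [i3]; ring
  unfold queryBody
  refine (ert_le_of_step_eq rfl).trans ?_
  refine (add_le_add le_rfl ((st1 _ f).trans (add_le_add le_rfl
    ((ert_le_of_step_eq rfl).trans (add_le_add le_rfl ((st2 _ f).trans (add_le_add le_rfl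
      ((ert_le_of_step_eq rfl).trans (add_le_add le_rfl (ert_rename_le _ _ _ _)))))))))).trans ?_
  rw [i2]
  have hfin := (expFinal_mono hafter).trans ((expFinal_add_le _ _ _ _).trans
    (add_le_add le_rfl (expFinal_const_le _ _ _)))
  refine (add_le_add le_rfl (add_le_add le_rfl (add_le_add le_rfl (add_le_add le_rfl
    (add_le_add le_rfl (add_le_add le_rfl hfin)))))).trans ?_
  unfold Inst.roundCost
  push_cast
  have : ∀ A B C D E : ℝ≥0∞, 1 + (350 + (1 + (200 + (1 + (A + (B + (C + D + 300 + E))))))) ≤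
      (A + B) + ((C + D + 900) + E) := fun A B C D E => by
    calc _ = (A + B) + ((C + D + 853) + E) := by ring
      _ ≤ _ := by gcongr; norm_num
  exact this _ _ _ _ _

/-- Iterating `ert_queryBody_le` rebuilds `seqTime` for the first `M` queries, where the host's own
work adds up deterministically. -/
theorem ert_queryLoop_le {I : Inst w} (h : I.OK) {S : DataStructure} {rep forb : Bool}
    (hS : S.Correct fun X q _ s => Reads rep (selects forb) X q s)
    (hw : (totalLength (I.docs forb) + 2) ^ S.c ≤ 2 ^ w) (rest : List Prog)
    (f : State w → ℝ≥0∞) (B : ℝ≥0∞)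
    (hB : ∀ s' : State w, s'.Clean →
      s'.get 39 = BitVec.ofNat w (b2n (∃ q < I.nq, I.Wins rep q)) → ert f (rest, s') ≤ B) :
    ∃ M ≤ I.nq, (∀ q, q + 1 < M → ¬ I.Wins rep q) ∧
      ∀ s : State w, LoopInv I S rep forb 0 s →
        ert f (whileP queryCond (queryBody S.query rep) :: rest, s) ≤
          S.seqTime ((List.range M).map (I.query rep)) s.inner +
            (((∑ q ∈ Finset.range M, (I.roundCost rep q + 50) + 50 : ℕ) : ℝ≥0∞) + B) := by
  obtain ⟨M, hM, hnw, hend⟩ := I.exists_first_win rep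
  refine ⟨M, hM, hnw, fun s hs => ?_⟩
  have hn : 1 < 2 ^ w := h.lt_of_le_Z (by have := h.n_lt_Z; omega)
  have hone : (b2n True : ℕ) ≠ 0 := b2n_ne_zero.2 trivial
  -- Induction on the number `d` of queries still to be posed; the embedded state is arbitrary among
  -- the idle ones.
  have H : ∀ d q, q + d = M → ∀ s, LoopInv I S rep forb q s →
      ert f (whileRest queryCond (queryBody S.query rep) rest, s) ≤
        S.seqTime ((List.range' q d).map (I.query rep)) s.inner +
          (((∑ i ∈ Finset.range d, (I.roundCost rep (q + i) + 50) + 40 : ℕ) : ℝ≥0∞) + B) := by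
    intro d
    induction d with
    | zero =>
      intro q hq s hI
      obtain rfl : q = M := by omega
      have hc := hI.cond h hM
      rw [b2n_false (by rintro ⟨h1, h2⟩; rcases hend with h3 | h3; exacts [h2 h3, by omega])] at hc
      refine (ert_whileRest_zero hI.clean hc.eq_zero _ _ _).trans ?_
      refine (add_le_add le_rfl (hB s hI.clean ?_)).trans ?_
      · rw [hI.found]
        congr 1
        refine b2n_congr ⟨fun ⟨q', h1, h2⟩ => ⟨q', by omega, h2⟩, fun ⟨q', h1, h2⟩ => ?_⟩
        rcases hend with h3 | h3
        · exact h3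
        · exact ⟨q', by omega, h2⟩
      · simp only [List.range'_zero, List.map_nil, DataStructure.seqTime, zero_add,
          Finset.range_zero, Finset.sum_empty]
        gcongr
        simp [queryCond, notE, Expr.cost, HMul.hMul, Mul.mul, HSub.hSub, Sub.sub]
    | succ d ih =>
      intro q hq s hI
      have hq' : q < I.nq := by omega
      have hwin : ¬ ∃ q' < q, I.Wins rep q' := fun ⟨q', h1, h2⟩ => hnw q' (by omega) h2
      have hc := hI.cond h hq'.le
      rw [b2n_true ⟨hq', hwin⟩] at hc
      refine (ert_whileRest_ne hI.clean ((hc.ne_zero_iff hn).2 one_ne_zero) _ _ _).trans ?_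
      refine (add_le_add le_rfl (ert_queryBody_le h hS hw hq' hwin hI _ f
        (S.seqTime ((List.range' (q + 1) d).map (I.query rep))) _
        fun s' hs' => ih (q + 1) (by omega) s' hs')).trans ?_
      rw [List.range'_succ, List.map_cons, DataStructure.seqTime, Finset.sum_range_succ']
      simp only [Nat.add_zero, Nat.add_assoc q, Nat.add_comm 1]
      have hcost : queryCond.cost + 4 ≤ 50 := by
        simp [queryCond, notE, Expr.cost, HMul.hMul, Mul.mul, HSub.hSub, Sub.sub]
      push_cast
      have : ∀ A B C D : ℝ≥0∞, (queryCond.cost : ℝ≥0∞) + 4 + (A + (B + (C + 40 + D))) ≤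
          A + ((C + (B + 50) + 40) + D) := fun A B C D => by
        calc _ ≤ (50 : ℕ) + (A + (B + (C + 40 + D))) := by
              gcongr
              exact_mod_cast hcost
          _ = _ := by push_cast; ring
      exact this _ _ _ _
  refine (ert_whileP_le _ _ _ _ _).trans ((add_le_add le_rfl (H M 0 (by omega) s hs)).trans ?_)
  simp only [Nat.zero_add, ← List.range_eq_range']
  push_cast
  calc _ = S.seqTime ((List.range M).map (I.query rep)) s.inner +
      (∑ q ∈ Finset.range M, ((I.roundCost rep q : ℝ≥0∞) + 50) + 41 + B) := by ring
    _ ≤ _ := by gcongr; norm_num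

end WordRAM
end

noncomputable section
namespace WordRAM
variable {w : ℕ}

local notation "V" => Expr.var

/-! ### The whole computation for a fixed hash function -/

def queryLoop (p : Prog) (rep : Bool) : Prog := whileP queryCond (queryBody p rep)

def startQueries : List Instr := [.asg 27 (.lit 0), .asg 28 (V 0 * (V 10 * .lit 8)), .asg 39 (.lit 0)]

def reduction (S : DataStructure) (rep forb : Bool) : Prog :=
  .seq (indexLoop rep) (.seq (occLoop forb) (.seq emitLoop (.seq S.prep.rename
    (.seq (block startQueries) (.seq (queryLoop S.query rep) (block [.asg 0 (V 39)]))))))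

theorem Steps.ert_seq_le {p q : Prog} {s s' : State w} {k : ℕ} (h : Steps p s s' k)
    (rest : List Prog) (f : State w → ℝ≥0∞) :
    ert f (.seq p q :: rest, s) ≤ ((k + 1 : ℕ) : ℝ≥0∞) + ert f (q :: rest, s') := by
  refine (ert_le_of_step_eq rfl).trans ((add_le_add le_rfl (h _ f)).trans (le_of_eq ?_))
  push_cast; ring

/-- The state before the tables are built. -/
structure Ready (I : Inst w) (s : State w) : Prop where
  clean : s.Clean
  env : Env I s
  num : s.get 10 = BitVec.ofNat w 0
  idx : s.get 14 = BitVec.ofNat w 0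
  mem : ∀ a, 1 ≤ a → a ≤ 12 → s.mem a = fun _ => 0
  inner : s.inner = State.zero w

theorem Ready.indexInv {I : Inst w} {s : State w} (hs : Ready I s) (rep : Bool) :
    IndexInv I rep s 0 s := by
  have hz : ∀ a, 1 ≤ a → a ≤ 12 → ∀ g : ℕ → ℕ, (∀ i, g i = 0) → s.mem a = arr g :=
    fun a h1 h2 g hg => by
      rw [hs.mem a h1 h2]; funext i; simp [arr, hg]
  refine ⟨Agree.refl _ _ _, hs.idx, hs.num, ?_, ?_, ?_, ?_, ?_, ?_, ?_, ?_⟩ <;>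
    refine hz _ (by norm_num) (by norm_num) _ fun i => ?_ <;> simp [last, link, chunks]

/-- For a fixed multiplier the host is deterministic, so all randomness is inside the data structure
and is averaged by `TimeBound`. The hypothesis on `f` makes correct outputs free. -/
theorem ert_reduction_le {I : Inst w} (h : I.OK) {S : DataStructure} {rep forb : Bool}
    {tp : ℕ → ℝ≥0} {cost : List Str → Query → ℝ≥0}
    (hS : S.Correct fun X q _ s => Reads rep (selects forb) X q s) (hT : S.TimeBound tp cost)
    (hw : (totalLength (I.docs forb) + 2) ^ S.c ≤ 2 ^ w) {f : State w → ℝ≥0∞}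
    (hf : ∀ s' : State w, (s'.reg 0 ≠ 0 ↔ ∃ q < I.nq, I.Wins rep q) → f s' = 0)
    {s : State w} (hs : Ready I s) :
    ∃ M ≤ I.nq, (∀ q, q + 1 < M → ¬ I.Wins rep q) ∧
      ert f ([reduction S rep forb], s) ≤
        ((tp (totalLength (I.docs forb)) +
          ∑ q ∈ Finset.range M, cost (I.docs forb) (I.query rep q) +
          (∑ q ∈ Finset.range M, (I.roundCost rep q + 50) +
            800 * (I.n + (I.GA + I.GB forb) + I.QQ + 2) : ℕ) : ℝ≥0) : ℝ≥0∞) := by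
  have hone : 1 < 2 ^ w := h.lt_of_le_Z (by have := h.n_lt_Z; omega)
  obtain ⟨M, hM, hnw, hloop⟩ := ert_queryLoop_le h hS hw [block [.asg 0 (V 39)]] f 20 (by
    intro s' hc h39
    obtain ⟨s1, -, h1, st⟩ := (Runs.block (l := [.asg 0 (V 39)]) (s := s')
      (Q := fun s1 => s1 = s'.set 0 (s'.get 39)) rfl) hc
    refine (st [] f).trans ?_
    rw [ert_nil, hf s1, add_zero]
    · simp only [blockCost, Instr.cost, Expr.cost]
      norm_num
    · rw [h1, h39]
      show (s'.set 0 _).get 0 ≠ 0 ↔ _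
      rw [State.get_set, if_pos rfl]
      refine Iff.trans (not_congr (ofNat_inj ?_ (by positivity))) b2n_ne_zero
      have := b2n_le (∃ q < I.nq, I.Wins rep q)
      omega)
  refine ⟨M, hM, hnw, ?_⟩
  obtain ⟨s1, c1, J1, st1⟩ := indexLoop_runs h rep hs.env (hs.indexInv rep) hs.clean
  have E1 : Env I s1 := hs.env.agree J1.agree (by decide) (by decide)
  obtain ⟨s2, c2, J2, st2⟩ := occLoop_runs h forb E1 J1.num J1.m6 (fun a h1 h2 => by
    rw [J1.agree.2 a (by simp; omega), hs.mem a (by omega) h2]) c1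
  obtain ⟨s3, c3, ⟨A3, i3⟩, st3⟩ := emitLoop_runs h forb J2.env J2.m9 J2.m10 J2.m11 (by
    rw [J2.agree.inner (by decide) (by decide), J1.agree.inner (by decide) (by decide),
      hs.inner]) c2
  have E3 : Env2 I forb s3 := J2.env.agree A3 (by decide) (by decide)
  have m3 : ∀ a, 1 ≤ a → a ≤ 8 → s3.mem a = s1.mem a := fun a h1 h2 => by
    rw [A3.2 a (by simp; omega), J2.agree.2 a (by simp; omega)]
  obtain ⟨hprep, hseq⟩ := hT w _ (h.validDocs forb) hw
  have hafter : ∀ d, MayHalt S.prep (docsInput w (I.docs forb)) d →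
      ert f ([.seq (block startQueries) (.seq (queryLoop S.query rep)
        (block [.asg 0 (V 39)]))], s3.embed d) ≤
        S.seqTime ((List.range M).map (I.query rep)) d +
          (((∑ q ∈ Finset.range M, (I.roundCost rep q + 50) + 150 : ℕ) : ℝ≥0∞)) := by
    intro d hd
    have g : ∀ r < 40, (s3.embed d).get r = s3.get r := fun r hr => State.get_embed _ _ hr
    obtain ⟨s4, c4, ⟨A4, k27, k28, k39⟩, st4⟩ := (Runs.block_agree (k := 70)
      (Q := fun s4 => Agree [27, 28, 39] [] (s3.embed d) s4 ∧ s4.get 27 = BitVec.ofNat w 0 ∧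
        s4.get 28 = BitVec.ofNat w I.nq ∧ s4.get 39 = BitVec.ofNat w 0)
      (Agree.refl [27, 28, 39] [] (s3.embed d)) (l := startQueries) (by decide) (by decide) (by
        unfold startQueries
        rw [exec_asg_nat (Ev.lit 0), exec_asg_nat (v := I.nq) ((Ev.var (by
          simpa [g] using E3.env.n)).mul ((Ev.var (by simpa [g] using E3.K)).mul (Ev.lit 8))),
          exec_asg_nat (Ev.lit 0), exec_nil]
        intro hA
        exact ⟨hA, by simp, by simp, by simp⟩)) (c3.embed d)
    have g4 : ∀ r < 27, s4.get r = s3.get r := fun r hr => by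
      rw [A4.1 r (by simp; omega), g r (by omega)]
    have n4 : ∀ a < 20, s4.mem a = s3.mem a := fun a ha => by
      rw [A4.2 a (by simp), State.mem_embed _ _ ha]
    have i4 : s4.inner = d := by rw [A4.inner (by decide) (by decide), State.inner_embed]
    have hL : LoopInv I S rep forb 0 s4 := by
      refine ⟨c4, ⟨?_, ?_, ?_, ?_, k28, ?_, ?_, ?_, ?_, ?_⟩, k27, ?_, ?_⟩
      · constructor
        all_goals first
          | rw [g4 _ (by norm_num)]
          | rw [n4 _ (by norm_num)]
        exacts [E3.env.n, E3.env.TT, E3.env.QQ, E3.env.RR, E3.env.BB, E3.env.k, E3.env.SS,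
          E3.env.m, E3.env.sg, E3.env.xs]
      · rw [g4 _ (by norm_num), E3.K]
      · rw [g4 _ (by norm_num), E3.CB]
      · rw [g4 _ (by norm_num), E3.DUM]
      · rw [n4 _ (by norm_num), m3 _ (by norm_num) (by norm_num), J1.m1]
      · rw [n4 _ (by norm_num), m3 _ (by norm_num) (by norm_num), J1.m2]
      · rw [n4 _ (by norm_num), m3 _ (by norm_num) (by norm_num), J1.m5]; rfl
      · rw [n4 _ (by norm_num), m3 _ (by norm_num) (by norm_num), J1.m7]
      · rw [n4 _ (by norm_num), m3 _ (by norm_num) (by norm_num), J1.m8]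
      · rw [k39, b2n_false (by simp)]
      · rw [i4]; exact .prep hd
    have := hloop s4 hL
    rw [i4] at this
    refine (st4.ert_seq_le _ f).trans ((add_le_add le_rfl ((ert_le_of_step_eq rfl).trans
      (add_le_add le_rfl this))).trans ?_)
    push_cast
    have hc : ∀ A B : ℝ≥0∞, 71 + (1 + (A + (B + 50 + 20))) ≤ A + (B + 150) := fun A B => by
      calc _ = A + (B + 142) := by ring
        _ ≤ _ := by gcongr; norm_num
    exact hc _ _
  -- The amortized bound is applied once, to the whole sequence of the `M` queries started after the
  -- preprocessing.
  have hfin := (expFinal_mono hafter).trans ((expFinal_add_le _ _ _ _).trans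
    (add_le_add (hseq _ (by
      intro q hq
      obtain ⟨q', hq', rfl⟩ := List.mem_map.1 hq
      exact h.query_valid rep forb ((List.mem_range.1 hq').trans_le hM)))
      (expFinal_const_le _ _ _)))
  have hsum : (((List.range M).map (I.query rep)).map (cost (I.docs forb))).sum =
      ∑ q ∈ Finset.range M, cost (I.docs forb) (I.query rep q) := by
    rw [List.map_map, ← List.sum_toFinset _ List.nodup_range, List.toFinset_range]; rfl
  rw [hsum] at hfin
  unfold reduction
  refine (st1.ert_seq_le _ f).trans ((add_le_add le_rfl ((st2.ert_seq_le _ f).trans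
    (add_le_add le_rfl ((st3.ert_seq_le _ f).trans (add_le_add le_rfl ((ert_le_of_step_eq rfl).trans
      (add_le_add le_rfl (ert_rename_le _ _ _ _)))))))).trans ?_)
  rw [i3]
  refine (add_le_add le_rfl (add_le_add le_rfl (add_le_add le_rfl (add_le_add le_rfl
    (add_le_add hprep hfin))))).trans ?_
  set G := I.GA + I.GB forb
  have e : ((400 * I.n + 20 + 1 : ℕ) : ℝ≥0∞) + (((700 * G + 400 + 1 : ℕ) : ℝ≥0∞) +
      (((70 * G + 120 * (4 * I.QQ) + 200 + 1 : ℕ) : ℝ≥0∞) + (1 + 150))) ≤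
      ((800 * (I.n + G + I.QQ + 2) : ℕ) : ℝ≥0∞) := by
    have : (400 * I.n + 20 + 1) + ((700 * G + 400 + 1) + ((70 * G + 120 * (4 * I.QQ) + 200 + 1) +
      (1 + 150))) ≤ 800 * (I.n + G + I.QQ + 2) := by omega
    exact_mod_cast this
  have e' : ∀ a b c A B D : ℝ≥0∞, a + (b + (c + (1 + (A + (B + (D + 150)))))) =
      A + B + (D + (a + (b + (c + (1 + 150))))) := by intros; ring
  rw [Nat.cast_add (∑ q ∈ Finset.range M, (I.roundCost rep q + 50)) 150, Nat.cast_ofNat, e']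
  rw [Nat.cast_add (∑ q ∈ Finset.range M, (I.roundCost rep q + 50)) (800 * _), ENNReal.coe_add,
    ENNReal.coe_add, ENNReal.coe_add, ENNReal.coe_natCast, ENNReal.coe_natCast]
  gcongr

end WordRAM
end

noncomputable section
namespace WordRAM
variable {w : ℕ}

local notation "V" => Expr.var

/-! ### Choosing the parameters -/

/-- The parameters are powers of `2 ^ scale q n`. -/
def scale (q n : ℕ) : ℕ := Nat.log 2 n / q + 1

/-- With X = 2 ^ `scale q n` one has n < X^q, and by `pow_scale_le` X^q exceeds n + 1 by a constant
factor at most. Fractional powers of n are thus replaced by integral powers of X that are powers of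
two. -/
theorem lt_pow_scale {q : ℕ} (hq : 0 < q) (n : ℕ) : n < 2 ^ (q * scale q n) := by
  refine (Nat.lt_pow_succ_log_self one_lt_two n).trans_le (Nat.pow_le_pow_right two_pos ?_)
  exact Nat.lt_mul_div_succ _ hq

theorem pow_scale_le {q : ℕ} (n : ℕ) : 2 ^ (q * scale q n) ≤ 2 ^ q * (n + 1) := by
  unfold scale
  rw [Nat.mul_add, Nat.mul_one, pow_add, Nat.mul_comm]
  gcongr
  rcases Nat.eq_zero_or_pos n with rfl | hn
  · simp
  · refine le_trans (Nat.pow_le_pow_right two_pos (Nat.mul_div_le _ _)) ?_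
    exact (Nat.pow_log_le_self 2 hn.ne').trans (Nat.le_succ n)

theorem pow_le_of_le_log {q n j : ℕ} (hj : j < Nat.log 2 n / q) : 2 ^ (q * (j + 1)) ≤ n := by
  have hn : n ≠ 0 := by rintro rfl; simp at hj
  have h1 : q * (j + 1) ≤ Nat.log 2 n :=
    (Nat.mul_le_mul_left q hj).trans (Nat.mul_div_le _ _)
  exact (Nat.pow_le_pow_right two_pos h1).trans (Nat.pow_log_le_self 2 hn)

def scaleLoop (q : ℕ) : Prog :=
  whileP (notE (.bin .lt (V 0) (.bin .shl (.lit 1) (.lit q * V 1)))) (block [.asg 1 (V 1 + .lit 1)])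

theorem scaleLoop_runs {q n : ℕ} (hq : 0 < q) (hL : 2 ^ (q * scale q n) < 2 ^ w) {s : State w}
    (h0 : s.get 0 = BitVec.ofNat w n) (h1 : s.get 1 = BitVec.ofNat w 1) :
    Runs (scaleLoop q) s (100 * (n + 1)) fun s' =>
      Agree [1] [] s s' ∧ s'.get 1 = BitVec.ofNat w (scale q n) := by
  have hn := lt_pow_scale hq n
  have h1w : 1 < 2 ^ w := Nat.one_le_two_pow.trans_lt hL
  have hcond : ∀ j ≤ Nat.log 2 n / q, ∀ s' : State w,
      (Agree [1] [] s s' ∧ s'.get 1 = BitVec.ofNat w (j + 1)) →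
      Ev s' (notE (.bin .lt (V 0) (.bin .shl (.lit 1) (.lit q * V 1))))
        (b2n (¬ n < 2 ^ (q * (j + 1)))) := by
    intro j hj s' hI
    have h3 : q * (j + 1) ≤ q * scale q n := Nat.mul_le_mul_left q (Nat.succ_le_succ hj)
    have h4 : 2 ^ (q * (j + 1)) < 2 ^ w := (Nat.pow_le_pow_right two_pos h3).trans_lt hL
    exact Ev.bnot (Ev.blt (Ev.var ((hI.1.1 0 (by decide)).trans h0))
      (Ev.shl (Ev.lit 1) ((Ev.lit q).mul (Ev.var hI.2)) (Nat.lt_two_pow_self.trans h4))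
      (hn.trans hL) h4)
  refine Runs.mono (Runs.while (fun j s' => Agree [1] [] s s' ∧ s'.get 1 = BitVec.ofNat w (j + 1))
    (Nat.log 2 n / q) (fun _ => 20) ⟨Agree.refl _ _ _, h1⟩ (fun s' hI => ?_)
    fun j hj s' hI => ⟨?_, ?_⟩) ?_ fun _ h => h
  · have := hcond _ le_rfl s' hI
    rw [b2n_false (P := ¬ n < 2 ^ (q * (Nat.log 2 n / q + 1))) (not_not.2 hn)] at this
    exact this.eq_zero
  · have := hcond j hj.le s' hI
    rw [b2n_true (not_lt.2 (pow_le_of_le_log hj))] at this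
    exact (this.ne_zero_iff h1w).2 one_ne_zero
  · refine Runs.block_agree hI.1 (by decide) (by decide) ?_
    rw [exec_asg_nat ((Ev.var hI.2).add (Ev.lit 1)), exec_nil]
    exact fun hA => ⟨hA, by simp⟩
  · have h5 : Nat.log 2 n / q ≤ n := (Nat.div_le_self _ _).trans (Nat.log_le_self 2 n)
    have hc : (notE (.bin .lt (V 0) (.bin .shl (.lit 1) (.lit q * V 1)))).cost = 25 := rfl
    rw [hc, Finset.sum_const, Finset.card_range, smul_eq_mul]
    omega

def parameters (q ρ τ : ℕ) : List Instr :=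
  [.asg 2 (.bin .shl (.lit 1) (.lit τ * V 1)), .asg 3 (V 2 * V 2),
    .asg 4 (.bin .shl (.lit 1) (.lit ρ * V 1)), .asg 5 (.bin .shl (.lit 1) (.lit (q - ρ) * V 1)),
    .asg 6 (.size - .lit (ρ + 2 * τ) * V 1), .asg 7 (V 4 * V 3), .asg 9 (.size - .lit 1)]

/-- The instance given by a list of numbers and a random number. -/
def inst (q ρ τ : ℕ) (A : List (BitVec w)) (r : Fin (2 ^ w)) : Inst w where
  n := A.length
  xs i := A.getD i 0
  m := oddMul r
  k := w - (ρ + 2 * τ) * scale q A.length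
  TT := 2 ^ (τ * scale q A.length)
  RR := 2 ^ (ρ * scale q A.length)
  BB := 2 ^ ((q - ρ) * scale q A.length)

theorem hasThreeSum_iff {I : Inst w} (h : I.OK) (rep : Bool) {A : List (BitVec w)}
    (hn : I.n = A.length) (hx : ∀ i, I.xs i = A.getD i 0) :
    (∃ q < I.nq, I.Wins rep q) ↔ HasThreeSum A := by
  have hmem : ∀ i < I.n, I.xs i ∈ A := fun i hi => by
    rw [hx, List.getD_eq_getElem _ _ (by omega)]; exact List.getElem_mem _
  have hget : ∀ a ∈ A, ∃ i < I.n, I.xs i = a := fun a ha => by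
    obtain ⟨i, hi, rfl⟩ := List.mem_iff_getElem.1 ha
    exact ⟨i, by omega, by rw [hx, List.getD_eq_getElem _ _ hi]⟩
  constructor
  · rintro ⟨q, hq, x, hwx, y, hy, h1, h2, h3, h4, h5⟩
    exact ⟨_, hmem x hwx.1, _, hmem y hy, _, hmem _ (h.zi_lt hq), h2, h3, h4,
      (toInt_add_eq_iff h.w_pos _ _ _).2 ⟨h1, h5⟩⟩
  · rintro ⟨a, ha, b, hb, c, hc, h2, h3, h4, hs⟩
    obtain ⟨x, hxn, rfl⟩ := hget a ha
    obtain ⟨y, hyn, rfl⟩ := hget b hb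
    obtain ⟨z, hzn, rfl⟩ := hget c hc
    obtain ⟨h1, h5⟩ := (toInt_add_eq_iff h.w_pos _ _ _).1 hs
    exact h.exists_wins rep hxn hzn ⟨y, hyn, h1, h2, h3, h4, h5⟩

section

variable {q ρ τ : ℕ} (hq : 0 < q) (hρ : ρ ≤ q) (hτ : τ ≤ q) {A : List (BitVec w)} (hA : A.Nodup)

/-- The first factor suffices for the addresses of the reduction. The factor `c + 1` raises this
bound to the power that the data structure demands for its own word size. -/
def wordConst (q c : ℕ) : ℕ := (6 * q + 17) * (c + 1)

/-- The sixth power comes from `Z`, a product of two factors for n + 1, three for `TT` and one for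
`RR`, each at most L = X^q. The factor 2^11 generously covers the constants 64 and 24 in the bounds
on `Z`. -/
theorem pow_scale_six_le (q n : ℕ) : 2 ^ 11 * (2 ^ (q * scale q n)) ^ 6 ≤ (n + 2) ^ (6 * q + 17) := by
  have h1 : 2 ^ (q * scale q n) ≤ (n + 2) ^ (q + 1) := by
    refine (pow_scale_le n).trans ?_
    rw [pow_succ]
    gcongr <;> omega
  calc _ ≤ (n + 2) ^ 11 * ((n + 2) ^ (q + 1)) ^ 6 := by gcongr; omega
    _ = _ := by rw [← pow_mul, ← pow_add]; congr 1; ring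

include hq hρ hτ hA

theorem inst_OK (hw : 2 ^ 11 * (2 ^ (q * scale q A.length)) ^ 6 ≤ 2 ^ w) (r : Fin (2 ^ w)) :
    (inst q ρ τ A r).OK ∧ 24 * (inst q ρ τ A r).Z ≤
      2 ^ 11 * (2 ^ (q * scale q A.length)) ^ 6 := by
  set ℓ := scale q A.length with hℓ
  have hn := lt_pow_scale hq A.length
  rw [← hℓ] at hn
  set L := 2 ^ (q * ℓ) with hL
  have hL1 : 1 ≤ L := Nat.one_le_two_pow
  have hT : 2 ^ (τ * ℓ) ≤ L := Nat.pow_le_pow_right two_pos (Nat.mul_le_mul_right _ hτ)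
  have hR : 2 ^ (ρ * ℓ) ≤ L := Nat.pow_le_pow_right two_pos (Nat.mul_le_mul_right _ hρ)
  have hB : 2 ^ ((q - ρ) * ℓ) ≤ L :=
    Nat.pow_le_pow_right two_pos (Nat.mul_le_mul_right _ (Nat.sub_le _ _))
  have hZ : (inst q ρ τ A r).Z ≤ L ^ 6 := by
    show (A.length + 1) ^ 2 * (2 ^ (τ * ℓ)) ^ 3 * 2 ^ (ρ * ℓ) ≤ _
    calc _ ≤ L ^ 2 * L ^ 3 * L := by gcongr; omega
      _ = _ := by ring
  have hZ0 : 1 ≤ L ^ 6 := Nat.one_le_pow _ _ hL1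
  have hLw : L < 2 ^ w := by
    have : L ≤ L ^ 6 := Nat.le_self_pow (by norm_num) _
    omega
  have hs : (ρ + 2 * τ) * ℓ ≤ w := by
    refine (Nat.pow_le_pow_iff_right (a := 2) (by norm_num)).1 ?_
    rw [show (ρ + 2 * τ) * ℓ = ρ * ℓ + τ * ℓ * 2 by ring, pow_add, pow_mul 2 (τ * ℓ)]
    calc _ ≤ L * L ^ 2 := Nat.mul_le_mul hR (Nat.pow_le_pow_left hT 2)
      _ = L ^ 3 := by ring
      _ ≤ L ^ 6 := Nat.pow_le_pow_right hL1 (by norm_num)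
      _ ≤ _ := by omega
  refine ⟨⟨?_, ?_, by simp [inst], by simp [inst], by simp [inst], ?_, ?_, ?_⟩, by omega⟩
  · show 2 ^ w = 2 ^ (ρ * ℓ) * (2 ^ (τ * ℓ) * 2 ^ (τ * ℓ)) * 2 ^ (w - (ρ + 2 * τ) * ℓ)
    rw [← pow_add, ← pow_add, ← pow_add]
    congr 1
    have : (ρ + 2 * τ) * ℓ = ρ * ℓ + (τ * ℓ + τ * ℓ) := by ring
    omega
  · by_contra h0
    obtain rfl : w = 0 := by omega
    omega
  · exact hB.trans_lt hLw
  · omega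
  · intro i hi j hj hij
    simp only [inst] at hi hj hij
    rw [List.getD_eq_getElem _ _ hi, List.getD_eq_getElem _ _ hj] at hij
    exact (List.Nodup.getElem_inj_iff hA).1 hij

end

/-! ### The algorithm for 3SUM -/

/-- Register 16 is variable 8. The random word is doubled and increased by one to give the odd
multiplier `oddMul`. -/
def threeSumProg (S : DataStructure) (rep forb : Bool) (q ρ τ : ℕ) : Prog :=
  .seq (block [.asg 1 (.lit 1)]) (.seq (scaleLoop q) (.seq (block (parameters q ρ τ))
    (.seq (.rand 16) (.seq (block [.asg 8 (.lit 2 * V 8 + .lit 1)]) (reduction S rep forb)))))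

theorem threeSumInput_spec (A : List (BitVec w)) :
    (threeSumInput A).Clean ∧ (threeSumInput A).get 0 = BitVec.ofNat w A.length ∧
    (∀ r, r ≠ 0 → (threeSumInput A).get r = 0) ∧
    (threeSumInput A).mem 0 = (fun i => A.getD i.toNat 0) ∧
    (∀ a, a ≠ 0 → (threeSumInput A).mem a = fun _ => 0) := by
  unfold threeSumInput
  refine ⟨fun t => ?_, ?_, fun r hr => ?_, ?_, fun a ha => ?_⟩
  · rw [State.setReg_reg, if_neg (by omega)]; rfl
  · show (State.setReg _ 0 _).reg 0 = _
    rw [State.setReg_reg, if_pos rfl]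
  · show (State.setReg _ 0 _).reg (2 * r) = _
    rw [State.setReg_reg, if_neg (by omega)]; rfl
  · simp [State.writeArr, State.zero]
  · simp [State.writeArr, State.zero, ha]

theorem ert_threeSumProg_le {S : DataStructure} {rep forb : Bool} {q ρ τ : ℕ} (hq : 0 < q)
    (hρ : ρ ≤ q) (hτ : τ ≤ q) {A : List (BitVec w)} (hA : A.Nodup)
    (hw : 2 ^ 11 * (2 ^ (q * scale q A.length)) ^ 6 ≤ 2 ^ w) (f : State w → ℝ≥0∞) :
    ∃ s : Fin (2 ^ w) → State w, (∀ r, Ready (inst q ρ τ A r) (s r)) ∧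
      ert f ([threeSumProg S rep forb q ρ τ], threeSumInput A) ≤
        ((100 * A.length + 500 : ℕ) : ℝ≥0∞) +
          (2 ^ w : ℝ≥0∞)⁻¹ * ∑ r, ert f ([reduction S rep forb], s r) := by
  obtain ⟨hc, h0, hz, m0, mz⟩ := threeSumInput_spec A
  set ℓ := scale q A.length with hℓ
  have hok := fun r => (inst_OK hq hρ hτ hA hw r).1
  have hLw : 2 ^ (q * ℓ) < 2 ^ w := by
    have : 2 ^ (q * ℓ) ≤ (2 ^ (q * ℓ)) ^ 6 := Nat.le_self_pow (by norm_num) _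
    have : 1 ≤ 2 ^ (q * ℓ) := Nat.one_le_two_pow
    omega
  have hlt : ∀ t ≤ q, t * ℓ < 2 ^ w := fun t ht =>
    ((Nat.mul_le_mul_right ℓ ht).trans_lt Nat.lt_two_pow_self).trans hLw
  have hr0 : 0 < 2 ^ w := by positivity
  have hsw : (ρ + 2 * τ) * ℓ ≤ w := by
    have h1 := (hok ⟨0, hr0⟩).hw
    have h2 : (inst q ρ τ A ⟨0, hr0⟩).SS = 2 ^ ((ρ + 2 * τ) * ℓ) := by
      show 2 ^ (ρ * ℓ) * (2 ^ (τ * ℓ) * 2 ^ (τ * ℓ)) = _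
      rw [← pow_add, ← pow_add]; congr 1; ring
    refine (Nat.pow_le_pow_iff_right (a := 2) (by norm_num)).1 ?_
    rw [← h2]
    exact (Nat.le_mul_of_pos_right _ (by positivity)).trans h1.ge
  have hw1 : 1 ≤ w := (hok ⟨0, hr0⟩).w_pos
  obtain ⟨s1, c1, ⟨a1, v1⟩, st1⟩ := (Runs.block_agree (k := 20)
    (Q := fun s1 => Agree [1] [] (threeSumInput A) s1 ∧ s1.get 1 = BitVec.ofNat w 1)
    (Agree.refl [1] [] (threeSumInput A)) (l := [.asg 1 (.lit 1)]) (by decide) (by decide) (by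
      rw [exec_asg_nat (Ev.lit 1), exec_nil]
      exact fun hA => ⟨hA, by simp⟩)) hc
  obtain ⟨s2, c2, ⟨a2, v2⟩, st2⟩ := scaleLoop_runs hq hLw
    ((a1.1 0 (by decide)).trans h0) v1 c1
  obtain ⟨s3, c3, ⟨a3, k2, k3, k4, k5, k6, k7, k9⟩, st3⟩ := (Runs.block_agree (k := 200)
    (Q := fun s3 => Agree [1, 2, 3, 4, 5, 6, 7, 9] [] (threeSumInput A) s3 ∧
      s3.get 2 = BitVec.ofNat w (2 ^ (τ * ℓ)) ∧
      s3.get 3 = BitVec.ofNat w (2 ^ (τ * ℓ) * 2 ^ (τ * ℓ)) ∧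
      s3.get 4 = BitVec.ofNat w (2 ^ (ρ * ℓ)) ∧ s3.get 5 = BitVec.ofNat w (2 ^ ((q - ρ) * ℓ)) ∧
      s3.get 6 = BitVec.ofNat w (w - (ρ + 2 * τ) * ℓ) ∧
      s3.get 7 = BitVec.ofNat w (2 ^ (ρ * ℓ) * (2 ^ (τ * ℓ) * 2 ^ (τ * ℓ))) ∧
      s3.get 9 = BitVec.ofNat w (w - 1))
    ((a1.mono (rs' := [1, 2, 3, 4, 5, 6, 7, 9]) (as' := []) (by decide) (by decide)).trans
      (a2.mono (by decide) (by decide)))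
    (l := parameters q ρ τ) rfl (show 109 ≤ 200 by norm_num) (by
      unfold parameters
      rw [exec_asg_nat (Ev.shl (Ev.lit 1) ((Ev.lit τ).mul (Ev.var (by simpa using v2)))
          (hlt τ hτ)),
        exec_asg_nat ((Ev.var (x := 2 ^ (τ * ℓ)) (by simp)).mul
          (Ev.var (x := 2 ^ (τ * ℓ)) (by simp))),
        exec_asg_nat (Ev.shl (Ev.lit 1) ((Ev.lit ρ).mul (Ev.var (by simpa using v2)))
          (hlt ρ hρ)),
        exec_asg_nat (Ev.shl (Ev.lit 1) ((Ev.lit (q - ρ)).mul (Ev.var (by simpa using v2)))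
          (hlt _ (Nat.sub_le _ _))),
        exec_asg_nat (Ev.size.sub ((Ev.lit (ρ + 2 * τ)).mul (Ev.var (by simpa using v2))) hsw),
        exec_asg_nat ((Ev.var (x := 2 ^ (ρ * ℓ)) (by simp)).mul
          (Ev.var (x := 2 ^ (τ * ℓ) * 2 ^ (τ * ℓ)) (by simp))),
        exec_asg_nat (Ev.size.sub (Ev.lit 1) hw1), exec_nil]
      intro hA
      refine ⟨hA, ?_, ?_, ?_, ?_, ?_, ?_, ?_⟩ <;> simp)) c2
  have H : ∀ r : Fin (2 ^ w), ∃ s : State w, Ready (inst q ρ τ A r) s ∧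
      ert f ([.seq (block [.asg 8 (.lit 2 * V 8 + .lit 1)]) (reduction S rep forb)],
        s3.setReg 16 (BitVec.ofFin r)) ≤ ((40 : ℕ) : ℝ≥0∞) + ert f ([reduction S rep forb], s) := by
    intro r
    obtain ⟨s4, c4, ⟨a4, k8⟩, st4⟩ := (Runs.block_agree (k := 39)
      (Q := fun s4 => Agree [8] [] (s3.set 8 (BitVec.ofFin r)) s4 ∧ s4.get 8 = oddMul r)
      (Agree.refl [8] [] (s3.set 8 (BitVec.ofFin r))) (l := [.asg 8 (.lit 2 * V 8 + .lit 1)])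
      (by decide) (by decide) (by
        rw [exec_asg (v := oddMul r) (by
          show BitVec.ofNat w 2 * (s3.set 8 (BitVec.ofFin r)).get 8 + BitVec.ofNat w 1 = _
          rw [State.get_set, if_pos rfl]; rfl), exec_nil]
        exact fun hA => ⟨hA, by simp⟩)) (c3.set 8 _)
    have g : ∀ t, t ≠ 8 → s4.get t = s3.get t := fun t ht => by
      rw [a4.1 t (by simpa using ht), State.get_set, if_neg ht]
    have m : ∀ a, s4.mem a = (threeSumInput A).mem a := fun a => by
      rw [a4.2 a (by simp), State.mem_set, a3.2 a (by simp)]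
    have g' : ∀ t, 10 ≤ t → s4.get t = 0 := fun t ht => by
      rw [g t (by omega), a3.1 t (by simp; omega), hz t (by omega)]
    refine ⟨s4, ⟨c4, ⟨?_, ?_, ?_, ?_, ?_, ?_, ?_, k8, ?_, ?_⟩, g' _ (by norm_num),
      g' _ (by norm_num), fun a h1 _ => (m a).trans (mz a (by omega)), ?_⟩,
      (st4.ert_seq_le [] f).trans le_rfl⟩
    · rw [g _ (by norm_num), a3.1 0 (by decide), h0]; rfl
    · rw [g _ (by norm_num), k2]; rfl
    · rw [g _ (by norm_num), k3]; rfl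
    · rw [g _ (by norm_num), k4]; rfl
    · rw [g _ (by norm_num), k5]; rfl
    · rw [g _ (by norm_num), k6]; rfl
    · rw [g _ (by norm_num), k7]; rfl
    · rw [g _ (by norm_num), k9]
    · rw [m, m0]; rfl
    · refine State.ext' (fun r => g' _ (by omega)) (funext fun a => ?_)
      exact (m _).trans (mz _ (by omega))
  choose s hs hsb using H
  refine ⟨s, hs, ?_⟩
  unfold threeSumProg
  refine (st1.ert_seq_le _ f).trans ((add_le_add le_rfl ((st2.ert_seq_le _ f).trans
    (add_le_add le_rfl ((st3.ert_seq_le _ f).trans (add_le_add le_rfl ((ert_le_of_step_eq rfl).trans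
      (add_le_add le_rfl (ert_rand_le _ _ _ _)))))))).trans ?_)
  have hsum : (2 ^ w : ℝ≥0∞)⁻¹ * ∑ v : Fin (2 ^ w),
      ert f ([.seq (block [.asg 8 (.lit 2 * V 8 + .lit 1)]) (reduction S rep forb)],
        s3.setReg 16 (BitVec.ofFin v)) ≤ ((40 : ℕ) : ℝ≥0∞) +
      (2 ^ w : ℝ≥0∞)⁻¹ * ∑ r, ert f ([reduction S rep forb], s r) := by
    refine (mul_le_mul_right (Finset.sum_le_sum fun r _ => hsb r) _).trans (le_of_eq ?_)
    rw [Finset.sum_add_distrib, mul_add]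
    congr 1
    rw [Finset.sum_const, Finset.card_univ, Fintype.card_fin, nsmul_eq_mul, ← mul_assoc,
      Nat.cast_pow, Nat.cast_ofNat, ENNReal.inv_mul_cancel (by positivity) (by finiteness), one_mul]
  refine (add_le_add le_rfl (add_le_add le_rfl (add_le_add le_rfl (add_le_add le_rfl
    (add_le_add le_rfl hsum))))).trans ?_
  push_cast
  have e : ∀ n B : ℝ≥0∞, 21 + (100 * (n + 1) + 1 + (201 + (1 + (1 + (40 + B))))) ≤
      100 * n + 500 + B := fun n B => by
    calc _ = 100 * n + 365 + B := by ring
      _ ≤ _ := by gcongr; norm_num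
  exact e _ _

end WordRAM
end

noncomputable section
namespace WordRAM
variable {w : ℕ}

/-! ### The expected running time -/

/-- The parameters are powers of `X`. -/
structure Sizes (forb : Bool) (q ρ τ E X : ℕ) (I : Inst w) : Prop where
  X_pos : 0 < X
  n : I.n ≤ X ^ q
  TT : I.TT = X ^ τ
  RR : I.RR = X ^ ρ
  BB : I.BB = X ^ (q - ρ)
  hρ : ρ ≤ q
  hτ : τ ≤ q
  hE : q + τ ≤ E
  hF : forb = true → 3 * τ + ρ ≤ E

namespace Sizes

variable {forb : Bool} {q ρ τ E X : ℕ} {I : Inst w} (hs : Sizes forb q ρ τ E X I)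
include hs

theorem pow_le {a b : ℕ} (h : a ≤ b) : X ^ a ≤ X ^ b := Nat.pow_le_pow_right hs.X_pos h

theorem K_le (h : I.OK) : I.K ≤ 3 * X ^ ρ := by
  have h1 := h.K_mul_le
  have h2 : I.RR * I.BB = X ^ q := by
    rw [hs.RR, hs.BB, ← pow_add, Nat.add_sub_cancel' hs.hρ]
  have h3 : I.K * I.BB ≤ 3 * X ^ ρ * I.BB := by
    rw [Nat.mul_assoc, ← hs.RR, h2]
    have := hs.n
    rw [Nat.mul_assoc, h2] at h1
    omega
  exact Nat.le_of_mul_le_mul_right h3 h.BB_pos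

theorem nq_le (h : I.OK) : I.nq ≤ 24 * X ^ (q + ρ) := by
  unfold Inst.nq
  calc _ ≤ X ^ q * (3 * X ^ ρ * 8) := by gcongr; exacts [hs.n, hs.K_le h]
    _ = _ := by rw [pow_add]; ring

theorem GA_le : I.GA ≤ 2 * X ^ E := by
  unfold Inst.GA
  calc _ ≤ X ^ q * (2 * X ^ τ) := by gcongr; exacts [hs.n, hs.TT.le]
    _ = 2 * X ^ (q + τ) := by rw [pow_add]; ring
    _ ≤ _ := by gcongr; exacts [hs.X_pos, hs.hE]

theorem GB_le : I.GB forb ≤ 8 * X ^ E := by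
  unfold Inst.GB
  cases forb with
  | false =>
    calc _ ≤ X ^ q * X ^ τ := by
          simp only [cond_false]; gcongr; exacts [hs.n, hs.TT.le]
      _ = X ^ (q + τ) := by rw [pow_add]
      _ ≤ X ^ E := hs.pow_le hs.hE
      _ ≤ _ := by omega
  | true =>
    simp only [cond_true]
    unfold Inst.QQ
    rw [hs.TT, hs.RR]
    calc _ = 8 * X ^ (3 * τ + ρ) := by rw [pow_add, pow_mul']; ring
      _ ≤ _ := by gcongr; exacts [hs.X_pos, hs.hF rfl]

theorem QQ_le : I.QQ ≤ X ^ E := by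
  unfold Inst.QQ
  rw [hs.TT, ← pow_add]
  exact hs.pow_le (by have := hs.hE; have := hs.hτ; omega)

theorem totalLength_le (h : I.OK) : totalLength (I.docs forb) ≤ 30 * X ^ E := by
  have h1 := h.totalLength_docs_le forb
  have h2 := hs.GA_le
  have h3 := hs.GB_le
  have h4 := hs.QQ_le
  have h5 : I.DUM ≤ 1 + 8 * X ^ E := by
    unfold Inst.DUM Inst.CB
    have h6 : X ^ ρ * X ^ τ ≤ X ^ E := by
      rw [← pow_add]; exact hs.pow_le (by have := hs.hE; have := hs.hρ; omega)
    have h7 : I.K * (2 * I.TT) ≤ 3 * X ^ ρ * (2 * X ^ τ) := by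
      gcongr; exacts [hs.K_le h, hs.TT.le]
    have h8 : 3 * X ^ ρ * (2 * X ^ τ) = 6 * (X ^ ρ * X ^ τ) := by ring
    have h9 : 2 * I.RR * I.TT = 2 * (X ^ ρ * X ^ τ) := by rw [hs.RR, hs.TT]; ring
    omega
  have h10 : 1 ≤ X ^ E := Nat.one_le_pow _ _ hs.X_pos
  omega

/-- A bound for the cost of verification, in terms of the number `H` of false pairs. -/
theorem roundCost_sum_le (h : I.OK) (rep : Bool) {M : ℕ} (hM : M ≤ I.nq)
    (hw : ∀ q, q + 1 < M → ¬ I.Wins rep q) :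
    ∑ q ∈ Finset.range M, (I.roundCost rep q + 50) +
        800 * (I.n + (I.GA + I.GB forb) + I.QQ + 2) ≤
      2000 * ((bif rep then 1 else I.BB) *
        (8 * I.Ftot + (bif rep then 8 * I.n else 0) + I.BB)) +
      10000 * I.Gtot + 60000 * X ^ (q + ρ) + 12000 * X ^ E := by
  set H := 8 * I.Ftot + (bif rep then 8 * I.n else 0) + I.BB with hH
  have h1 := h.sum_walkCost_le rep hM hw
  have h2 := h.sum_hits_le rep hM hw
  rw [← hH] at h1 h2
  have h3 : ∑ q ∈ Finset.range M, (I.roundCost rep q + 50) =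
      600 * ∑ q ∈ Finset.range M, I.walkCost rep q +
        150 * ∑ q ∈ Finset.range M, (I.hits rep q).card + M * 950 := by
    unfold Inst.roundCost
    simp only [Finset.sum_add_distrib, ← Finset.mul_sum, Finset.sum_const, Finset.card_range,
      smul_eq_mul]
    ring
  have h4 : H ≤ (bif rep then 1 else I.BB) * H := by
    refine Nat.le_mul_of_pos_left _ ?_
    cases rep
    exacts [h.BB_pos, one_pos]
  have h5 : 8 * I.Ftot ≤ H := by omega
  have h6 := hs.nq_le h
  have h7 := hs.GA_le
  have h8 := hs.GB_le
  have h9 := hs.QQ_le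
  have h10 : 1 ≤ X ^ E := Nat.one_le_pow _ _ hs.X_pos
  have h11 : I.n ≤ X ^ E := hs.n.trans (hs.pow_le (by have := hs.hE; omega))
  rw [h3]
  omega

end Sizes

/-- A bound for the cost of the reduction, for a fixed hash function. -/
theorem total_cost_le {forb rep : Bool} {q ρ τ E X : ℕ} {I : Inst w}
    (hs : Sizes forb q ρ τ E X I) (h : I.OK) {tp tr : ℕ → ℝ≥0} {tq : ℕ → ℕ → ℝ≥0} {a b d : ℝ≥0}
    (hbd : ∀ N ≤ 30 * X ^ E, tp N ≤ a ∧ tq N 2 ≤ b ∧ tr N ≤ d) {M : ℕ} (hM : M ≤ I.nq)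
    (hw : ∀ q, q + 1 < M → ¬ I.Wins rep q) :
    tp (totalLength (I.docs forb)) + ∑ q ∈ Finset.range M,
      (tq (totalLength (I.docs forb)) (patLength (I.query rep q)) +
        ((answer (selects forb) (I.docs forb) (I.query rep q)).ncard : ℝ≥0) *
          tr (totalLength (I.docs forb))) +
      ((∑ q ∈ Finset.range M, (I.roundCost rep q + 50) +
        800 * (I.n + (I.GA + I.GB forb) + I.QQ + 2) : ℕ) : ℝ≥0) ≤
    a + 24 * (X ^ (q + ρ) * b) + 60000 * X ^ (q + ρ) + 12000 * X ^ E +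
      (d + 2000 * ((bif rep then 1 else X ^ (q - ρ) : ℕ) : ℝ≥0)) *
        (8 * (I.Ftot : ℝ≥0) + ((bif rep then 8 * X ^ q else 0 : ℕ) : ℝ≥0) + X ^ (q - ρ)) +
      10000 * (I.Gtot : ℝ≥0) := by
  obtain ⟨ha, hb, hd⟩ := hbd _ (hs.totalLength_le h)
  have h1 := h.sum_hits_le rep hM hw
  have h2 := hs.roundCost_sum_le h rep hM hw
  have h3 : (bif rep then 8 * I.n else 0) ≤ (bif rep then 8 * X ^ q else 0) := by
    cases rep
    · simp
    · simpa using hs.n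
  rw [hs.BB] at h1 h2
  have h4 : ∑ q ∈ Finset.range M,
      (tq (totalLength (I.docs forb)) (patLength (I.query rep q)) +
        ((answer (selects forb) (I.docs forb) (I.query rep q)).ncard : ℝ≥0) *
          tr (totalLength (I.docs forb))) ≤ 24 * (X ^ (q + ρ) * b) + d * (8 * (I.Ftot : ℝ≥0) +
            ((bif rep then 8 * X ^ q else 0 : ℕ) : ℝ≥0) + X ^ (q - ρ)) := by
    rw [Finset.sum_add_distrib]
    gcongr
    · calc _ = ∑ q ∈ Finset.range M, tq (totalLength (I.docs forb)) 2 := rfl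
        _ = M * tq (totalLength (I.docs forb)) 2 := by simp
        _ ≤ ((24 * X ^ (q + ρ) : ℕ) : ℝ≥0) * b := by
            gcongr; exact hM.trans (hs.nq_le h)
        _ = _ := by push_cast; ring
    · calc _ = ((∑ q ∈ Finset.range M,
            (answer (selects forb) (I.docs forb) (I.query rep q)).ncard : ℕ) : ℝ≥0) *
              tr (totalLength (I.docs forb)) := by push_cast; rw [Finset.sum_mul]
        _ ≤ ((8 * I.Ftot + (bif rep then 8 * X ^ q else 0) + X ^ (q - ρ) : ℕ) : ℝ≥0) * d := by
            gcongr
            refine (Finset.sum_le_sum fun q hq => h.answer_ncard_le rep forb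
              ((Finset.mem_range.1 hq).trans_le hM)).trans (h1.trans ?_)
            gcongr
        _ = _ := by push_cast; ring
  have h5 : ((∑ q ∈ Finset.range M, (I.roundCost rep q + 50) +
        800 * (I.n + (I.GA + I.GB forb) + I.QQ + 2) : ℕ) : ℝ≥0) ≤
      ((2000 * ((bif rep then 1 else X ^ (q - ρ)) *
        (8 * I.Ftot + (bif rep then 8 * X ^ q else 0) + X ^ (q - ρ))) +
      10000 * I.Gtot + 60000 * X ^ (q + ρ) + 12000 * X ^ E : ℕ) : ℝ≥0) := by
    refine Nat.cast_le.2 (h2.trans ?_)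
    gcongr
  refine (add_le_add (add_le_add ha h4) h5).trans (le_of_eq ?_)
  push_cast
  ring

theorem inst_sizes {forb : Bool} {q ρ τ E : ℕ} (hq : 0 < q) (hρ : ρ ≤ q) (hτ : τ ≤ q)
    (hE : q + τ ≤ E) (hF : forb = true → 3 * τ + ρ ≤ E) (A : List (BitVec w)) (r : Fin (2 ^ w)) :
    Sizes forb q ρ τ E (2 ^ scale q A.length) (inst q ρ τ A r) :=
  ⟨by positivity, by rw [← pow_mul']; exact (lt_pow_scale hq _).le, by rw [← pow_mul']; rfl,
    by rw [← pow_mul']; rfl, by rw [← pow_mul']; rfl, hρ, hτ, hE, hF⟩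

/-- The expected number of false triples is O(n³ / SS) with n ≤ X^q and SS = X^(ρ + 2τ), hence
O(X^φ). -/
theorem sum_inst_Ftot_le {q ρ τ φ : ℕ} (hq : 0 < q) (hφ : 3 * q ≤ φ + (ρ + 2 * τ))
    (A : List (BitVec w)) (hk : (ρ + 2 * τ) * scale q A.length ≤ w) :
    ∑ r : Fin (2 ^ w), (inst q ρ τ A r).Ftot ≤ 2 ^ w * (32 * (2 ^ scale q A.length) ^ φ) := by
  set ℓ := scale q A.length with hℓ
  set n := A.length
  refine (sum_Ftot_le _ n (w - (ρ + 2 * τ) * ℓ) (fun i => A.getD i 0)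
    fun r => ⟨rfl, rfl, rfl, rfl⟩).trans ?_
  have h1 : n ^ 3 ≤ 2 ^ ((ρ + 2 * τ) * ℓ) * (2 ^ ℓ) ^ φ := by
    calc n ^ 3 ≤ (2 ^ (q * ℓ)) ^ 3 := by gcongr; exact (lt_pow_scale hq _).le
      _ = 2 ^ (3 * q * ℓ) := by rw [← pow_mul]; congr 1; ring
      _ ≤ 2 ^ ((φ + (ρ + 2 * τ)) * ℓ) := by gcongr; norm_num
      _ = _ := by rw [Nat.add_mul, pow_add, ← pow_mul', Nat.mul_comm]
  calc _ ≤ 32 * 2 ^ (w - (ρ + 2 * τ) * ℓ) * (2 ^ ((ρ + 2 * τ) * ℓ) * (2 ^ ℓ) ^ φ) := by gcongr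
    _ = 2 ^ (w - (ρ + 2 * τ) * ℓ) * 2 ^ ((ρ + 2 * τ) * ℓ) * (32 * (2 ^ ℓ) ^ φ) := by ring
    _ = _ := by rw [← pow_add, Nat.sub_add_cancel hk]

/-- The expectation is O(n² / RR + n). It stays below X^(2q-1) because ρ ≥ 1. -/
theorem sum_inst_Gtot_le {q ρ τ : ℕ} (hq : 0 < q) (hρ : 1 ≤ ρ)
    (A : List (BitVec w)) (hk : (ρ + 2 * τ) * scale q A.length ≤ w)
    (hok : ∀ r, (inst q ρ τ A r).OK) :
    ∑ r : Fin (2 ^ w), (inst q ρ τ A r).Gtot ≤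
      2 ^ w * (33 * (2 ^ scale q A.length) ^ (2 * q - 1)) := by
  set ℓ := scale q A.length with hℓ
  set n := A.length with hn
  refine (sum_Gtot_le _ hok n (w - (ρ + 2 * τ) * ℓ) (2 ^ (τ * ℓ) * 2 ^ (τ * ℓ))
    (fun i => A.getD i 0) fun r => ⟨rfl, rfl, rfl, rfl, rfl⟩).trans ?_
  have hnq : n ≤ 2 ^ (q * ℓ) := (lt_pow_scale hq _).le
  have h1 : n ^ 2 ≤ 2 ^ (ρ * ℓ) * (2 ^ ℓ) ^ (2 * q - 1) := by
    calc n ^ 2 ≤ (2 ^ (q * ℓ)) ^ 2 := by gcongr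
      _ = 2 ^ (2 * q * ℓ) := by rw [← pow_mul]; congr 1; ring
      _ ≤ 2 ^ ((ρ + (2 * q - 1)) * ℓ) := by gcongr; exacts [by norm_num, by omega]
      _ = _ := by rw [Nat.add_mul, pow_add, ← pow_mul']
  have h2 : n ≤ (2 ^ ℓ) ^ (2 * q - 1) := by
    refine hnq.trans ?_
    rw [← pow_mul']
    exact Nat.pow_le_pow_right two_pos (Nat.mul_le_mul_right _ (by omega))
  have h3 : 2 ^ (τ * ℓ) * 2 ^ (τ * ℓ) * 2 ^ (w - (ρ + 2 * τ) * ℓ) * 2 ^ (ρ * ℓ) = 2 ^ w := by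
    rw [← pow_add, ← pow_add, ← pow_add]
    congr 1
    have : (ρ + 2 * τ) * ℓ = ρ * ℓ + (τ * ℓ + τ * ℓ) := by ring
    omega
  calc _ ≤ 32 * (2 ^ (τ * ℓ) * 2 ^ (τ * ℓ) * 2 ^ (w - (ρ + 2 * τ) * ℓ)) *
        (2 ^ (ρ * ℓ) * (2 ^ ℓ) ^ (2 * q - 1)) + 2 ^ w * (2 ^ ℓ) ^ (2 * q - 1) := by gcongr
    _ = 32 * (2 ^ (τ * ℓ) * 2 ^ (τ * ℓ) * 2 ^ (w - (ρ + 2 * τ) * ℓ) * 2 ^ (ρ * ℓ)) *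
        (2 ^ ℓ) ^ (2 * q - 1) + 2 ^ w * (2 ^ ℓ) ^ (2 * q - 1) := by ring
    _ = _ := by rw [h3]; ring

theorem scale_le_word {q ρ τ : ℕ} {A : List (BitVec w)} (hok : ∀ r, (inst q ρ τ A r).OK) :
    (ρ + 2 * τ) * scale q A.length ≤ w := by
  have h0 : 0 < 2 ^ w := by positivity
  have h1 := (hok ⟨0, h0⟩).hw
  have h2 : (inst q ρ τ A ⟨0, h0⟩).SS = 2 ^ ((ρ + 2 * τ) * scale q A.length) := by
    show 2 ^ (ρ * scale q A.length) *
      (2 ^ (τ * scale q A.length) * 2 ^ (τ * scale q A.length)) = _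
    rw [← pow_add, ← pow_add]; congr 1; ring
  refine (Nat.pow_le_pow_iff_right (a := 2) (by norm_num)).1 ?_
  rw [← h2]
  exact (Nat.le_mul_of_pos_right _ (by positivity)).trans h1.ge

/-- Exponents for which the reduction takes less than quadratic time, provided that the data
structure is fast. -/
structure Exponents (rep forb : Bool) (q ρ τ E φ : ℕ) : Prop where
  ρ_pos : 1 ≤ ρ
  hρ : ρ < q
  hτ : τ ≤ q
  hE : q + τ ≤ E
  hF : forb = true → 3 * τ + ρ ≤ E
  E_le : E ≤ 2 * q - 1
  hφ : 3 * q ≤ φ + (ρ + 2 * τ)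
  φ_le : φ ≤ 2 * q - 1
  φ_le' : rep = false → q - ρ + φ ≤ 2 * q - 1

/-- The data structure is fast on the collections that come from `X`. -/
def Fast (rep : Bool) (tp : ℕ → ℝ≥0) (tq : ℕ → ℕ → ℝ≥0) (tr : ℕ → ℝ≥0) (q ρ E φ : ℕ) (C : ℝ≥0)
    (X : ℕ) : Prop :=
  ∃ a b d : ℝ≥0, (∀ N ≤ 30 * X ^ E, tp N ≤ a ∧ tq N 2 ≤ b ∧ tr N ≤ d) ∧
    a ≤ C * X ^ (2 * q - 1) ∧ X ^ (q + ρ) * b ≤ C * X ^ (2 * q - 1) ∧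
    X ^ φ * d ≤ C * X ^ (2 * q - 1) ∧ X ^ (q - ρ) * d ≤ C * X ^ (2 * q - 1) ∧
    (rep = true → X ^ q * d ≤ C * X ^ (2 * q - 1))

/-- The average over all hash functions. -/
theorem average_le {ι : Type*} [Fintype ι] {rep forb : Bool} {q ρ τ E φ : ℕ}
    (hx : Exponents rep forb q ρ τ E φ) {X : ℕ} (hX : 0 < X) {a b d C : ℝ≥0}
    (ha : a ≤ C * X ^ (2 * q - 1)) (hb : X ^ (q + ρ) * b ≤ C * X ^ (2 * q - 1))
    (hd1 : X ^ φ * d ≤ C * X ^ (2 * q - 1)) (hd2 : X ^ (q - ρ) * d ≤ C * X ^ (2 * q - 1))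
    (hd3 : rep = true → X ^ q * d ≤ C * X ^ (2 * q - 1)) {F G : ι → ℕ}
    (hFs : ∑ r, F r ≤ Fintype.card ι * (32 * X ^ φ))
    (hGs : ∑ r, G r ≤ Fintype.card ι * (33 * X ^ (2 * q - 1))) :
    ∑ r, (a + 24 * (X ^ (q + ρ) * b) + 60000 * X ^ (q + ρ) + 12000 * X ^ E +
        (d + 2000 * ((bif rep then 1 else X ^ (q - ρ) : ℕ) : ℝ≥0)) *
          (8 * (F r : ℝ≥0) + ((bif rep then 8 * X ^ q else 0 : ℕ) : ℝ≥0) + X ^ (q - ρ)) +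
          10000 * (G r : ℝ≥0)) ≤
      Fintype.card ι * ((300 * C + 2000000) * (X : ℝ≥0) ^ (2 * q - 1)) := by
  obtain ⟨hρ1, hρ, hτ, hE, hF, hE', hφ, hφ', hφ2⟩ := hx
  set e : ℕ := bif rep then 8 * X ^ q else 0 with he
  set β : ℕ := bif rep then 1 else X ^ (q - ρ) with hβ
  have hmono : ∀ {i j : ℕ}, i ≤ j → X ^ i ≤ X ^ j := fun h => Nat.pow_le_pow_right hX h
  have hWc : (X : ℝ≥0) ^ (2 * q - 1) = ((X ^ (2 * q - 1) : ℕ) : ℝ≥0) := by push_cast; rfl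
  rw [hWc] at ha hb hd1 hd2 hd3 ⊢
  set W := X ^ (2 * q - 1) with hW
  -- The work of verification. In the decision version every hit costs a chunk of size X^(q-ρ),
  -- which is what `φ_le'` provides for; in the reporting version it costs O(1), but n degenerate
  -- hits are added.
  have hβU : β * (256 * X ^ φ + e + X ^ (q - ρ)) ≤ 265 * W := by
    cases rep with
    | false =>
      simp only [hβ, he, cond_false]
      have h1 : X ^ (q - ρ) * X ^ φ ≤ W := by rw [← pow_add]; exact hmono (hφ2 rfl)
      have h2 : X ^ (q - ρ) * X ^ (q - ρ) ≤ W := by rw [← pow_add]; exact hmono (by omega)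
      calc _ = 256 * (X ^ (q - ρ) * X ^ φ) + X ^ (q - ρ) * X ^ (q - ρ) := by ring
        _ ≤ _ := by omega
    | true =>
      simp only [hβ, he, cond_true]
      have h1 : X ^ φ ≤ W := hmono hφ'
      have h2 : X ^ (q - ρ) ≤ W := hmono (by omega)
      have h3 : X ^ q ≤ W := hmono (by omega)
      omega
  -- The price of reporting: the false pairs, the degenerate pairs, and the true pairs of the last
  -- query.
  have hdU : d * (256 * X ^ φ + e + X ^ (q - ρ) : ℕ) ≤ 265 * (C * W) := by
    have he' : d * (e : ℝ≥0) ≤ 8 * (C * W) := by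
      cases rep with
      | false => simp [he]
      | true =>
        have hd3' := hd3 rfl
        calc d * (e : ℝ≥0) = 8 * (X ^ q * d) := by simp only [he, cond_true]; push_cast; ring
          _ ≤ _ := by gcongr
    calc _ = 256 * (X ^ φ * d) + d * (e : ℝ≥0) + X ^ (q - ρ) * d := by push_cast; ring
      _ ≤ 256 * (C * W) + 8 * (C * W) + C * W := by
          gcongr
      _ = _ := by ring
  have hFs' : ∑ r, (F r : ℝ≥0) ≤ Fintype.card ι * (32 * (X : ℝ≥0) ^ φ) := by
    exact_mod_cast hFs
  have hGs' : ∑ r, (G r : ℝ≥0) ≤ Fintype.card ι * (33 * (W : ℝ≥0)) := by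
    exact_mod_cast hGs
  have h1 : ((X : ℝ≥0)) ^ (q + ρ) ≤ W := by exact_mod_cast hmono (by omega)
  have h2 : ((X : ℝ≥0)) ^ E ≤ W := by exact_mod_cast hmono hE'
  have hβU' : (β : ℝ≥0) * (256 * X ^ φ + e + X ^ (q - ρ)) ≤ 265 * W := by exact_mod_cast hβU
  have hdU' : d * (256 * X ^ φ + e + X ^ (q - ρ)) ≤ 265 * (C * W) := by exact_mod_cast hdU
  simp only [Finset.sum_add_distrib, ← Finset.mul_sum, Finset.sum_const, Finset.card_univ,
    nsmul_eq_mul]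
  calc _ = Fintype.card ι * (a + 24 * (X ^ (q + ρ) * b) + 60000 * X ^ (q + ρ) + 12000 * X ^ E) +
        (d + 2000 * (β : ℝ≥0)) * (8 * ∑ r, (F r : ℝ≥0) +
          Fintype.card ι * ((e : ℝ≥0) + X ^ (q - ρ))) +
        10000 * ∑ r, (G r : ℝ≥0) := by ring
    _ ≤ Fintype.card ι * (C * W + 24 * (C * W) + 60000 * W + 12000 * W) +
        (d + 2000 * (β : ℝ≥0)) * (8 * (Fintype.card ι * (32 * (X : ℝ≥0) ^ φ)) +
          Fintype.card ι * ((e : ℝ≥0) + X ^ (q - ρ))) + 10000 * (Fintype.card ι * (33 * (W : ℝ≥0))) := by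
        gcongr
    _ = Fintype.card ι * (25 * (C * W) + 402000 * W + d * (256 * X ^ φ + e + X ^ (q - ρ)) +
        2000 * ((β : ℝ≥0) * (256 * X ^ φ + e + X ^ (q - ρ)))) := by ring
    _ ≤ Fintype.card ι * (25 * (C * W) + 402000 * W + 265 * (C * W) + 2000 * (265 * W)) := by gcongr
    _ = Fintype.card ι * ((290 * C + 932000) * (W : ℝ≥0)) := by ring
    _ ≤ _ := by gcongr <;> norm_num

/-- For every input the cost of `total_cost_le` is averaged over the multiplier. The bounds of
`Fast` are required for all powers of two at once, because X grows with n. -/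
theorem solvesThreeSum {S : DataStructure} {rep forb : Bool} {tp tr : ℕ → ℝ≥0}
    {tq : ℕ → ℕ → ℝ≥0} (hS : S.Correct fun X q _ s => Reads rep (selects forb) X q s)
    (hT : S.TimeBound tp fun X q => tq (totalLength X) (patLength q) +
      ((answer (selects forb) X q).ncard : ℝ≥0) * tr (totalLength X))
    {q ρ τ E φ : ℕ} (hx : Exponents rep forb q ρ τ E φ) {C : ℝ≥0}
    (hfast : ∀ ℓ, Fast rep tp tq tr q ρ E φ C (2 ^ ℓ)) :
    SolvesThreeSum (threeSumProg S rep forb q ρ τ) (wordConst q S.c)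
      fun n => (300 * C + 2500000) * ((2 ^ scale q n : ℕ) : ℝ≥0) ^ (2 * q - 1) := by
  intro w A hA hw
  have hx' := hx
  obtain ⟨hρ1, hρ, hτ, hE, hF, hE', hφ, -, -⟩ := hx'
  have hq : 0 < q := by omega
  have hsix := pow_scale_six_le q A.length
  have hw1 : (A.length + 2) ^ (6 * q + 17) ≤ 2 ^ w := by
    refine le_trans (Nat.pow_le_pow_right (by omega) ?_) hw
    exact Nat.le_mul_of_pos_right _ (Nat.succ_pos _)
  have hw2 := hsix.trans hw1
  have hok := fun r => (inst_OK (ρ := ρ) (τ := τ) hq hρ.le hτ hA hw2 r).1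
  have hsz := inst_sizes hq hρ.le hτ hE hF A
  have hNw : ∀ r, (totalLength ((inst q ρ τ A r).docs forb) + 2) ^ S.c ≤ 2 ^ w := by
    intro r
    refine le_trans (Nat.pow_le_pow_left (((hok r).totalLength_le_Z forb).trans
      ((inst_OK hq hρ.le hτ hA hw2 r).2.trans hsix)) _) (le_trans ?_ hw)
    rw [← pow_mul]
    exact Nat.pow_le_pow_right (Nat.succ_pos _) (Nat.mul_le_mul_left _ (Nat.le_succ _))
  classical
  -- Infinite on wrong answers: a finite value of `ert` then implies that no wrong answer has
  -- positive probability.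
  set f : State w → ℝ≥0∞ := fun s => if (s.reg 0 ≠ 0 ↔ HasThreeSum A) then 0 else ∞ with hf
  obtain ⟨s, hs, hert⟩ := ert_threeSumProg_le (S := S) (rep := rep) (forb := forb) hq hρ.le hτ hA
    hw2 f
  obtain ⟨a, b, d, hbd, ha, hb, hd1, hd2, hd3⟩ := hfast (scale q A.length)
  have hk : (ρ + 2 * τ) * scale q A.length ≤ w := scale_le_word hok
  have hFs := sum_inst_Ftot_le hq hφ A hk
  have hGs := sum_inst_Gtot_le hq hρ1 A hk hok
  have hX0 : 0 < 2 ^ scale q A.length := by positivity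
  have hnX : A.length < (2 ^ scale q A.length) ^ q := by
    rw [← pow_mul']; exact lt_pow_scale hq _
  show _ ≤ (((300 * C + 2500000) * ((2 ^ scale q A.length : ℕ) : ℝ≥0) ^ (2 * q - 1) : ℝ≥0) : ℝ≥0∞) ∧
    _
  obtain ⟨X, hX⟩ : ∃ X, X = 2 ^ scale q A.length := ⟨_, rfl⟩
  rw [← hX] at hbd ha hb hd1 hd2 hd3 hFs hGs hX0 hnX hsz ⊢
  have hr : ∀ r, ert f ([reduction S rep forb], s r) ≤
      ((a + 24 * (X ^ (q + ρ) * b) + 60000 * X ^ (q + ρ) + 12000 * X ^ E +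
        (d + 2000 * ((bif rep then 1 else X ^ (q - ρ) : ℕ) : ℝ≥0)) *
          (8 * ((inst q ρ τ A r).Ftot : ℝ≥0) + ((bif rep then 8 * X ^ q else 0 : ℕ) : ℝ≥0) +
            X ^ (q - ρ)) + 10000 * ((inst q ρ τ A r).Gtot : ℝ≥0) : ℝ≥0) : ℝ≥0∞) := by
    intro r
    obtain ⟨M, hM, hnw, hle⟩ := ert_reduction_le (hok r) hS hT (hNw r) (f := f) (fun s' hs' => by
      rw [hasThreeSum_iff (hok r) rep rfl fun _ => rfl] at hs'
      exact if_pos hs') (hs r)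
    exact hle.trans (ENNReal.coe_le_coe.2 (total_cost_le (hsz r) (hok r) hbd hM hnw))
  have havg := average_le hx hX0 ha hb hd1 hd2 hd3 (F := fun r => (inst q ρ τ A r).Ftot)
    (G := fun r => (inst q ρ τ A r).Gtot) (by rwa [Fintype.card_fin]) (by rwa [Fintype.card_fin])
  rw [Fintype.card_fin] at havg
  have hn1 : 100 * A.length + 500 ≤ 500000 * X ^ (2 * q - 1) := by
    have h2 : X ^ q ≤ X ^ (2 * q - 1) := Nat.pow_le_pow_right hX0 (by omega)
    omega
  have htotal : ert f ([threeSumProg S rep forb q ρ τ], threeSumInput A) ≤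
      (((300 * C + 2500000) * (X : ℝ≥0) ^ (2 * q - 1) : ℝ≥0) : ℝ≥0∞) := by
    refine hert.trans ?_
    have h1 : (2 ^ w : ℝ≥0∞)⁻¹ * ∑ r, ert f ([reduction S rep forb], s r) ≤
        (((300 * C + 2000000) * (X : ℝ≥0) ^ (2 * q - 1) : ℝ≥0) : ℝ≥0∞) := by
      refine (mul_le_mul_right ((Finset.sum_le_sum fun r _ => hr r).trans
        ((ENNReal.ofNNReal_finsetSum _ _).symm.le.trans (ENNReal.coe_le_coe.2 havg))) _).trans (le_of_eq ?_)
      rw [ENNReal.coe_mul, ← mul_assoc, ENNReal.coe_natCast, Nat.cast_pow, Nat.cast_ofNat,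
        ENNReal.inv_mul_cancel (by positivity) (by finiteness), one_mul]
    refine (add_le_add (Nat.cast_le.2 hn1) h1).trans (le_of_eq ?_)
    rw [← ENNReal.coe_natCast, ← ENNReal.coe_add]
    congr 1
    push_cast
    ring
  rw [ert_eq] at htotal
  refine ⟨le_self_add.trans htotal, fun s' hs' => ?_⟩
  have hfin : expFinal (threeSumProg S rep forb q ρ τ) (threeSumInput A) f ≠ ∞ :=
    ((le_add_self.trans htotal).trans_lt ENNReal.coe_lt_top).ne
  by_contra hne
  exact of_expFinal_lt_top hfin hs' (if_neg hne)

end WordRAM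
end

noncomputable section
namespace WordRAM

/-! ### Asymptotics -/

/-- The algorithm contradicts the conjecture. -/
theorem not_solvesThreeSum (h3SUM : ThreeSumConjecture) {p : Prog} {c q : ℕ} (hq : 0 < q)
    (C : ℝ≥0) : ¬ SolvesThreeSum p c fun n => C * ((2 ^ scale q n : ℕ) : ℝ≥0) ^ (2 * q - 1) := by
  intro h
  have hq' : (0 : ℝ) < q := by exact_mod_cast hq
  have he : (0 : ℝ) ≤ 2 - 1 / (q : ℝ) := by
    have : 1 / (q : ℝ) ≤ 1 := by rw [div_le_one hq']; exact_mod_cast hq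
    linarith
  refine h3SUM p c _ h (1 / (q : ℝ)) (by positivity) (IsBigO.of_bound
    (C * ((2 : ℝ) ^ (q + 1)) ^ (2 - 1 / (q : ℝ))) ?_)
  filter_upwards [eventually_ge_atTop 1] with n hn
  have hn' : (1 : ℝ) ≤ n := by exact_mod_cast hn
  have h1 : ((2 ^ scale q n : ℕ) : ℝ) ^ q ≤ 2 ^ (q + 1) * n := by
    have h2 := pow_scale_le (q := q) n
    rw [pow_mul'] at h2
    calc ((2 ^ scale q n : ℕ) : ℝ) ^ q ≤ 2 ^ q * (n + 1) := by exact_mod_cast h2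
      _ ≤ 2 ^ q * (2 * n) := by gcongr; linarith
      _ = _ := by ring
  set X : ℝ := ((2 ^ scale q n : ℕ) : ℝ) with hX
  have hX0 : 0 ≤ X := Nat.cast_nonneg _
  -- The saving of one factor X in X^(2q) is a saving of n^(1/q).
  have h3 : X ^ (2 * q - 1) = (X ^ q) ^ (2 - 1 / (q : ℝ)) := by
    rw [← Real.rpow_natCast X q, ← Real.rpow_mul hX0, ← Real.rpow_natCast]
    congr 1
    rw [Nat.cast_sub (by omega)]
    push_cast
    field_simp
  rw [Real.norm_of_nonneg (by positivity), Real.norm_of_nonneg (by positivity)]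
  push_cast
  calc (C : ℝ) * (2 ^ scale q n) ^ (2 * q - 1) = C * X ^ (2 * q - 1) := by
        rw [hX]; push_cast; rfl
    _ = C * (X ^ q) ^ (2 - 1 / (q : ℝ)) := by rw [h3]
    _ ≤ C * (2 ^ (q + 1) * n) ^ (2 - 1 / (q : ℝ)) := by gcongr
    _ = _ := by rw [Real.mul_rpow (by positivity) (by positivity), mul_assoc]

/-- `g N` is at most a constant times `(N + 1) ^ e`, and `e` is nonnegative. -/
def PowBound (g : ℕ → ℝ≥0) (e : ℝ) : Prop :=
  0 ≤ e ∧ ∃ C : ℝ≥0, ∀ N : ℕ, g N ≤ C * ((N : ℝ≥0) + 1) ^ e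

/-- A bound on the sum bounds each summand. The finitely many N before the asymptotic range are
absorbed into the constant, which is possible because `e` is nonnegative. -/
theorem PowBound.of_isBigO {f : ℕ → ℝ} {g : ℕ → ℝ≥0} {a β e : ℝ}
    (hf : f =O[atTop] fun N : ℕ => (N : ℝ) ^ β) (hg : ∀ N : ℕ, (N : ℝ) ^ a * g N ≤ f N)
    (he : 0 ≤ e) (hβ : β - a ≤ e) : PowBound g e := by
  refine ⟨he, ?_⟩
  obtain ⟨c, hc, hb⟩ := hf.exists_pos
  obtain ⟨N₀, hN₀⟩ := eventually_atTop.1 hb.bound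
  refine ⟨∑ N ∈ Finset.range (N₀ + 1), g N + c.toNNReal, fun N => ?_⟩
  have h1 : (1 : ℝ≥0) ≤ ((N : ℝ≥0) + 1) ^ e := NNReal.one_le_rpow (by simp) he
  rcases Nat.lt_or_ge N (N₀ + 1) with hN | hN
  · calc g N ≤ ∑ N ∈ Finset.range (N₀ + 1), g N :=
          Finset.single_le_sum (f := g) (fun _ _ => zero_le) (Finset.mem_range.2 hN)
      _ ≤ ∑ N ∈ Finset.range (N₀ + 1), g N + c.toNNReal := le_self_add
      _ ≤ _ := le_mul_of_one_le_right' h1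
  · have hN1 : (1 : ℝ) ≤ N := by exact_mod_cast (by omega : 1 ≤ N)
    have hN0 : (0 : ℝ) < N := by linarith
    have h2 := hN₀ N (by omega)
    rw [Real.norm_of_nonneg (by positivity : (0 : ℝ) ≤ (N : ℝ) ^ β)] at h2
    have h3 : (g N : ℝ) ≤ c * ((N : ℝ) + 1) ^ e := by
      have h4 : (N : ℝ) ^ a * g N ≤ c * (N : ℝ) ^ β := (hg N).trans ((le_abs_self _).trans h2)
      have h5 : (N : ℝ) ^ β = (N : ℝ) ^ a * (N : ℝ) ^ (β - a) := by
        rw [← Real.rpow_add hN0]; congr 1; ring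
      have h6 : (g N : ℝ) ≤ c * (N : ℝ) ^ (β - a) := by
        refine le_of_mul_le_mul_left ?_ (Real.rpow_pos_of_pos hN0 a)
        calc _ ≤ c * (N : ℝ) ^ β := h4
          _ = _ := by rw [h5]; ring
      refine h6.trans ?_
      gcongr
      exact (Real.rpow_le_rpow_of_exponent_le hN1 hβ).trans
        (Real.rpow_le_rpow hN0.le (by linarith) he)
    have h7 : g N ≤ c.toNNReal * ((N : ℝ≥0) + 1) ^ e := by
      rw [← NNReal.coe_le_coe]
      push_cast
      rwa [Real.coe_toNNReal c hc.le]
    refine h7.trans ?_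
    gcongr
    exact le_add_self

theorem PowBound.le {g : ℕ → ℝ≥0} {e : ℝ} (h : PowBound g e) :
    ∃ C : ℝ≥0, ∀ E X N : ℕ, 0 < X → N ≤ 30 * X ^ E → g N ≤ C * (X : ℝ≥0) ^ (E * e) := by
  obtain ⟨he, C, hC⟩ := h
  refine ⟨C * 31 ^ e, fun E X N hX hN => (hC N).trans ?_⟩
  have h1 : (1 : ℝ≥0) ≤ X ^ E := by exact_mod_cast Nat.one_le_pow _ _ hX
  have h2 : (N : ℝ≥0) + 1 ≤ 31 * X ^ E := by
    have : (N : ℝ≥0) ≤ 30 * X ^ E := by exact_mod_cast hN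
    calc (N : ℝ≥0) + 1 ≤ 30 * X ^ E + X ^ E := add_le_add this h1
      _ = _ := by ring
  calc _ ≤ C * (31 * (X : ℝ≥0) ^ E) ^ e := by gcongr
    _ = _ := by
        rw [NNReal.mul_rpow, mul_assoc, ← NNReal.rpow_natCast, ← NNReal.rpow_mul]

/-- On collections of length at most 30 X^E a bound with exponent e becomes a power X^(E e). What
remains are the linear inequalities between exponents. -/
theorem fast_of_powBound {rep : Bool} {tp tr : ℕ → ℝ≥0} {tq : ℕ → ℕ → ℝ≥0} {e₁ e₂ e₃ : ℝ}
    (hp : PowBound tp e₁) (hq : PowBound (fun N => tq N 2) e₂) (hr : PowBound tr e₃)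
    {q ρ E φ : ℕ} (hqpos : 0 < q) (h1 : E * e₁ ≤ 2 * q - 1) (h2 : q + ρ + E * e₂ ≤ 2 * q - 1)
    (h3 : φ + E * e₃ ≤ 2 * q - 1) (h4 : (q - ρ : ℕ) + E * e₃ ≤ 2 * q - 1)
    (h5 : rep = true → q + E * e₃ ≤ 2 * q - 1) :
    ∃ C : ℝ≥0, ∀ X : ℕ, 0 < X → Fast rep tp tq tr q ρ E φ C X := by
  obtain ⟨C₁, hC₁⟩ := hp.le
  obtain ⟨C₂, hC₂⟩ := hq.le
  obtain ⟨C₃, hC₃⟩ := hr.le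
  refine ⟨C₁ + C₂ + C₃, fun X hX => ⟨C₁ * (X : ℝ≥0) ^ (E * e₁), C₂ * (X : ℝ≥0) ^ (E * e₂),
    C₃ * (X : ℝ≥0) ^ (E * e₃), fun N hN => ⟨hC₁ E X N hX hN, hC₂ E X N hX hN, hC₃ E X N hX hN⟩,
    ?_⟩⟩
  have hX1 : (1 : ℝ≥0) ≤ X := by exact_mod_cast hX
  have hX0 : (X : ℝ≥0) ≠ 0 := by positivity
  have hcast : (2 * (q : ℝ) - 1) = ((2 * q - 1 : ℕ) : ℝ) := by
    rw [Nat.cast_sub (by omega)]; push_cast; ring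
  have key : ∀ (i : ℕ) (e : ℝ) (D : ℝ≥0), D ≤ C₁ + C₂ + C₃ → i + e ≤ 2 * q - 1 →
      (X : ℝ≥0) ^ i * (D * (X : ℝ≥0) ^ e) ≤ (C₁ + C₂ + C₃) * (X : ℝ≥0) ^ (2 * q - 1) := by
    intro i e D hD hi
    calc (X : ℝ≥0) ^ i * (D * (X : ℝ≥0) ^ e) = D * (X : ℝ≥0) ^ ((i : ℝ) + e) := by
          rw [NNReal.rpow_add hX0, NNReal.rpow_natCast]; ring
      _ ≤ (C₁ + C₂ + C₃) * (X : ℝ≥0) ^ ((2 * q - 1 : ℕ) : ℝ) := by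
          gcongr
          rw [← hcast]
          exact hi
      _ = _ := by rw [NNReal.rpow_natCast]
  have hC1 : C₁ ≤ C₁ + C₂ + C₃ := by rw [add_assoc]; exact le_self_add
  have hC2 : C₂ ≤ C₁ + C₂ + C₃ := le_self_add.trans' le_add_self
  have hC3 : C₃ ≤ C₁ + C₂ + C₃ := le_add_self
  refine ⟨?_, key _ _ _ hC2 (by push_cast; linarith), key _ _ _ hC3 h3, key _ _ _ hC3 h4,
    fun h => key _ _ _ hC3 (h5 h)⟩
  simpa using key 0 _ _ hC1 (by simpa using h1)

/-- There is no fast data structure. -/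
theorem not_fast (h3SUM : ThreeSumConjecture) {S : DataStructure} {rep forb : Bool}
    {tp tr : ℕ → ℝ≥0} {tq : ℕ → ℕ → ℝ≥0}
    (hS : S.Correct fun X q _ s => Reads rep (selects forb) X q s)
    (hT : S.TimeBound tp fun X q => tq (totalLength X) (patLength q) +
      ((answer (selects forb) X q).ncard : ℝ≥0) * tr (totalLength X))
    {q ρ τ E φ : ℕ} (hx : Exponents rep forb q ρ τ E φ) {γ δ D ε : ℝ} (hD : 1 ≤ D)
    (hγ0 : 0 ≤ γ) (hγ : γ ≤ 1) (hδ0 : 0 ≤ δ) (hδ : δ ≤ 1 + γ) (hδr : rep = true → δ ≤ 1)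
    (hE : (E : ℝ) ≤ D * q + 1) (hε : 0 ≤ ε) (hq : 6 ≤ q * ε)
    (hρ₁ : γ * q ≤ ρ) (hρ₂ : (ρ : ℝ) ≤ γ * q + 2) (hφ : φ + δ * q ≤ 2 * q)
    (hp : PowBound tp (2 / D - ε)) (hq' : PowBound (fun N => tq N 2) ((1 - γ) / D - ε))
    (hr : PowBound tr (δ / D - ε)) : False := by
  have hqpos : 0 < q := by have := hx.hρ; omega
  have hq0 : (0 : ℝ) < q := by exact_mod_cast hqpos
  have hEq : (q : ℝ) ≤ E := by exact_mod_cast (Nat.le_add_right q τ).trans hx.hE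
  -- Since E ≤ D q + 1, a bound with exponent x / D - ε costs at most X^(xq + x - qε). The surplus
  -- qε ≥ 6 pays for all roundings in E and ρ and for the final saving of one factor X.
  have key : ∀ x : ℝ, 0 ≤ x → E * (x / D - ε) ≤ x * q + x - q * ε := by
    intro x hx0
    have hD0 : 0 < D := by linarith
    have h1 : E * (x / D) ≤ x * q + x := by
      calc E * (x / D) ≤ (D * q + 1) * (x / D) := by gcongr
        _ = x * q + x / D := by field_simp
        _ ≤ x * q + x := by
          have : x / D ≤ x := div_le_self hx0 hD
          linarith
    have h2 : q * ε ≤ E * ε := by gcongr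
    linarith [mul_sub (E : ℝ) (x / D) ε]
  have k1 := key 2 (by norm_num)
  have k2 := key (1 - γ) (by linarith)
  have k3 := key δ hδ0
  have hsub : ((q - ρ : ℕ) : ℝ) = q - ρ := Nat.cast_sub hx.hρ.le
  have hδq : δ * q ≤ (1 + γ) * q := by gcongr
  obtain ⟨C, hC⟩ := fast_of_powBound (rep := rep) (φ := φ) (ρ := ρ) (E := E) hp hq' hr hqpos
    (by linarith) (by linarith) (by linarith) (by rw [hsub]; linarith) (fun h => by
      have : δ * q ≤ 1 * q := by gcongr; exact hδr h
      linarith)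
  exact not_solvesThreeSum h3SUM hqpos _ (solvesThreeSum hS hT hx fun ℓ => hC _ (by positivity))

/-- A linear lower bound needs no conjecture. -/
theorem isAlmostOmega_of_linear {f : ℕ → ℝ} {b : ℝ} (hb : b ≤ 1)
    (hf : ∀ N : ℕ, 2 ≤ N → (N : ℝ) ≤ f N) : IsAlmostOmega f b := by
  intro ε hε hO
  obtain ⟨c, hc⟩ := hO.bound
  have h1 : Tendsto (fun N : ℕ => (N : ℝ) ^ (1 - b + ε)) atTop atTop :=
    (tendsto_rpow_atTop (by linarith)).comp tendsto_natCast_atTop_atTop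
  obtain ⟨N, hN, hN2, hNc⟩ := (hc.and ((eventually_ge_atTop 2).and
    (h1.eventually_gt_atTop c))).exists
  have hN0 : (0 : ℝ) < N := by exact_mod_cast (by omega : 0 < N)
  rw [Real.norm_of_nonneg (by positivity : (0 : ℝ) ≤ (N : ℝ) ^ (b - ε))] at hN
  have h2 : (N : ℝ) ≤ c * (N : ℝ) ^ (b - ε) := (hf N hN2).trans ((le_abs_self _).trans hN)
  have h3 : (N : ℝ) = (N : ℝ) ^ (1 - b + ε) * (N : ℝ) ^ (b - ε) := by
    rw [← Real.rpow_add hN0]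
    simp
  have h4 := mul_lt_mul_of_pos_right hNc (Real.rpow_pos_of_pos hN0 (b - ε))
  linarith

end WordRAM
end

/-! ### The choice of exponents for the three bounds -/

noncomputable section
namespace WordRAM

theorem DataStructure.Correct.mono {S : DataStructure}
    {G G' : List Str → Query → ∀ {w : ℕ}, State w → Prop} (h : S.Correct G)
    (hG : ∀ (w : ℕ) X q (s : State w), G X q s → G' X q s) : S.Correct G' :=
  fun w X hX hw s hs q hq s' hs' => hG w X q s' (h w X hX hw s hs q hq s' hs')

theorem DataStructure.Decides.reads {S : DataStructure} {forb : Bool} {tp : ℕ → ℝ≥0}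
    {tq : ℕ → ℕ → ℝ≥0} (h : S.Decides (selects forb) tp tq) :
    S.Correct (fun X q _ s => Reads false (selects forb) X q s) ∧
    S.TimeBound tp fun X q => tq (totalLength X) (patLength q) +
      ((answer (selects forb) X q).ncard : ℝ≥0) * (fun _ => 0 : ℕ → ℝ≥0) (totalLength X) :=
  ⟨h.1, by simpa using h.2⟩

theorem DataStructure.Reports.reads {S : DataStructure} {forb : Bool} {tp tr : ℕ → ℝ≥0}
    {tq : ℕ → ℕ → ℝ≥0} (h : S.Reports (selects forb) tp tq tr) (rep : Bool) :
    S.Correct fun X q _ s => Reads rep (selects forb) X q s := by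
  refine h.1.mono fun w X q s hl => ?_
  cases rep with
  | true => exact hl
  | false =>
    obtain ⟨l, -, hl, hlen, -⟩ := hl
    change s.reg 0 ≠ 0 ↔ _
    have h1 : s.reg 0 ≠ 0 ↔ l ≠ [] := by
      rw [ne_eq, ne_eq, ← List.length_eq_zero_iff, ← hlen, ← BitVec.toNat_inj]
      rfl
    rw [h1]
    exact ⟨fun h => (List.exists_mem_of_ne_nil l h).imp fun i hi => (hl i).1 hi,
      fun ⟨i, hi⟩ => List.ne_nil_of_mem ((hl i).2 hi)⟩

/-- It suffices to consider small `ε`. -/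
theorem IsAlmostOmega.of_le {f : ℕ → ℝ} {b ε₀ : ℝ} (h₀ : 0 < ε₀)
    (h : ∀ ε, 0 < ε → ε ≤ ε₀ → ¬ f =O[atTop] fun N : ℕ => (N : ℝ) ^ (b - ε)) :
    IsAlmostOmega f b := by
  intro ε hε hO
  refine h (min ε ε₀) (lt_min hε h₀) (min_le_right _ _) (hO.trans (IsBigO.of_bound 1 ?_))
  filter_upwards [eventually_ge_atTop 1] with N hN
  have hN1 : (1 : ℝ) ≤ N := by exact_mod_cast hN
  rw [one_mul, Real.norm_of_nonneg (by positivity), Real.norm_of_nonneg (by positivity)]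
  exact Real.rpow_le_rpow_of_exponent_le hN1 (by linarith [min_le_left ε ε₀])

theorem le_add_rpow_mul {N : ℕ} (hN : 2 ≤ N) {a : ℝ} (ha : 0 ≤ a) {x y : ℝ≥0}
    (h : (N : ℝ≥0) ≤ x + y) : (N : ℝ) ≤ x + (N : ℝ) ^ a * y := by
  have h1 : (1 : ℝ) ≤ (N : ℝ) ^ a :=
    Real.one_le_rpow (by exact_mod_cast (by omega : 1 ≤ N)) ha
  have h2 : (N : ℝ) ≤ x + y := by exact_mod_cast h
  have h3 : (y : ℝ) ≤ (N : ℝ) ^ a * y := le_mul_of_one_le_left y.2 h1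
  linarith

theorem powBound_zero {e : ℝ} (he : 0 ≤ e) : PowBound (fun _ => 0) e := ⟨he, 0, by simp⟩

theorem exists_nat_bounds {x y z : ℝ} (hx : 0 < x) (hy : 0 < y) (hz : 0 < z) :
    ∃ q : ℕ, 0 < q ∧ 6 ≤ q * x ∧ 6 ≤ q * y ∧ 6 ≤ q * z := by
  obtain ⟨q, hq⟩ := exists_nat_ge (max (6 / x) (max (6 / y) (6 / z)))
  simp only [max_le_iff, div_le_iff₀ hx, div_le_iff₀ hy, div_le_iff₀ hz] at hq
  refine ⟨q, Nat.pos_of_ne_zero ?_, hq.1, hq.2.1, hq.2.2⟩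
  rintro rfl
  norm_num at hq

theorem ceil_bounds {x : ℝ} (hx : 0 ≤ x) :
    x + 1 ≤ ((⌈x⌉₊ + 1 : ℕ) : ℝ) ∧ ((⌈x⌉₊ + 1 : ℕ) : ℝ) < x + 2 := by
  push_cast
  constructor <;> linarith [Nat.le_ceil x, Nat.ceil_lt_add_one hx]

/-- The complemented characters dominate, so N is about X^(3τ + ρ). With ρ about γq and τ about (1 -
γ)q this is n^(3 - 2γ), and the false hits, each costing a chunk, stay just below n². -/
theorem isAlmostOmega_forbidden (h3SUM : ThreeSumConjecture) {γ : ℝ} (h0 : 0 < γ) (h1 : γ < 1)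
    {S : DataStructure} {tp : ℕ → ℝ≥0} {tq : ℕ → ℕ → ℝ≥0}
    (h : S.Decides forbiddenPattern tp tq) :
    IsAlmostOmega (fun N => (tp N : ℝ) + (N : ℝ) ^ ((1 + γ) / (3 - 2 * γ)) * (tq N 2 : ℝ))
      (2 / (3 - 2 * γ)) := by
  obtain ⟨hS, hT⟩ := DataStructure.Decides.reads (forb := true) h
  have hD : 1 ≤ 3 - 2 * γ := by linarith
  have hD0 : 0 < 3 - 2 * γ := by linarith
  -- For γ ≤ 1/2 the claimed exponent is at most 1 and reading the text suffices. For larger γ the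
  -- text is shorter than quadratic in n, as the reduction requires.
  rcases le_or_gt γ (1 / 2) with hγ | hγ
  · refine isAlmostOmega_of_linear (by rw [div_le_one hD0]; linarith) fun N hN =>
      le_add_rpow_mul hN (by positivity) (le_time_of_decides h hN (q := ([1], [0]))
        (validQuery_pair (by omega) (by omega)) ?_ ?_) <;>
    · simp [forbiddenPattern]
  have hd : 0 < (1 - γ) / (3 - 2 * γ) := div_pos (by linarith) hD0
  -- Restricting to such ε keeps the assumed exponent (1 - γ)/D - ε of the query time nonnegative,
  -- as `PowBound` demands.
  refine IsAlmostOmega.of_le hd fun ε hε hε' hO => ?_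
  obtain ⟨q, hq, q1, q2, q3⟩ := exists_nat_bounds hε (show 0 < 1 - γ by linarith)
    (show 0 < 2 * γ - 1 by linarith)
  obtain ⟨r1, r2⟩ := ceil_bounds (show 0 ≤ γ * q by positivity)
  set ρ := ⌈γ * q⌉₊ + 1 with hρ
  have hρ1 : 1 ≤ ρ := by omega
  have hρq : ρ < q := by exact_mod_cast (by linarith : (ρ : ℝ) < q)
  -- This is where 2γ > 1 enters: it makes E = 3q + 3 - 2ρ at most 2q - 1.
  have hρ2 : q + 4 ≤ 2 * ρ := by exact_mod_cast (by linarith : (q : ℝ) + 4 ≤ 2 * ρ)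
  have hE : 3 * (q - ρ + 1) + ρ = 3 * q + 3 - 2 * ρ := by omega
  have hdiv : (1 - γ) / (3 - 2 * γ) ≤ 2 / (3 - 2 * γ) := by gcongr; linarith
  refine not_fast h3SUM hS hT
    (q := q) (ρ := ρ) (τ := q - ρ + 1) (E := 3 * (q - ρ + 1) + ρ) (φ := q + ρ - 2)
    ⟨hρ1, hρq, by omega, by omega, fun _ => le_rfl, by omega, by omega, by omega,
      fun _ => by omega⟩ (γ := γ) (δ := 1 - γ) (D := 3 - 2 * γ) (ε := ε) hD h0.le h1.le
    (by linarith) (by linarith) (by simp) ?_ hε.le q1 (by linarith) r2.le ?_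
    (PowBound.of_isBigO (a := 0) hO (fun N => ?_) (by linarith) (by simp))
    (PowBound.of_isBigO (a := (1 + γ) / (3 - 2 * γ)) hO (fun N => ?_) (by linarith) (le_of_eq ?_))
    (powBound_zero (by linarith))
  · rw [hE, Nat.cast_sub (by omega)]
    push_cast
    linarith
  · rw [Nat.cast_sub (by omega)]
    push_cast
    linarith
  · rw [Real.rpow_zero, one_mul]
    exact le_add_of_nonneg_right (by positivity)
  · exact le_add_of_nonneg_left (by positivity)
  · rw [sub_right_comm, ← sub_div]
    congr 2
    ring

/-- The same choice of ρ and τ; without the complement the length is about X^(q + τ) = X^(2q + 1 -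
ρ), hence D = 2 - γ. -/
theorem isAlmostOmega_twoPatterns (h3SUM : ThreeSumConjecture) {γ : ℝ} (h0 : 0 < γ) (h1 : γ < 1)
    {S : DataStructure} {tp : ℕ → ℝ≥0} {tq : ℕ → ℕ → ℝ≥0}
    (h : S.Decides twoPatterns tp tq) :
    IsAlmostOmega (fun N => (tp N : ℝ) + (N : ℝ) ^ ((1 + γ) / (2 - γ)) * (tq N 2 : ℝ))
      (2 / (2 - γ)) := by
  obtain ⟨hS, hT⟩ := DataStructure.Decides.reads (forb := false) h
  have hD : 1 ≤ 2 - γ := by linarith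
  have hD0 : 0 < 2 - γ := by linarith
  have hd : 0 < (1 - γ) / (2 - γ) := div_pos (by linarith) hD0
  refine IsAlmostOmega.of_le hd fun ε hε hε' hO => ?_
  obtain ⟨q, hq, q1, q2, -⟩ := exists_nat_bounds hε (show 0 < 1 - γ by linarith) h0
  have hγq : 0 < γ * q := by positivity
  obtain ⟨r1, r2⟩ := ceil_bounds hγq.le
  set ρ := ⌈γ * q⌉₊ + 1 with hρ
  -- Positivity of γ gives ρ ≥ 2, so the length exponent 2q + 1 - ρ is at most 2q - 1.
  have hρ1 : 2 ≤ ρ := by have := Nat.ceil_pos.2 hγq; omega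
  have hρq : ρ < q := by exact_mod_cast (by linarith : (ρ : ℝ) < q)
  have hE : q + (q - ρ + 1) = 2 * q + 1 - ρ := by omega
  have hdiv : (1 - γ) / (2 - γ) ≤ 2 / (2 - γ) := by gcongr; linarith
  refine not_fast h3SUM hS hT
    (q := q) (ρ := ρ) (τ := q - ρ + 1) (E := q + (q - ρ + 1)) (φ := q + ρ - 2)
    ⟨by omega, hρq, by omega, le_rfl, by simp, by omega, by omega, by omega,
      fun _ => by omega⟩ (γ := γ) (δ := 1 - γ) (D := 2 - γ) (ε := ε) hD h0.le h1.le
    (by linarith) (by linarith) (by simp) ?_ hε.le q1 (by linarith) r2.le ?_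
    (PowBound.of_isBigO (a := 0) hO (fun N => ?_) (by linarith) (by simp))
    (PowBound.of_isBigO (a := (1 + γ) / (2 - γ)) hO (fun N => ?_) (by linarith) (le_of_eq ?_))
    (powBound_zero (by linarith))
  · rw [hE, Nat.cast_sub (by omega)]
    push_cast
    linarith
  · rw [Nat.cast_sub (by omega)]
    push_cast
    linarith
  · rw [Real.rpow_zero, one_mul]
    exact le_add_of_nonneg_right (by positivity)
  · exact le_add_of_nonneg_left (by positivity)
  · rw [sub_right_comm, ← sub_div]
    congr 2
    ring

/-- Now τ is about (1 + δ - γ)q/2, chosen so that the number X^φ of false pairs is about n^(2 - δ);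
reporting them at price n^δ costs just about n². The length is n^D with D = (3 + δ - γ)/2. -/
theorem isAlmostOmega_reporting (h3SUM : ThreeSumConjecture) {γ δ : ℝ} (h0 : 0 ≤ γ) (h1 : γ < 1)
    (hδ : 0 < δ) {S : DataStructure} {tp : ℕ → ℝ≥0} {tq : ℕ → ℕ → ℝ≥0} {tr : ℕ → ℝ≥0}
    (h : S.Reports twoPatterns tp tq tr) :
    IsAlmostOmega (fun N => (tp N : ℝ) + (N : ℝ) ^ (2 * (1 + γ) / (3 + δ - γ)) * (tq N 2 : ℝ)
        + (N : ℝ) ^ (2 * (2 - δ) / (3 + δ - γ)) * (tr N : ℝ))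
      (4 / (3 + δ - γ)) := by
  have hD0 : 0 < 3 + δ - γ := by linarith
  -- For δ ≥ 1 + γ the claimed exponent is at most 1 and reading the text suffices; otherwise τ < q
  -- can be arranged.
  rcases le_or_gt (1 + γ) δ with hγ | hγ
  · refine isAlmostOmega_of_linear (by rw [div_le_one hD0]; linarith) fun N hN =>
      (le_add_rpow_mul hN (by positivity) (le_time_of_reports h hN (q := ([1], [1]))
        (validQuery_pair (by omega) (by omega)) ?_ ?_)).trans
        (le_add_of_nonneg_right (by positivity)) <;>
    · simp [twoPatterns]
  set D := (3 + δ - γ) / 2 with hD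
  have hD1 : 1 ≤ D := by linarith
  have hDp : 0 < D := by linarith
  have hDe : ∀ x : ℝ, 2 * x / (3 + δ - γ) = x / D := fun x => by
    rw [hD]; field_simp
  have h4 : (4 : ℝ) / (3 + δ - γ) = 2 / D := by rw [← hDe]; norm_num
  rw [h4]
  simp only [hDe]
  have hd : 0 < min ((1 - γ) / D) (δ / D) :=
    lt_min (div_pos (by linarith) hDp) (div_pos hδ hDp)
  refine IsAlmostOmega.of_le hd fun ε hε hε' hO => ?_
  obtain ⟨e1, e2⟩ := le_min_iff.1 hε'
  obtain ⟨q, hq, q1, q2, q3⟩ := exists_nat_bounds hε (show 0 < 1 - γ by linarith)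
    (show 0 < 1 - δ + γ by linarith)
  have hq0 : (0 : ℝ) < q := by exact_mod_cast hq
  obtain ⟨r1, r2⟩ := ceil_bounds (show 0 ≤ γ * q by positivity)
  set ρ := ⌈γ * q⌉₊ + 1 with hρ
  have hx : 0 ≤ (1 + δ - γ) * q / 2 := by
    have : 0 ≤ 1 + δ - γ := by linarith
    positivity
  have t1 := Nat.le_ceil ((1 + δ - γ) * q / 2)
  have t2 := Nat.ceil_lt_add_one hx
  set τ := ⌈(1 + δ - γ) * q / 2⌉₊ with hτ
  have hρq : ρ < q := by exact_mod_cast (by linarith : (ρ : ℝ) < q)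
  have hτq : τ + 1 ≤ q := by exact_mod_cast (by linarith : (τ : ℝ) + 1 ≤ q)
  -- The exponent φ is a truncated difference, so the case in which it vanishes is treated
  -- separately. The second part is the budget for checking whole chunks.
  have hφ : ((3 * q - ρ - 2 * τ : ℕ) : ℝ) + δ * q ≤ 2 * q ∧
      (1 ≤ δ → ((q - ρ : ℕ) : ℝ) + (3 * q - ρ - 2 * τ : ℕ) ≤ 2 * q - 1) := by
    have hsub : ((q - ρ : ℕ) : ℝ) = q - ρ := Nat.cast_sub hρq.le
    have hρ1 : (1 : ℝ) ≤ ρ := by exact_mod_cast (by omega : 1 ≤ ρ)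
    have hq1 : (1 : ℝ) ≤ q := by exact_mod_cast hq
    have hδq : δ * q ≤ 2 * q := by gcongr; linarith
    rw [hsub]
    rcases Nat.le_total (ρ + 2 * τ) (3 * q) with hle | hle
    · rw [Nat.sub_sub, Nat.cast_sub hle]
      push_cast
      refine ⟨by linarith, fun h => ?_⟩
      have : 1 * (q : ℝ) ≤ δ * q := by gcongr
      have : 0 ≤ γ * q := by positivity
      linarith
    · rw [show 3 * q - ρ - 2 * τ = 0 by omega]
      simp only [Nat.cast_zero, zero_add, add_zero]
      exact ⟨hδq, fun _ => by linarith⟩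
  have hφ1 : 3 * q - ρ - 2 * τ ≤ 2 * q - 1 := by
    have h5 : ((3 * q - ρ - 2 * τ : ℕ) : ℝ) < ((2 * q : ℕ) : ℝ) := by
      push_cast
      have : 0 < δ * q := by positivity
      linarith [hφ.1]
    have := Nat.cast_lt.1 h5
    omega
  -- For δ < 1 the reported documents guide the verification, and the n degenerate pairs cost at
  -- most n^(1 + δ). For δ ≥ 1 they would be too expensive; there the output is used only as a
  -- yes/no answer, which hides these pairs, and false pairs are rare enough for whole chunks to be
  -- checked.
  refine not_fast h3SUM (forb := false)
    ((h : S.Reports (selects false) tp tq tr).reads (decide (δ < 1))) h.2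
    (q := q) (ρ := ρ) (τ := τ) (E := q + τ) (φ := 3 * q - ρ - 2 * τ)
    ⟨by omega, hρq, by omega, le_rfl, by simp, by omega, by omega, hφ1, fun hrep => ?_⟩
    (γ := γ) (δ := δ) (D := D) (ε := ε) hD1 h0 h1.le
    hδ.le hγ.le (fun hrep => (of_decide_eq_true hrep).le) ?_ hε.le q1 (by linarith) r2.le hφ.1
    (PowBound.of_isBigO (a := 0) hO (fun N => ?_) ?_ (by simp))
    (PowBound.of_isBigO (a := (1 + γ) / D) hO (fun N => ?_) (by linarith) (le_of_eq ?_))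
    (PowBound.of_isBigO (a := (2 - δ) / D) hO (fun N => ?_) (by linarith) (le_of_eq ?_))
  · have h5 := hφ.2 (not_lt.1 (of_decide_eq_false hrep))
    have h6 : q - ρ + (3 * q - ρ - 2 * τ) + 1 ≤ 2 * q := by
      have : (((q - ρ : ℕ) + (3 * q - ρ - 2 * τ : ℕ) + 1 : ℕ) : ℝ) ≤ ((2 * q : ℕ) : ℝ) := by
        push_cast
        linarith
      exact_mod_cast this
    omega
  · push_cast
    rw [hD]
    linarith
  · rw [Real.rpow_zero, one_mul, add_assoc]
    exact le_add_of_nonneg_right (by positivity)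
  · have : (1 - γ) / D ≤ 2 / D := by gcongr; linarith
    linarith
  · exact (le_add_of_nonneg_left (by positivity)).trans (le_add_of_nonneg_right (by positivity))
  · rw [sub_right_comm, ← sub_div]
    congr 2
    ring
  · exact le_add_of_nonneg_left (by positivity)
  · rw [sub_right_comm, ← sub_div]
    congr 2
    ring

end WordRAM
end

theorem mainTheorem12 (h3SUM : ThreeSumConjecture) :
    -- Forbidden Pattern, decision version
    (∀ γ : ℝ, 0 < γ → γ < 1 →
      ∀ (S : DataStructure) (tp : ℕ → ℝ≥0) (tq : ℕ → ℕ → ℝ≥0),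
        S.Decides forbiddenPattern tp tq →
        IsAlmostOmega
          (fun N => (tp N : ℝ) + (N : ℝ) ^ ((1 + γ) / (3 - 2 * γ)) * (tq N 2 : ℝ))
          (2 / (3 - 2 * γ))) ∧
    -- Two Patterns, decision version
    (∀ γ : ℝ, 0 < γ → γ < 1 →
      ∀ (S : DataStructure) (tp : ℕ → ℝ≥0) (tq : ℕ → ℕ → ℝ≥0),
        S.Decides twoPatterns tp tq →
        IsAlmostOmega
          (fun N => (tp N : ℝ) + (N : ℝ) ^ ((1 + γ) / (2 - γ)) * (tq N 2 : ℝ))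
          (2 / (2 - γ))) ∧
    -- Two Patterns, reporting version
    (∀ γ δ : ℝ, 0 ≤ γ → γ < 1 → 0 < δ →
      ∀ (S : DataStructure) (tp : ℕ → ℝ≥0) (tq : ℕ → ℕ → ℝ≥0) (tr : ℕ → ℝ≥0),
        S.Reports twoPatterns tp tq tr →
        IsAlmostOmega
          (fun N => (tp N : ℝ) + (N : ℝ) ^ (2 * (1 + γ) / (3 + δ - γ)) * (tq N 2 : ℝ)
            + (N : ℝ) ^ (2 * (2 - δ) / (3 + δ - γ)) * (tr N : ℝ))
          (4 / (3 + δ - γ))) :=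
  ⟨fun _ h0 h1 _ _ _ h => isAlmostOmega_forbidden h3SUM h0 h1 h,
    fun _ h0 h1 _ _ _ h => isAlmostOmega_twoPatterns h3SUM h0 h1 h,
    fun _ _ h0 h1 hδ _ _ _ _ h => isAlmostOmega_reporting h3SUM h0 h1 hδ h⟩
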